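/- Let $\Omega=\Omega_h\times\mathbf T$, where $\Omega_h$ is $\mathbf R^2$ or a periodic box $\mathbf T^2$, and let $B=b(x_h)e_3$, where $b:\Omega_h\to\mathbf R$ is smooth, bounded and has no zero. Let $\nu>0$, and let $H$ be the space of divergence free vector fields of $L^2(\Omega)^3$, $P$ the orthogonal projection of $L^2(\Omega)^3$ onto $H$, $Lu=P(u\wedge B)$ for $u\in H$, $\Pi$ the orthogonal projection of $L^2(\Omega)^3$ onto $\mathrm{Ker}(L)$ and $\Pi_\perp=\mathrm{Id}-\Pi$. Let $\mathcal O=\{x_h\in\Omega_h:\nabla b(x_h)\neq0\}$ and let $\mathcal S$ be the interior of $\{x_h\in\Omega_h:\nabla b(x_h)=0\}$. Let $u^0\in H$ and, for every $\varepsilon>0$, let $u_\varepsilon\in L^\infty(\mathbf R^+;L^2(\Omega))\cap L^2(\mathbf R^+;\dot H^1(\Omega))$ be a weak (Leray) solution of $$\partial_t u_\varepsilon+u_\varepsilon\cdot\nabla u_\varepsilon-\nu\Delta u_\varepsilon+\frac1\varepsilon\,u_\varepsilon\wedge B+\nabla p_\varepsilon=0,\qquad \mathrm{div}\,u_\varepsilon=0,\qquad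 u_{\varepsilon|t=0}=u^0,$$ that is, a solution in the sense of distributions which satisfies $\|u_\varepsilon(t)\|_{L^2}^2+2\nu\int_0^t\|\nabla u_\varepsilon(s)\|_{L^2}^2\,ds\le\|u^0\|_{L^2}^2$ for almost every $t>0$. Put $w_\varepsilon=\Pi_\perp u_\varepsilon$. Then $$\Pi\left(w_\varepsilon\wedge\mathrm{rot}\,w_\varepsilon\right)\to0\quad\text{in }\mathcal D'(\mathbf R^+\times(\mathcal O\cup\mathcal S))\quad\text{as }\varepsilon\to0.$$ Here $w\wedge\mathrm{rot}\,w$ is the distribution $\nabla(|w|^2/2)-\mathrm{div}(w\otimes w)$ and $\Pi$ acts by duality: the convergence means that, for every $\Phi\in C_c^\infty([0,\infty)\times(\mathcal O\cup\mathcal S)\times\mathbf T;\mathbf R^3)$ with $\Phi(t)\in\mathrm{Ker}(L)$ for all $t\ge0$, $$\int_0^\infty\!\!\int_\Omega\Big(w_\varepsilon\otimes w_\varepsilon:\nabla\Phi-\tfrac12|w_\varepsilon|^2\,\mathrm{div}\,\Phi\Big)\,dx\,dt\to0\quad\text{as }\varepsilon\to0 .$$ -/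

import Mathlib

open Set Filter Topology MeasureTheory
open scoped ContDiff InnerProductSpace Matrix

noncomputable section

namespace RotatingFluid

/-- The space `ℝ³`, with its Euclidean norm. -/
abbrev E3 := EuclideanSpace ℝ (Fin 3)

/-- The space `ℝ²`, with its Euclidean norm. -/
abbrev E2 := EuclideanSpace ℝ (Fin 2)

/-- The `j`-th vector of the canonical basis of `ℝ³`. -/
def e (j : Fin 3) : E3 := EuclideanSpace.single j 1

/-- Horizontal part `x_h = (x₁, x₂)` of a point of `ℝ³`. -/
def hor (x : E3) : E2 := !₂[x 0, x 1]

/-- The domain `Ω = Ω_h × 𝕋`, where `Ω_h` is the plane `ℝ²` or a periodic box `𝕋²`.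
The number `len i` is the period in the direction `i`, and `len i = 0` means that the
direction `i` is a full line. Functions on `Ω` are functions on `ℝ³` with these periods. -/
structure Domain where
  len : Fin 3 → ℝ
  horizontal : (len 0 = 0 ∧ len 1 = 0) ∨ (0 < len 0 ∧ 0 < len 1)
  vertical : 0 < len 2

namespace Domain

/-- A fundamental cell of `Ω`. -/
def cell (Ω : Domain) : Set E3 := {x | ∀ i, Ω.len i ≠ 0 → x i ∈ Ico 0 (Ω.len i)}

/-- Lebesgue measure on `Ω`. -/
def μ (Ω : Domain) : Measure E3 := volume.restrict Ω.cell

/-- `f` is a function on `Ω` (the condition is empty in the directions that are full lines). -/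
def Periodic {F : Type*} (Ω : Domain) (f : E3 → F) : Prop :=
  ∀ (x : E3) (i : Fin 3), f (x + Ω.len i • e i) = f x

/-- The Hilbert space `L²(Ω; ℝ³)`. -/
abbrev L2 (Ω : Domain) := Lp E3 2 Ω.μ

/-- Scalar test functions: `φ ∈ C_c^∞(Ω)`. -/
structure IsTest (Ω : Domain) (φ : E3 → ℝ) : Prop where
  smooth : ContDiff ℝ ∞ φ
  periodic : Ω.Periodic φ
  compact_support : ∃ R : ℝ, ∀ x ∈ tsupport φ, ∀ i, Ω.len i = 0 → |x i| ≤ R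

/-- Time dependent test fields: `Φ ∈ C_c^∞(ℝ × Ω; ℝ³)`. Restricted to times `t ≥ 0` they are the
test fields of `[0, ∞) × Ω`. -/
structure IsTestField (Ω : Domain) (Φ : ℝ → E3 → E3) : Prop where
  smooth : ContDiff ℝ ∞ (fun p : ℝ × E3 => Φ p.1 p.2)
  periodic : ∀ t, Ω.Periodic (Φ t)
  compact_support : ∃ R : ℝ, ∀ p ∈ tsupport (fun p : ℝ × E3 => Φ p.1 p.2),
    |p.1| ≤ R ∧ ∀ i, Ω.len i = 0 → |p.2 i| ≤ R

lemma gradient_memLp (Ω : Domain) {φ : E3 → ℝ} (h : Ω.IsTest φ) :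
    MemLp (gradient φ) 2 Ω.μ := by
  obtain ⟨R, hR⟩ := h.compact_support
  have hc : Continuous (gradient φ) :=
    (InnerProductSpace.toDual ℝ E3).symm.continuous.comp
      (h.smooth.continuous_fderiv (by simp))
  have hsupp : ∀ x, x ∉ tsupport φ → gradient φ x = 0 := by
    intro x hx
    have h0 : fderiv ℝ φ x = 0 := by
      by_contra hne
      exact hx (support_fderiv_subset ℝ (f := φ) hne)
    simp [gradient, h0]
  obtain ⟨r, hr⟩ : ∃ r : ℝ, ∀ i, R ≤ r ∧ Ω.len i ≤ r := by
    refine ⟨|R| + ∑ i, |Ω.len i|, fun i => ⟨?_, ?_⟩⟩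
    · have := Finset.sum_nonneg (fun i (_ : i ∈ Finset.univ) => abs_nonneg (Ω.len i))
      linarith [le_abs_self R]
    · have := Finset.single_le_sum (f := fun i => |Ω.len i|)
        (fun i _ => abs_nonneg _) (Finset.mem_univ i)
      linarith [le_abs_self (Ω.len i), abs_nonneg R]
  set A : Set E3 := WithLp.ofLp ⁻¹' (Set.pi univ fun _ => Icc (-r) r) with hA
  have hAc : IsCompact A :=
    (EuclideanSpace.equiv (Fin 3) ℝ).toHomeomorph.isCompact_preimage.2
      (isCompact_univ_pi fun _ => isCompact_Icc)
  have hcell : MeasurableSet Ω.cell := by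
    have : Ω.cell = ⋂ i, ⋂ (_ : Ω.len i ≠ 0), (fun x : E3 => x i) ⁻¹' Ico 0 (Ω.len i) := by
      ext x; simp [cell]
    rw [this]
    exact MeasurableSet.iInter fun i => MeasurableSet.iInter fun _ =>
      measurableSet_Ico.preimage (by fun_prop)
  have key : gradient φ =ᵐ[Ω.μ] A.indicator (gradient φ) := by
    filter_upwards [ae_restrict_mem hcell] with x hx
    by_cases hxA : x ∈ A
    · rw [indicator_of_mem hxA]
    · rw [indicator_of_notMem hxA]
      refine hsupp x fun hxs => hxA ?_
      rw [hA, mem_preimage, Set.mem_univ_pi]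
      intro i
      by_cases hi : Ω.len i = 0
      · have := abs_le.1 (hR x hxs i hi)
        exact ⟨by linarith [(hr i).1], by linarith [(hr i).1]⟩
      · have := hx i hi
        exact ⟨by linarith [this.1, this.2, (hr i).2], by linarith [this.2, (hr i).2]⟩
  refine (memLp_congr_ae key).2 ?_
  rw [memLp_indicator_iff_restrict hAc.measurableSet]
  obtain ⟨C, hC⟩ := hAc.exists_bound_of_continuousOn hc.continuousOn
  have : IsFiniteMeasure (Ω.μ.restrict A) := ⟨by
    rw [Measure.restrict_apply_univ]
    exact (Measure.restrict_apply_le _ _).trans_lt hAc.measure_lt_top⟩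
  exact MemLp.of_bound hc.aestronglyMeasurable C
    (by filter_upwards [ae_restrict_mem hAc.measurableSet] with x hx using hC x hx)

/-- The gradient of a test function as an element of `L²(Ω)`. -/
def gradL2 (Ω : Domain) {φ : E3 → ℝ} (h : Ω.IsTest φ) : Ω.L2 := (Ω.gradient_memLp h).toLp _

/-- The closed subspace `H` of the divergence free fields of `L²(Ω)`: the fields orthogonal to
the gradients of all test functions. -/
def H (Ω : Domain) : Submodule ℝ Ω.L2 :=
  (Submodule.span ℝ {g | ∃ (φ : E3 → ℝ) (h : Ω.IsTest φ), g = Ω.gradL2 h})ᗮ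

lemma mem_H_iff (Ω : Domain) (u : Ω.L2) :
    u ∈ Ω.H ↔ ∀ φ : E3 → ℝ, Ω.IsTest φ → ∫ x, ⟪u x, gradient φ x⟫_ℝ ∂Ω.μ = 0 := by
  have aux : ∀ (φ : E3 → ℝ) (h : Ω.IsTest φ),
      ⟪u, Ω.gradL2 h⟫_ℝ = ∫ x, ⟪u x, gradient φ x⟫_ℝ ∂Ω.μ := by
    intro φ h
    rw [L2.inner_def]
    refine integral_congr_ae ?_
    filter_upwards [(Ω.gradient_memLp h).coeFn_toLp] with x hx
    rw [gradL2, hx]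
  rw [H, Submodule.mem_orthogonal']
  constructor
  · intro hu φ h
    rw [← aux φ h]
    exact hu _ (Submodule.subset_span ⟨φ, h, rfl⟩)
  · intro hu v hv
    induction hv using Submodule.span_induction with
    | mem v hv => obtain ⟨φ, h, rfl⟩ := hv; rw [aux φ h]; exact hu φ h
    | zero => simp
    | add x y _ _ hx hy => rw [inner_add_right, hx, hy, add_zero]
    | smul a x _ hx => rw [inner_smul_right, hx, mul_zero]

instance (Ω : Domain) : CompleteSpace Ω.H := by
  unfold H
  infer_instance

/-- `g` is the partial derivative `∂_j u` in the sense of distributions on `Ω`. -/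
def IsWeakPartial (Ω : Domain) (j : Fin 3) (u g : Ω.L2) : Prop :=
  ∀ φ : E3 → ℝ, Ω.IsTest φ →
    ∫ x, (fderiv ℝ φ x (e j)) • u x ∂Ω.μ = - ∫ x, φ x • g x ∂Ω.μ

end Domain

/-- The amplitude `b` of the rotation vector `B = b(x_h) e₃`: a smooth bounded function on `Ω_h`
without zeros. -/
structure Rotation (Ω : Domain) where
  b : E2 → ℝ
  smooth : ContDiff ℝ ∞ b
  periodic : ∀ (y : E2) (i : Fin 2), b (y + EuclideanSpace.single i (Ω.len i.castSucc)) = b y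
  bounded : ∃ M : ℝ, ∀ y, |b y| ≤ M
  ne_zero : ∀ y, b y ≠ 0

/-- The vector `v ∧ B` of `ℝ³`, where `B = c e₃`. -/
def wedge (v : E3) (c : ℝ) : E3 := WithLp.toLp 2 (WithLp.ofLp v ⨯₃ ![0, 0, c])

lemma wedge_apply (v : E3) (c : ℝ) : wedge v c = !₂[c * v 1, - (c * v 0), 0] := by
  ext i
  fin_cases i <;> simp [wedge, cross_apply, mul_comm]

lemma norm_wedge_le (v : E3) (c : ℝ) : ‖wedge v c‖ ≤ |c| * ‖v‖ := by
  rw [wedge_apply]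
  refine abs_le_of_sq_le_sq' ?_ (by positivity) |>.2
  rw [mul_pow, sq_abs, EuclideanSpace.norm_sq_eq, EuclideanSpace.norm_sq_eq]
  simp only [Fin.sum_univ_three, Real.norm_eq_abs, sq_abs]
  simp
  nlinarith [mul_nonneg (sq_nonneg c) (sq_nonneg (v 2))]

lemma continuous_wedge : Continuous fun p : E3 × ℝ => wedge p.1 p.2 := by
  simp only [wedge_apply]
  refine (PiLp.continuous_toLp 2 _).comp (continuous_pi fun i => ?_)
  fin_cases i <;> simp <;> fun_prop

namespace Rotation

variable {Ω : Domain} (B : Rotation Ω)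

lemma wedge_memLp (u : Ω.L2) : MemLp (fun x => wedge (u x) (B.b (hor x))) 2 Ω.μ := by
  obtain ⟨M, hM⟩ := B.bounded
  have hhor : Continuous hor :=
    (PiLp.continuous_toLp 2 _).comp (continuous_pi fun i => by fin_cases i <;> simp <;> fun_prop)
  refine (Lp.memLp u).of_le_mul (c := M) (continuous_wedge.comp_aestronglyMeasurable
    ((Lp.aestronglyMeasurable u).prodMk
      (B.smooth.continuous.comp hhor).aestronglyMeasurable)) (ae_of_all _ fun x => ?_)
  exact (norm_wedge_le _ _).trans (mul_le_mul_of_nonneg_right (hM _) (norm_nonneg _))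

/-- The bounded operator `u ↦ u ∧ B` of `L²(Ω)`. -/
def wedgeL2 : Ω.L2 →L[ℝ] Ω.L2 :=
  LinearMap.mkContinuousOfExistsBound
    { toFun := fun u => (B.wedge_memLp u).toLp _
      map_add' := fun u v => by
        apply Lp.ext
        filter_upwards [(B.wedge_memLp (u + v)).coeFn_toLp, (B.wedge_memLp u).coeFn_toLp,
          (B.wedge_memLp v).coeFn_toLp, Lp.coeFn_add u v, Lp.coeFn_add
            ((B.wedge_memLp u).toLp _) ((B.wedge_memLp v).toLp _)] with x h1 h2 h3 h4 h5
        rw [h1, h5, Pi.add_apply, h2, h3, h4]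
        ext i
        fin_cases i <;> simp [wedge_apply] <;> ring
      map_smul' := fun a u => by
        apply Lp.ext
        filter_upwards [(B.wedge_memLp (a • u)).coeFn_toLp, (B.wedge_memLp u).coeFn_toLp,
          Lp.coeFn_smul a u, Lp.coeFn_smul a ((B.wedge_memLp u).toLp _)] with x h1 h2 h3 h4
        rw [RingHom.id_apply, h1, h4, Pi.smul_apply, h2, h3]
        ext i
        fin_cases i <;> simp [wedge_apply] <;> ring }
    (by
      obtain ⟨M, hM⟩ := B.bounded
      refine ⟨M, fun u => Lp.norm_le_mul_norm_of_ae_le_mul ?_⟩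
      filter_upwards [(B.wedge_memLp u).coeFn_toLp] with x hx
      refine (le_of_eq (congrArg _ hx)).trans ((norm_wedge_le _ _).trans ?_)
      exact mul_le_mul_of_nonneg_right (hM _) (norm_nonneg _))

lemma coeFn_wedgeL2 (u : Ω.L2) :
    B.wedgeL2 u =ᵐ[Ω.μ] fun x => wedge (u x) (B.b (hor x)) :=
  (B.wedge_memLp u).coeFn_toLp

/-- The operator `L u = P (u ∧ B)`, where `P` is the Leray projector, that is, the orthogonal
projection of `L²(Ω)` onto the divergence free fields. -/
def L : Ω.L2 →L[ℝ] Ω.L2 := Ω.H.starProjection ∘L B.wedgeL2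

/-- The kernel of `L`, an operator on the space of divergence free fields. -/
def KerL : Submodule ℝ Ω.L2 := Ω.H ⊓ B.L.ker

instance : CompleteSpace B.KerL := by
  have h : IsClosed ((Ω.H : Set Ω.L2) ∩ (B.L.ker : Set Ω.L2)) :=
    (Submodule.isClosed_orthogonal _).inter B.L.isClosed_ker
  exact h.completeSpace_coe

/-- The orthogonal projection `Π` of `L²(Ω)` onto `Ker L`. -/
def Pi : Ω.L2 →L[ℝ] Ω.L2 := B.KerL.starProjection

/-- `Π_⊥ = Id - Π`. -/
def PiPerp : Ω.L2 →L[ℝ] Ω.L2 := ContinuousLinearMap.id ℝ Ω.L2 - B.Pi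

/-- The open set `𝒪` of the points of `Ω_h` at which `∇b` does not vanish. -/
def O : Set E2 := {y | fderiv ℝ B.b y ≠ 0}

/-- The open set `𝒮`, the interior of the set of critical points of `b` (where `b` is locally
constant). -/
def S : Set E2 := interior {y | fderiv ℝ B.b y = 0}

end Rotation

/-- The partial derivative `∂_j v_i` of a smooth field. -/
def pd (v : E3 → E3) (i j : Fin 3) (x : E3) : ℝ := (fderiv ℝ v x (e j)) i

/-- The divergence of a smooth field. -/
def div (v : E3 → E3) (x : E3) : ℝ := ∑ i, pd v i i x

/-- Weak (Leray) solutions on `[0, ∞) × Ω` of the system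
`∂ₜ u + u · ∇u - ν Δu + (1/ε) u ∧ B + ∇p = 0`, `div u = 0`, `u(0) = u⁰`:
`u ∈ L^∞(ℝ⁺; L²) ∩ L²(ℝ⁺; Ḣ¹)` satisfies the energy inequality, and the equation holds in the
sense of distributions against divergence free test fields. Here `G t j` is `∂_j u(t)`. -/
def IsWeakSolution {Ω : Domain} (B : Rotation Ω) (ν ε : ℝ) (u0 : Ω.L2) (u : ℝ → Ω.L2) : Prop :=
  AEStronglyMeasurable u (volume.restrict (Ioi 0)) ∧
  (∀ᵐ t ∂(volume.restrict (Ioi (0 : ℝ))), u t ∈ Ω.H) ∧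
  ∃ G : ℝ → Fin 3 → Ω.L2,
    (∀ j, MemLp (fun t => G t j) 2 (volume.restrict (Ioi 0))) ∧
    (∀ᵐ t ∂(volume.restrict (Ioi (0 : ℝ))), ∀ j, Ω.IsWeakPartial j (u t) (G t j)) ∧
    (∀ᵐ t ∂(volume.restrict (Ioi (0 : ℝ))),
      ‖u t‖ ^ 2 + 2 * ν * ∫ s in Ioc 0 t, ∑ j, ‖G s j‖ ^ 2 ≤ ‖u0‖ ^ 2) ∧
    ∀ Φ : ℝ → E3 → E3, Ω.IsTestField Φ → (∀ t x, div (Φ t) x = 0) →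
      ∫ t in Ioi (0 : ℝ), ∫ x,
        (- ⟪u t x, deriv (fun s => Φ s x) t⟫_ℝ
          + ν * ∑ j, ⟪G t j x, fderiv ℝ (Φ t) x (e j)⟫_ℝ
          - ∑ i, ∑ j, u t x i * u t x j * pd (Φ t) i j x
          + (1 / ε) * ⟪wedge (u t x) (B.b (hor x)), Φ t x⟫_ℝ) ∂Ω.μ
      = ∫ x, ⟪u0 x, Φ 0 x⟫_ℝ ∂Ω.μ

/-- The action on a test field `Φ` of the distribution `w ∧ rot w`, for a divergence free
`w(t) ∈ L²(Ω)`. As `w ∧ rot w = ∇(|w|²/2) - w · ∇w = ∇(|w|²/2) - div (w ⊗ w)`, it is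
`∫∫ (w ⊗ w : ∇Φ - (|w|²/2) div Φ) dx dt`. -/
def wedgeRot {Ω : Domain} (w : ℝ → Ω.L2) (Φ : ℝ → E3 → E3) : ℝ :=
  ∫ t in Ioi (0 : ℝ), ∫ x,
    (∑ i, ∑ j, w t x i * w t x j * pd (Φ t) i j x - ‖w t x‖ ^ 2 / 2 * div (Φ t) x) ∂Ω.μ

/-- `Φ` is a test field of `ℝ⁺ × (𝒪 ∪ 𝒮)` (times the vertical circle) with values in `Ker L`. -/
structure IsKerTest {Ω : Domain} (B : Rotation Ω) (Φ : ℝ → E3 → E3) : Prop where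
  test : Ω.IsTestField Φ
  support : ∀ p ∈ tsupport (fun p : ℝ × E3 => Φ p.1 p.2), hor p.2 ∈ B.O ∪ B.S
  mem_ker : ∀ t, 0 ≤ t → ∃ g ∈ B.KerL, ⇑g =ᵐ[Ω.μ] Φ t

/-- Convergence `Π (F_ε) → 0` in `𝒟'(ℝ⁺ × (𝒪 ∪ 𝒮))` as `ε → 0⁺`, for a family of distributions
`F_ε`. The projection `Π` is symmetric with range `Ker L`, so it acts on distributions by duality:
`Π F` is the restriction of `F` to the test fields `Φ = Π Φ` with values in `Ker L`. -/
def ProjTendstoZero {Ω : Domain} (B : Rotation Ω) (F : ℝ → (ℝ → E3 → E3) → ℝ) : Prop :=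
  ∀ Φ : ℝ → E3 → E3, IsKerTest B Φ → Tendsto (fun ε => F ε Φ) (𝓝[>] 0) (𝓝 0)

end RotatingFluid

end

/-! For a test field `Φ` with values in `Ker L`, the expression to be studied is the time integral
of a quadratic form `⟪quadOp hΦ w, w⟫` with `w = Π_⊥ u`. Only quadratic correlations of `u_ε` enter.
Along an ultrafilter, the integrals of `⟪u_ε, a⟫ ⟪u_ε, b⟫` over a time interval converge to `⟪R a,
b⟫` for some operator `R` (`exists_isCorrelation`). The energy bound makes `R` symmetric,
nonnegative and of finite trace, hence compact. The time derivative of `⟪u_ε, ψ⟫ ⟪u_ε, φ⟫` is `ε⁻¹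
(⟪u_ε, Lψ⟫ ⟪u_ε, φ⟫ + ⟪u_ε, ψ⟫ ⟪u_ε, Lφ⟫)` plus bounded terms. The bracket therefore averages to
zero, which means that `R` commutes with `L` (`correlation_comm`). The eigenspaces of `R` for
nonzero eigenvalues are thus finite dimensional, invariant by `L`, and made of divergence free
fields with square integrable derivatives.

On such a space the trace of the quadratic form vanishes (`exists_sum_quadOp_PiPerp_eq_zero`). The
restriction of `L` is skew and its square is diagonalizable. An eigenvector `f` with eigenvalue `0`
is in `Ker L`, where `Π_⊥` vanishes. Otherwise `f = c⁻¹ L L f` is orthogonal to `Ker L`, and the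
form at `f` is `c⁻¹ ∫ (f ∧ rot L(Lf)) · Φ`. The bilinear form `(g, f) ↦ ∫ (g ∧ rot Lf) · Φ` is
symmetric (`rotForm_L_symm`), because `Φ` does not depend on the vertical variable and is tangent to
the level lines of `b`. The trace then pairs a symmetric matrix with a skew one, so it is zero.

It remains to identify the limit of the quadratic form with its trace against `R`. This requires an
approximation by finite rank operators, up to a small multiple of the norm of the gradient
(`IsRellich`). The obstacle is that `Π` has no reason to preserve square integrable derivatives.
`exists_isRellich` circumvents it. Where `∇b ≠ 0`, the horizontal part of `Π u` is parallel to `Φ`;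
where `b` is locally constant, the vertical average of `Π_⊥ u` is irrotational. A planar field of
either kind contributes nothing to the form, so one argument of the form can be replaced by an image
of `u` under an operator commuting with translations. `IsRellich.tendsto_zero` then gives the limit
for static `Φ`, and a subdivision of time treats the general case. -/

noncomputable section

namespace RotatingFluid

/-! ### Periods, the fundamental cell and measure preserving translations. -/

namespace Domain

variable (Ω : Domain)

/-- The lattice of the periods of `Ω`. -/
def lattice : AddSubgroup E3 where
  -- In a full-line direction the period is `0` and forces the coordinate to vanish, so that the
  -- plane and the periodic box are treated together.
  carrier := {v | ∀ i, ∃ n : ℤ, v i = n * Ω.len i}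
  add_mem' := by
    intro v w hv hw i
    obtain ⟨n, hn⟩ := hv i
    obtain ⟨m, hm⟩ := hw i
    exact ⟨n + m, by simp [hn, hm, add_mul]⟩
  zero_mem' := fun i => ⟨0, by simp⟩
  neg_mem' := by
    intro v hv i
    obtain ⟨n, hn⟩ := hv i
    exact ⟨-n, by simp [hn]⟩

variable {Ω} in
lemma mem_lattice {v : E3} : v ∈ Ω.lattice ↔ ∀ i, ∃ n : ℤ, v i = n * Ω.len i := Iff.rfl

instance : Countable Ω.lattice := by
  have : (Ω.lattice : Set E3) ⊆ range fun n : Fin 3 → ℤ =>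
      (WithLp.toLp 2 fun i => (n i : ℝ) * Ω.len i : E3) := by
    intro v hv
    choose n hn using hv
    exact ⟨n, by ext i; simp [hn]⟩
  exact ((countable_range _).mono this).to_subtype

/-- Closedness ensures that a compact set plus the lattice is closed, as needed in
`smoothCpt_comp_wrap`. -/
lemma isClosed_lattice : IsClosed (Ω.lattice : Set E3) := by
  have : (Ω.lattice : Set E3) = ⋂ i, (fun v : E3 => v i) ⁻¹' (range fun n : ℤ => n * Ω.len i) := by
    ext v
    simp only [SetLike.mem_coe, mem_lattice, mem_iInter, mem_preimage, mem_range, eq_comm]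
  rw [this]
  refine isClosed_iInter fun i => IsClosed.preimage (by fun_prop) ?_
  have h : (range fun n : ℤ => (n : ℝ) * Ω.len i)
      = (AddSubgroup.zmultiples (Ω.len i) : Set ℝ) := by
    ext x; simp [AddSubgroup.mem_zmultiples_iff]
  rw [h]
  exact AddSubgroup.isClosed_of_discrete

/-- The representative of a point in the fundamental cell. -/
def wrap (x : E3) : E3 :=
  WithLp.toLp 2 fun i => if Ω.len i = 0 then x i else Ω.len i * Int.fract (x i / Ω.len i)

lemma wrap_apply (x : E3) (i : Fin 3) :
    Ω.wrap x i = if Ω.len i = 0 then x i else Ω.len i * Int.fract (x i / Ω.len i) := rfl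

lemma len_nonneg (i : Fin 3) : 0 ≤ Ω.len i := by
  have h2 := Ω.vertical.le
  rcases Ω.horizontal with ⟨h0, h1⟩ | ⟨h0, h1⟩ <;> fin_cases i <;> simp_all [le_of_lt]

lemma len_pos {i : Fin 3} (h : Ω.len i ≠ 0) : 0 < Ω.len i := (Ω.len_nonneg i).lt_of_ne' h

lemma wrap_mem_cell (x : E3) : Ω.wrap x ∈ Ω.cell := by
  intro i hi
  have := Ω.len_pos hi
  rw [wrap_apply, if_neg hi]
  exact ⟨mul_nonneg this.le (Int.fract_nonneg _),
    mul_lt_of_lt_one_right this (Int.fract_lt_one _)⟩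

lemma wrap_sub_mem (x : E3) : Ω.wrap x - x ∈ Ω.lattice := by
  intro i
  by_cases hi : Ω.len i = 0
  · exact ⟨0, by simp [wrap_apply, hi]⟩
  · refine ⟨-⌊x i / Ω.len i⌋, ?_⟩
    simp only [PiLp.sub_apply, wrap_apply, if_neg hi, Int.fract]
    field_simp
    push_cast
    ring

lemma wrap_of_mem {x : E3} (hx : x ∈ Ω.cell) : Ω.wrap x = x := by
  ext i
  by_cases hi : Ω.len i = 0
  · simp [wrap_apply, hi]
  · have hp := Ω.len_pos hi
    have hxi := hx i hi
    rw [wrap_apply, if_neg hi, Int.fract_eq_self.2 ⟨div_nonneg hxi.1 hp.le, (div_lt_one hp).2 hxi.2⟩]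
    field_simp

lemma wrap_add_of_mem {v : E3} (hv : v ∈ Ω.lattice) (x : E3) : Ω.wrap (x + v) = Ω.wrap x := by
  ext i
  obtain ⟨n, hn⟩ := hv i
  by_cases hi : Ω.len i = 0
  · simp [wrap_apply, hi, hn]
  · rw [wrap_apply, wrap_apply, if_neg hi, if_neg hi, PiLp.add_apply, hn, add_div,
      mul_div_cancel_right₀ _ hi, Int.fract_add_intCast]

lemma wrap_wrap_add (x y : E3) : Ω.wrap (Ω.wrap x + y) = Ω.wrap (x + y) := by
  have := Ω.wrap_add_of_mem (Ω.wrap_sub_mem x) (x + y)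
  rw [← this]
  congr 1
  abel

lemma measurable_wrap : Measurable Ω.wrap := by
  refine (PiLp.continuous_toLp 2 _).measurable.comp (measurable_pi_lambda _ fun i => ?_)
  by_cases hi : Ω.len i = 0
  · simp only [hi, if_true]
    fun_prop
  · simp only [hi, if_false]
    exact (measurable_fract.comp (by fun_prop)).const_mul _

lemma measurableSet_cell : MeasurableSet Ω.cell := by
  have : Ω.cell = ⋂ i, ⋂ (_ : Ω.len i ≠ 0), (fun x : E3 => x i) ⁻¹' Ico 0 (Ω.len i) := by
    ext x; simp [cell]
  rw [this]
  exact MeasurableSet.iInter fun i => MeasurableSet.iInter fun _ =>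
    measurableSet_Ico.preimage (by fun_prop)

variable {Ω} in
lemma Periodic.add_mem {F : Type*} {f : E3 → F} (hf : Ω.Periodic f) {v : E3}
    (hv : v ∈ Ω.lattice) (x : E3) : f (x + v) = f x := by
  have key : ∀ (i : Fin 3) (n : ℤ) (x : E3), f (x + (n * Ω.len i) • e i) = f x := by
    intro i n
    induction n using Int.induction_on with
    | zero => simp
    | succ n ih =>
      intro x
      have := hf (x + ((n : ℤ) * Ω.len i) • e i) i
      rw [ih, add_assoc, ← add_smul] at this
      rw [← this]; congr 3; push_cast; ring
    | pred n ih =>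
      intro x
      have := hf (x + (((-n - 1 : ℤ) : ℝ) * Ω.len i) • e i) i
      rw [← this, ← ih x, add_assoc, ← add_smul]; congr 3; push_cast; ring
  choose n hn using hv
  have hv' : v = (n 0 * Ω.len 0) • e 0 + (n 1 * Ω.len 1) • e 1 + (n 2 * Ω.len 2) • e 2 := by
    ext i
    rw [hn i]
    fin_cases i <;> simp [e]
  rw [hv', ← add_assoc, ← add_assoc, key, key, key]

variable {Ω} in
lemma Periodic.wrap {F : Type*} {f : E3 → F} (hf : Ω.Periodic f) (x : E3) : f (Ω.wrap x) = f x := by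
  have := hf.add_mem (Ω.wrap_sub_mem x) x
  rwa [add_sub_cancel] at this

lemma smul_e_mem_lattice (i : Fin 3) : Ω.len i • e i ∈ Ω.lattice := by
  intro j
  by_cases h : j = i
  · subst h
    exact ⟨1, by simp [e]⟩
  · exact ⟨0, by simp [e, h]⟩

lemma periodic_comp_wrap {F : Type*} (f : E3 → F) : Ω.Periodic (fun x => f (Ω.wrap x)) :=
  fun x i => by simp only [Ω.wrap_add_of_mem (Ω.smul_e_mem_lattice i)]

lemma isAddFundamentalDomain_cell : IsAddFundamentalDomain Ω.lattice Ω.cell volume := by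
  refine IsAddFundamentalDomain.mk' Ω.measurableSet_cell.nullMeasurableSet fun x => ?_
  refine ⟨⟨Ω.wrap x - x, Ω.wrap_sub_mem x⟩, ?_, ?_⟩
  · change (Ω.wrap x - x) + x ∈ Ω.cell
    rw [sub_add_cancel]
    exact Ω.wrap_mem_cell x
  · rintro ⟨v, hv⟩ (h : v + x ∈ Ω.cell)
    have := Ω.wrap_of_mem h
    rw [add_comm, Ω.wrap_add_of_mem hv] at this
    ext1
    simp [this]

-- The cell and its translate by `h` are fundamental domains of the same lattice, and a periodic
-- function has the same integral on both.
open scoped Pointwise in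
lemma lintegral_add_right {F : E3 → ENNReal} (hF : Ω.Periodic F) (h : E3) :
    ∫⁻ x, F (x + h) ∂Ω.μ = ∫⁻ x, F x ∂Ω.μ := by
  have h1 := Ω.isAddFundamentalDomain_cell
  have h2 : IsAddFundamentalDomain Ω.lattice (h +ᵥ Ω.cell) volume := h1.vadd_of_comm h
  have h3 := h2.setLIntegral_eq h1 F (fun g x => by
    change F (g.1 + x) = F x
    rw [add_comm, hF.add_mem g.2])
  rw [μ, ← h3]
  have h4 := (measurePreserving_add_right (volume : Measure E3) h).setLIntegral_comp_preimage_emb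
    (measurableEmbedding_addRight h) F (h +ᵥ Ω.cell)
  rw [← h4]
  congr 2
  ext x
  simp [Set.mem_vadd_set_iff_neg_vadd_mem, add_comm]

/-- The translation by `h` on the fundamental cell. -/
def shift (h x : E3) : E3 := Ω.wrap (x + h)

lemma measurable_shift (h : E3) : Measurable (Ω.shift h) :=
  Ω.measurable_wrap.comp (measurable_id.add_const h)

/-- The indicator of a set becomes periodic after composition with `wrap`, so `lintegral_add_right`
compares the measures. -/
lemma measurePreserving_shift (h : E3) : MeasurePreserving (Ω.shift h) Ω.μ Ω.μ := by
  refine ⟨Ω.measurable_shift h, ?_⟩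
  ext s hs
  rw [Measure.map_apply (Ω.measurable_shift h) hs, ← lintegral_indicator_one hs,
    ← lintegral_indicator_one (Ω.measurable_shift h hs)]
  have h1 := Ω.lintegral_add_right (Ω.periodic_comp_wrap (s.indicator (1 : E3 → ENNReal))) h
  refine (Eq.trans ?_ h1).trans ?_
  · rfl
  · refine lintegral_congr_ae ?_
    filter_upwards [ae_restrict_mem Ω.measurableSet_cell] with x hx
    rw [Ω.wrap_of_mem hx]

variable {Ω} in
lemma Periodic.comp_shift {F : Type*} {f : E3 → F} (hf : Ω.Periodic f) (h x : E3) :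
    f (Ω.shift h x) = f (x + h) := hf.wrap _

lemma ae_mem_cell : ∀ᵐ x ∂Ω.μ, x ∈ Ω.cell := ae_restrict_mem Ω.measurableSet_cell

lemma shift_shift (h k x : E3) : Ω.shift h (Ω.shift k x) = Ω.shift (k + h) x := by
  simp only [shift, wrap_wrap_add, add_assoc]

lemma shift_zero {x : E3} (hx : x ∈ Ω.cell) : Ω.shift 0 x = x := by
  rw [shift, add_zero, Ω.wrap_of_mem hx]

/-- A property of the points of `Ω` which holds almost everywhere in the cell holds almost
everywhere. -/
lemma Periodic.ae_of_ae {p : E3 → Prop} (hp : Ω.Periodic p) (h : ∀ᵐ x ∂Ω.μ, p x) :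
    ∀ᵐ x, p x := by
  have h1 : ∀ v : Ω.lattice, ∀ᵐ x, x + v.1 ∈ Ω.cell → p x := by
    intro v
    have h2 : ∀ᵐ x, x ∈ Ω.cell → p x := (ae_restrict_iff' Ω.measurableSet_cell).1 h
    have h3 := (measurePreserving_add_right (volume : Measure E3) v.1).quasiMeasurePreserving.ae h2
    filter_upwards [h3] with x hx hxc
    have := hx hxc
    rwa [hp.add_mem v.2] at this
  filter_upwards [ae_all_iff.2 h1] with x hx
  refine hx ⟨Ω.wrap x - x, Ω.wrap_sub_mem x⟩ ?_
  rw [add_sub_cancel]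
  exact Ω.wrap_mem_cell x

lemma eq_of_ae_eq {F : Type*} [TopologicalSpace F] [T2Space F] {f g : E3 → F}
    (hf : Ω.Periodic f) (hg : Ω.Periodic g) (hfc : Continuous f) (hgc : Continuous g)
    (h : f =ᵐ[Ω.μ] g) : f = g := by
  have : ∀ᵐ x, f x = g x :=
    Periodic.ae_of_ae Ω (p := fun x => f x = g x) (fun x i => by simp only [hf x i, hg x i]) h
  exact Continuous.ae_eq_iff_eq volume hfc hgc |>.1 this

/-- The cube of side `2 r` with centre `0`. -/
def box (r : ℝ) : Set E3 := {x | ∀ i, |x i| ≤ r}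

lemma isCompact_box (r : ℝ) : IsCompact (box r) := by
  have : box r = WithLp.ofLp ⁻¹' (Set.pi univ fun _ : Fin 3 => Icc (-r) r) := by
    ext x; simp [box, abs_le, Pi.le_def, forall_and]
  rw [this]
  exact (EuclideanSpace.equiv (Fin 3) ℝ).toHomeomorph.isCompact_preimage.2
      (isCompact_univ_pi fun _ => isCompact_Icc)

lemma μ_box_lt_top (r : ℝ) : Ω.μ (box r) < ⊤ :=
  (Measure.restrict_apply_le _ _).trans_lt (isCompact_box r).measure_lt_top

instance : SFinite Ω.μ := by unfold μ; infer_instance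

instance : IsLocallyFiniteMeasure Ω.μ := by unfold μ; infer_instance

end Domain

/-! ### Smooth functions with compact support on the domain. -/

namespace Domain

variable (Ω : Domain) {F G : Type*} [NormedAddCommGroup F] [NormedSpace ℝ F]
  [NormedAddCommGroup G] [NormedSpace ℝ G]

/-- Smooth functions on `Ω` with compact support and values in a normed space. -/
structure SmoothCpt (f : E3 → F) : Prop where
  smooth : ContDiff ℝ ∞ f
  periodic : Ω.Periodic f
  compact_support : ∃ R : ℝ, ∀ x ∈ tsupport f, ∀ i, Ω.len i = 0 → |x i| ≤ R

variable {Ω}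

lemma isTest_iff {φ : E3 → ℝ} : Ω.IsTest φ ↔ Ω.SmoothCpt φ :=
  ⟨fun h => ⟨h.1, h.2, h.3⟩, fun h => ⟨h.1, h.2, h.3⟩⟩

namespace SmoothCpt

lemma continuous {f : E3 → F} (hf : Ω.SmoothCpt f) : Continuous f := hf.smooth.continuous

lemma differentiable {f : E3 → F} (hf : Ω.SmoothCpt f) : Differentiable ℝ f :=
  hf.smooth.differentiable (by simp)

lemma of_tsupport_subset {f : E3 → F} (hf : Ω.SmoothCpt f) {g : E3 → G} (hg : ContDiff ℝ ∞ g)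
    (hp : Ω.Periodic g) (h : tsupport g ⊆ tsupport f) : Ω.SmoothCpt g := by
  obtain ⟨R, hR⟩ := hf.compact_support
  exact ⟨hg, hp, R, fun x hx => hR x (h hx)⟩

lemma of_zero {f : E3 → F} (hf : Ω.SmoothCpt f) {g : E3 → G} (hg : ContDiff ℝ ∞ g)
    (hp : Ω.Periodic g) (h : ∀ x, f x = 0 → g x = 0) : Ω.SmoothCpt g :=
  hf.of_tsupport_subset hg hp (closure_mono fun x hx hfx => hx (h x hfx))

lemma smul_left {f : E3 → F} (hf : Ω.SmoothCpt f) {a : E3 → ℝ} (ha : ContDiff ℝ ∞ a)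
    (hp : Ω.Periodic a) : Ω.SmoothCpt fun x => a x • f x :=
  hf.of_zero (ha.smul hf.smooth) (fun x i => by simp only [hp x i, hf.periodic x i])
    fun x hx => by simp only [hx, smul_zero]

lemma mul_left {f : E3 → ℝ} (hf : Ω.SmoothCpt f) {a : E3 → ℝ} (ha : ContDiff ℝ ∞ a)
    (hp : Ω.Periodic a) : Ω.SmoothCpt fun x => a x * f x := hf.smul_left ha hp

lemma smul_const {f : E3 → ℝ} (hf : Ω.SmoothCpt f) (v : F) : Ω.SmoothCpt fun x => f x • v :=
  hf.of_zero (hf.smooth.smul contDiff_const) (fun x i => by simp only [hf.periodic x i])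
    fun x hx => by simp only [hx, zero_smul]

lemma clm {f : E3 → F} (hf : Ω.SmoothCpt f) (L : F →L[ℝ] G) : Ω.SmoothCpt fun x => L (f x) :=
  hf.of_zero (L.contDiff.comp hf.smooth) (fun x i => by simp only [hf.periodic x i])
    fun x hx => by simp only [hx, map_zero]

lemma coord {f : E3 → E3} (hf : Ω.SmoothCpt f) (i : Fin 3) : Ω.SmoothCpt fun x => f x i :=
  hf.clm (EuclideanSpace.proj i)

lemma add {f g : E3 → F} (hf : Ω.SmoothCpt f) (hg : Ω.SmoothCpt g) :
    Ω.SmoothCpt fun x => f x + g x := by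
  obtain ⟨R, hR⟩ := hf.compact_support
  obtain ⟨R', hR'⟩ := hg.compact_support
  refine ⟨hf.smooth.add hg.smooth, fun x i => by simp only [hf.periodic x i, hg.periodic x i],
    max R R', fun x hx i hi => ?_⟩
  rcases tsupport_add f g hx with h | h
  · exact (hR x h i hi).trans (le_max_left _ _)
  · exact (hR' x h i hi).trans (le_max_right _ _)

lemma neg {f : E3 → F} (hf : Ω.SmoothCpt f) : Ω.SmoothCpt fun x => - f x :=
  hf.clm (-(ContinuousLinearMap.id ℝ F))

lemma const_smul {f : E3 → F} (hf : Ω.SmoothCpt f) (c : ℝ) : Ω.SmoothCpt fun x => c • f x :=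
  hf.clm (c • (ContinuousLinearMap.id ℝ F))

lemma sub {f g : E3 → F} (hf : Ω.SmoothCpt f) (hg : Ω.SmoothCpt g) :
    Ω.SmoothCpt fun x => f x - g x := by
  simpa only [sub_eq_add_neg] using hf.add hg.neg

variable (Ω F) in
lemma zero : Ω.SmoothCpt fun _ => (0 : F) :=
  ⟨contDiff_const, fun _ _ => rfl, 0, fun x hx => by simp [tsupport, Function.support] at hx⟩

lemma sum {ι : Type*} {f : ι → E3 → F} (s : Finset ι) (hf : ∀ i ∈ s, Ω.SmoothCpt (f i)) :
    Ω.SmoothCpt fun x => ∑ i ∈ s, f i x := by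
  classical
  induction s using Finset.induction_on with
  | empty => simpa using zero Ω F
  | insert a s ha ih =>
    simp only [Finset.sum_insert ha]
    exact (hf a (by simp)).add (ih fun i hi => hf i (by simp [hi]))

lemma translate {f : E3 → F} (hf : Ω.SmoothCpt f) (h : E3) : Ω.SmoothCpt fun x => f (x + h) := by
  obtain ⟨R, hR⟩ := hf.compact_support
  refine ⟨hf.smooth.comp (contDiff_id.add contDiff_const), fun x i => ?_,
    R + ∑ i, |h i|, fun x hx i hi => ?_⟩
  · have := hf.periodic (x + h) i
    rwa [add_right_comm] at this
  · have hx' : x + h ∈ tsupport f :=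
      tsupport_comp_subset_preimage (g := f) (f := fun x => x + h) (by fun_prop) hx
    have h1 := hR _ hx' i hi
    have h2 := Finset.single_le_sum (f := fun i => |h i|) (fun i _ => abs_nonneg _)
      (Finset.mem_univ i)
    have h3 : |x i| ≤ |(x + h) i| + |h i| := by
      rw [PiLp.add_apply]
      have := abs_sub (x i + h i) (h i)
      simpa using this
    linarith

lemma fderiv {f : E3 → F} (hf : Ω.SmoothCpt f) : Ω.SmoothCpt (fderiv ℝ f) := by
  refine hf.of_tsupport_subset (hf.smooth.fderiv_right (by simp)) (fun x i => ?_)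
    (tsupport_fderiv_subset ℝ)
  have : f = fun x => f (x + Ω.len i • e i) := by ext x; rw [hf.periodic x i]
  conv_rhs => rw [this]
  rw [fderiv_comp_add_right]

lemma fderiv_apply {f : E3 → F} (hf : Ω.SmoothCpt f) (v : E3) :
    Ω.SmoothCpt fun x => _root_.fderiv ℝ f x v :=
  hf.fderiv.clm (ContinuousLinearMap.apply ℝ F v)

/-- The support is bounded only in the full-line directions. Inside the cell the other coordinates
are bounded by the periods, so one box serves for all cases. -/
lemma exists_box {f : E3 → F} (hf : Ω.SmoothCpt f) :
    ∃ r, 0 ≤ r ∧ ∀ x ∈ Ω.cell, x ∉ box r → f x = 0 := by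
  obtain ⟨R, hR⟩ := hf.compact_support
  refine ⟨|R| + ∑ i, |Ω.len i|, by positivity, fun x hx hxr => ?_⟩
  by_contra hne
  refine hxr fun i => ?_
  have h2 := Finset.single_le_sum (f := fun i => |Ω.len i|) (fun i _ => abs_nonneg _)
      (Finset.mem_univ i)
  by_cases hi : Ω.len i = 0
  · have := hR x (subset_tsupport _ hne) i hi
    have h3 := Finset.sum_nonneg (fun i (_ : i ∈ Finset.univ) => abs_nonneg (Ω.len i))
    linarith [le_abs_self R]
  · have := hx i hi
    rw [abs_of_nonneg this.1]
    linarith [this.2, le_abs_self (Ω.len i), abs_nonneg R]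

lemma exists_bound {f : E3 → F} (hf : Ω.SmoothCpt f) : ∃ C, 0 ≤ C ∧ ∀ x, ‖f x‖ ≤ C := by
  obtain ⟨r, hr, h⟩ := hf.exists_box
  obtain ⟨C, hC⟩ := (isCompact_box r).exists_bound_of_continuousOn hf.continuous.continuousOn
  refine ⟨max C 0, le_max_right _ _, fun x => ?_⟩
  rw [← hf.periodic.wrap]
  by_cases hx : Ω.wrap x ∈ box r
  · exact (hC _ hx).trans (le_max_left _ _)
  · rw [h _ (Ω.wrap_mem_cell x) hx, norm_zero]
    exact le_max_right _ _

lemma exists_lipschitz {f : E3 → F} (hf : Ω.SmoothCpt f) :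
    ∃ C, 0 ≤ C ∧ ∀ x y, ‖f x - f y‖ ≤ C * ‖x - y‖ := by
  obtain ⟨C, hC, h⟩ := hf.fderiv.exists_bound
  refine ⟨C, hC, fun x y => ?_⟩
  exact convex_univ.norm_image_sub_le_of_norm_fderiv_le (𝕜 := ℝ)
    (fun x _ => hf.differentiable x) (fun x _ => h x) (mem_univ y) (mem_univ x)

lemma memLp {f : E3 → F} (hf : Ω.SmoothCpt f) (p : ENNReal) : MemLp f p Ω.μ := by
  obtain ⟨r, hr, h⟩ := hf.exists_box
  obtain ⟨C, hC, hb⟩ := hf.exists_bound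
  have key : f =ᵐ[Ω.μ] (box r).indicator f := by
    filter_upwards [Ω.ae_mem_cell] with x hx
    by_cases hxr : x ∈ box r
    · rw [indicator_of_mem hxr]
    · rw [indicator_of_notMem hxr, h x hx hxr]
  refine (memLp_congr_ae key).2 ?_
  rw [memLp_indicator_iff_restrict (isCompact_box r).measurableSet]
  have : IsFiniteMeasure (Ω.μ.restrict (box r)) := ⟨by
    rw [Measure.restrict_apply_univ]
    exact Ω.μ_box_lt_top r⟩
  exact MemLp.of_bound hf.continuous.aestronglyMeasurable C (ae_of_all _ hb)

lemma integrable {f : E3 → F} (hf : Ω.SmoothCpt f) : Integrable f Ω.μ :=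
  memLp_one_iff_integrable.1 (hf.memLp 1)

lemma integrable_smul {φ : E3 → ℝ} (hφ : Ω.SmoothCpt φ) {k : E3 → F}
    (hk : LocallyIntegrable k Ω.μ) : Integrable (fun x => φ x • k x) Ω.μ := by
  obtain ⟨r, hr, h⟩ := hφ.exists_box
  obtain ⟨C, hC, hb⟩ := hφ.exists_bound
  have h1 : IntegrableOn k (box r) Ω.μ := hk.integrableOn_isCompact (isCompact_box r)
  have h2 := (integrable_indicator_iff (isCompact_box r).measurableSet).2 h1
  have h3 : Integrable (fun x => φ x • (box r).indicator k x) Ω.μ :=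
    h2.bdd_smul C hφ.continuous.aestronglyMeasurable (ae_of_all _ hb)
  refine h3.congr ?_
  filter_upwards [Ω.ae_mem_cell] with x hx
  by_cases hxr : x ∈ box r
  · rw [indicator_of_mem hxr]
  · rw [h x hx hxr, zero_smul, zero_smul]

/-- Differentiation of the translates of a smooth function under the integral sign. -/
lemma hasDerivAt_integral {φ : E3 → ℝ} (hφ : Ω.SmoothCpt φ) {k : E3 → F}
    (hk : LocallyIntegrable k Ω.μ) (v : E3) :
    HasDerivAt (fun s : ℝ => ∫ x, φ (x + s • v) • k x ∂Ω.μ)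
      (∫ x, _root_.fderiv ℝ φ x v • k x ∂Ω.μ) 0 := by
  obtain ⟨R, hR⟩ := hφ.compact_support
  obtain ⟨C, hC, hb⟩ := (hφ.fderiv_apply v).exists_bound
  -- The last sum leaves room for the translations `s • v` with `|s| < 1`, so that a single box
  -- dominates all of them.
  set r : ℝ := |R| + ∑ i, |Ω.len i| + ∑ i, |v i| with hr
  have hsupp : ∀ x ∈ Ω.cell, x ∉ box r → ∀ s ∈ Metric.ball (0 : ℝ) 1,
      _root_.fderiv ℝ φ (x + s • v) v = 0 := by
    intro x hx hxr s hs
    by_contra hne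
    have hmem : x + s • v ∈ tsupport φ := by
      refine support_fderiv_subset ℝ (f := φ) ?_
      intro h0
      rw [h0] at hne
      exact hne rfl
    refine hxr fun i => ?_
    have h2 := Finset.single_le_sum (f := fun i => |Ω.len i|) (fun i _ => abs_nonneg _)
      (Finset.mem_univ i)
    have h3 := Finset.single_le_sum (f := fun i => |v i|) (fun i _ => abs_nonneg _)
      (Finset.mem_univ i)
    simp only at h2 h3
    have h4 := Finset.sum_nonneg (fun i (_ : i ∈ Finset.univ) => abs_nonneg (Ω.len i))
    have h5 := Finset.sum_nonneg (fun i (_ : i ∈ Finset.univ) => abs_nonneg (v i))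
    by_cases hi : Ω.len i = 0
    · have h6 := hR _ hmem i hi
      have h7 : |x i| ≤ |(x + s • v) i| + |s| * |v i| := by
        rw [← abs_mul, PiLp.add_apply, PiLp.smul_apply, smul_eq_mul]
        have := abs_sub (x i + s * v i) (s * v i)
        simpa using this
      have h8 : |s| * |v i| ≤ |v i| := by
        have : |s| ≤ 1 := by simpa using (Metric.mem_ball.1 hs).le
        exact mul_le_of_le_one_left (abs_nonneg _) this
      linarith [le_abs_self R]
    · have := hx i hi
      rw [abs_of_nonneg this.1]
      linarith [this.2, le_abs_self (Ω.len i), abs_nonneg R]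
  have hint := (integrable_indicator_iff (isCompact_box r).measurableSet).2
    (hk.integrableOn_isCompact (isCompact_box r))
  have key := hasDerivAt_integral_of_dominated_loc_of_deriv_le (μ := Ω.μ) (𝕜 := ℝ)
    (F := fun (s : ℝ) x => φ (x + s • v) • k x)
    (F' := fun (s : ℝ) x => _root_.fderiv ℝ φ (x + s • v) v • k x) (x₀ := 0)
    (bound := fun x => C * ‖(box r).indicator k x‖) (Metric.ball_mem_nhds 0 one_pos)
    ?_ ?_ ?_ ?_ ?_ ?_
  · simpa using key.2
  · refine Eventually.of_forall fun s => ?_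
    exact (hφ.continuous.comp (by fun_prop)).aestronglyMeasurable.smul hk.aestronglyMeasurable
  · simpa using hφ.integrable_smul hk
  · simp only [zero_smul, add_zero]
    exact ((hφ.fderiv_apply v).continuous.aestronglyMeasurable).smul hk.aestronglyMeasurable
  · filter_upwards [Ω.ae_mem_cell] with x hx s hs
    by_cases hxr : x ∈ box r
    · rw [indicator_of_mem hxr, norm_smul]
      exact mul_le_mul_of_nonneg_right (hb _) (norm_nonneg _)
    · rw [hsupp x hx hxr s hs, zero_smul, norm_zero]
      positivity
  · exact hint.norm.const_mul C
  · refine ae_of_all _ fun x s _ => ?_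
    have h1 : HasDerivAt (fun s : ℝ => x + s • v) v s := by
      simpa using ((hasDerivAt_id s).smul_const v).const_add x
    have h2 := (hφ.differentiable (x + s • v)).hasFDerivAt.comp_hasDerivAt s h1
    exact h2.smul_const (k x)

/-- By translation invariance the integral of `φ (x + s • v)` does not depend on `s`; its derivative
at `s = 0` is the integral in question. -/
lemma integral_fderiv {φ : E3 → ℝ} (hφ : Ω.SmoothCpt φ) (v : E3) :
    ∫ x, _root_.fderiv ℝ φ x v ∂Ω.μ = 0 := by
  have h1 := hφ.hasDerivAt_integral (k := fun _ => (1 : ℝ)) (locallyIntegrable_const _) v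
  have h2 : (fun s : ℝ => ∫ x, φ (x + s • v) • (1 : ℝ) ∂Ω.μ) = fun _ => ∫ x, φ x ∂Ω.μ := by
    ext s
    simp only [smul_eq_mul, mul_one]
    have := integral_map (μ := Ω.μ) (Ω.measurable_shift (s • v)).aemeasurable
      (f := φ) hφ.continuous.aestronglyMeasurable
    rw [(Ω.measurePreserving_shift (s • v)).map_eq] at this
    rw [this]
    exact integral_congr_ae (ae_of_all _ fun x => (hφ.periodic.comp_shift _ _).symm)
  rw [h2] at h1
  simpa using h1.unique (hasDerivAt_const _ _)

end SmoothCpt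

/-- A smooth function with compact support in the open cell extends to a function on `Ω`. -/
lemma smoothCpt_comp_wrap {g : E3 → ℝ} (hg : ContDiff ℝ ∞ g) (hc : HasCompactSupport g)
    (hs : tsupport g ⊆ {x | ∀ i, Ω.len i ≠ 0 → x i ∈ Ioo 0 (Ω.len i)}) :
    Ω.SmoothCpt fun x => g (Ω.wrap x) := by
  set U : Set E3 := {x | ∀ i, Ω.len i ≠ 0 → x i ∈ Ioo 0 (Ω.len i)} with hU
  have hUo : IsOpen U := by
    have : U = ⋂ i, ⋂ (_ : Ω.len i ≠ 0), (fun x : E3 => x i) ⁻¹' Ioo 0 (Ω.len i) := by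
      ext x; simp [hU]
    rw [this]
    exact isOpen_iInter_of_finite fun i => isOpen_iInter_of_finite fun _ =>
      isOpen_Ioo.preimage (by fun_prop)
  have hUc : U ⊆ Ω.cell := fun x hx i hi => Ioo_subset_Ico_self (hx i hi)
  have hp := Ω.periodic_comp_wrap g
  -- This closed set consists of the points that `wrap` sends into the support. Near it the
  -- extension is a translate of `g`; on its complement it is zero.
  open scoped Pointwise in
  have hZ : IsClosed (tsupport g + (Ω.lattice : Set E3)) :=
    IsClosed.add_left_of_isCompact Ω.isClosed_lattice hc
  have hmem : ∀ x, Ω.wrap x ∈ tsupport g → x ∈ tsupport g + (Ω.lattice : Set E3) := by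
    intro x hx
    refine Set.mem_add.2 ⟨_, hx, x - Ω.wrap x, ?_, by abel⟩
    have := Ω.lattice.neg_mem (Ω.wrap_sub_mem x)
    rwa [neg_sub] at this
  have hmem' : ∀ x ∈ tsupport g + (Ω.lattice : Set E3), Ω.wrap x ∈ tsupport g := by
    intro x hx
    obtain ⟨y, hy, v, hv, rfl⟩ := Set.mem_add.1 hx
    rw [Ω.wrap_add_of_mem hv, Ω.wrap_of_mem (hUc (hs hy))]
    exact hy
  refine ⟨contDiff_iff_contDiffAt.2 fun x => ?_, hp, ?_⟩
  · by_cases hx : x ∈ tsupport g + (Ω.lattice : Set E3)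
    · have h1 := hs (hmem' x hx)
      have h2 : ∀ᶠ y in 𝓝 x, y + (Ω.wrap x - x) ∈ U := by
        have : ContinuousAt (fun y => y + (Ω.wrap x - x)) x := by fun_prop
        refine this.eventually_mem (hUo.mem_nhds ?_)
        rwa [add_sub_cancel]
      refine ContDiffAt.congr_of_eventuallyEq
        (f := fun y => g (y + (Ω.wrap x - x))) ?_ ?_
      · exact (hg.comp (contDiff_id.add contDiff_const)).contDiffAt
      · filter_upwards [h2] with y hy
        rw [← Ω.wrap_add_of_mem (Ω.wrap_sub_mem x) y, Ω.wrap_of_mem (hUc hy)]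
    · refine ContDiffAt.congr_of_eventuallyEq (f := fun _ => 0) contDiffAt_const ?_
      filter_upwards [hZ.isOpen_compl.mem_nhds hx] with y hy
      by_contra hne
      exact hy (hmem y (subset_tsupport _ hne))
  · obtain ⟨R, hR⟩ := hc.isCompact.isBounded.exists_norm_le
    refine ⟨R, fun x hx i hi => ?_⟩
    have hx' : x ∈ tsupport g + (Ω.lattice : Set E3) :=
      closure_minimal (fun y hy => hmem y (subset_tsupport _ hy)) hZ hx
    have h1 := hR _ (hmem' x hx')
    have h2 := PiLp.norm_apply_le (Ω.wrap x) i
    rw [wrap_apply, if_pos hi] at h2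
    exact h2.trans h1

/-- The fundamental lemma of the calculus of variations on `Ω`. -/
lemma ae_eq_zero_of_integral_smul [CompleteSpace F] {f : E3 → F} (hf : LocallyIntegrable f Ω.μ)
    (h : ∀ φ : E3 → ℝ, Ω.SmoothCpt φ → ∫ x, φ x • f x ∂Ω.μ = 0) : f =ᵐ[Ω.μ] 0 := by
  set U : Set E3 := {x | ∀ i, Ω.len i ≠ 0 → x i ∈ Ioo 0 (Ω.len i)} with hU
  have hUo : IsOpen U := by
    have : U = ⋂ i, ⋂ (_ : Ω.len i ≠ 0), (fun x : E3 => x i) ⁻¹' Ioo 0 (Ω.len i) := by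
      ext x; simp [hU]
    rw [this]
    exact isOpen_iInter_of_finite fun i => isOpen_iInter_of_finite fun _ =>
      isOpen_Ioo.preimage (by fun_prop)
  have h1 := hUo.ae_eq_zero_of_integral_contDiff_smul_eq_zero (μ := Ω.μ)
    (hf.locallyIntegrableOn U) (fun g hg hc hs => by
      rw [← h _ (smoothCpt_comp_wrap hg hc hs)]
      refine integral_congr_ae ?_
      filter_upwards [Ω.ae_mem_cell] with x hx
      rw [Ω.wrap_of_mem hx])
  -- The open cell differs from the cell only on the hyperplanes `x i = 0`, which are null.
  have h2 : ∀ i : Fin 3, ∀ᵐ x ∂Ω.μ, x i ≠ 0 := by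
    intro i
    refine ae_restrict_of_ae ?_
    have h3 := Measure.addHaar_submodule (volume : Measure E3)
      (LinearMap.ker (EuclideanSpace.proj i : E3 →L[ℝ] ℝ).toLinearMap) (fun htop => by
        have : e i ∈ LinearMap.ker (EuclideanSpace.proj i : E3 →L[ℝ] ℝ).toLinearMap := by
          rw [htop]; trivial
        simp [e] at this)
    rw [ae_iff]
    convert h3 using 2
    ext x
    simp
  filter_upwards [h1, ae_all_iff.2 h2, Ω.ae_mem_cell] with x hx1 hx2 hx3
  exact hx1 fun i hi => ⟨(hx3 i hi).1.lt_of_ne' (hx2 i), (hx3 i hi).2⟩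

end Domain

/-! ### The translation group of `L²`, with weak derivatives as its generators, and directional
averages. -/

namespace Domain

variable {Ω : Domain}

lemma memLp_locallyIntegrable {F : Type*} [NormedAddCommGroup F] {f : E3 → F}
    (hf : MemLp f 2 Ω.μ) : LocallyIntegrable f Ω.μ := hf.locallyIntegrable (by norm_num)

lemma L2_locallyIntegrable (u : Ω.L2) : LocallyIntegrable u Ω.μ :=
  memLp_locallyIntegrable (Lp.memLp u)

lemma L2_integrable_smul {φ : E3 → ℝ} (hφ : Ω.SmoothCpt φ) (u : Ω.L2) :
    Integrable (fun x => φ x • u x) Ω.μ := hφ.integrable_smul (L2_locallyIntegrable u)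

/-- Two square integrable fields are equal if they have the same integrals against all test
functions. -/
lemma L2_ext {u v : Ω.L2} (h : ∀ φ : E3 → ℝ, Ω.SmoothCpt φ →
    ∫ x, φ x • u x ∂Ω.μ = ∫ x, φ x • v x ∂Ω.μ) : u = v := by
  have h1 : (fun x => u x - v x) =ᵐ[Ω.μ] 0 := by
    refine ae_eq_zero_of_integral_smul ((L2_locallyIntegrable u).sub (L2_locallyIntegrable v))
      fun φ hφ => ?_
    simp only [smul_sub]
    rw [integral_sub (L2_integrable_smul hφ u) (L2_integrable_smul hφ v), h φ hφ, sub_self]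
  apply Lp.ext
  filter_upwards [h1] with x hx
  exact sub_eq_zero.1 hx

variable (Ω) in
/-- The translation group of `L²(Ω)`. -/
def trans (h : E3) : Ω.L2 →ₗᵢ[ℝ] Ω.L2 :=
  Lp.compMeasurePreservingₗᵢ ℝ (Ω.shift h) (Ω.measurePreserving_shift h)

lemma coeFn_trans (h : E3) (u : Ω.L2) : Ω.trans h u =ᵐ[Ω.μ] fun x => u (Ω.shift h x) :=
  Lp.coeFn_compMeasurePreserving u (Ω.measurePreserving_shift h)

lemma trans_trans (h k : E3) (u : Ω.L2) : Ω.trans h (Ω.trans k u) = Ω.trans (h + k) u := by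
  apply Lp.ext
  have h1 := (Ω.measurePreserving_shift h).quasiMeasurePreserving.ae (coeFn_trans k u)
  filter_upwards [coeFn_trans h (Ω.trans k u), coeFn_trans (h + k) u, h1] with x h2 h3 h4
  rw [h2, h3, h4, Ω.shift_shift]

lemma trans_zero (u : Ω.L2) : Ω.trans 0 u = u := by
  apply Lp.ext
  filter_upwards [coeFn_trans 0 u, Ω.ae_mem_cell] with x h1 h2
  rw [h1, Ω.shift_zero h2]

lemma inner_trans (h : E3) (u v : Ω.L2) : ⟪Ω.trans h u, v⟫_ℝ = ⟪u, Ω.trans (-h) v⟫_ℝ := by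
  rw [← (Ω.trans (-h)).inner_map_map, trans_trans, neg_add_cancel, trans_zero]

/-- Integration of a function of a translate. -/
lemma integral_comp_shift {F : Type*} [NormedAddCommGroup F] [NormedSpace ℝ F] (h : E3)
    {f : E3 → F} (hf : AEStronglyMeasurable f Ω.μ) :
    ∫ x, f (Ω.shift h x) ∂Ω.μ = ∫ x, f x ∂Ω.μ := by
  have h1 := Ω.measurePreserving_shift h
  conv_rhs => rw [← h1.map_eq]
  rw [integral_map h1.measurable.aemeasurable]
  rwa [h1.map_eq]

lemma integral_smul_trans {φ : E3 → ℝ} (hφ : Ω.SmoothCpt φ) (h : E3) (u : Ω.L2) :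
    ∫ x, φ x • Ω.trans h u x ∂Ω.μ = ∫ x, φ (x + -h) • u x ∂Ω.μ := by
  have h1 := integral_comp_shift h (Ω := Ω) (f := fun x => φ (x + -h) • u x)
    (L2_integrable_smul (hφ.translate (-h)) u).aestronglyMeasurable
  rw [← h1]
  refine integral_congr_ae ?_
  filter_upwards [coeFn_trans h u] with x hx
  have : φ (Ω.shift h x + -h) = φ x := by
    rw [(hφ.translate (-h)).periodic.comp_shift h x, add_neg_cancel_right]
  rw [hx, this]

/-- A smooth field with compact support as an element of `L²(Ω)`. -/
def SmoothCpt.toL2 {ψ : E3 → E3} (hψ : Ω.SmoothCpt ψ) : Ω.L2 := (hψ.memLp 2).toLp ψ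

lemma SmoothCpt.coeFn_toL2 {ψ : E3 → E3} (hψ : Ω.SmoothCpt ψ) : hψ.toL2 =ᵐ[Ω.μ] ψ :=
  (hψ.memLp 2).coeFn_toLp

lemma SmoothCpt.inner_toL2 {ψ : E3 → E3} (hψ : Ω.SmoothCpt ψ) (u : Ω.L2) :
    ⟪u, hψ.toL2⟫_ℝ = ∫ x, ⟪u x, ψ x⟫_ℝ ∂Ω.μ := by
  rw [L2.inner_def]
  refine integral_congr_ae ?_
  filter_upwards [hψ.coeFn_toL2] with x hx
  rw [hx]

lemma inner_smul_toL2 {φ : E3 → ℝ} (hφ : Ω.SmoothCpt φ) (v : E3) (u : Ω.L2) :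
    ⟪u, (hφ.smul_const v).toL2⟫_ℝ = ⟪∫ x, φ x • u x ∂Ω.μ, v⟫_ℝ := by
  rw [(hφ.smul_const v).inner_toL2, real_inner_comm, ← integral_inner (L2_integrable_smul hφ u)]
  refine integral_congr_ae (ae_of_all _ fun x => ?_)
  simp only [real_inner_smul_left, real_inner_smul_right, real_inner_comm]

/-- Integration against a test function, as a continuous linear map. -/
def pairL {φ : E3 → ℝ} (hφ : Ω.SmoothCpt φ) : Ω.L2 →L[ℝ] E3 :=
  ∑ i, (innerSL ℝ (hφ.smul_const (e i)).toL2).smulRight (e i)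

lemma pairL_apply {φ : E3 → ℝ} (hφ : Ω.SmoothCpt φ) (u : Ω.L2) :
    pairL hφ u = ∫ x, φ x • u x ∂Ω.μ := by
  simp only [pairL, _root_.sum_apply, ContinuousLinearMap.smulRight_apply,
    innerSL_apply_apply]
  have := (EuclideanSpace.basisFun (Fin 3) ℝ).sum_repr (∫ x, φ x • u x ∂Ω.μ)
  rw [← this]
  refine Finset.sum_congr rfl fun i _ => ?_
  rw [real_inner_comm, inner_smul_toL2 hφ]
  simp [e, EuclideanSpace.inner_single_right]

lemma pairL_trans {φ : E3 → ℝ} (hφ : Ω.SmoothCpt φ) (h : E3) (u : Ω.L2) :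
    pairL hφ (Ω.trans h u) = pairL (hφ.translate (-h)) u := by
  rw [pairL_apply, pairL_apply, integral_smul_trans hφ]

lemma pairL_ext {u v : Ω.L2} (h : ∀ (φ : E3 → ℝ) (hφ : Ω.SmoothCpt φ), pairL hφ u = pairL hφ v) :
    u = v := L2_ext fun φ hφ => by rw [← pairL_apply hφ, ← pairL_apply hφ, h]

/-- The test fields span a dense subspace of `L²(Ω)`. -/
lemma dense_tests (S : Submodule ℝ Ω.L2)
    (hS : ∀ (φ : E3 → ℝ) (hφ : Ω.SmoothCpt φ) (v : E3), (hφ.smul_const v).toL2 ∈ S) :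
    Dense (S : Set Ω.L2) := by
  rw [Submodule.dense_iff_topologicalClosure_eq_top, Submodule.topologicalClosure_eq_top_iff,
    Submodule.eq_bot_iff]
  intro u hu
  refine L2_ext fun φ hφ => ?_
  have h1 : ∀ v : E3, ⟪∫ x, φ x • u x ∂Ω.μ, v⟫_ℝ = 0 := by
    intro v
    rw [← inner_smul_toL2 hφ v u, real_inner_comm]
    exact hu _ (hS φ hφ v)
  have h2 := inner_self_eq_zero.1 (h1 _)
  rw [h2, eq_comm]
  refine integral_eq_zero_of_ae ?_
  filter_upwards [Lp.coeFn_zero E3 2 Ω.μ] with x hx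
  rw [hx]
  simp

lemma L2_norm_le_of_box {u : Ω.L2} {r c : ℝ} (hc : 0 ≤ c)
    (h : ∀ᵐ x ∂Ω.μ, ‖u x‖ ≤ (box r).indicator (fun _ => c) x) :
    ‖u‖ ≤ c * Ω.μ.real (box r) ^ (1 / 2 : ℝ) := by
  have h1 := Lp.norm_le_norm_of_ae_le (f := u)
    (g := indicatorConstLp 2 (isCompact_box r).measurableSet (Ω.μ_box_lt_top r).ne c) (by
      filter_upwards [h, indicatorConstLp_coeFn (p := 2) (hs := (isCompact_box r).measurableSet)
        (hμs := (Ω.μ_box_lt_top r).ne) (c := c)] with x h2 h3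
      rw [h3]
      exact h2.trans (le_abs_self _))
  refine h1.trans (le_of_eq ?_)
  rw [norm_indicatorConstLp (by norm_num) (by norm_num), Real.norm_of_nonneg hc]
  norm_num

/-- For `‖h‖ ≤ 1` the field and its translate vanish outside a common box, so a Lipschitz bound
becomes a bound in `L²`. -/
lemma SmoothCpt.exists_norm_trans_sub_le {ψ : E3 → E3} (hψ : Ω.SmoothCpt ψ) :
    ∃ C, 0 ≤ C ∧ ∀ h : E3, ‖h‖ ≤ 1 → ‖Ω.trans h hψ.toL2 - hψ.toL2‖ ≤ C * ‖h‖ := by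
  obtain ⟨R, hR⟩ := hψ.compact_support
  obtain ⟨C, hC, hL⟩ := hψ.exists_lipschitz
  set r : ℝ := |R| + ∑ i, |Ω.len i| + 1 with hr
  refine ⟨C * Ω.μ.real (box r) ^ (1 / 2 : ℝ), by positivity, fun h hh => ?_⟩
  have key : ∀ x ∈ Ω.cell, x ∉ box r → ψ (x + h) = 0 ∧ ψ x = 0 := by
    intro x hx hxr
    by_contra hne
    refine hxr fun i => ?_
    have h2 := Finset.single_le_sum (f := fun i => |Ω.len i|) (fun i _ => abs_nonneg _)
      (Finset.mem_univ i)
    have h4 := Finset.sum_nonneg (fun i (_ : i ∈ Finset.univ) => abs_nonneg (Ω.len i))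
    by_cases hi : Ω.len i = 0
    · have h5 : |x i| ≤ R + 1 := by
        rw [not_and_or] at hne
        rcases hne with h0 | h0
        · have h6 := hR _ (subset_tsupport _ h0) i hi
          have h7 := abs_sub (x i + h i) (h i)
          rw [add_sub_cancel_right] at h7
          have h8 : |h i| ≤ ‖h‖ := PiLp.norm_apply_le h i
          rw [PiLp.add_apply] at h6
          linarith
        · linarith [hR _ (subset_tsupport _ h0) i hi]
      linarith [le_abs_self R]
    · have := hx i hi
      rw [abs_of_nonneg this.1]
      linarith [this.2, le_abs_self (Ω.len i), abs_nonneg R]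
  have h1 : ‖Ω.trans h hψ.toL2 - hψ.toL2‖ ≤ (C * ‖h‖) * Ω.μ.real (box r) ^ (1 / 2 : ℝ) := by
    refine L2_norm_le_of_box (by positivity) ?_
    have h2 := (Ω.measurePreserving_shift h).quasiMeasurePreserving.ae hψ.coeFn_toL2
    filter_upwards [Lp.coeFn_sub (Ω.trans h hψ.toL2) hψ.toL2, coeFn_trans h hψ.toL2,
      hψ.coeFn_toL2, h2, Ω.ae_mem_cell] with x h3 h4 h5 h6 h7
    rw [h3, Pi.sub_apply, h4, h5, h6, hψ.periodic.comp_shift]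
    by_cases hx : x ∈ box r
    · rw [indicator_of_mem hx]
      simpa using hL (x + h) x
    · rw [indicator_of_notMem hx, (key x h7 hx).1, (key x h7 hx).2]
      simp
  calc _ ≤ _ := h1
    _ = _ := by ring

/-- The translation group is strongly continuous. -/
lemma tendsto_trans_zero (u : Ω.L2) : Tendsto (fun h => Ω.trans h u) (𝓝 0) (𝓝 u) := by
  -- The fields with an orbit continuous at `0` form a subspace. It contains the test fields, hence
  -- is dense, and translations being isometries the property passes to the closure.
  let S : Submodule ℝ Ω.L2 :=
    { carrier := {u | Tendsto (fun h => Ω.trans h u) (𝓝 0) (𝓝 u)}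
      add_mem' := fun {a b} ha hb => by
        change Tendsto _ _ _
        simp only [map_add]
        exact Tendsto.add (f := fun h => Ω.trans h a) (g := fun h => Ω.trans h b) ha hb
      zero_mem' := by simp
      smul_mem' := fun c a ha => by
        change Tendsto _ _ _
        simp only [map_smul]
        exact Tendsto.const_smul (f := fun h => Ω.trans h a) ha c }
  have hd := dense_tests S (fun φ hφ v => by
    obtain ⟨C, hC, h⟩ := (hφ.smul_const v).exists_norm_trans_sub_le
    change Tendsto _ _ _
    rw [tendsto_iff_norm_sub_tendsto_zero]
    refine squeeze_zero' (g := fun h => C * ‖h‖) (Eventually.of_forall fun _ => norm_nonneg _) ?_ ?_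
    · filter_upwards [Metric.ball_mem_nhds (0 : E3) one_pos] with x hx
      exact h x (by simpa using (Metric.mem_ball.1 hx).le)
    · have : Continuous fun h : E3 => C * ‖h‖ := by fun_prop
      simpa using this.tendsto 0)
  rw [Metric.tendsto_nhds]
  intro ε hε
  obtain ⟨v, hv, hvu⟩ := Metric.mem_closure_iff.1 (hd u) (ε / 3) (by positivity)
  have hv' : Tendsto (fun h => Ω.trans h v) (𝓝 0) (𝓝 v) := hv
  filter_upwards [Metric.tendsto_nhds.1 hv' (ε / 3) (by positivity)] with h hh
  have h1 : dist (Ω.trans h u) (Ω.trans h v) = dist u v := (Ω.trans h).dist_map u v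
  have h2 := dist_triangle4 (Ω.trans h u) (Ω.trans h v) v u
  rw [h1, dist_comm v u] at h2
  linarith

lemma continuous_trans (u : Ω.L2) : Continuous fun h => Ω.trans h u := by
  rw [continuous_iff_continuousAt]
  intro h
  have h1 : Tendsto (fun k => Ω.trans h (Ω.trans (k - h) u)) (𝓝 h) (𝓝 (Ω.trans h u)) := by
    refine ((Ω.trans h).continuous.tendsto u).comp ((tendsto_trans_zero u).comp ?_)
    have : Continuous fun k : E3 => k - h := by fun_prop
    simpa using this.tendsto h
  refine h1.congr fun k => ?_
  rw [trans_trans, add_sub_cancel]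

lemma continuous_trans_smul (v : E3) (u : Ω.L2) : Continuous fun s : ℝ => Ω.trans (s • v) u :=
  (continuous_trans u).comp (by fun_prop)

/-- The derivative of the translates of a test function in the sense of distributions. -/
lemma hasDerivAt_pairL_translate {φ : E3 → ℝ} (hφ : Ω.SmoothCpt φ) (v : E3) (u : Ω.L2) (s : ℝ) :
    HasDerivAt (fun s : ℝ => pairL (hφ.translate (-(s • v))) u)
      (-pairL ((hφ.fderiv_apply v).translate (-(s • v))) u) s := by
  have h1 := (hφ.translate (-(s • v))).hasDerivAt_integral (L2_locallyIntegrable u) v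
  have h2 : HasDerivAt (fun t : ℝ => -(t - s)) (-1) s := by
    exact ((hasDerivAt_id s).sub_const s).neg
  have h1' : HasDerivAt (fun t : ℝ => ∫ x, φ (x + t • v + -(s • v)) • u x ∂Ω.μ)
      (∫ x, _root_.fderiv ℝ (fun x => φ (x + -(s • v))) x v • u x ∂Ω.μ) (-(s - s)) := by
    simpa using h1
  have h3 := h1'.scomp s h2
  have h4 : (fun t : ℝ => pairL (hφ.translate (-(t • v))) u)
      = (fun t : ℝ => ∫ x, φ (x + t • v + -(s • v)) • u x ∂Ω.μ) ∘ fun t => -(t - s) := by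
    ext1 t
    rw [pairL_apply, Function.comp_apply]
    congr 1
    ext1 x
    congr 2
    rw [neg_sub, sub_smul]
    abel
  rw [h4]
  convert! h3 using 1
  rw [pairL_apply, neg_one_smul]
  simp only [fderiv_comp_add_right]

lemma isWeakPartial_iff {j : Fin 3} {u g : Ω.L2} : Ω.IsWeakPartial j u g ↔
    ∀ (φ : E3 → ℝ) (hφ : Ω.SmoothCpt φ), pairL (hφ.fderiv_apply (e j)) u = - pairL hφ g := by
  simp only [IsWeakPartial, isTest_iff, pairL_apply]

/-- Against a test function both sides are primitives of the same continuous function of the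
translation parameter, because translation can be moved onto the test function. -/
lemma IsWeakPartial.trans_sub {j : Fin 3} {u g : Ω.L2} (h : Ω.IsWeakPartial j u g) (s : ℝ) :
    Ω.trans (s • e j) u - u = ∫ τ in (0 : ℝ)..s, Ω.trans (τ • e j) g := by
  rw [isWeakPartial_iff] at h
  refine pairL_ext fun φ hφ => ?_
  have h1 : ∀ τ : ℝ, HasDerivAt (fun τ : ℝ => pairL hφ (Ω.trans (τ • e j) u))
      (pairL hφ (Ω.trans (τ • e j) g)) τ := by
    intro τ
    simp only [pairL_trans]
    have h2 := hasDerivAt_pairL_translate hφ (e j) u τ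
    have h3 := h _ (hφ.translate (-(τ • e j)))
    rw [eq_comm, neg_eq_iff_eq_neg] at h3
    rw [h3]
    convert! h2 using 3
    refine ContinuousLinearMap.ext fun w => ?_
    rw [pairL_apply, pairL_apply]
    simp only [fderiv_comp_add_right]
  have hc : Continuous fun τ : ℝ => Ω.trans (τ • e j) g := continuous_trans_smul _ _
  rw [← ContinuousLinearMap.intervalIntegral_comp_comm _ (hc.intervalIntegrable _ _),
    intervalIntegral.integral_eq_sub_of_hasDerivAt (fun τ _ => h1 τ)
      (((pairL hφ).continuous.comp hc).intervalIntegrable _ _), map_sub]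
  simp [trans_zero]

/-- A weak partial derivative is a derivative of the translation group. -/
lemma isWeakPartial_iff_hasDerivAt {j : Fin 3} {u g : Ω.L2} : Ω.IsWeakPartial j u g ↔
    HasDerivAt (fun s : ℝ => Ω.trans (s • e j) u) g 0 := by
  constructor
  · intro h
    have hc : Continuous fun τ : ℝ => Ω.trans (τ • e j) g := continuous_trans_smul _ _
    have h1 := intervalIntegral.integral_hasDerivAt_right (hc.intervalIntegrable 0 0)
      (hc.stronglyMeasurableAtFilter _ _) hc.continuousAt
    simp only [zero_smul, trans_zero] at h1
    have h2 := h1.add_const u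
    convert! h2 using 1
    ext1 s
    rw [← h.trans_sub, sub_add_cancel]
  · intro h
    rw [isWeakPartial_iff]
    intro φ hφ
    have h1 := (pairL hφ).hasFDerivAt.comp_hasDerivAt (0 : ℝ) h
    have h2 := hasDerivAt_pairL_translate hφ (e j) u 0
    have h3 : (pairL hφ ∘ fun s : ℝ => Ω.trans (s • e j) u)
        = fun s : ℝ => pairL (hφ.translate (-(s • e j))) u := by
      ext1 s; simp [pairL_trans]
    rw [h3] at h1
    have h4 := h1.unique h2
    rw [h4, neg_neg, pairL_apply, pairL_apply]
    simp

namespace IsWeakPartial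

lemma unique {j : Fin 3} {u g g' : Ω.L2} (h : Ω.IsWeakPartial j u g)
    (h' : Ω.IsWeakPartial j u g') : g = g' :=
  (isWeakPartial_iff_hasDerivAt.1 h).unique (isWeakPartial_iff_hasDerivAt.1 h')

lemma add {j : Fin 3} {u u' g g' : Ω.L2} (h : Ω.IsWeakPartial j u g)
    (h' : Ω.IsWeakPartial j u' g') : Ω.IsWeakPartial j (u + u') (g + g') := by
  rw [isWeakPartial_iff_hasDerivAt] at *
  simpa only [map_add] using! HasDerivAt.add h h'

lemma smul {j : Fin 3} {u g : Ω.L2} (h : Ω.IsWeakPartial j u g) (c : ℝ) :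
    Ω.IsWeakPartial j (c • u) (c • g) := by
  rw [isWeakPartial_iff_hasDerivAt] at *
  simpa only [map_smul] using! HasDerivAt.const_smul c h

/-- This is the gain from seeing derivatives as generators: a bounded operator commuting with
translations preserves square integrable derivatives. The vertical average and the constant matrices
are of this type; `Π` is not treated so, as `b` depends on the horizontal variables. -/
lemma clm {j : Fin 3} {u g : Ω.L2} (h : Ω.IsWeakPartial j u g) (T : Ω.L2 →L[ℝ] Ω.L2)
    (hT : ∀ (h : E3) (u : Ω.L2), T (Ω.trans h u) = Ω.trans h (T u)) :
    Ω.IsWeakPartial j (T u) (T g) := by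
  rw [isWeakPartial_iff_hasDerivAt] at *
  have := T.hasFDerivAt.comp_hasDerivAt (0 : ℝ) h
  convert! this using 1
  ext1 s
  simp [hT]

/-- Integration by parts. -/
lemma inner_eq {j : Fin 3} {u u' g g' : Ω.L2} (h : Ω.IsWeakPartial j u g)
    (h' : Ω.IsWeakPartial j u' g') : ⟪g, u'⟫_ℝ = - ⟪u, g'⟫_ℝ := by
  rw [isWeakPartial_iff_hasDerivAt] at *
  have h1 := HasDerivAt.inner ℝ h h'
  simp only [LinearIsometry.inner_map_map, zero_smul, trans_zero] at h1
  have := h1.unique (hasDerivAt_const _ _)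
  linarith

lemma norm_trans_sub_le {j : Fin 3} {u g : Ω.L2} (h : Ω.IsWeakPartial j u g) (s : ℝ) :
    ‖Ω.trans (s • e j) u - u‖ ≤ |s| * ‖g‖ := by
  rw [h.trans_sub]
  have := intervalIntegral.norm_integral_le_of_norm_le_const (a := 0) (b := s) (C := ‖g‖)
    (f := fun τ => Ω.trans (τ • e j) g) (fun τ _ => by simp)
  rwa [sub_zero, mul_comm] at this

end IsWeakPartial

lemma eq_sum_smul_e (h : E3) : h = h 0 • e 0 + h 1 • e 1 + h 2 • e 2 := by
  ext i
  fin_cases i <;> simp [e]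

/-- The translation is followed along the three axes in turn, and each leg is bounded since
translations are isometries. -/
lemma norm_trans_sub_le {u : Ω.L2} {g : Fin 3 → Ω.L2} (hg : ∀ j, Ω.IsWeakPartial j u (g j))
    (h : E3) : ‖Ω.trans h u - u‖ ≤ ∑ j, |h j| * ‖g j‖ := by
  have h1 : Ω.trans h u - u = Ω.trans (h 0 • e 0) (Ω.trans (h 1 • e 1)
      (Ω.trans (h 2 • e 2) u - u) + (Ω.trans (h 1 • e 1) u - u))
      + (Ω.trans (h 0 • e 0) u - u) := by
    simp only [map_add, map_sub, trans_trans, ← add_assoc]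
    rw [← eq_sum_smul_e]
    abel
  rw [h1, Fin.sum_univ_three]
  refine (norm_add_le _ _).trans ?_
  rw [LinearIsometry.norm_map]
  have h2 := norm_add_le (Ω.trans (h 1 • e 1) (Ω.trans (h 2 • e 2) u - u))
    (Ω.trans (h 1 • e 1) u - u)
  rw [LinearIsometry.norm_map] at h2
  have := (hg 0).norm_trans_sub_le (h 0)
  have := (hg 1).norm_trans_sub_le (h 1)
  have := (hg 2).norm_trans_sub_le (h 2)
  linarith

/-- The average of the translates of a field by a segment in the direction `j`. -/
def avg (j : Fin 3) (δ : ℝ) : Ω.L2 →L[ℝ] Ω.L2 :=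
  LinearMap.mkContinuous
    { toFun := fun u => δ⁻¹ • ∫ s in (0 : ℝ)..δ, Ω.trans (s • e j) u
      map_add' := fun u v => by
        simp only [map_add]
        rw [intervalIntegral.integral_add ((continuous_trans_smul _ _).intervalIntegrable _ _)
          ((continuous_trans_smul _ _).intervalIntegrable _ _), smul_add]
      map_smul' := fun c u => by
        simp only [map_smul, RingHom.id_apply]
        rw [intervalIntegral.integral_smul, smul_comm] }
    1 (fun u => by
      have := intervalIntegral.norm_integral_le_of_norm_le_const (a := 0) (b := δ) (C := ‖u‖)
        (f := fun τ => Ω.trans (τ • e j) u) (fun τ _ => by simp)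
      rw [one_mul]
      simp only [LinearMap.coe_mk, AddHom.coe_mk, norm_smul, norm_inv, Real.norm_eq_abs]
      rw [sub_zero] at this
      -- For `δ = 0` the convention `0⁻¹ = 0` makes the average zero.
      rcases eq_or_ne δ 0 with rfl | hδ
      · simp
      · rw [inv_mul_le_iff₀ (abs_pos.2 hδ), mul_comm]
        exact this)

lemma avg_apply (j : Fin 3) (δ : ℝ) (u : Ω.L2) :
    avg j δ u = δ⁻¹ • ∫ s in (0 : ℝ)..δ, Ω.trans (s • e j) u := rfl

lemma clm_avg (T : Ω.L2 →L[ℝ] Ω.L2) (j : Fin 3) (δ : ℝ)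
    (hT : ∀ (s : ℝ) (u : Ω.L2), T (Ω.trans (s • e j) u) = Ω.trans (s • e j) (T u)) (u : Ω.L2) :
    T (avg j δ u) = avg j δ (T u) := by
  rw [avg_apply, avg_apply, map_smul, ← ContinuousLinearMap.intervalIntegral_comp_comm _
    ((continuous_trans_smul _ _).intervalIntegrable _ _)]
  simp only [hT]

lemma trans_comm (h k : E3) (u : Ω.L2) : Ω.trans h (Ω.trans k u) = Ω.trans k (Ω.trans h u) := by
  rw [trans_trans, trans_trans, add_comm]

lemma avg_trans (j : Fin 3) (δ : ℝ) (h : E3) (u : Ω.L2) :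
    avg j δ (Ω.trans h u) = Ω.trans h (avg j δ u) :=
  (clm_avg (Ω.trans h).toContinuousLinearMap j δ (fun _ u => trans_comm _ _ u) u).symm

lemma avg_comm (j k : Fin 3) (δ η : ℝ) (u : Ω.L2) :
    avg j δ (avg k η u) = avg k η (avg j δ u) :=
  clm_avg (avg j δ) k η (fun _ u => avg_trans _ _ _ u) u

/-- An average has a derivative in the direction in which it is taken. -/
lemma isWeakPartial_avg (j : Fin 3) (δ : ℝ) (u : Ω.L2) :
    Ω.IsWeakPartial j (avg j δ u) (δ⁻¹ • (Ω.trans (δ • e j) u - u)) := by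
  rw [isWeakPartial_iff_hasDerivAt]
  have hc : Continuous fun τ : ℝ => Ω.trans (τ • e j) u := continuous_trans_smul _ _
  -- A translate of the average is a difference of two values of one primitive, whose derivative at
  -- the two ends is known.
  have h1 : (fun s : ℝ => Ω.trans (s • e j) (avg j δ u))
      = fun s => δ⁻¹ • ((∫ τ in (0 : ℝ)..(s + δ), Ω.trans (τ • e j) u)
          - ∫ τ in (0 : ℝ)..s, Ω.trans (τ • e j) u) := by
    ext1 s
    rw [avg_apply, map_smul]
    congr 1
    have h2 : Ω.trans (s • e j) (∫ τ in (0 : ℝ)..δ, Ω.trans (τ • e j) u)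
        = ∫ τ in (0 : ℝ)..δ, Ω.trans (s • e j) (Ω.trans (τ • e j) u) :=
      ((Ω.trans (s • e j)).toContinuousLinearMap.intervalIntegral_comp_comm
        (hc.intervalIntegrable _ _)).symm
    rw [h2]
    simp only [trans_trans, ← add_smul]
    rw [intervalIntegral.integral_comp_add_left (fun τ => Ω.trans (τ • e j) u),
      intervalIntegral.integral_interval_sub_left (hc.intervalIntegrable _ _)
        (hc.intervalIntegrable _ _), add_zero]
  rw [h1]
  have h3 : HasDerivAt (fun s : ℝ => ∫ τ in (0 : ℝ)..s, Ω.trans (τ • e j) u)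
      (Ω.trans ((0 : ℝ) • e j) u) 0 :=
    intervalIntegral.integral_hasDerivAt_right (hc.intervalIntegrable _ _)
      (hc.stronglyMeasurableAtFilter _ _) hc.continuousAt
  have h4 : HasDerivAt (fun s : ℝ => ∫ τ in (0 : ℝ)..s, Ω.trans (τ • e j) u)
      (Ω.trans (δ • e j) u) (0 + δ) := by
    rw [zero_add]
    exact intervalIntegral.integral_hasDerivAt_right (hc.intervalIntegrable _ _)
      (hc.stronglyMeasurableAtFilter _ _) hc.continuousAt
  have h5 := (h4.comp_add_const 0 δ).sub h3
  rw [zero_smul, trans_zero] at h5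
  exact h5.const_smul δ⁻¹

/-- A closed subspace is its double orthogonal, so membership is tested by inner products, and these
pass under the integral. -/
lemma avg_mem_of_trans_mem (j : Fin 3) (δ : ℝ) (S : Submodule ℝ Ω.L2) (hS : IsClosed (S : Set Ω.L2))
    {u : Ω.L2} (h : ∀ s : ℝ, Ω.trans (s • e j) u ∈ S) : avg j δ u ∈ S := by
  have h1 : S = (Sᗮ)ᗮ := by
    rw [Submodule.orthogonal_orthogonal_eq_closure]
    exact (hS.submodule_topologicalClosure_eq).symm
  rw [h1, Submodule.mem_orthogonal]
  intro v hv
  rw [avg_apply, real_inner_smul_right]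
  have h2 := (innerSL ℝ v).intervalIntegral_comp_comm (a := 0) (b := δ)
    ((continuous_trans_smul (e j) u).intervalIntegrable (μ := volume) _ _)
  simp only [innerSL_apply_apply] at h2
  rw [← h2]
  simp [fun s : ℝ => Submodule.inner_left_of_mem_orthogonal (h s) hv]

/-- Averages on short segments converge to the identity. -/
lemma norm_avg_sub_le (j : Fin 3) {δ : ℝ} (hδ : 0 < δ) {C : ℝ} (u : Ω.L2)
    (h : ∀ s ∈ Icc 0 δ, ‖Ω.trans (s • e j) u - u‖ ≤ C) : ‖avg j δ u - u‖ ≤ C := by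
  have hc : Continuous fun τ : ℝ => Ω.trans (τ • e j) u := continuous_trans_smul _ _
  have h1 : avg j δ u - u = δ⁻¹ • ∫ s in (0 : ℝ)..δ, (Ω.trans (s • e j) u - u) := by
    rw [intervalIntegral.integral_sub (hc.intervalIntegrable _ _) (by simp), smul_sub, avg_apply]
    simp [smul_smul, hδ.ne']
  have h2 := intervalIntegral.norm_integral_le_of_norm_le_const (a := 0) (b := δ) (C := C)
        (f := fun τ => Ω.trans (τ • e j) u - u) (fun τ hτ => h τ (by
          rw [uIoc_of_le hδ.le] at hτ
          exact ⟨hτ.1.le, hτ.2⟩))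
  rw [h1, norm_smul, norm_inv, Real.norm_of_nonneg hδ.le, inv_mul_le_iff₀ hδ, mul_comm]
  rwa [sub_zero, abs_of_pos hδ] at h2

end Domain

/-! ### The operator of the quadratic form and its expression by the curl. -/

namespace Domain

variable {Ω : Domain}

lemma SmoothCpt.memLp_smul_clm {c : E3 → ℝ} (hc : Ω.SmoothCpt c) (E : E3 →L[ℝ] E3) (u : Ω.L2) :
    MemLp (fun x => c x • E (u x)) 2 Ω.μ := by
  obtain ⟨C, hC, hb⟩ := hc.exists_bound
  refine (Lp.memLp u).of_le_mul (c := C * ‖E‖) ?_ (ae_of_all _ fun x => ?_)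
  · exact hc.continuous.aestronglyMeasurable.smul
      (E.continuous.comp_aestronglyMeasurable (Lp.aestronglyMeasurable u))
  · rw [norm_smul, mul_assoc]
    exact mul_le_mul (hb x) (E.le_opNorm _) (norm_nonneg _) hC

/-- Multiplication by a smooth function with compact support and a constant matrix. -/
def mulC {c : E3 → ℝ} (hc : Ω.SmoothCpt c) (E : E3 →L[ℝ] E3) : Ω.L2 →L[ℝ] Ω.L2 :=
  LinearMap.mkContinuousOfExistsBound
    { toFun := fun u => (hc.memLp_smul_clm E u).toLp _
      map_add' := fun u v => by
        apply Lp.ext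
        filter_upwards [(hc.memLp_smul_clm E (u + v)).coeFn_toLp,
          (hc.memLp_smul_clm E u).coeFn_toLp, (hc.memLp_smul_clm E v).coeFn_toLp,
          Lp.coeFn_add u v, Lp.coeFn_add ((hc.memLp_smul_clm E u).toLp _)
            ((hc.memLp_smul_clm E v).toLp _)] with x h1 h2 h3 h4 h5
        rw [h1, h5, Pi.add_apply, h2, h3, h4, Pi.add_apply, map_add, smul_add]
      map_smul' := fun a u => by
        apply Lp.ext
        filter_upwards [(hc.memLp_smul_clm E (a • u)).coeFn_toLp,
          (hc.memLp_smul_clm E u).coeFn_toLp,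
          Lp.coeFn_smul a u, Lp.coeFn_smul a ((hc.memLp_smul_clm E u).toLp _)] with x h1 h2 h3 h4
        rw [RingHom.id_apply, h1, h4, Pi.smul_apply, h2, h3, Pi.smul_apply, map_smul,
          smul_comm] }
    (by
      obtain ⟨C, hC, hb⟩ := hc.exists_bound
      refine ⟨C * ‖E‖, fun u => Lp.norm_le_mul_norm_of_ae_le_mul ?_⟩
      filter_upwards [(hc.memLp_smul_clm E u).coeFn_toLp] with x hx
      refine (le_of_eq (congrArg _ hx)).trans ?_
      rw [norm_smul, mul_assoc]
      exact mul_le_mul (hb x) (E.le_opNorm _) (norm_nonneg _) hC)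

lemma coeFn_mulC {c : E3 → ℝ} (hc : Ω.SmoothCpt c) (E : E3 →L[ℝ] E3) (u : Ω.L2) :
    mulC hc E u =ᵐ[Ω.μ] fun x => c x • E (u x) := (hc.memLp_smul_clm E u).coeFn_toLp

lemma pairL_mulC {φ c : E3 → ℝ} (hφ : Ω.SmoothCpt φ) (hc : Ω.SmoothCpt c) (E : E3 →L[ℝ] E3)
    (u : Ω.L2) : pairL hφ (mulC hc E u) = E (pairL (hφ.mul_left hc.smooth hc.periodic) u) := by
  rw [pairL_apply, pairL_apply, ← E.integral_comp_comm (L2_integrable_smul _ u)]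
  · refine integral_congr_ae ?_
    filter_upwards [coeFn_mulC hc E u] with x hx
    rw [hx, smul_smul, map_smul, mul_comm]
  · exact hφ.mul_left hc.smooth hc.periodic

lemma SmoothCpt.fderiv_mul {φ c : E3 → ℝ} (hφ : Differentiable ℝ φ) (hc : Differentiable ℝ c)
    (x v : E3) : _root_.fderiv ℝ (fun x => c x * φ x) x v
      = c x * _root_.fderiv ℝ φ x v + _root_.fderiv ℝ c x v * φ x := by
  rw [_root_.fderiv_fun_mul (hc x) (hφ x)]
  simp [mul_comm]

/-- The Leibniz rule. -/
lemma IsWeakPartial.mulC {c : E3 → ℝ} (hc : Ω.SmoothCpt c) (E : E3 →L[ℝ] E3) {j : Fin 3}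
    {u g : Ω.L2} (h : Ω.IsWeakPartial j u g) :
    Ω.IsWeakPartial j (mulC hc E u) (Domain.mulC (hc.fderiv_apply (e j)) E u
      + Domain.mulC hc E g) := by
  rw [isWeakPartial_iff] at *
  intro φ hφ
  have h1 := h _ (hφ.mul_left hc.smooth hc.periodic)
  rw [map_add, pairL_mulC, pairL_mulC, pairL_mulC, eq_neg_iff_add_eq_zero, ← map_add, ← map_add]
  rw [eq_neg_iff_add_eq_zero] at h1
  rw [← map_zero E, ← h1, ← add_assoc]
  congr 2
  simp only [pairL_apply]
  rw [← integral_add (L2_integrable_smul ((hφ.fderiv_apply (e j)).mul_left hc.smooth hc.periodic) u)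
    (L2_integrable_smul (hφ.mul_left (hc.fderiv_apply (e j)).smooth
      (hc.fderiv_apply (e j)).periodic) u)]
  refine integral_congr_ae (ae_of_all _ fun x => ?_)
  simp only
  rw [← add_smul, SmoothCpt.fderiv_mul hφ.differentiable hc.differentiable]

/-- The matrix with a single nonzero coefficient, in row `k` and column `i`. -/
def unitMat (k i : Fin 3) : E3 →L[ℝ] E3 := (EuclideanSpace.proj i : E3 →L[ℝ] ℝ).smulRight (e k)

lemma unitMat_apply (k i : Fin 3) (v : E3) : unitMat k i v = v i • e k := rfl

lemma inner_e (v : E3) (k : Fin 3) : ⟪e k, v⟫_ℝ = v k := by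
  simp [e, EuclideanSpace.inner_single_left]

lemma inner_e_right (v : E3) (k : Fin 3) : ⟪v, e k⟫_ℝ = v k := by
  rw [real_inner_comm, inner_e]

lemma inner_mulC {c : E3 → ℝ} (hc : Ω.SmoothCpt c) (k i : Fin 3) (u v : Ω.L2) :
    ⟪mulC hc (unitMat k i) u, v⟫_ℝ = ∫ x, c x * u x i * v x k ∂Ω.μ := by
  rw [L2.inner_def]
  refine integral_congr_ae ?_
  filter_upwards [coeFn_mulC hc (unitMat k i) u] with x hx
  rw [hx, unitMat_apply, real_inner_smul_left, real_inner_smul_left, inner_e, mul_assoc]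

lemma integrable_mul3 {c : E3 → ℝ} (hc : Ω.SmoothCpt c) (u v : Ω.L2) (i k : Fin 3) :
    Integrable (fun x => c x * u x i * v x k) Ω.μ := by
  refine (L2.integrable_inner (𝕜 := ℝ) (mulC hc (unitMat k i) u) v).congr ?_
  filter_upwards [coeFn_mulC hc (unitMat k i) u] with x hx
  rw [hx, unitMat_apply, real_inner_smul_left, real_inner_smul_left, inner_e, mul_assoc]

/-- Skewness of the derivative (`inner_eq`) applied to `c u` and `v`, with the Leibniz rule for `c
u`. -/
lemma integral_mul3_by_parts {c : E3 → ℝ} (hc : Ω.SmoothCpt c) {j : Fin 3} {u v u' v' : Ω.L2}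
    (hu : Ω.IsWeakPartial j u u') (hv : Ω.IsWeakPartial j v v') (i k : Fin 3) :
    ∫ x, fderiv ℝ c x (e j) * u x i * v x k ∂Ω.μ
      = -(∫ x, c x * u' x i * v x k ∂Ω.μ) - ∫ x, c x * u x i * v' x k ∂Ω.μ := by
  have := (hu.mulC hc (unitMat k i)).inner_eq hv
  rw [inner_add_left, inner_mulC, inner_mulC, inner_mulC] at this
  linarith

/-- The coefficients of the quadratic form `w ⊗ w : ∇Φ - |w|² div Φ / 2`. -/
def qCoeff (Φ : E3 → E3) (i j : Fin 3) (x : E3) : ℝ :=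
  (pd Φ i j x + pd Φ j i x) / 2 - if i = j then div Φ x / 2 else 0

lemma SmoothCpt.pd {Φ : E3 → E3} (hΦ : Ω.SmoothCpt Φ) (i j : Fin 3) : Ω.SmoothCpt (pd Φ i j) :=
  (hΦ.fderiv_apply (e j)).coord i

lemma SmoothCpt.div {Φ : E3 → E3} (hΦ : Ω.SmoothCpt Φ) : Ω.SmoothCpt (div Φ) :=
  SmoothCpt.sum _ fun i _ => hΦ.pd i i

lemma SmoothCpt.qCoeff {Φ : E3 → E3} (hΦ : Ω.SmoothCpt Φ) (i j : Fin 3) :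
    Ω.SmoothCpt (qCoeff Φ i j) := by
  have h1 : Ω.SmoothCpt fun x => (1 / 2 : ℝ) • (RotatingFluid.pd Φ i j x
      + RotatingFluid.pd Φ j i x) := ((hΦ.pd i j).add (hΦ.pd j i)).const_smul _
  have h2 : Ω.SmoothCpt fun x => (if i = j then (1 / 2 : ℝ) else 0) • RotatingFluid.div Φ x :=
    hΦ.div.const_smul _
  convert! h1.sub h2 using 1
  ext x
  by_cases h : i = j <;> simp [Domain.qCoeff, h] <;> ring

/-- The symmetric operator of the quadratic form `∫ w ⊗ w : ∇Φ - |w|² div Φ / 2`. -/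
def quadOp {Φ : E3 → E3} (hΦ : Ω.SmoothCpt Φ) : Ω.L2 →L[ℝ] Ω.L2 :=
  ∑ i, ∑ j, mulC (hΦ.qCoeff i j) (unitMat i j)

lemma inner_quadOp {Φ : E3 → E3} (hΦ : Ω.SmoothCpt Φ) (u v : Ω.L2) :
    ⟪quadOp hΦ u, v⟫_ℝ = ∑ i, ∑ j, ∫ x, qCoeff Φ i j x * u x j * v x i ∂Ω.μ := by
  simp only [quadOp, _root_.sum_apply, sum_inner, inner_mulC]

lemma qCoeff_comm (Φ : E3 → E3) (i j : Fin 3) : qCoeff Φ i j = qCoeff Φ j i := by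
  ext x
  simp only [qCoeff, eq_comm (a := i) (b := j), add_comm]

lemma quadOp_symm {Φ : E3 → E3} (hΦ : Ω.SmoothCpt Φ) (u v : Ω.L2) :
    ⟪quadOp hΦ u, v⟫_ℝ = ⟪u, quadOp hΦ v⟫_ℝ := by
  rw [real_inner_comm (quadOp hΦ v) u, inner_quadOp, inner_quadOp, Finset.sum_comm]
  refine Finset.sum_congr rfl fun i _ => Finset.sum_congr rfl fun j _ => ?_
  rw [qCoeff_comm]
  exact integral_congr_ae (ae_of_all _ fun x => by ring)

lemma integral_quad {Φ : E3 → E3} (hΦ : Ω.SmoothCpt Φ) (w : Ω.L2) :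
    ∫ x, (∑ i, ∑ j, w x i * w x j * pd Φ i j x - ‖w x‖ ^ 2 / 2 * div Φ x) ∂Ω.μ
      = ⟪quadOp hΦ w, w⟫_ℝ := by
  rw [inner_quadOp]
  simp only [← integral_finsetSum _ fun j _ => integrable_mul3 (hΦ.qCoeff _ j) w w j _]
  rw [← integral_finsetSum _ fun i _ => integrable_finsetSum _ fun j _ =>
    integrable_mul3 (hΦ.qCoeff i j) w w j i]
  refine integral_congr_ae (ae_of_all _ fun x => ?_)
  simp only [EuclideanSpace.norm_sq_eq, Real.norm_eq_abs, sq_abs, Fin.sum_univ_three, qCoeff]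
  simp
  ring

/-- A divergence free field with square integrable derivatives. -/
lemma div_eq_zero {u : Ω.L2} (hu : u ∈ Ω.H) {u' : Fin 3 → Ω.L2}
    (h : ∀ j, Ω.IsWeakPartial j u (u' j)) : ∀ᵐ x ∂Ω.μ, ∑ j, u' j x j = 0 := by
  have hloc : ∀ (j : Fin 3) (v : Ω.L2), LocallyIntegrable (fun x => v x j) Ω.μ := fun j v =>
    memLp_locallyIntegrable ((EuclideanSpace.proj j : E3 →L[ℝ] ℝ).comp_memLp v)
  have key : (fun x => ∑ j, u' j x j) =ᵐ[Ω.μ] 0 := by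
    refine ae_eq_zero_of_integral_smul (locallyIntegrable_finsetSum _ fun j _ => hloc j (u' j))
      fun φ hφ => ?_
    have h1 := (Ω.mem_H_iff u).1 hu φ (isTest_iff.2 hφ)
    have h2 : ∀ j, ∫ x, fderiv ℝ φ x (e j) • u x j ∂Ω.μ = - ∫ x, φ x • u' j x j ∂Ω.μ := by
      intro j
      have h3 := congrArg (fun v : E3 => v j) (isWeakPartial_iff.1 (h j) φ hφ)
      simp only [pairL_apply, PiLp.neg_apply] at h3
      rw [← integral_comp_proj j (L2_integrable_smul (hφ.fderiv_apply (e j)) u),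
        ← integral_comp_proj j (L2_integrable_smul hφ (u' j))] at h3
      simpa using h3
    have h4 : ∀ x, ⟪u x, gradient φ x⟫_ℝ = ∑ j, fderiv ℝ φ x (e j) • u x j := by
      intro x
      rw [real_inner_comm, gradient, InnerProductSpace.toDual_symm_apply]
      conv_lhs => rw [eq_sum_smul_e (u x)]
      simp only [map_add, map_smul, Fin.sum_univ_three, smul_eq_mul, mul_comm]
    simp only [h4] at h1
    rw [integral_finsetSum _ fun j _ => (hφ.fderiv_apply (e j)).integrable_smul (hloc j u)] at h1
    simp only [h2, Finset.sum_neg_distrib, neg_eq_zero] at h1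
    simp only [Finset.smul_sum]
    rwa [integral_finsetSum _ fun j _ => hφ.integrable_smul (hloc j (u' j))]
  exact key
where
  integral_comp_proj {f : E3 → E3} (j : Fin 3) (hf : Integrable f Ω.μ) :
      ∫ x, f x j ∂Ω.μ = (∫ x, f x ∂Ω.μ) j :=
    (EuclideanSpace.proj j : E3 →L[ℝ] ℝ).integral_comp_comm hf

/-- The bilinear form `∫ (g ∧ rot y) · Φ`, in terms of the partial derivatives `y'` of `y`. -/
def rotForm (Φ : E3 → E3) (g : Ω.L2) (y' : Fin 3 → Ω.L2) : ℝ :=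
  ∑ i, ∑ j, (∫ x, Φ x j * y' j x i * g x i ∂Ω.μ - ∫ x, Φ x j * y' i x j * g x i ∂Ω.μ)

/-- For a divergence free field, `w ⊗ w : ∇Φ - |w|² div Φ / 2` is `(w ∧ rot w) · Φ`. -/
lemma inner_quadOp_self {Φ : E3 → E3} (hΦ : Ω.SmoothCpt Φ) {u : Ω.L2} (hu : u ∈ Ω.H)
    {u' : Fin 3 → Ω.L2} (h : ∀ j, Ω.IsWeakPartial j u (u' j)) :
    ⟪quadOp hΦ u, u⟫_ℝ = rotForm Φ u u' := by
  have hint : ∀ (i j : Fin 3), Integrable (fun x => pd Φ i j x * u x i * u x j) Ω.μ :=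
    fun i j => integrable_mul3 (hΦ.pd i j) u u i j
  have hint' : ∀ (i j : Fin 3), Integrable (fun x => pd Φ j j x * u x i * u x i) Ω.μ :=
    fun i j => integrable_mul3 (hΦ.pd j j) u u i i
  have h0 : ⟪quadOp hΦ u, u⟫_ℝ = ∑ i, ∑ j, (∫ x, pd Φ i j x * u x i * u x j ∂Ω.μ
      - 1 / 2 * ∫ x, pd Φ j j x * u x i * u x i ∂Ω.μ) := by
    rw [← integral_quad]
    have h8 : ∀ i j, ∫ x, pd Φ i j x * u x i * u x j ∂Ω.μ
        - 1 / 2 * ∫ x, pd Φ j j x * u x i * u x i ∂Ω.μ = ∫ x, (pd Φ i j x * u x i * u x j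
          - 1 / 2 * (pd Φ j j x * u x i * u x i)) ∂Ω.μ := fun i j => by
      rw [integral_sub (hint i j) ((hint' i j).const_mul _), integral_const_mul]
    have hint2 : ∀ i j, Integrable (fun x => pd Φ i j x * u x i * u x j
          - 1 / 2 * (pd Φ j j x * u x i * u x i)) Ω.μ := fun i j =>
      (hint i j).sub ((hint' i j).const_mul _)
    simp only [h8]
    simp only [← integral_finsetSum _ fun j _ => hint2 _ j]
    rw [← integral_finsetSum _ fun i _ => integrable_finsetSum _ fun j _ => hint2 i j]
    refine integral_congr_ae (ae_of_all _ fun x => ?_)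
    simp only [EuclideanSpace.norm_sq_eq, Real.norm_eq_abs, sq_abs, Fin.sum_univ_three, div]
    ring
  -- The derivative is moved off `Φ`: the first term is the convective one, the second contains `div
  -- u` after summation over `j`.
  have h1 : ∀ i j, ∫ x, pd Φ i j x * u x i * u x j ∂Ω.μ
      = -(∫ x, Φ x i * u' j x i * u x j ∂Ω.μ) - ∫ x, Φ x i * u x i * u' j x j ∂Ω.μ := by
    intro i j
    have := integral_mul3_by_parts (hΦ.coord i) (h j) (h j) i j
    rw [← this]
    refine integral_congr_ae (ae_of_all _ fun x => ?_)
    simp only [pd, fderiv_coord hΦ]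
  have h2 : ∀ i j, ∫ x, pd Φ j j x * u x i * u x i ∂Ω.μ
      = - 2 * ∫ x, Φ x j * u' j x i * u x i ∂Ω.μ := by
    intro i j
    have h3 := integral_mul3_by_parts (hΦ.coord j) (h j) (h j) i i
    have h4 : ∫ x, Φ x j * u x i * u' j x i ∂Ω.μ = ∫ x, Φ x j * u' j x i * u x i ∂Ω.μ :=
      integral_congr_ae (ae_of_all _ fun x => by ring)
    rw [h4] at h3
    have h5 : ∫ x, pd Φ j j x * u x i * u x i ∂Ω.μ
        = ∫ x, fderiv ℝ (fun x => Φ x j) x (e j) * u x i * u x i ∂Ω.μ := by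
      refine integral_congr_ae (ae_of_all _ fun x => ?_)
      simp only [pd, fderiv_coord hΦ]
    rw [h5, h3]
    ring
  -- This is the only use of the vanishing divergence.
  have h6 : ∀ i, ∑ j, ∫ x, Φ x i * u x i * u' j x j ∂Ω.μ = 0 := by
    intro i
    rw [← integral_finsetSum _ fun j _ => integrable_mul3 (hΦ.coord i) u (u' j) i j]
    refine integral_eq_zero_of_ae ?_
    filter_upwards [div_eq_zero hu h] with x hx
    rw [← Finset.mul_sum, hx, mul_zero]
    rfl
  rw [h0, rotForm]
  simp only [h1, h2]
  have h7 : ∑ i, ∑ j, ∫ x, Φ x i * u' j x i * u x j ∂Ω.μ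
      = ∑ i, ∑ j, ∫ x, Φ x j * u' i x j * u x i ∂Ω.μ := Finset.sum_comm
  simp only [Finset.sum_sub_distrib, h6, h7, Finset.sum_neg_distrib, Finset.sum_const_zero,
    ← Finset.mul_sum]
  ring
where
  fderiv_coord {Φ : E3 → E3} (hΦ : Ω.SmoothCpt Φ) (i : Fin 3) (x v : E3) :
      fderiv ℝ (fun x => Φ x i) x v = fderiv ℝ Φ x v i := by
    have := (EuclideanSpace.proj i : E3 →L[ℝ] ℝ).hasFDerivAt.comp x
      (hΦ.differentiable x).hasFDerivAt
    have h2 := this.fderiv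
    change fderiv ℝ (fun x => Φ x i) x = _ at h2
    rw [h2]
    rfl

end Domain

/-! ### Divergence free fields and the test fields which detect the curl. -/

namespace Domain

variable {Ω : Domain}

lemma integral_coord {f : E3 → E3} (j : Fin 3) (hf : Integrable f Ω.μ) :
    ∫ x, f x j ∂Ω.μ = (∫ x, f x ∂Ω.μ) j :=
  (EuclideanSpace.proj j : E3 →L[ℝ] ℝ).integral_comp_comm hf

lemma fderiv_coord {Φ : E3 → E3} (hΦ : Differentiable ℝ Φ) (i : Fin 3) (x v : E3) :
    fderiv ℝ (fun x => Φ x i) x v = fderiv ℝ Φ x v i := by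
  have := (EuclideanSpace.proj i : E3 →L[ℝ] ℝ).hasFDerivAt.comp x (hΦ x).hasFDerivAt
  have h2 := this.fderiv
  change fderiv ℝ (fun x => Φ x i) x = _ at h2
  rw [h2]
  rfl

lemma locallyIntegrable_coord (j : Fin 3) (v : Ω.L2) : LocallyIntegrable (fun x => v x j) Ω.μ :=
  memLp_locallyIntegrable ((EuclideanSpace.proj j : E3 →L[ℝ] ℝ).comp_memLp v)

lemma integrable_mul_coord {φ : E3 → ℝ} (hφ : Ω.SmoothCpt φ) (u : Ω.L2) (i : Fin 3) :
    Integrable (fun x => φ x * u x i) Ω.μ := hφ.integrable_smul (locallyIntegrable_coord i u)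

lemma IsWeakPartial.integral_mul {j : Fin 3} {u g : Ω.L2} (h : Ω.IsWeakPartial j u g)
    {φ : E3 → ℝ} (hφ : Ω.SmoothCpt φ) (i : Fin 3) :
    ∫ x, fderiv ℝ φ x (e j) * u x i ∂Ω.μ = - ∫ x, φ x * g x i ∂Ω.μ := by
  have h3 := congrArg (fun v : E3 => v i) (isWeakPartial_iff.1 h φ hφ)
  simp only [pairL_apply, PiLp.neg_apply] at h3
  rw [← integral_coord i (L2_integrable_smul (hφ.fderiv_apply (e j)) u),
    ← integral_coord i (L2_integrable_smul hφ g)] at h3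
  simpa using h3

lemma inner_gradient (φ : E3 → ℝ) (x v : E3) :
    ⟪v, gradient φ x⟫_ℝ = ∑ j, fderiv ℝ φ x (e j) * v j := by
  rw [real_inner_comm, gradient, InnerProductSpace.toDual_symm_apply]
  conv_lhs => rw [eq_sum_smul_e v]
  simp only [map_add, map_smul, Fin.sum_univ_three, smul_eq_mul, mul_comm]

lemma mem_H_iff_sum {u : Ω.L2} : u ∈ Ω.H ↔ ∀ φ : E3 → ℝ, Ω.SmoothCpt φ →
    ∑ j, ∫ x, fderiv ℝ φ x (e j) * u x j ∂Ω.μ = 0 := by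
  rw [Ω.mem_H_iff]
  simp only [isTest_iff, inner_gradient]
  refine forall₂_congr fun φ hφ => ?_
  rw [integral_finsetSum _ fun j _ => integrable_mul_coord (hφ.fderiv_apply (e j)) u j]

/-- The divergence free test field `∂_jφ e_i - ∂_iφ e_j`. -/
def curlTest (φ : E3 → ℝ) (i j : Fin 3) (x : E3) : E3 :=
  fderiv ℝ φ x (e j) • e i - fderiv ℝ φ x (e i) • e j

lemma SmoothCpt.curlTest {φ : E3 → ℝ} (hφ : Ω.SmoothCpt φ) (i j : Fin 3) :
    Ω.SmoothCpt (curlTest φ i j) :=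
  ((hφ.fderiv_apply (e j)).smul_const (e i)).sub ((hφ.fderiv_apply (e i)).smul_const (e j))

lemma inner_curlTest {φ : E3 → ℝ} (hφ : Ω.SmoothCpt φ) (i j : Fin 3) (u : Ω.L2) :
    ⟪u, (hφ.curlTest i j).toL2⟫_ℝ = ∫ x, fderiv ℝ φ x (e j) * u x i ∂Ω.μ
      - ∫ x, fderiv ℝ φ x (e i) * u x j ∂Ω.μ := by
  rw [(hφ.curlTest i j).inner_toL2, ← integral_sub (integrable_mul_coord (hφ.fderiv_apply (e j)) u i)
    (integrable_mul_coord (hφ.fderiv_apply (e i)) u j)]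
  refine integral_congr_ae (ae_of_all _ fun x => ?_)
  simp only [Domain.curlTest, inner_sub_right, real_inner_smul_right, inner_e_right]

lemma fderiv_fderiv_apply {φ : E3 → ℝ} (hφ : ContDiff ℝ ∞ φ) (x v w : E3) :
    fderiv ℝ (fun y => fderiv ℝ φ y v) x w = fderiv ℝ (fun y => fderiv ℝ φ y w) x v := by
  have hd : Differentiable ℝ (fderiv ℝ φ) :=
    (hφ.fderiv_right (m := ∞) (by simp)).differentiable (by simp)
  have h1 : ∀ v w : E3, fderiv ℝ (fun y => fderiv ℝ φ y v) x w
      = fderiv ℝ (fderiv ℝ φ) x w v := by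
    intro v w
    rw [fderiv_clm_apply (hd x) (differentiableAt_const v)]
    simp
  rw [h1, h1]
  exact (hφ.contDiffAt.isSymmSndFDerivAt (by
    rw [minSmoothness_of_isRCLikeNormedField]; exact WithTop.coe_le_coe.2 le_top)) w v

lemma integral_fderiv_mul {φ c : E3 → ℝ} (hφ : Ω.SmoothCpt φ) (hc : Ω.SmoothCpt c) (v : E3) :
    ∫ x, fderiv ℝ φ x v * c x ∂Ω.μ = - ∫ x, φ x * fderiv ℝ c x v ∂Ω.μ := by
  have h1 := (hφ.mul_left hc.smooth hc.periodic).integral_fderiv v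
  simp only [SmoothCpt.fderiv_mul hφ.differentiable hc.differentiable] at h1
  rw [integral_add ((hφ.fderiv_apply v).mul_left hc.smooth hc.periodic).integrable
    (hφ.mul_left (hc.fderiv_apply v).smooth (hc.fderiv_apply v).periodic).integrable] at h1
  rw [eq_neg_iff_add_eq_zero, ← h1]
  congr 1
  · exact integral_congr_ae (ae_of_all _ fun x => mul_comm _ _)
  · exact integral_congr_ae (ae_of_all _ fun x => mul_comm _ _)

/-- The two second derivatives obtained after integration by parts cancel by symmetry. Since such a
test lies in `H`, pairing with it sees the curl of a field and ignores its gradient part. -/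
lemma curlTest_mem_H {φ : E3 → ℝ} (hφ : Ω.SmoothCpt φ) (i j : Fin 3) :
    (hφ.curlTest i j).toL2 ∈ Ω.H := by
  rw [Ω.mem_H_iff]
  intro ψ hψ
  rw [isTest_iff] at hψ
  have h0 : ∫ x, ⟪(hφ.curlTest i j).toL2 x, gradient ψ x⟫_ℝ ∂Ω.μ
      = ∫ x, (fderiv ℝ φ x (e j) * fderiv ℝ ψ x (e i)
        - fderiv ℝ φ x (e i) * fderiv ℝ ψ x (e j)) ∂Ω.μ := by
    refine integral_congr_ae ?_
    filter_upwards [(hφ.curlTest i j).coeFn_toL2] with x hx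
    rw [hx, gradient, real_inner_comm, InnerProductSpace.toDual_symm_apply]
    simp [Domain.curlTest]
  rw [h0, integral_sub
    ((hψ.fderiv_apply (e i)).mul_left (hφ.fderiv_apply (e j)).smooth
      (hφ.fderiv_apply (e j)).periodic).integrable
    ((hψ.fderiv_apply (e j)).mul_left (hφ.fderiv_apply (e i)).smooth
      (hφ.fderiv_apply (e i)).periodic).integrable,
    integral_fderiv_mul hφ (hψ.fderiv_apply (e i)), integral_fderiv_mul hφ (hψ.fderiv_apply (e j))]
  simp only [fderiv_fderiv_apply hψ.smooth _ (e i) (e j), sub_self]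

end Domain

/-! ### The curl of `L f` and the symmetry of the associated form. -/

namespace Rotation

open Domain

variable {Ω : Domain} (B : Rotation Ω)

/-- The amplitude of the rotation as a function on `Ω`. -/
def amp (x : E3) : ℝ := B.b (hor x)

lemma hor_add (x y : E3) : hor (x + y) = hor x + hor y := by
  ext i; fin_cases i <;> simp [hor]

lemma hor_smul (c : ℝ) (x : E3) : hor (c • x) = c • hor x := by
  ext i; fin_cases i <;> simp [hor]

/-- The horizontal projection as a linear map. -/
def horL : E3 →L[ℝ] E2 := LinearMap.toContinuousLinearMap
  { toFun := hor, map_add' := hor_add, map_smul' := hor_smul }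

lemma hor_e_two : hor (e 2) = 0 := by
  ext i; fin_cases i <;> simp [hor, e]

lemma amp_smooth : ContDiff ℝ ∞ B.amp := B.smooth.comp horL.contDiff

lemma amp_periodic : Ω.Periodic B.amp := by
  intro x i
  simp only [amp, hor_add, hor_smul]
  fin_cases i
  · have := B.periodic (hor x) 0
    convert this using 3
    ext k; fin_cases k <;> simp [hor, e]
  · have := B.periodic (hor x) 1
    convert this using 3
    ext k; fin_cases k <;> simp [hor, e]
  · change B.b (hor x + Ω.len 2 • hor (e 2)) = B.b (hor x)
    rw [hor_e_two, smul_zero, add_zero]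

lemma amp_ne_zero (x : E3) : B.amp x ≠ 0 := B.ne_zero _

lemma fderiv_amp (x v : E3) : fderiv ℝ B.amp x v = fderiv ℝ B.b (hor x) (hor v) := by
  have h1 : DifferentiableAt ℝ B.b (horL x) := B.smooth.differentiable (by simp) _
  have := (h1.hasFDerivAt.comp x horL.hasFDerivAt).fderiv
  change fderiv ℝ B.amp x = _ at this
  rw [this]
  rfl

lemma fderiv_amp_two (x : E3) : fderiv ℝ B.amp x (e 2) = 0 := by
  rw [fderiv_amp, hor_e_two, map_zero]

lemma amp_differentiable : Differentiable ℝ B.amp := B.amp_smooth.differentiable (by simp)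

lemma amp_fderiv_continuous (v : E3) : Continuous fun x => fderiv ℝ B.amp x v :=
  (B.amp_smooth.continuous_fderiv (by simp)).clm_apply continuous_const

lemma amp_fderiv_periodic (v : E3) : Ω.Periodic fun x => fderiv ℝ B.amp x v := by
  intro x i
  have : B.amp = fun x => B.amp (x + Ω.len i • e i) := by ext x; rw [B.amp_periodic x i]
  change fderiv ℝ B.amp (x + Ω.len i • e i) v = fderiv ℝ B.amp x v
  conv_rhs => rw [this]
  rw [fderiv_comp_add_right]

lemma inner_wedgeL2 (u v : Ω.L2) : ⟪B.wedgeL2 u, v⟫_ℝ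
    = ∫ x, (B.amp x * u x 1 * v x 0 - B.amp x * u x 0 * v x 1) ∂Ω.μ := by
  rw [L2.inner_def]
  refine integral_congr_ae ?_
  filter_upwards [B.coeFn_wedgeL2 u] with x hx
  rw [hx, wedge_apply, real_inner_comm]
  simp [PiLp.inner_apply, Fin.sum_univ_three, amp]
  ring

lemma inner_wedgeL2_left (u v : Ω.L2) : ⟪B.wedgeL2 u, v⟫_ℝ = - ⟪u, B.wedgeL2 v⟫_ℝ := by
  rw [real_inner_comm (B.wedgeL2 v) u, inner_wedgeL2, inner_wedgeL2, ← integral_neg]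
  exact integral_congr_ae (ae_of_all _ fun x => by ring)

lemma coord_wedgeL2 (u : Ω.L2) : ∀ᵐ x ∂Ω.μ, B.wedgeL2 u x 0 = B.amp x * u x 1 ∧
    B.wedgeL2 u x 1 = -(B.amp x * u x 0) ∧ B.wedgeL2 u x 2 = 0 := by
  filter_upwards [B.coeFn_wedgeL2 u] with x hx
  rw [hx, wedge_apply]
  simp [amp]

/-- The action of `u ∧ B` on the divergence free test fields. -/
lemma inner_wedgeL2_curlTest {φ : E3 → ℝ} (hφ : Ω.SmoothCpt φ) (u : Ω.L2) :
    ⟪B.wedgeL2 u, (hφ.curlTest 0 2).toL2⟫_ℝ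
        = ∫ x, fderiv ℝ (fun x => B.amp x * φ x) x (e 2) * u x 1 ∂Ω.μ ∧
    ⟪B.wedgeL2 u, (hφ.curlTest 1 2).toL2⟫_ℝ
        = - ∫ x, fderiv ℝ (fun x => B.amp x * φ x) x (e 2) * u x 0 ∂Ω.μ ∧
    ⟪B.wedgeL2 u, (hφ.curlTest 1 0).toL2⟫_ℝ
        = - ∫ x, fderiv ℝ (fun x => B.amp x * φ x) x (e 0) * u x 0 ∂Ω.μ
          - ∫ x, fderiv ℝ (fun x => B.amp x * φ x) x (e 1) * u x 1 ∂Ω.μ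
          + ∫ x, φ x * (fderiv ℝ B.amp x (e 0) * u x 0 + fderiv ℝ B.amp x (e 1) * u x 1) ∂Ω.μ := by
  have hc := B.coord_wedgeL2 u
  have hm := SmoothCpt.fderiv_mul hφ.differentiable B.amp_differentiable
  have hβ := hφ.mul_left B.amp_smooth B.amp_periodic
  -- Moving `b` inside the derivative is free in the vertical direction, on which `b` does not
  -- depend. In the horizontal directions it costs the commutator with `∇b`.
  refine ⟨?_, ?_, ?_⟩
  · rw [inner_curlTest hφ]
    have h1 : ∫ x, fderiv ℝ φ x (e 0) * B.wedgeL2 u x 2 ∂Ω.μ = 0 := by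
      refine integral_eq_zero_of_ae ?_
      filter_upwards [hc] with x hx
      simp [hx.2.2]
    rw [h1, sub_zero]
    refine integral_congr_ae ?_
    filter_upwards [hc] with x hx
    rw [hx.1, hm, fderiv_amp_two]
    ring
  · rw [inner_curlTest hφ]
    have h1 : ∫ x, fderiv ℝ φ x (e 1) * B.wedgeL2 u x 2 ∂Ω.μ = 0 := by
      refine integral_eq_zero_of_ae ?_
      filter_upwards [hc] with x hx
      simp [hx.2.2]
    rw [h1, sub_zero, ← integral_neg]
    refine integral_congr_ae ?_
    filter_upwards [hc] with x hx
    rw [hx.2.1, hm, fderiv_amp_two]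
    ring
  · rw [inner_curlTest hφ]
    have i0 := integrable_mul_coord (hβ.fderiv_apply (e 0)) u 0
    have i1 := integrable_mul_coord (hβ.fderiv_apply (e 1)) u 1
    have i2 : Integrable (fun x => φ x * (fderiv ℝ B.amp x (e 0) * u x 0
        + fderiv ℝ B.amp x (e 1) * u x 1)) Ω.μ :=
      hφ.integrable_smul (((locallyIntegrable_coord 0 u).continuous_smul
        (B.amp_fderiv_continuous (e 0))).add ((locallyIntegrable_coord 1 u).continuous_smul
        (B.amp_fderiv_continuous (e 1))))
    have h1 := integral_sub i0.neg i1
    have h2 := integral_add (i0.neg.sub i1) i2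
    simp only [Pi.sub_apply, Pi.neg_apply, integral_neg] at h1 h2
    rw [← h1, ← h2, ← integral_sub (integrable_mul_coord (hφ.fderiv_apply (e 0)) _ 1)
        (integrable_mul_coord (hφ.fderiv_apply (e 1)) _ 0)]
    refine integral_congr_ae ?_
    filter_upwards [hc] with x hx
    rw [hx.1, hx.2.1, hm, hm]
    ring

/-- The curl of `L f`. -/
lemma curl_L {f y : Ω.L2} (hf : f ∈ Ω.H) {f' y' : Fin 3 → Ω.L2}
    (hf' : ∀ j, Ω.IsWeakPartial j f (f' j)) (hy' : ∀ j, Ω.IsWeakPartial j y (y' j))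
    (hy : ∀ ξ ∈ Ω.H, ⟪y, ξ⟫_ℝ = ⟪B.wedgeL2 f, ξ⟫_ℝ) : ∀ᵐ x ∂Ω.μ,
    y' 2 x 0 - y' 0 x 2 = B.amp x * f' 2 x 1 ∧
    y' 2 x 1 - y' 1 x 2 = -(B.amp x * f' 2 x 0) ∧
    y' 0 x 1 - y' 1 x 0 = B.amp x * f' 2 x 2
      - (fderiv ℝ B.amp x (e 0) * f x 0 + fderiv ℝ B.amp x (e 1) * f x 1) := by
  have hβl : ∀ (i : Fin 3) (v : Ω.L2), LocallyIntegrable (fun x => B.amp x * v x i) Ω.μ :=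
    fun i v => (locallyIntegrable_coord i v).continuous_smul B.amp_smooth.continuous
  have hgl : LocallyIntegrable (fun x => fderiv ℝ B.amp x (e 0) * f x 0
      + fderiv ℝ B.amp x (e 1) * f x 1) Ω.μ :=
    ((locallyIntegrable_coord 0 f).continuous_smul (B.amp_fderiv_continuous (e 0))).add
      ((locallyIntegrable_coord 1 f).continuous_smul (B.amp_fderiv_continuous (e 1)))
  -- The tests are divergence free, so the hypothesis on `y` replaces it by `f ∧ B`, with no need to
  -- know the pressure.
  have hcurl : ∀ (φ : E3 → ℝ) (hφ : Ω.SmoothCpt φ) (i j : Fin 3),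
      ∫ x, φ x * (y' j x i - y' i x j) ∂Ω.μ
        = - ⟪B.wedgeL2 f, (hφ.curlTest i j).toL2⟫_ℝ := by
    intro φ hφ i j
    rw [← hy _ (curlTest_mem_H hφ i j), inner_curlTest hφ, (hy' j).integral_mul hφ,
      (hy' i).integral_mul hφ]
    simp only [mul_sub]
    rw [integral_sub (integrable_mul_coord hφ _ _) (integrable_mul_coord hφ _ _)]
    ring
  have hmain : ∀ (i j : Fin 3) (r : E3 → ℝ), LocallyIntegrable r Ω.μ →
      (∀ (φ : E3 → ℝ) (hφ : Ω.SmoothCpt φ),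
        - ⟪B.wedgeL2 f, (hφ.curlTest i j).toL2⟫_ℝ = ∫ x, φ x * r x ∂Ω.μ) →
      ∀ᵐ x ∂Ω.μ, y' j x i - y' i x j = r x := by
    intro i j r hr h
    have hl := (locallyIntegrable_coord i (y' j)).sub (locallyIntegrable_coord j (y' i))
    have := ae_eq_zero_of_integral_smul (Ω := Ω) (f := fun x => (y' j x i - y' i x j) - r x)
      (hl.sub hr) (fun φ hφ => by
        have h1 := integral_sub (hφ.integrable_smul hl) (hφ.integrable_smul hr)
        simp only [smul_eq_mul, Pi.sub_apply] at h1
        simp only [smul_eq_mul, mul_sub (φ _) (_ - _) (r _)]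
        rw [h1, hcurl φ hφ, h φ hφ, sub_self])
    filter_upwards [this] with x hx
    exact sub_eq_zero.1 hx
  have h1 := hmain 0 2 _ (hβl 1 (f' 2)) (fun φ hφ => by
    have hβ := hφ.mul_left B.amp_smooth B.amp_periodic
    rw [(B.inner_wedgeL2_curlTest hφ f).1, (hf' 2).integral_mul hβ, neg_neg]
    exact integral_congr_ae (ae_of_all _ fun x => by ring))
  have h2 := hmain 1 2 _ (hβl 0 (f' 2)).neg (fun φ hφ => by
    have hβ := hφ.mul_left B.amp_smooth B.amp_periodic
    rw [(B.inner_wedgeL2_curlTest hφ f).2.1, (hf' 2).integral_mul hβ, neg_neg, ← integral_neg]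
    exact integral_congr_ae (ae_of_all _ fun x => by simp only [Pi.neg_apply]; ring))
  have h3 := hmain 1 0 _ ((hβl 2 (f' 2)).sub hgl) (fun φ hφ => by
    have hβ := hφ.mul_left B.amp_smooth B.amp_periodic
    rw [(B.inner_wedgeL2_curlTest hφ f).2.2, (hf' 0).integral_mul hβ, (hf' 1).integral_mul hβ]
    have i0 := integrable_mul_coord hβ (f' 0) 0
    have i1 := integrable_mul_coord hβ (f' 1) 1
    have i2 := hφ.integrable_smul hgl
    simp only [smul_eq_mul] at i2
    have h1 := integral_add i1 i0
    have h2 := integral_add (i1.add i0) i2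
    simp only [Pi.add_apply] at h1 h2
    rw [show ∀ a b c : ℝ, -(- -a - -b + c) = -(b + a + c) by intros; ring, ← h1, ← h2,
      ← integral_neg]
    refine integral_congr_ae ?_
    -- The divergence condition turns `-(∂₀ f₀ + ∂₁ f₁)` into the vertical derivative of `f₂`.
    filter_upwards [div_eq_zero hf hf'] with x hx
    rw [Fin.sum_univ_three] at hx
    simp only [Pi.sub_apply]
    have : f' 2 x 2 = - f' 0 x 0 - f' 1 x 1 := by linarith
    rw [this]
    ring)
  filter_upwards [h1, h2, h3] with x h1 h2 h3
  exact ⟨h1, h2, h3⟩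

lemma rotForm_eq_integral {Φ : E3 → E3} (hΦ : Ω.SmoothCpt Φ) (g : Ω.L2) (y' : Fin 3 → Ω.L2) :
    Integrable (fun x => ∑ i, ∑ j, Φ x j * (y' j x i - y' i x j) * g x i) Ω.μ ∧
    rotForm Φ g y' = ∫ x, ∑ i, ∑ j, Φ x j * (y' j x i - y' i x j) * g x i ∂Ω.μ := by
  have h1 : ∀ i j, Integrable (fun x => Φ x j * (y' j x i - y' i x j) * g x i) Ω.μ := by
    intro i j
    refine ((integrable_mul3 (hΦ.coord j) (y' j) g i i).sub
      (integrable_mul3 (hΦ.coord j) (y' i) g j i)).congr (ae_of_all _ fun x => ?_)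
    simp only [Pi.sub_apply]
    ring
  refine ⟨integrable_finsetSum _ fun i _ => integrable_finsetSum _ fun j _ => h1 i j, ?_⟩
  rw [integral_finsetSum _ fun i _ => integrable_finsetSum _ fun j _ => h1 i j]
  simp only [integral_finsetSum _ fun j _ => h1 _ j]
  rw [rotForm]
  refine Finset.sum_congr rfl fun i _ => Finset.sum_congr rfl fun j _ => ?_
  rw [← integral_sub (integrable_mul3 (hΦ.coord j) (y' j) g i i)
      (integrable_mul3 (hΦ.coord j) (y' i) g j i)]
  exact integral_congr_ae (ae_of_all _ fun x => by ring)

/-- The form `(g, f) ↦ ∫ (g ∧ rot L f) · Φ` is symmetric. -/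
lemma rotForm_L_symm {Φ : E3 → E3} (hΦ : Ω.SmoothCpt Φ) (hΦ2 : ∀ x, fderiv ℝ Φ x (e 2) = 0)
    (hΦb : ∀ x, fderiv ℝ B.amp x (e 0) * Φ x 0 + fderiv ℝ B.amp x (e 1) * Φ x 1 = 0)
    {f g y z : Ω.L2} (hf : f ∈ Ω.H) (hg : g ∈ Ω.H) {f' g' y' z' : Fin 3 → Ω.L2}
    (hf' : ∀ j, Ω.IsWeakPartial j f (f' j)) (hg' : ∀ j, Ω.IsWeakPartial j g (g' j))
    (hy' : ∀ j, Ω.IsWeakPartial j y (y' j)) (hz' : ∀ j, Ω.IsWeakPartial j z (z' j))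
    (hy : ∀ ξ ∈ Ω.H, ⟪y, ξ⟫_ℝ = ⟪B.wedgeL2 f, ξ⟫_ℝ)
    (hz : ∀ ξ ∈ Ω.H, ⟪z, ξ⟫_ℝ = ⟪B.wedgeL2 g, ξ⟫_ℝ) :
    rotForm Φ g y' = rotForm Φ f z' := by
  obtain ⟨i1, e1⟩ := rotForm_eq_integral hΦ g y'
  obtain ⟨i2, e2⟩ := rotForm_eq_integral hΦ f z'
  rw [e1, e2, ← sub_eq_zero, ← integral_sub i1 i2]
  -- Vertical derivatives of products `f_b g_a`, weighted by `b Φ_k`, have zero integral, as the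
  -- weight does not depend on the vertical variable. The difference of the two sides is a
  -- combination of these and a term in `∇b · Φ`.
  have hp : ∀ k a b : Fin 3,
      Integrable (fun x => B.amp x * Φ x k * (f' 2 x b * g x a + f x b * g' 2 x a)) Ω.μ ∧
      ∫ x, B.amp x * Φ x k * (f' 2 x b * g x a + f x b * g' 2 x a) ∂Ω.μ = 0 := by
    intro k a b
    have hc := (hΦ.coord k).mul_left B.amp_smooth B.amp_periodic
    have h1 := integral_mul3_by_parts hc (hf' 2) (hg' 2) b a
    have h2 : ∀ x, fderiv ℝ (fun x => B.amp x * Φ x k) x (e 2) = 0 := by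
      intro x
      rw [SmoothCpt.fderiv_mul (hΦ.coord k).differentiable B.amp_differentiable, fderiv_amp_two,
        fderiv_coord hΦ.differentiable, hΦ2]
      simp
    simp only [h2, zero_mul, integral_zero] at h1
    have j1 := integrable_mul3 hc (f' 2) g b a
    have j2 := integrable_mul3 hc f (g' 2) b a
    have h3 : ∀ x, B.amp x * Φ x k * (f' 2 x b * g x a + f x b * g' 2 x a)
        = B.amp x * Φ x k * f' 2 x b * g x a + B.amp x * Φ x k * f x b * g' 2 x a := by
      intro x; ring
    simp only [h3]
    refine ⟨j1.add j2, ?_⟩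
    rw [integral_add j1 j2]
    linarith
  have hadd : ∀ {p q : E3 → ℝ}, (Integrable p Ω.μ ∧ ∫ x, p x ∂Ω.μ = 0) →
      (Integrable q Ω.μ ∧ ∫ x, q x ∂Ω.μ = 0) →
      (Integrable (fun x => p x - q x) Ω.μ ∧ ∫ x, (p x - q x) ∂Ω.μ = 0) ∧
      (Integrable (fun x => p x + q x) Ω.μ ∧ ∫ x, (p x + q x) ∂Ω.μ = 0) := by
    intro p q h1 h2
    refine ⟨⟨h1.1.sub h2.1, ?_⟩, ⟨h1.1.add h2.1, ?_⟩⟩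
    · rw [integral_sub h1.1 h2.1, h1.2, h2.2, sub_zero]
    · rw [integral_add h1.1 h2.1, h1.2, h2.2, add_zero]
  have k0 := (hadd (hp 0 1 2) (hp 0 2 1)).1
  have k1 := (hadd (hp 1 2 0) (hp 1 0 2)).1
  have k2 := (hadd (hp 2 0 1) (hp 2 1 0)).1
  have k3 := (hadd (hadd k0 k1).2 k2).2.2
  rw [← k3]
  refine integral_congr_ae ?_
  filter_upwards [B.curl_L hf hf' hy' hy, B.curl_L hg hg' hz' hz] with x ⟨a1, a2, a3⟩ ⟨b1, b2, b3⟩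
  simp only [Fin.sum_univ_three, sub_self, mul_zero, zero_mul]
  rw [a1, a2, a3, b1, b2, b3]
  have a1' : y' 0 x 2 - y' 2 x 0 = - (B.amp x * f' 2 x 1) := by linarith
  have a2' : y' 1 x 2 - y' 2 x 1 = B.amp x * f' 2 x 0 := by linarith
  have a3' : y' 1 x 0 - y' 0 x 1 = - (B.amp x * f' 2 x 2
      - (fderiv ℝ B.amp x (e 0) * f x 0 + fderiv ℝ B.amp x (e 1) * f x 1)) := by linarith
  have b1' : z' 0 x 2 - z' 2 x 0 = - (B.amp x * g' 2 x 1) := by linarith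
  have b2' : z' 1 x 2 - z' 2 x 1 = B.amp x * g' 2 x 0 := by linarith
  have b3' : z' 1 x 0 - z' 0 x 1 = - (B.amp x * g' 2 x 2
      - (fderiv ℝ B.amp x (e 0) * g x 0 + fderiv ℝ B.amp x (e 1) * g x 1)) := by linarith
  rw [a1', a2', a3', b1', b2', b3']
  -- What remains of the commutators with `∇b` is proportional to `∇b · Φ`, which is zero.
  linear_combination (f x 1 * g x 0 - f x 0 * g x 1) * hΦb x

end Rotation

/-! ### Operators commuting with translations: constant matrices and the vertical average. -/

namespace Domain

variable {Ω : Domain}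

/-- The pointwise action of a constant matrix. -/
def matL (E : E3 →L[ℝ] E3) : Ω.L2 →L[ℝ] Ω.L2 := E.compLpL 2 Ω.μ

lemma coeFn_matL (E : E3 →L[ℝ] E3) (u : Ω.L2) : matL E u =ᵐ[Ω.μ] fun x => E (u x) :=
  E.coeFn_compLpL u

lemma matL_trans (E : E3 →L[ℝ] E3) (h : E3) (u : Ω.L2) :
    matL E (Ω.trans h u) = Ω.trans h (matL E u) := by
  apply Lp.ext
  have h1 := (Ω.measurePreserving_shift h).quasiMeasurePreserving.ae (coeFn_matL E u)
  filter_upwards [coeFn_matL E (Ω.trans h u), coeFn_trans h u, coeFn_trans h (matL E u), h1]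
    with x h2 h3 h4 h5
  rw [h2, h3, h4, h5]

lemma matL_unitMat_symm (i : Fin 3) (u v : Ω.L2) :
    ⟪matL (unitMat i i) u, v⟫_ℝ = ⟪u, matL (unitMat i i) v⟫_ℝ := by
  rw [L2.inner_def, L2.inner_def]
  refine integral_congr_ae ?_
  filter_upwards [coeFn_matL (unitMat i i) u, coeFn_matL (unitMat i i) v] with x h1 h2
  rw [h1, h2, unitMat_apply, unitMat_apply, real_inner_smul_left, real_inner_smul_right, inner_e,
    inner_e_right, mul_comm]

lemma matL_unitMat_coord (i k : Fin 3) (u : Ω.L2) :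
    ∀ᵐ x ∂Ω.μ, matL (unitMat i i) u x k = if k = i then u x i else 0 := by
  filter_upwards [coeFn_matL (unitMat i i) u] with x h1
  rw [h1, unitMat_apply]
  by_cases h : k = i
  · subst h; simp [e]
  · simp [e, h]

lemma trans_mem_H {u : Ω.L2} (hu : u ∈ Ω.H) (h : E3) : Ω.trans h u ∈ Ω.H := by
  rw [mem_H_iff_sum] at hu ⊢
  intro φ hφ
  have h1 := hu _ (hφ.translate (-h))
  rw [← h1]
  refine Finset.sum_congr rfl fun j _ => ?_
  have h2 := congrArg (fun v : E3 => v j) (integral_smul_trans (hφ.fderiv_apply (e j)) h u)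
  rw [← integral_coord j (L2_integrable_smul (hφ.fderiv_apply (e j)) _),
    ← integral_coord j (L2_integrable_smul ((hφ.fderiv_apply (e j)).translate (-h)) _)] at h2
  simpa [fderiv_comp_add_right] using h2

lemma isClosed_H : IsClosed (Ω.H : Set Ω.L2) := Submodule.isClosed_orthogonal _

lemma avg_mem_H {u : Ω.L2} (hu : u ∈ Ω.H) (j : Fin 3) (δ : ℝ) : avg j δ u ∈ Ω.H :=
  avg_mem_of_trans_mem j δ _ isClosed_H fun s => trans_mem_H hu (s • e j)

lemma isWeakPartial_zero_of_coord {j : Fin 3} {u : Ω.L2} (h : ∀ (i : Fin 3) (φ : E3 → ℝ),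
    Ω.SmoothCpt φ → ∫ x, fderiv ℝ φ x (e j) * u x i ∂Ω.μ = 0) : Ω.IsWeakPartial j u 0 := by
  rw [isWeakPartial_iff]
  intro φ hφ
  rw [map_zero, neg_zero, pairL_apply]
  ext i
  rw [← integral_coord i (L2_integrable_smul (hφ.fderiv_apply (e j)) _)]
  simpa using h i φ hφ

lemma IsWeakPartial.trans_eq {j : Fin 3} {u : Ω.L2} (h : Ω.IsWeakPartial j u 0) (s : ℝ) :
    Ω.trans (s • e j) u = u := by
  have := h.norm_trans_sub_le s
  rw [norm_zero, mul_zero, norm_le_zero_iff] at this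
  exact sub_eq_zero.1 this

lemma isWeakPartial_zero_of_trans {j : Fin 3} {u : Ω.L2} (h : ∀ s : ℝ, Ω.trans (s • e j) u = u) :
    Ω.IsWeakPartial j u 0 := by
  rw [isWeakPartial_iff_hasDerivAt]
  simp only [h]
  exact hasDerivAt_const _ _

lemma integral_fderiv_mul_eq_zero_of_trans {j : Fin 3} {u : Ω.L2}
    (h : ∀ s : ℝ, Ω.trans (s • e j) u = u) {φ : E3 → ℝ} (hφ : Ω.SmoothCpt φ) (i : Fin 3) :
    ∫ x, fderiv ℝ φ x (e j) * u x i ∂Ω.μ = 0 := by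
  rw [(isWeakPartial_zero_of_trans h).integral_mul hφ i, neg_eq_zero]
  refine integral_eq_zero_of_ae ?_
  filter_upwards [Lp.coeFn_zero E3 2 Ω.μ] with x hx
  rw [hx]
  simp

/-- The vertical average. -/
def vert : Ω.L2 →L[ℝ] Ω.L2 := avg 2 (Ω.len 2)

lemma trans_lattice {h : E3} (hh : h ∈ Ω.lattice) (u : Ω.L2) : Ω.trans h u = u := by
  apply Lp.ext
  filter_upwards [coeFn_trans h u, Ω.ae_mem_cell] with x h1 h2
  rw [h1, shift, Ω.wrap_add_of_mem hh, Ω.wrap_of_mem h2]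

/-- The derivative of an average over a segment is the difference of the translates at its ends,
here zero because the length is a period. -/
lemma trans_vert (s : ℝ) (u : Ω.L2) : Ω.trans (s • e 2) (vert u) = vert u := by
  refine IsWeakPartial.trans_eq ?_ s
  have := isWeakPartial_avg 2 (Ω.len 2) u
  rwa [trans_lattice (Ω.smul_e_mem_lattice 2), sub_self, smul_zero] at this

lemma avg_of_trans_eq {j : Fin 3} {δ : ℝ} (hδ : δ ≠ 0) {u : Ω.L2}
    (h : ∀ s : ℝ, Ω.trans (s • e j) u = u) : avg j δ u = u := by
  rw [avg_apply]
  simp [h, smul_smul, hδ]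

lemma vert_of_trans_eq {u : Ω.L2} (h : ∀ s : ℝ, Ω.trans (s • e 2) u = u) : vert u = u :=
  avg_of_trans_eq Ω.vertical.ne' h

lemma vert_vert (u : Ω.L2) : vert (vert u) = vert u := vert_of_trans_eq fun s => trans_vert s u

lemma inner_avg (j : Fin 3) (δ : ℝ) (u v : Ω.L2) :
    ⟪avg j δ u, v⟫_ℝ = δ⁻¹ * ∫ s in (0 : ℝ)..δ, ⟪Ω.trans (s • e j) u, v⟫_ℝ := by
  rw [avg_apply, real_inner_smul_left, real_inner_comm]
  have h2 := (innerSL ℝ v).intervalIntegral_comp_comm (a := 0) (b := δ)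
    ((continuous_trans_smul (e j) u).intervalIntegrable (μ := volume) _ _)
  simp only [innerSL_apply_apply] at h2
  rw [← h2]
  simp only [real_inner_comm]

/-- Against a vertically invariant field, averaging the other argument changes nothing. Hence both
sides equal `⟪vert u, vert v⟫`. -/
lemma vert_symm (u v : Ω.L2) : ⟪vert u, v⟫_ℝ = ⟪u, vert v⟫_ℝ := by
  have key : ∀ u v : Ω.L2, ⟪vert u, vert v⟫_ℝ = ⟪u, vert v⟫_ℝ := by
    intro u v
    have h1 : ∀ s : ℝ, ⟪Ω.trans (s • e 2) u, vert v⟫_ℝ = ⟪u, vert v⟫_ℝ := by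
      intro s
      rw [inner_trans, ← neg_smul, trans_vert]
    have h2 : ⟪vert u, vert v⟫_ℝ
      = (Ω.len 2)⁻¹ * ∫ s in (0 : ℝ)..Ω.len 2, ⟪Ω.trans (s • e 2) u, vert v⟫_ℝ :=
      inner_avg 2 (Ω.len 2) u (vert v)
    rw [h2]
    simp only [h1]
    rw [intervalIntegral.integral_const, smul_eq_mul, sub_zero, inv_mul_cancel_left₀ Ω.vertical.ne']
  rw [← key u v, real_inner_comm v (vert u), ← key v u, real_inner_comm]

lemma vert_trans (h : E3) (u : Ω.L2) : vert (Ω.trans h u) = Ω.trans h (vert u) :=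
  avg_trans 2 _ h u

lemma vert_matL (E : E3 →L[ℝ] E3) (u : Ω.L2) : vert (matL E u) = matL E (vert u) :=
  (clm_avg (matL E) 2 _ (fun _ u => matL_trans E _ u) u).symm

lemma vert_mem_H {u : Ω.L2} (hu : u ∈ Ω.H) : vert u ∈ Ω.H := avg_mem_H hu 2 _

end Domain

/-! ### The kernel of `L` and the projection on it. -/

namespace Rotation

open Domain

variable {Ω : Domain} (B : Rotation Ω)

lemma mem_KerL_iff {k : Ω.L2} :
    k ∈ B.KerL ↔ k ∈ Ω.H ∧ ∀ ξ ∈ Ω.H, ⟪B.wedgeL2 k, ξ⟫_ℝ = 0 := by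
  rw [KerL, Submodule.mem_inf]
  refine and_congr_right fun _ => ?_
  change B.L k = 0 ↔ _
  rw [L, ContinuousLinearMap.comp_apply, Submodule.starProjection_apply_eq_zero_iff,
    Submodule.mem_orthogonal']

lemma wedgeL2_trans (s : ℝ) (u : Ω.L2) :
    B.wedgeL2 (Ω.trans (s • e 2) u) = Ω.trans (s • e 2) (B.wedgeL2 u) := by
  apply Lp.ext
  have h1 := (Ω.measurePreserving_shift (s • e 2)).quasiMeasurePreserving.ae (B.coeFn_wedgeL2 u)
  filter_upwards [B.coeFn_wedgeL2 (Ω.trans (s • e 2) u), coeFn_trans (s • e 2) u,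
    coeFn_trans (s • e 2) (B.wedgeL2 u), h1] with x h2 h3 h4 h5
  have h6 : B.b (hor (Ω.shift (s • e 2) x)) = B.b (hor x) := by
    have := Periodic.comp_shift B.amp_periodic (s • e 2) x
    rw [amp, amp, hor_add, hor_smul, hor_e_two, smul_zero, add_zero] at this
    exact this
  rw [h2, h3, h4, h5, h6]

lemma vert_wedgeL2 (u : Ω.L2) : vert (B.wedgeL2 u) = B.wedgeL2 (vert u) :=
  (clm_avg B.wedgeL2 2 _ (fun s u => B.wedgeL2_trans s u) u).symm

lemma trans_mem_KerL {k : Ω.L2} (hk : k ∈ B.KerL) (s : ℝ) : Ω.trans (s • e 2) k ∈ B.KerL := by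
  rw [mem_KerL_iff] at hk ⊢
  refine ⟨trans_mem_H hk.1 _, fun ξ hξ => ?_⟩
  rw [wedgeL2_trans, inner_trans]
  exact hk.2 _ (trans_mem_H hξ _)

lemma amp_inv_smooth : ContDiff ℝ ∞ fun x => (B.amp x)⁻¹ := B.amp_smooth.inv B.amp_ne_zero

lemma amp_inv_periodic : Ω.Periodic fun x => (B.amp x)⁻¹ := fun x i => by
  simp only [B.amp_periodic x i]

/-- The scalar equations satisfied by the elements of the kernel of `L`. -/
lemma KerL_equations {k : Ω.L2} (hk : k ∈ B.KerL) {ψ : E3 → ℝ} (hψ : Ω.SmoothCpt ψ) :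
    ∫ x, fderiv ℝ ψ x (e 2) * k x 0 ∂Ω.μ = 0 ∧ ∫ x, fderiv ℝ ψ x (e 2) * k x 1 ∂Ω.μ = 0 ∧
    ∫ x, fderiv ℝ ψ x (e 2) * k x 2 ∂Ω.μ + ∫ x, (B.amp x)⁻¹ * ψ x *
      (fderiv ℝ B.amp x (e 0) * k x 0 + fderiv ℝ B.amp x (e 1) * k x 1) ∂Ω.μ = 0 := by
  rw [mem_KerL_iff] at hk
  -- The test `ψ / b`, available because `b` has no zero, makes `b` disappear from the derivatives.
  have hφ := hψ.mul_left B.amp_inv_smooth B.amp_inv_periodic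
  have h0 : (fun x => B.amp x * ((B.amp x)⁻¹ * ψ x)) = ψ := by
    ext x
    rw [mul_inv_cancel_left₀ (B.amp_ne_zero x)]
  obtain ⟨h1, h2, h3⟩ := B.inner_wedgeL2_curlTest hφ k
  rw [h0, hk.2 _ (curlTest_mem_H hφ _ _)] at h1 h2 h3
  -- The divergence condition exchanges the horizontal derivatives in the third relation for the
  -- vertical one.
  have h4 := mem_H_iff_sum.1 hk.1 ψ hψ
  rw [Fin.sum_univ_three] at h4
  refine ⟨by linarith, by linarith, by linarith⟩

/-- The elements of the kernel of `L` do not depend on the vertical variable. -/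
lemma KerL_trans_eq {k : Ω.L2} (hk : k ∈ B.KerL) (s : ℝ) : Ω.trans (s • e 2) k = k := by
  -- With no horizontal part, the term with `∇b` in the third scalar equation vanishes, and the
  -- vertical component is invariant too.
  have key : ∀ d ∈ B.KerL, (∀ᵐ x ∂Ω.μ, d x 0 = 0) → (∀ᵐ x ∂Ω.μ, d x 1 = 0) →
      Ω.trans (s • e 2) d = d := by
    intro d hd h0 h1
    refine IsWeakPartial.trans_eq (isWeakPartial_zero_of_coord fun i φ hφ => ?_) s
    obtain ⟨k1, k2, k3⟩ := B.KerL_equations hd hφ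
    fin_cases i
    · exact k1
    · exact k2
    · have h5 : ∫ x, (B.amp x)⁻¹ * φ x * (fderiv ℝ B.amp x (e 0) * d x 0
          + fderiv ℝ B.amp x (e 1) * d x 1) ∂Ω.μ = 0 := by
        refine integral_eq_zero_of_ae ?_
        filter_upwards [h0, h1] with x h0 h1
        simp [h0, h1]
      rw [h5, add_zero] at k3
      exact k3
  have hor0 : ∀ i : Fin 3, i ≠ 2 → ∀ᵐ x ∂Ω.μ, (Ω.trans (s • e 2) k - k) x i = 0 := by
    intro i hi
    have h1 : Ω.IsWeakPartial 2 (matL (unitMat i i) k) 0 := by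
      refine isWeakPartial_zero_of_coord fun l φ hφ => ?_
      by_cases hl : l = i
      · subst hl
        have h2 : ∫ x, fderiv ℝ φ x (e 2) * k x l ∂Ω.μ = 0 := by
          obtain ⟨k1, k2, -⟩ := B.KerL_equations hk hφ
          fin_cases l
          · exact k1
          · exact k2
          · exact absurd rfl hi
        rw [← h2]
        refine integral_congr_ae ?_
        filter_upwards [matL_unitMat_coord l l k] with x hx
        rw [hx, if_pos rfl]
      · refine integral_eq_zero_of_ae ?_
        filter_upwards [matL_unitMat_coord i l k] with x hx
        rw [hx, if_neg hl, mul_zero]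
        rfl
    have h2 := h1.trans_eq s
    rw [← matL_trans, ← sub_eq_zero, ← map_sub] at h2
    filter_upwards [matL_unitMat_coord i i (Ω.trans (s • e 2) k - k),
      Lp.coeFn_zero E3 2 Ω.μ] with x hx h0
    rw [h2, h0, if_pos rfl] at hx
    exact hx.symm
  set d := Ω.trans (s • e 2) k - k with hd
  have hdK : d ∈ B.KerL := B.KerL.sub_mem (B.trans_mem_KerL hk s) hk
  have hinv := key d hdK (hor0 0 (by decide)) (hor0 1 (by decide))
  -- The increment `d` is in the kernel with zero horizontal part, so it is itself invariant and the
  -- orbit of `k` is an arithmetic progression. Its norm is constant, which forces `d = 0`.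
  have hn : ∀ n : ℕ, Ω.trans ((n * s) • e 2) k = k + (n : ℝ) • d := by
    intro n
    induction n with
    | zero => simp [trans_zero]
    | succ n ih =>
      have : ((n + 1 : ℕ) * s) • e 2 = s • e 2 + (n * s) • e 2 := by
        rw [← add_smul]; push_cast; ring_nf
      rw [this, ← trans_trans, ih, map_add, map_smul, hinv]
      have h3 : Ω.trans (s • e 2) k = k + d := by rw [hd]; abel
      rw [h3]
      push_cast
      rw [add_smul, one_smul]
      abel
  have hb : ∀ n : ℕ, n * ‖d‖ ≤ 2 * ‖k‖ := by
    intro n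
    have h1 : (n : ℝ) • d = Ω.trans ((n * s) • e 2) k - k := by rw [hn]; abel
    have h2 : ‖(n : ℝ) • d‖ ≤ ‖Ω.trans ((n * s) • e 2) k‖ + ‖k‖ := by
      rw [h1]; exact norm_sub_le _ _
    rw [LinearIsometry.norm_map, norm_smul, Real.norm_of_nonneg (Nat.cast_nonneg n)] at h2
    linarith
  have hd0 : ‖d‖ = 0 := by
    by_contra hne
    have hpos : 0 < ‖d‖ := lt_of_le_of_ne (norm_nonneg _) (Ne.symm hne)
    obtain ⟨n, hn⟩ := exists_nat_gt (2 * ‖k‖ / ‖d‖)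
    rw [div_lt_iff₀ hpos] at hn
    linarith [hb n]
  exact sub_eq_zero.1 (norm_eq_zero.1 hd0)

/-- The elements of the kernel of `L` are tangent to the level lines of `b`. -/
lemma KerL_tangent {k : Ω.L2} (hk : k ∈ B.KerL) :
    ∀ᵐ x ∂Ω.μ, fderiv ℝ B.amp x (e 0) * k x 0 + fderiv ℝ B.amp x (e 1) * k x 1 = 0 := by
  have hl : LocallyIntegrable (fun x => fderiv ℝ B.amp x (e 0) * k x 0
      + fderiv ℝ B.amp x (e 1) * k x 1) Ω.μ :=
    ((locallyIntegrable_coord 0 k).continuous_smul (B.amp_fderiv_continuous (e 0))).add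
      ((locallyIntegrable_coord 1 k).continuous_smul (B.amp_fderiv_continuous (e 1)))
  refine ae_eq_zero_of_integral_smul hl fun φ hφ => ?_
  obtain ⟨-, -, h3⟩ := B.KerL_equations hk (hφ.mul_left B.amp_smooth B.amp_periodic)
  -- Vertical invariance removes the vertical derivative from the third scalar equation; with the
  -- test `b φ` only `φ` times `∇b · k` is left.
  rw [integral_fderiv_mul_eq_zero_of_trans (B.KerL_trans_eq hk)
    (hφ.mul_left B.amp_smooth B.amp_periodic), zero_add] at h3
  rw [← h3]
  refine integral_congr_ae (ae_of_all _ fun x => ?_)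
  simp only [inv_mul_cancel_left₀ (B.amp_ne_zero x), smul_eq_mul]

/-- A vertically invariant vertical field is in the kernel of `L`. -/
lemma vert_vertical_mem_KerL (u : Ω.L2) : matL (unitMat 2 2) (vert u) ∈ B.KerL := by
  have hv : ∀ s : ℝ, Ω.trans (s • e 2) (matL (unitMat 2 2) (vert u))
      = matL (unitMat 2 2) (vert u) := fun s => by rw [← matL_trans, trans_vert]
  have h0 := matL_unitMat_coord 2 0 (vert u)
  have h1 := matL_unitMat_coord 2 1 (vert u)
  rw [mem_KerL_iff]
  refine ⟨mem_H_iff_sum.2 fun φ hφ => ?_, fun ξ _ => ?_⟩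
  · rw [Fin.sum_univ_three, integral_fderiv_mul_eq_zero_of_trans hv hφ, add_zero]
    rw [integral_eq_zero_of_ae, integral_eq_zero_of_ae, add_zero]
    · filter_upwards [h1] with x hx
      rw [hx]; simp
    · filter_upwards [h0] with x hx
      rw [hx]; simp
  · rw [inner_wedgeL2]
    refine integral_eq_zero_of_ae ?_
    filter_upwards [h0, h1] with x h0 h1
    rw [h0, h1]
    simp

lemma Pi_mem (u : Ω.L2) : B.Pi u ∈ B.KerL := Submodule.starProjection_apply_mem _ _

lemma inner_PiPerp {k : Ω.L2} (hk : k ∈ B.KerL) (u : Ω.L2) : ⟪B.PiPerp u, k⟫_ℝ = 0 := by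
  have := Submodule.sub_starProjection_mem_orthogonal (K := B.KerL) u
  exact Submodule.inner_left_of_mem_orthogonal hk this

lemma PiPerp_apply (u : Ω.L2) : B.PiPerp u = u - B.Pi u := rfl

lemma Pi_symm (u v : Ω.L2) : ⟪B.Pi u, v⟫_ℝ = ⟪u, B.Pi v⟫_ℝ :=
  Submodule.inner_starProjection_left_eq_right _ _ _

lemma vert_Pi (u : Ω.L2) : vert (B.Pi u) = B.Pi u :=
  vert_of_trans_eq (B.KerL_trans_eq (B.Pi_mem u))

/-- The vertical component of `Π u` is the vertical average of that of `u`. -/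
lemma vertical_Pi (u : Ω.L2) : matL (unitMat 2 2) (B.Pi u) = matL (unitMat 2 2) (vert u) := by
  -- All the operators are symmetric. Transferred to `v`, they produce a vertical, vertically
  -- invariant field, and `Π` fixes it.
  refine ext_inner_right ℝ fun v => ?_
  rw [matL_unitMat_symm, ← vert_Pi, vert_symm, vert_matL, Pi_symm]
  have : B.Pi (matL (unitMat 2 2) (vert v)) = matL (unitMat 2 2) (vert v) :=
    Submodule.starProjection_eq_self_iff.2 (B.vert_vertical_mem_KerL v)
  rw [this, ← vert_matL, ← vert_symm, matL_unitMat_symm]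

end Rotation

/-! ### Horizontal regularization and planar fields on which the quadratic form vanishes. -/

namespace Domain

variable {Ω : Domain}

/-- An average belongs to every ball which contains the averaged values. -/
lemma norm_clm_avg_sub_le (T : Ω.L2 →L[ℝ] Ω.L2) (w : Ω.L2) (j : Fin 3) {δ : ℝ} (hδ : 0 < δ) {C : ℝ}
    (u : Ω.L2) (h : ∀ s ∈ Icc 0 δ, ‖T (Ω.trans (s • e j) u) - w‖ ≤ C) :
    ‖T (avg j δ u) - w‖ ≤ C := by
  have hc : Continuous fun τ : ℝ => Ω.trans (τ • e j) u := continuous_trans_smul _ _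
  have hT : Continuous fun τ : ℝ => T (Ω.trans (τ • e j) u) := T.continuous.comp hc
  have h1 : T (avg j δ u) - w = δ⁻¹ • ∫ s in (0 : ℝ)..δ, (T (Ω.trans (s • e j) u) - w) := by
    rw [intervalIntegral.integral_sub (hT.intervalIntegrable _ _) (by simp), smul_sub, avg_apply,
      map_smul, ← T.intervalIntegral_comp_comm (hc.intervalIntegrable _ _)]
    simp [smul_smul, hδ.ne']
  have h2 := intervalIntegral.norm_integral_le_of_norm_le_const (a := 0) (b := δ) (C := C)
        (f := fun τ => T (Ω.trans (τ • e j) u) - w) (fun τ hτ => h τ (by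
          rw [uIoc_of_le hδ.le] at hτ
          exact ⟨hτ.1.le, hτ.2⟩))
  rw [h1, norm_smul, norm_inv, Real.norm_of_nonneg hδ.le, inv_mul_le_iff₀ hδ, mul_comm]
  rwa [sub_zero, abs_of_pos hδ] at h2

lemma norm_avg_le (j : Fin 3) {δ : ℝ} (hδ : 0 < δ) (u : Ω.L2) : ‖avg j δ u‖ ≤ ‖u‖ := by
  have := norm_clm_avg_sub_le (ContinuousLinearMap.id ℝ Ω.L2) 0 j hδ (C := ‖u‖) u (by simp)
  simpa using this

/-- The horizontal average on a square of side `δ`. -/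
def horAvg (δ : ℝ) (u : Ω.L2) : Ω.L2 := avg 0 δ (avg 1 δ u)

/-- The operator `T` is left free for three uses: the identity gives convergence of the averages,
`wedgeOp` gives a commutator bound, and a rank one operator transfers orthogonality to the averages.
-/
lemma norm_clm_horAvg_sub_le (T : Ω.L2 →L[ℝ] Ω.L2) (w : Ω.L2) {δ : ℝ} (hδ : 0 < δ) {C : ℝ}
    (u : Ω.L2) (h : ∀ s ∈ Icc 0 δ, ∀ t ∈ Icc 0 δ, ‖T (Ω.trans (s • e 0 + t • e 1) u) - w‖ ≤ C) :
    ‖T (horAvg δ u) - w‖ ≤ C := by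
  refine norm_clm_avg_sub_le T w 0 hδ _ fun s hs => ?_
  rw [← avg_trans]
  refine norm_clm_avg_sub_le T w 1 hδ _ fun t ht => ?_
  rw [trans_trans, add_comm]
  exact h s hs t ht

lemma norm_smul_e_add_le {s t δ : ℝ} (hs : s ∈ Icc 0 δ) (ht : t ∈ Icc 0 δ) :
    ‖s • e 0 + t • e 1‖ ≤ 2 * δ := by
  refine (norm_add_le _ _).trans ?_
  rw [norm_smul, norm_smul, Real.norm_of_nonneg hs.1, Real.norm_of_nonneg ht.1]
  have : ∀ i, ‖e i‖ = 1 := fun i => by simp [e]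
  rw [this, this]
  linarith [hs.2, ht.2]

lemma tendsto_horAvg (u : Ω.L2) : Tendsto (fun δ => horAvg δ u) (𝓝[>] 0) (𝓝 u) := by
  rw [Metric.tendsto_nhds]
  intro η hη
  obtain ⟨d, hd, h⟩ := Metric.tendsto_nhds_nhds.1 (tendsto_trans_zero u) (η / 2) (by positivity)
  filter_upwards [Ioo_mem_nhdsGT (show (0 : ℝ) < d / 2 by positivity)] with δ hδ
  refine lt_of_le_of_lt ?_ (half_lt_self hη)
  rw [dist_eq_norm]
  refine norm_clm_horAvg_sub_le (ContinuousLinearMap.id ℝ Ω.L2) u hδ.1 u fun s hs t ht => ?_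
  rw [ContinuousLinearMap.id_apply, ← dist_eq_norm]
  refine (h ?_).le
  rw [dist_zero_right]
  linarith [norm_smul_e_add_le hs ht, hδ.2]

lemma horAvg_mem_H {u : Ω.L2} (hu : u ∈ Ω.H) (δ : ℝ) : horAvg δ u ∈ Ω.H :=
  avg_mem_H (avg_mem_H hu _ _) _ _

lemma matL_horAvg (E : E3 →L[ℝ] E3) (δ : ℝ) (u : Ω.L2) :
    matL E (horAvg δ u) = horAvg δ (matL E u) := by
  rw [horAvg, clm_avg (matL E) 0 δ (fun _ u => matL_trans E _ u), clm_avg (matL E) 1 δ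
    (fun _ u => matL_trans E _ u), horAvg]

/-- The partial derivatives of the horizontal average of a field which does not depend on the
vertical variable. -/
def horAvgPd (δ : ℝ) (u : Ω.L2) : Fin 3 → Ω.L2 :=
  ![avg 1 δ (δ⁻¹ • (Ω.trans (δ • e 0) u - u)), avg 0 δ (δ⁻¹ • (Ω.trans (δ • e 1) u - u)), 0]

lemma isWeakPartial_horAvg (δ : ℝ) {u : Ω.L2} (hu : ∀ s : ℝ, Ω.trans (s • e 2) u = u) (j : Fin 3) :
    Ω.IsWeakPartial j (horAvg δ u) (horAvgPd δ u j) := by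
  fin_cases j
  · have := (isWeakPartial_avg 0 δ u).clm (avg 1 δ) (fun h u => avg_trans 1 δ h u)
    rw [avg_comm] at this
    exact this
  · exact (isWeakPartial_avg 1 δ u).clm (avg 0 δ) (fun h u => avg_trans 0 δ h u)
  · refine isWeakPartial_zero_of_trans fun s => ?_
    change Ω.trans (s • e 2) (horAvg δ u) = horAvg δ u
    rw [horAvg, ← avg_trans, ← avg_trans, hu]

lemma matL_unitMat_eq_zero_iff {i : Fin 3} {u : Ω.L2} :
    matL (unitMat i i) u = 0 ↔ ∀ᵐ x ∂Ω.μ, u x i = 0 := by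
  constructor
  · intro h
    filter_upwards [matL_unitMat_coord i i u, Lp.coeFn_zero E3 2 Ω.μ] with x hx h0
    rw [h, h0, if_pos rfl] at hx
    exact hx.symm
  · intro h
    apply Lp.ext
    filter_upwards [h, coeFn_matL (unitMat i i) u, Lp.coeFn_zero E3 2 Ω.μ] with x hx h1 h0
    rw [h1, h0, unitMat_apply, hx, zero_smul]
    rfl

lemma IsWeakPartial.coord_eq_zero {j i : Fin 3} {u g : Ω.L2} (h : Ω.IsWeakPartial j u g)
    (hu : matL (unitMat i i) u = 0) : matL (unitMat i i) g = 0 := by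
  have h1 := h.clm (matL (unitMat i i)) (fun h u => matL_trans _ h u)
  rw [hu] at h1
  exact h1.unique (isWeakPartial_zero_of_trans fun s => map_zero _)

/-- The operator `u ↦ (Φ₀ u₁ - Φ₁ u₀) e₀`. -/
def wedgeOp {Φ : E3 → E3} (hΦ : Ω.SmoothCpt Φ) : Ω.L2 →L[ℝ] Ω.L2 :=
  mulC (hΦ.coord 0) (unitMat 0 1) - mulC (hΦ.coord 1) (unitMat 0 0)

lemma coeFn_wedgeOp {Φ : E3 → E3} (hΦ : Ω.SmoothCpt Φ) (u : Ω.L2) :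
    wedgeOp hΦ u =ᵐ[Ω.μ] fun x => (Φ x 0 * u x 1 - Φ x 1 * u x 0) • e 0 := by
  rw [wedgeOp, sub_apply]
  filter_upwards [coeFn_mulC (hΦ.coord 0) (unitMat 0 1) u, coeFn_mulC (hΦ.coord 1) (unitMat 0 0) u,
    Lp.coeFn_sub (mulC (hΦ.coord 0) (unitMat 0 1) u) (mulC (hΦ.coord 1) (unitMat 0 0) u)]
    with x h1 h2 h3
  rw [h3, Pi.sub_apply, h1, h2, unitMat_apply, unitMat_apply, smul_smul, smul_smul, sub_smul]

/-- The vertical component of the curl, from the partial derivatives. -/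
def curlOp (u' : Fin 3 → Ω.L2) : Ω.L2 := matL (unitMat 0 1) (u' 0) - matL (unitMat 0 0) (u' 1)

lemma coeFn_curlOp (u' : Fin 3 → Ω.L2) :
    curlOp u' =ᵐ[Ω.μ] fun x => (u' 0 x 1 - u' 1 x 0) • e 0 := by
  filter_upwards [coeFn_matL (unitMat 0 1) (u' 0), coeFn_matL (unitMat 0 0) (u' 1),
    Lp.coeFn_sub (matL (unitMat 0 1) (u' 0)) (matL (unitMat 0 0) (u' 1))] with x h1 h2 h3
  rw [curlOp, h3, Pi.sub_apply, h1, h2, unitMat_apply, unitMat_apply, sub_smul]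

/-- The quadratic form for a planar field which does not depend on the vertical variable. -/
lemma inner_quadOp_planar {Φ : E3 → E3} (hΦ : Ω.SmoothCpt Φ) {u : Ω.L2} (hu : u ∈ Ω.H)
    {u' : Fin 3 → Ω.L2} (h : ∀ j, Ω.IsWeakPartial j u (u' j))
    (h2 : matL (unitMat 2 2) u = 0) (h0 : u' 2 = 0) :
    ⟪quadOp hΦ u, u⟫_ℝ = ⟪wedgeOp hΦ u, curlOp u'⟫_ℝ := by
  rw [inner_quadOp_self hΦ hu h, (Rotation.rotForm_eq_integral hΦ u u').2, L2.inner_def]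
  refine integral_congr_ae ?_
  filter_upwards [coeFn_wedgeOp hΦ u, coeFn_curlOp u', matL_unitMat_eq_zero_iff.1 h2,
    matL_unitMat_eq_zero_iff.1 ((h 0).coord_eq_zero h2),
    matL_unitMat_eq_zero_iff.1 ((h 1).coord_eq_zero h2), Lp.coeFn_zero E3 2 Ω.μ]
    with x h1 h3 h4 h5 h6 h7
  rw [h1, h3, real_inner_smul_left, real_inner_smul_right, inner_e]
  simp only [Fin.sum_univ_three, h0, h7, h4, h5, h6]
  simp [e]
  ring

/-- The commutator of a translation with multiplication by a Lipschitz function is of order `‖h‖`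
without any regularity of `u`. -/
lemma norm_mulC_trans_sub_le {c : E3 → ℝ} (hc : Ω.SmoothCpt c) (E : E3 →L[ℝ] E3) {K : ℝ}
    (hK : ∀ x y, ‖c x - c y‖ ≤ K * ‖x - y‖) (h : E3) (u : Ω.L2) :
    ‖mulC hc E (Ω.trans h u) - Ω.trans h (mulC hc E u)‖ ≤ K * ‖h‖ * ‖E‖ * ‖u‖ := by
  rw [← LinearIsometry.norm_map (Ω.trans h) u]
  refine Lp.norm_le_mul_norm_of_ae_le_mul ?_
  have h1 := (Ω.measurePreserving_shift h).quasiMeasurePreserving.ae (coeFn_mulC hc E u)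
  filter_upwards [coeFn_mulC hc E (Ω.trans h u), coeFn_trans h u, coeFn_trans h (mulC hc E u), h1,
    Lp.coeFn_sub (mulC hc E (Ω.trans h u)) (Ω.trans h (mulC hc E u))] with x h2 h3 h4 h5 h6
  rw [h6, Pi.sub_apply, h2, h4, h5, ← h3, Periodic.comp_shift hc.periodic, ← sub_smul, norm_smul,
    mul_assoc]
  refine mul_le_mul ?_ (E.le_opNorm _) (norm_nonneg _) ?_
  · have := hK x (x + h)
    rwa [sub_add_cancel_left, norm_neg] at this
  · have := (norm_nonneg _).trans (hK h 0)
    rwa [sub_zero] at this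

/-- The quadratic form vanishes on the planar fields which are parallel to `Φ`. -/
lemma inner_quadOp_eq_zero_of_parallel {Φ : E3 → E3} (hΦ : Ω.SmoothCpt Φ) {z : Ω.L2} (hz : z ∈ Ω.H)
    (hz2 : ∀ s : ℝ, Ω.trans (s • e 2) z = z) (hz3 : matL (unitMat 2 2) z = 0)
    (hpar : ∀ᵐ x ∂Ω.μ, Φ x 0 * z x 1 - Φ x 1 * z x 0 = 0) : ⟪quadOp hΦ z, z⟫_ℝ = 0 := by
  have hM : wedgeOp hΦ z = 0 := by
    apply Lp.ext
    filter_upwards [coeFn_wedgeOp hΦ z, hpar, Lp.coeFn_zero E3 2 Ω.μ] with x h1 h2 h3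
    rw [h1, h2, h3, zero_smul]
    rfl
  obtain ⟨K0, hK0, hL0⟩ := (hΦ.coord 0).exists_lipschitz
  obtain ⟨K1, hK1, hL1⟩ := (hΦ.coord 1).exists_lipschitz
  set C : ℝ := K0 * ‖unitMat 0 1‖ * ‖z‖ + K1 * ‖unitMat 0 0‖ * ‖z‖ with hC
  -- As `wedgeOp hΦ z = 0`, its value on a translate of `z` is a pure commutator.
  have hMh : ∀ h : E3, ‖wedgeOp hΦ (Ω.trans h z)‖ ≤ C * ‖h‖ := by
    intro h
    have e1 : wedgeOp hΦ (Ω.trans h z) = (mulC (hΦ.coord 0) (unitMat 0 1) (Ω.trans h z)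
        - Ω.trans h (mulC (hΦ.coord 0) (unitMat 0 1) z))
        - (mulC (hΦ.coord 1) (unitMat 0 0) (Ω.trans h z)
        - Ω.trans h (mulC (hΦ.coord 1) (unitMat 0 0) z)) := by
      have e2 := congrArg (Ω.trans h) hM
      simp only [wedgeOp, sub_apply, map_sub, map_zero] at e2 ⊢
      rw [sub_eq_zero] at e2
      rw [e2]
      abel
    rw [e1]
    refine (norm_sub_le _ _).trans ?_
    have := norm_mulC_trans_sub_le (hΦ.coord 0) (unitMat 0 1) hL0 h z
    have := norm_mulC_trans_sub_le (hΦ.coord 1) (unitMat 0 0) hL1 h z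
    rw [hC]
    linarith
  have hMe : ∀ δ : ℝ, 0 < δ → ‖wedgeOp hΦ (horAvg δ z)‖ ≤ C * (2 * δ) := by
    intro δ hδ
    have := norm_clm_horAvg_sub_le (wedgeOp hΦ) 0 hδ (C := C * (2 * δ)) z fun s hs t ht => by
      rw [sub_zero]
      exact (hMh _).trans (mul_le_mul_of_nonneg_left (norm_smul_e_add_le hs ht) (by positivity))
    rwa [sub_zero] at this
  -- The curl of the average costs `δ⁻¹` times an increment of `z` under translation, and this
  -- increment is `o(1)`.
  have hDe : ∀ δ : ℝ, 0 < δ → ‖curlOp (horAvgPd δ z)‖ ≤ ‖matL (Ω := Ω) (unitMat 0 1)‖ *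
      (δ⁻¹ * ‖Ω.trans (δ • e 0) z - z‖) + ‖matL (Ω := Ω) (unitMat 0 0)‖ *
      (δ⁻¹ * ‖Ω.trans (δ • e 1) z - z‖) := by
    intro δ hδ
    refine (norm_sub_le _ _).trans (add_le_add ?_ ?_)
    · refine ((matL _).le_opNorm _).trans (mul_le_mul_of_nonneg_left ?_ (norm_nonneg _))
      refine (norm_avg_le 1 hδ _).trans ?_
      rw [norm_smul, Real.norm_of_nonneg (by positivity)]
    · refine ((matL _).le_opNorm _).trans (mul_le_mul_of_nonneg_left ?_ (norm_nonneg _))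
      refine (norm_avg_le 0 hδ _).trans ?_
      rw [norm_smul, Real.norm_of_nonneg (by positivity)]
  have hlim : ∀ j : Fin 3, Tendsto (fun δ : ℝ => ‖Ω.trans (δ • e j) z - z‖) (𝓝[>] 0) (𝓝 0) := by
    intro j
    have h1 : Tendsto (fun δ : ℝ => Ω.trans (δ • e j) z) (𝓝[>] 0) (𝓝 z) := by
      have := (continuous_trans_smul (e j) z).tendsto 0
      rw [zero_smul, trans_zero] at this
      exact this.mono_left nhdsWithin_le_nhds
    simpa using (h1.sub_const z).norm
  have h1 : Tendsto (fun δ => ⟪quadOp hΦ (horAvg δ z), horAvg δ z⟫_ℝ) (𝓝[>] 0)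
      (𝓝 ⟪quadOp hΦ z, z⟫_ℝ) :=
    (((quadOp hΦ).continuous.tendsto z).comp (tendsto_horAvg z)).inner (tendsto_horAvg z)
  refine tendsto_nhds_unique h1 ?_
  -- The factor `2 δ` gained from the commutator cancels the `δ⁻¹` of the curl; the increments still
  -- tend to zero.
  have h2 : Tendsto (fun δ : ℝ => 2 * C * (‖matL (Ω := Ω) (unitMat 0 1)‖ *
      ‖Ω.trans (δ • e 0) z - z‖ + ‖matL (Ω := Ω) (unitMat 0 0)‖ *
      ‖Ω.trans (δ • e 1) z - z‖)) (𝓝[>] 0) (𝓝 0) := by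
    have := (((hlim 0).const_mul ‖matL (Ω := Ω) (unitMat 0 1)‖).add
      ((hlim 1).const_mul ‖matL (Ω := Ω) (unitMat 0 0)‖)).const_mul (2 * C)
    simpa using this
  refine squeeze_zero_norm' ?_ h2
  filter_upwards [self_mem_nhdsWithin] with δ hδ
  have hδ : 0 < δ := hδ
  rw [inner_quadOp_planar hΦ (horAvg_mem_H hz δ) (isWeakPartial_horAvg δ hz2)
    (by rw [matL_horAvg, hz3, horAvg, map_zero, map_zero]) rfl]
  refine (norm_inner_le_norm _ _).trans
    ((mul_le_mul (hMe δ hδ) (hDe δ hδ) (norm_nonneg _) (by positivity)).trans_eq ?_)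
  field_simp

/-- The quadratic form vanishes on the planar fields which are irrotational near the support
of `Φ`. -/
lemma inner_quadOp_eq_zero_of_irrotational {Φ : E3 → E3} (hΦ : Ω.SmoothCpt Φ) {z : Ω.L2}
    (hz : z ∈ Ω.H) (hz2 : ∀ s : ℝ, Ω.trans (s • e 2) z = z) (hz3 : matL (unitMat 2 2) z = 0)
    {δ : ℝ} (hδ : 0 < δ) (hirr : ∀ (φ : E3 → ℝ) (hφ : Ω.SmoothCpt φ), tsupport φ ⊆ tsupport Φ →
      ∀ h : E3, ‖h‖ ≤ δ → ⟪Ω.trans h z, (hφ.curlTest 1 0).toL2⟫_ℝ = 0) :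
    ⟪quadOp hΦ z, z⟫_ℝ = 0 := by
  have h1 : Tendsto (fun δ => ⟪quadOp hΦ (horAvg δ z), horAvg δ z⟫_ℝ) (𝓝[>] 0)
      (𝓝 ⟪quadOp hΦ z, z⟫_ℝ) :=
    (((quadOp hΦ).continuous.tendsto z).comp (tendsto_horAvg z)).inner (tendsto_horAvg z)
  refine tendsto_nhds_unique h1 (tendsto_const_nhds.congr' ?_)
  filter_upwards [Ioo_mem_nhdsGT (show (0 : ℝ) < δ / 2 by positivity)] with r hr
  symm
  have hw := isWeakPartial_horAvg r hz2
  rw [inner_quadOp_planar hΦ (horAvg_mem_H hz r) hw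
    (by rw [matL_horAvg, hz3, horAvg, map_zero, map_zero]) rfl]
  have h2 : ∀ (φ : E3 → ℝ) (hφ : Ω.SmoothCpt φ), tsupport φ ⊆ tsupport Φ →
      ⟪horAvg r z, (hφ.curlTest 1 0).toL2⟫_ℝ = 0 := by
    intro φ hφ hs
    -- The rank one operator with vector `ξ` kills all the small translates of `z`, hence the
    -- average of `z`, by the ball estimate with radius `0`.
    set ξ := (hφ.curlTest 1 0).toL2
    have := norm_clm_horAvg_sub_le ((innerSL ℝ ξ).smulRight ξ) 0 hr.1 (C := 0) z
      fun s hs' t ht => by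
        have h3 := hirr φ hφ hs (s • e 0 + t • e 1) (by linarith [norm_smul_e_add_le hs' ht, hr.2])
        rw [real_inner_comm] at h3
        simp [ContinuousLinearMap.smulRight_apply, ξ, h3]
    rw [sub_zero, norm_le_zero_iff, ContinuousLinearMap.smulRight_apply, smul_eq_zero,
      innerSL_apply_apply, real_inner_comm] at this
    rcases this with h | h
    · exact h
    · rw [h, inner_zero_right]
  have hl : LocallyIntegrable (fun x => horAvgPd r z 0 x 1 - horAvgPd r z 1 x 0) Ω.μ :=
    (locallyIntegrable_coord 1 _).sub (locallyIntegrable_coord 0 _)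
  -- Testing the curl with `φ Φ_k`, supported in the support of `Φ`, shows that it vanishes wherever
  -- `Φ` does not.
  have h3 : ∀ k, ∀ᵐ x ∂Ω.μ, Φ x k * (horAvgPd r z 0 x 1 - horAvgPd r z 1 x 0) = 0 := by
    intro k
    refine ae_eq_zero_of_integral_smul (hl.continuous_smul (hΦ.coord k).continuous) fun φ hφ => ?_
    have hφk := hφ.mul_left (hΦ.coord k).smooth (hΦ.coord k).periodic
    have h4 := h2 _ hφk (closure_mono fun x hx hΦx => hx (by simp [hΦx]))
    rw [inner_curlTest hφk, (hw 0).integral_mul hφk, (hw 1).integral_mul hφk, sub_neg_eq_add,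
      neg_add_eq_zero] at h4
    have h5 := integral_sub (integrable_mul_coord hφk (horAvgPd r z 0) 1)
      (integrable_mul_coord hφk (horAvgPd r z 1) 0)
    rw [h4, sub_self] at h5
    rw [← h5]
    refine integral_congr_ae (ae_of_all _ fun x => ?_)
    simp only [smul_eq_mul]
    ring
  rw [L2.inner_def]
  refine integral_eq_zero_of_ae ?_
  filter_upwards [h3 0, h3 1, coeFn_wedgeOp hΦ (horAvg r z), coeFn_curlOp (horAvgPd r z)]
    with x h0 h1 h4 h5
  rw [h4, h5, real_inner_smul_left, real_inner_smul_right, inner_e]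
  simp only [e, PiLp.single_apply, if_true, mul_one, Pi.zero_apply]
  linear_combination (horAvg r z x 1) * h0 - (horAvg r z x 0) * h1

end Domain

/-! ### Rellich's theorem by projection on grids. -/

namespace Domain

variable {Ω : Domain}

lemma volume_box_eq (s : Fin 3 → Set ℝ) (hs : ∀ i, MeasurableSet (s i)) :
    volume {x : E3 | ∀ i, x i ∈ s i} = ∏ i, volume (s i) := by
  have h1 : {x : E3 | ∀ i, x i ∈ s i} = WithLp.ofLp ⁻¹' (Set.pi univ s) := by
    ext x; simp
  rw [h1, (PiLp.volume_preserving_ofLp (Fin 3)).measure_preimage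
    (MeasurableSet.univ_pi hs).nullMeasurableSet, volume_pi_pi]

/-- The grid of mesh `δ`: the cell of index `q`. -/
def gridCell (δ : Fin 3 → ℝ) (q : Fin 3 → ℤ) : Set E3 :=
  {x | ∀ i, x i ∈ Ico (q i * δ i) ((q i + 1) * δ i)}

lemma measurableSet_gridCell (δ : Fin 3 → ℝ) (q : Fin 3 → ℤ) : MeasurableSet (gridCell δ q) := by
  have : gridCell δ q = ⋂ i, (fun x : E3 => x i) ⁻¹' (Ico (q i * δ i) ((q i + 1) * δ i)) := by
    ext x; simp [gridCell]
  rw [this]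
  exact MeasurableSet.iInter fun i => measurableSet_Ico.preimage (by fun_prop)

lemma volume_gridCell (δ : Fin 3 → ℝ) (q : Fin 3 → ℤ) :
    volume (gridCell δ q) = ∏ i, ENNReal.ofReal (δ i) := by
  rw [gridCell, volume_box_eq _ fun i => measurableSet_Ico]
  refine Finset.prod_congr rfl fun i _ => ?_
  rw [Real.volume_Ico]
  congr 1
  ring

/-- The index of the grid cell of a point. -/
def gridIdx (δ : Fin 3 → ℝ) (x : E3) (i : Fin 3) : ℤ := ⌊x i / δ i⌋

lemma mem_gridCell_iff {δ : Fin 3 → ℝ} (hδ : ∀ i, 0 < δ i) {q : Fin 3 → ℤ} {x : E3} :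
    x ∈ gridCell δ q ↔ gridIdx δ x = q := by
  rw [funext_iff]
  refine forall_congr' fun i => ?_
  rw [gridIdx, Int.floor_eq_iff, mem_Ico, le_div_iff₀ (hδ i), div_lt_iff₀ (hδ i)]

/-- A mesh compatible with the periods. -/
def mesh (Ω : Domain) (N : ℕ) (i : Fin 3) : ℝ := (if Ω.len i = 0 then 1 else Ω.len i) / N

lemma mesh_pos {N : ℕ} (hN : 0 < N) (i : Fin 3) : 0 < Ω.mesh N i := by
  have : 0 < (N : ℝ) := by exact_mod_cast hN
  rw [mesh]
  split_ifs with h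
  · positivity
  · exact div_pos (Ω.len_pos h) this

/-- The mesh divides the periods, so no cell of the grid crosses the boundary of the fundamental
cell. -/
lemma gridCell_subset_cell {N : ℕ} (hN : 0 < N) {x : E3} (hx : x ∈ Ω.cell) :
    gridCell (Ω.mesh N) (gridIdx (Ω.mesh N) x) ⊆ Ω.cell := by
  intro y hy i hi
  have hN' : 0 < (N : ℝ) := by exact_mod_cast hN
  have hm := mesh_pos (Ω := Ω) hN i
  have hmi : Ω.mesh N i = Ω.len i / N := by rw [mesh, if_neg hi]
  have h1 := hx i hi
  have h2 := hy i
  have h3 : (0 : ℤ) ≤ gridIdx (Ω.mesh N) x i := Int.floor_nonneg.2 (div_nonneg h1.1 hm.le)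
  have h4 : gridIdx (Ω.mesh N) x i + 1 ≤ (N : ℤ) := by
    rw [Int.add_one_le_iff, gridIdx, Int.floor_lt]
    rw [div_lt_iff₀ hm, hmi]
    push_cast
    rw [mul_div_cancel₀ _ hN'.ne']
    exact h1.2
  have h3' : (0 : ℝ) ≤ gridIdx (Ω.mesh N) x i := by exact_mod_cast h3
  have h4' : (gridIdx (Ω.mesh N) x i + 1 : ℝ) ≤ N := by exact_mod_cast h4
  refine ⟨(mul_nonneg h3' hm.le).trans h2.1, h2.2.trans_le ?_⟩
  calc _ ≤ (N : ℝ) * Ω.mesh N i := mul_le_mul_of_nonneg_right h4' hm.le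
    _ = Ω.len i := by rw [hmi, mul_div_cancel₀ _ hN'.ne']

lemma μ_gridCell {N : ℕ} (hN : 0 < N) {x : E3} (hx : x ∈ Ω.cell) :
    Ω.μ (gridCell (Ω.mesh N) (gridIdx (Ω.mesh N) x)) = ∏ i, ENNReal.ofReal (Ω.mesh N i) := by
  rw [μ, Measure.restrict_apply (measurableSet_gridCell _ _),
    inter_eq_left.2 (gridCell_subset_cell hN hx), volume_gridCell]

lemma μ_gridCell_lt_top (δ : Fin 3 → ℝ) (q : Fin 3 → ℤ) : Ω.μ (gridCell δ q) < ⊤ := by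
  refine (Measure.restrict_apply_le _ _).trans_lt ?_
  rw [volume_gridCell]
  exact ENNReal.prod_lt_top fun i _ => ENNReal.ofReal_lt_top

/-- The square mean oscillation of a field on the grid cells. -/
lemma norm_sub_average_sq_le {s : Set E3} (h0 : Ω.μ s ≠ 0) (htop : Ω.μ s ≠ ⊤)
    (u : Ω.L2) (v : E3) : ‖v - ⨍ y in s, u y ∂Ω.μ‖ₑ ^ 2
      ≤ (Ω.μ s)⁻¹ * ∫⁻ y in s, ‖v - u y‖ₑ ^ 2 ∂Ω.μ := by
  have hfin : IsFiniteMeasure (Ω.μ.restrict s) := ⟨by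
    rw [Measure.restrict_apply_univ]; exact htop.lt_top⟩
  have hne : NeZero (Ω.μ.restrict s) := ⟨by simpa using h0⟩
  have hint : IntegrableOn u s Ω.μ :=
    ((Lp.memLp u).restrict s).integrable (by norm_num)
  have h1 : v - ⨍ y in s, u y ∂Ω.μ = ⨍ y in s, (v - u y) ∂Ω.μ := by
    simp only [average_eq]
    rw [integral_sub (integrable_const v) hint, integral_const, smul_sub, smul_smul,
      inv_mul_cancel₀, one_smul]
    rw [Measure.real, ENNReal.toReal_ne_zero, Measure.restrict_apply_univ]
    exact ⟨h0, htop⟩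
  have hp : ENNReal.HolderConjugate 2 2 := inferInstance
  have h2 : ‖⨍ y in s, (v - u y) ∂Ω.μ‖ₑ ≤ (Ω.μ s)⁻¹ * ∫⁻ y in s, ‖v - u y‖ₑ ∂Ω.μ := by
    rw [average_eq, enorm_smul, measureReal_restrict_apply_univ, Measure.real,
      Real.enorm_eq_ofReal (by positivity), ENNReal.ofReal_inv_of_pos (ENNReal.toReal_pos h0 htop),
      ENNReal.ofReal_toReal htop]
    gcongr
    exact enorm_integral_le_lintegral_enorm _
  have hm : AEMeasurable (fun y => ‖v - u y‖ₑ) (Ω.μ.restrict s) :=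
    ((Lp.stronglyMeasurable u).measurable.const_sub v).enorm.aemeasurable
  have h3 : ∫⁻ y in s, ‖v - u y‖ₑ ∂Ω.μ
      ≤ (∫⁻ y in s, ‖v - u y‖ₑ ^ 2 ∂Ω.μ) ^ (1 / 2 : ℝ) * (Ω.μ s) ^ (1 / 2 : ℝ) := by
    have := ENNReal.lintegral_mul_le_Lp_mul_Lq (Ω.μ.restrict s) Real.HolderConjugate.two_two hm
      (aemeasurable_const (b := (1 : ENNReal)))
    simpa using this
  rw [h1]
  calc _ ≤ ((Ω.μ s)⁻¹ * ((∫⁻ y in s, ‖v - u y‖ₑ ^ 2 ∂Ω.μ) ^ (1 / 2 : ℝ)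
        * (Ω.μ s) ^ (1 / 2 : ℝ))) ^ 2 := by
        gcongr
        exact h2.trans (by gcongr)
    _ = (Ω.μ s)⁻¹ * ((Ω.μ s)⁻¹ * Ω.μ s) * ∫⁻ y in s, ‖v - u y‖ₑ ^ 2 ∂Ω.μ := by
        rw [mul_pow, mul_pow, ← ENNReal.rpow_natCast (_ ^ (1 / 2 : ℝ)), ← ENNReal.rpow_mul,
          ← ENNReal.rpow_natCast (_ ^ (1 / 2 : ℝ)), ← ENNReal.rpow_mul]
        norm_num
        ring
    _ = _ := by rw [ENNReal.inv_mul_cancel h0 htop, mul_one]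

/-- The set of the differences of the points of a grid cell. -/
def gridDiff (δ : Fin 3 → ℝ) : Set E3 := {h | ∀ i, h i ∈ Icc (-δ i) (δ i)}

lemma measurableSet_gridDiff (δ : Fin 3 → ℝ) : MeasurableSet (gridDiff δ) := by
  have : gridDiff δ = ⋂ i, (fun x : E3 => x i) ⁻¹' (Icc (-δ i) (δ i)) := by
    ext x; simp [gridDiff]
  rw [this]
  exact MeasurableSet.iInter fun i => measurableSet_Icc.preimage (by fun_prop)

lemma volume_gridDiff (δ : Fin 3 → ℝ) :
    volume (gridDiff δ) = 8 * ∏ i, ENNReal.ofReal (δ i) := by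
  rw [gridDiff, volume_box_eq _ fun i => measurableSet_Icc]
  have : ∀ i, volume (Icc (-δ i) (δ i)) = 2 * ENNReal.ofReal (δ i) := by
    intro i
    rw [Real.volume_Icc, sub_neg_eq_add, ← two_mul, ENNReal.ofReal_mul (by norm_num)]
    norm_num
  simp only [this, Fin.prod_univ_three]
  ring

/-- Two points of one grid cell differ by an element of `gridDiff`, so the oscillation on the cell
is bounded by increments under translation. -/
lemma lintegral_gridCell_le {N : ℕ} (hN : 0 < N) (u : Ω.L2) {x : E3} (hx : x ∈ Ω.cell) :
    ∫⁻ y in gridCell (Ω.mesh N) (gridIdx (Ω.mesh N) x), ‖u x - u y‖ₑ ^ 2 ∂Ω.μ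
      ≤ ∫⁻ h in gridDiff (Ω.mesh N), ‖u x - u (Ω.shift h x)‖ₑ ^ 2 := by
  set Q := gridCell (Ω.mesh N) (gridIdx (Ω.mesh N) x) with hQ
  have hQm : MeasurableSet Q := measurableSet_gridCell _ _
  have hμ : Ω.μ.restrict Q = volume.restrict Q := by
    rw [μ, Measure.restrict_restrict hQm, inter_eq_left.2 (gridCell_subset_cell hN hx)]
  rw [hμ, ← lintegral_indicator hQm, ← lintegral_indicator (measurableSet_gridDiff _),
    ← lintegral_add_left_eq_self _ x]
  refine lintegral_mono fun h => ?_
  by_cases hh : x + h ∈ Q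
  · have hxQ : x ∈ Q := (mem_gridCell_iff (mesh_pos hN)).2 rfl
    have hd : h ∈ gridDiff (Ω.mesh N) := by
      intro i
      have h1 := hh i
      have h2 := hxQ i
      rw [PiLp.add_apply] at h1
      constructor <;> nlinarith [h1.1, h1.2, h2.1, h2.2]
    rw [indicator_of_mem hh, indicator_of_mem hd, shift,
      Ω.wrap_of_mem (gridCell_subset_cell hN hx hh)]
  · rw [indicator_of_notMem hh]
    exact zero_le

/-- The projection on the fields which are constant on the cells of a grid. -/
def gridProj (Ω : Domain) (N M : ℕ) : Ω.L2 →L[ℝ] Ω.L2 :=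
  ∑ q ∈ Fintype.piFinset fun _ : Fin 3 => Finset.Icc (-(M : ℤ)) M, ∑ i,
    (innerSL ℝ (indicatorConstLp 2 (measurableSet_gridCell (Ω.mesh N) q)
        (μ_gridCell_lt_top (Ω.mesh N) q).ne (e i))).smulRight
      ((Ω.μ.real (gridCell (Ω.mesh N) q))⁻¹ • indicatorConstLp 2
        (measurableSet_gridCell (Ω.mesh N) q) (μ_gridCell_lt_top (Ω.mesh N) q).ne (e i))

lemma gridProj_apply (N M : ℕ) (hN : 0 < N) (u : Ω.L2) : ∀ᵐ x ∂Ω.μ,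
    (∀ i, gridIdx (Ω.mesh N) x i ∈ Finset.Icc (-(M : ℤ)) M) →
    Ω.gridProj N M u x = ⨍ y in gridCell (Ω.mesh N) (gridIdx (Ω.mesh N) x), u y ∂Ω.μ := by
  have h1 : ∀ᵐ x ∂Ω.μ, Ω.gridProj N M u x =
      ∑ q ∈ Fintype.piFinset fun _ : Fin 3 => Finset.Icc (-(M : ℤ)) M, ∑ i,
        ⟪indicatorConstLp 2 (measurableSet_gridCell (Ω.mesh N) q)
          (μ_gridCell_lt_top (Ω.mesh N) q).ne (e i), u⟫_ℝ •
        (Ω.μ.real (gridCell (Ω.mesh N) q))⁻¹ • (gridCell (Ω.mesh N) q).indicator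
          (fun _ => e i) x := by
    have h2 : ∀ᵐ x ∂Ω.μ, ∀ (q : Fin 3 → ℤ) (i : Fin 3), (⟪indicatorConstLp 2
        (measurableSet_gridCell (Ω.mesh N) q) (μ_gridCell_lt_top (Ω.mesh N) q).ne (e i), u⟫_ℝ •
        (Ω.μ.real (gridCell (Ω.mesh N) q))⁻¹ • indicatorConstLp 2
        (measurableSet_gridCell (Ω.mesh N) q) (μ_gridCell_lt_top (Ω.mesh N) q).ne (e i) : Ω.L2) x
        = ⟪indicatorConstLp 2 (measurableSet_gridCell (Ω.mesh N) q)
          (μ_gridCell_lt_top (Ω.mesh N) q).ne (e i), u⟫_ℝ •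
          (Ω.μ.real (gridCell (Ω.mesh N) q))⁻¹ • (gridCell (Ω.mesh N) q).indicator
          (fun _ => e i) x := by
      rw [ae_all_iff]
      intro q
      rw [ae_all_iff]
      intro i
      rw [smul_smul]
      filter_upwards [Lp.coeFn_smul (⟪indicatorConstLp 2
        (measurableSet_gridCell (Ω.mesh N) q) (μ_gridCell_lt_top (Ω.mesh N) q).ne (e i), u⟫_ℝ *
        (Ω.μ.real (gridCell (Ω.mesh N) q))⁻¹) (indicatorConstLp 2
        (measurableSet_gridCell (Ω.mesh N) q) (μ_gridCell_lt_top (Ω.mesh N) q).ne (e i)),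
        indicatorConstLp_coeFn (p := 2) (hs := measurableSet_gridCell (Ω.mesh N) q)
          (hμs := (μ_gridCell_lt_top (Ω := Ω) (Ω.mesh N) q).ne) (c := e i)] with x h3 h4
      rw [h3, Pi.smul_apply, h4, smul_smul]
    simp only [gridProj, _root_.sum_apply, ContinuousLinearMap.smulRight_apply,
      innerSL_apply_apply]
    filter_upwards [h2, Lp.coeFn_finsetSum (Fintype.piFinset fun _ : Fin 3 =>
      Finset.Icc (-(M : ℤ)) M) (fun q => ∑ i, ⟪indicatorConstLp 2
        (measurableSet_gridCell (Ω.mesh N) q) (μ_gridCell_lt_top (Ω.mesh N) q).ne (e i), u⟫_ℝ •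
        (Ω.μ.real (gridCell (Ω.mesh N) q))⁻¹ • (indicatorConstLp 2
        (measurableSet_gridCell (Ω.mesh N) q) (μ_gridCell_lt_top (Ω.mesh N) q).ne (e i) : Ω.L2)),
      ae_all_iff.2 fun q => Lp.coeFn_finsetSum Finset.univ fun i => ⟪indicatorConstLp 2
        (measurableSet_gridCell (Ω.mesh N) q) (μ_gridCell_lt_top (Ω.mesh N) q).ne (e i), u⟫_ℝ •
        (Ω.μ.real (gridCell (Ω.mesh N) q))⁻¹ • (indicatorConstLp 2
        (measurableSet_gridCell (Ω.mesh N) q) (μ_gridCell_lt_top (Ω.mesh N) q).ne (e i) : Ω.L2)]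
      with x h3 h4 h5
    rw [h4, Finset.sum_apply]
    refine Finset.sum_congr rfl fun q _ => ?_
    rw [h5, Finset.sum_apply]
    exact Finset.sum_congr rfl fun i _ => h3 q i
  filter_upwards [h1] with x h1 hx
  rw [h1, Finset.sum_eq_single (gridIdx (Ω.mesh N) x)]
  · have hxQ : x ∈ gridCell (Ω.mesh N) (gridIdx (Ω.mesh N) x) :=
      (mem_gridCell_iff (mesh_pos hN)).2 rfl
    simp only [indicator_of_mem hxQ, smul_smul]
    rw [setAverage_eq, ← (EuclideanSpace.basisFun (Fin 3) ℝ).sum_repr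
      (∫ y in gridCell (Ω.mesh N) (gridIdx (Ω.mesh N) x), u y ∂Ω.μ), Finset.smul_sum]
    refine Finset.sum_congr rfl fun i _ => ?_
    rw [L2.inner_indicatorConstLp_eq_inner_setIntegral, smul_smul, mul_comm, inner_e]
    simp [e]
  · intro q _ hq
    have : x ∉ gridCell (Ω.mesh N) q := fun h => hq ((mem_gridCell_iff (mesh_pos hN)).1 h).symm
    simp [indicator_of_notMem this]
  · intro h
    exact absurd (Fintype.mem_piFinset.2 hx) h

lemma enorm_sq_eq_lintegral (u : Ω.L2) : ‖u‖ₑ ^ 2 = ∫⁻ x, ‖u x‖ₑ ^ 2 ∂Ω.μ := by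
  rw [Lp.enorm_def, eLpNorm_eq_lintegral_rpow_enorm_toReal (by norm_num) (by norm_num),
    ← ENNReal.rpow_natCast, ← ENNReal.rpow_mul]
  norm_num

lemma lintegral_sub_shift (h : E3) (u : Ω.L2) :
    ∫⁻ x, ‖u x - u (Ω.shift h x)‖ₑ ^ 2 ∂Ω.μ = ‖u - Ω.trans h u‖ₑ ^ 2 := by
  rw [enorm_sq_eq_lintegral]
  refine lintegral_congr_ae ?_
  filter_upwards [Lp.coeFn_sub u (Ω.trans h u), coeFn_trans h u] with x h1 h2
  rw [h1, Pi.sub_apply, h2]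

/-- Jensen's inequality on each grid cell and Fubini's theorem reduce the error to the mean of `‖u -
trans h u‖²` over `gridDiff`. The factor `8` is the ratio of the volumes of `gridDiff` and of a grid
cell. -/
lemma lintegral_sub_gridProj_le {N M : ℕ} (hN : 0 < N) {r : ℝ}
    (hM : ∀ x ∈ box r, ∀ i, gridIdx (Ω.mesh N) x i ∈ Finset.Icc (-(M : ℤ)) M) (u : Ω.L2) {C : ENNReal}
    (hC : ∀ h ∈ gridDiff (Ω.mesh N), ‖u - Ω.trans h u‖ₑ ≤ C) :
    ∫⁻ x in box r, ‖u x - Ω.gridProj N M u x‖ₑ ^ 2 ∂Ω.μ ≤ 8 * C ^ 2 := by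
  set m : ENNReal := ∏ i, ENNReal.ofReal (Ω.mesh N i) with hm
  have hm0 : m ≠ 0 := Finset.prod_ne_zero_iff.2 fun i _ => by
    simpa using mesh_pos hN i
  have hmt : m ≠ ⊤ := (ENNReal.prod_lt_top fun i _ => ENNReal.ofReal_lt_top).ne
  have hu : Measurable u := (Lp.stronglyMeasurable u).measurable
  have hsh : Measurable fun p : E3 × E3 => Ω.shift p.2 p.1 :=
    Ω.measurable_wrap.comp (measurable_fst.add measurable_snd)
  have hF : Measurable fun p : E3 × E3 => ‖u p.1 - u (Ω.shift p.2 p.1)‖ₑ ^ 2 :=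
    ((hu.comp measurable_fst).sub (hu.comp hsh)).enorm.pow_const 2
  calc ∫⁻ x in box r, ‖u x - Ω.gridProj N M u x‖ₑ ^ 2 ∂Ω.μ
      ≤ ∫⁻ x in box r,
          (m⁻¹ * ∫⁻ h in gridDiff (Ω.mesh N), ‖u x - u (Ω.shift h x)‖ₑ ^ 2) ∂Ω.μ := by
        refine lintegral_mono_ae ?_
        filter_upwards [ae_restrict_mem (isCompact_box r).measurableSet,
          ae_restrict_of_ae (gridProj_apply N M hN u), ae_restrict_of_ae Ω.ae_mem_cell]
          with x hx hp hxc
        have hμQ := μ_gridCell hN hxc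
        rw [hp (hM x hx)]
        refine (norm_sub_average_sq_le (by rwa [hμQ]) (by rwa [hμQ]) u (u x)).trans ?_
        rw [hμQ]
        exact mul_le_mul_right (lintegral_gridCell_le hN u hxc) _
    _ ≤ ∫⁻ x, (m⁻¹ * ∫⁻ h in gridDiff (Ω.mesh N), ‖u x - u (Ω.shift h x)‖ₑ ^ 2) ∂Ω.μ :=
        setLIntegral_le_lintegral _ _
    _ = m⁻¹ * ∫⁻ h in gridDiff (Ω.mesh N), ∫⁻ x, ‖u x - u (Ω.shift h x)‖ₑ ^ 2 ∂Ω.μ := by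
        rw [lintegral_const_mul' _ _ (ENNReal.inv_ne_top.2 hm0),
          lintegral_lintegral_swap hF.aemeasurable]
    _ ≤ m⁻¹ * ∫⁻ _h in gridDiff (Ω.mesh N), C ^ 2 := by
        gcongr m⁻¹ * ?_
        refine setLIntegral_mono' (measurableSet_gridDiff _) fun h hh => ?_
        rw [lintegral_sub_shift]
        gcongr
        exact hC h hh
    _ = (m⁻¹ * m) * (8 * C ^ 2) := by
        rw [setLIntegral_const, volume_gridDiff, ← hm]
        ring
    _ = 8 * C ^ 2 := by rw [ENNReal.inv_mul_cancel hm0 hmt, one_mul]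

/-- The operators of finite rank. -/
def finiteRank (V : Type*) [NormedAddCommGroup V] [InnerProductSpace ℝ V] :
    Submodule ℝ (V →L[ℝ] V) :=
  Submodule.span ℝ {T | ∃ a f : V, T = (innerSL ℝ a).smulRight f}

lemma gridProj_mem_finiteRank (N M : ℕ) : Ω.gridProj N M ∈ finiteRank Ω.L2 :=
  Submodule.sum_mem _ fun _ _ => Submodule.sum_mem _ fun _ _ =>
    Submodule.subset_span ⟨_, _, rfl⟩

lemma comp_mem_finiteRank {V : Type*} [NormedAddCommGroup V] [InnerProductSpace ℝ V]
    [CompleteSpace V] {F : V →L[ℝ] V} (hF : F ∈ finiteRank V) (S T : V →L[ℝ] V) :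
    S ∘L F ∘L T ∈ finiteRank V := by
  induction hF using Submodule.span_induction with
  | mem F hF =>
    obtain ⟨a, f, rfl⟩ := hF
    refine Submodule.subset_span ⟨T.adjoint a, S f, ?_⟩
    ext x
    simp [ContinuousLinearMap.adjoint_inner_left]
  | zero => simp
  | add F G _ _ hF hG =>
    rw [ContinuousLinearMap.add_comp, ContinuousLinearMap.comp_add]
    exact Submodule.add_mem _ hF hG
  | smul c F _ hF =>
    rw [ContinuousLinearMap.smul_comp, ContinuousLinearMap.comp_smul]
    exact Submodule.smul_mem _ c hF

/-- The operators which are compact on the fields with square integrable derivatives. -/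
def IsRellich (K : Ω.L2 →L[ℝ] Ω.L2) : Prop :=
  ∀ η > 0, ∃ F ∈ finiteRank Ω.L2, ∀ (u : Ω.L2) (g : Fin 3 → Ω.L2),
    (∀ j, Ω.IsWeakPartial j u (g j)) → ‖K u - F u‖ ≤ η * ∑ j, ‖g j‖

namespace IsRellich

lemma add {K K' : Ω.L2 →L[ℝ] Ω.L2} (hK : IsRellich K) (hK' : IsRellich K') : IsRellich (K + K') := by
  intro η hη
  obtain ⟨F, hF, h⟩ := hK (η / 2) (by positivity)
  obtain ⟨F', hF', h'⟩ := hK' (η / 2) (by positivity)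
  refine ⟨F + F', Submodule.add_mem _ hF hF', fun u g hg => ?_⟩
  have h1 := h u g hg
  have h2 := h' u g hg
  calc ‖(K + K') u - (F + F') u‖ = ‖(K u - F u) + (K' u - F' u)‖ := by
        simp only [add_apply]; congr 1; abel
    _ ≤ ‖K u - F u‖ + ‖K' u - F' u‖ := norm_add_le _ _
    _ ≤ _ := by linarith

lemma zero : IsRellich (0 : Ω.L2 →L[ℝ] Ω.L2) := fun η hη => ⟨0, Submodule.zero_mem _, fun u g _ => by
  simp only [zero_apply, sub_self, norm_zero]
  positivity⟩

lemma sum {ι : Type*} (s : Finset ι) {K : ι → Ω.L2 →L[ℝ] Ω.L2} (h : ∀ i ∈ s, IsRellich (K i)) :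
    IsRellich (∑ i ∈ s, K i) :=
  Finset.sum_induction _ _ (fun _ _ => add) zero h

/-- Only the inner operator has to commute with translations, since it must carry derivatives to
derivatives. The outer one is arbitrary, and can therefore involve `Π`. -/
lemma comp {K : Ω.L2 →L[ℝ] Ω.L2} (hK : IsRellich K) (S X : Ω.L2 →L[ℝ] Ω.L2)
    (hX : ∀ (h : E3) (u : Ω.L2), X (Ω.trans h u) = Ω.trans h (X u)) : IsRellich (S ∘L K ∘L X) := by
  intro η hη
  obtain ⟨F, hF, h⟩ := hK (η / ((‖S‖ + 1) * (‖X‖ + 1))) (by positivity)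
  refine ⟨S ∘L F ∘L X, comp_mem_finiteRank hF S X, fun u g hg => ?_⟩
  have h1 := h (X u) (fun j => X (g j)) fun j => (hg j).clm X hX
  have h2 : ∑ j, ‖X (g j)‖ ≤ (‖X‖ + 1) * ∑ j, ‖g j‖ := by
    rw [Finset.mul_sum]
    refine Finset.sum_le_sum fun j _ => (X.le_opNorm _).trans ?_
    gcongr
    linarith
  calc ‖(S ∘L K ∘L X) u - (S ∘L F ∘L X) u‖ = ‖S (K (X u) - F (X u))‖ := by
        rw [map_sub]; rfl
    _ ≤ (‖S‖ + 1) * ‖K (X u) - F (X u)‖ := (S.le_opNorm _).trans (by gcongr; linarith)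
    _ ≤ (‖S‖ + 1) * (η / ((‖S‖ + 1) * (‖X‖ + 1)) * ((‖X‖ + 1) * ∑ j, ‖g j‖)) := by
        gcongr
        exact h1.trans (by gcongr)
    _ = _ := by field_simp

end IsRellich

/-- Rellich's theorem. -/
lemma isRellich_mulC {c : E3 → ℝ} (hc : Ω.SmoothCpt c) (E : E3 →L[ℝ] E3) :
    IsRellich (mulC hc E) := by
  intro η hη
  obtain ⟨r, hr, hbox⟩ := hc.exists_box
  obtain ⟨K, hK, hb⟩ := hc.exists_bound
  set L : ℝ := 1 + ∑ i, Ω.len i with hL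
  have hLpos : 0 < L := by
    have := Finset.sum_nonneg fun i (_ : i ∈ Finset.univ) => Ω.len_nonneg i
    linarith
  -- The final error is `3 K ‖E‖ (L / N) ∑ ‖g j‖`, and this choice of `N` puts it below `η ∑ ‖g j‖`.
  obtain ⟨N, hN⟩ := exists_nat_gt (3 * K * ‖E‖ * L / η)
  have hN0' : (0 : ℝ) < N := lt_of_le_of_lt (by positivity) hN
  have hN0 : 0 < N := by exact_mod_cast hN0'
  have hmesh : ∀ i, Ω.mesh N i ≤ L / N := by
    intro i
    rw [mesh]
    gcongr
    split_ifs
    · have := Finset.sum_nonneg fun i (_ : i ∈ Finset.univ) => Ω.len_nonneg i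
      linarith
    · have := Finset.single_le_sum (fun i _ => Ω.len_nonneg i) (Finset.mem_univ i)
      linarith
  -- Finitely many grid cells, with indices at most `M` in absolute value, cover the box that
  -- carries `c`.
  obtain ⟨M, hM⟩ := exists_nat_gt (∑ i, r / Ω.mesh N i)
  have hMbox : ∀ x ∈ box r, ∀ i, gridIdx (Ω.mesh N) x i ∈ Finset.Icc (-(M : ℤ)) M := by
    intro x hx i
    have h1 := abs_le.1 (hx i)
    have hmp := mesh_pos (Ω := Ω) hN0 i
    have h2 : r / Ω.mesh N i ≤ M := by
      refine le_trans ?_ hM.le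
      exact Finset.single_le_sum (f := fun i => r / Ω.mesh N i)
        (fun i _ => div_nonneg hr (mesh_pos hN0 i).le) (Finset.mem_univ i)
    rw [div_le_iff₀ hmp] at h2
    rw [Finset.mem_Icc, gridIdx, Int.le_floor, le_div_iff₀ hmp]
    refine ⟨by push_cast; linarith, Int.floor_le_iff.2 ?_⟩
    rw [div_lt_iff₀ hmp]
    push_cast
    nlinarith
  refine ⟨mulC hc E ∘L Ω.gridProj N M ∘L ContinuousLinearMap.id ℝ _,
    comp_mem_finiteRank (gridProj_mem_finiteRank N M) _ _, fun u g hg => ?_⟩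
  set D : ℝ := L / N * ∑ j, ‖g j‖ with hD
  have hD0 : 0 ≤ D := by positivity
  have hdiff : ∀ h ∈ gridDiff (Ω.mesh N), ‖u - Ω.trans h u‖ₑ ≤ ENNReal.ofReal D := by
    intro h hh
    rw [← ofReal_norm, norm_sub_rev]
    refine ENNReal.ofReal_le_ofReal ((norm_trans_sub_le hg h).trans ?_)
    rw [hD, Finset.mul_sum]
    refine Finset.sum_le_sum fun j _ => ?_
    gcongr
    exact (abs_le.2 (hh j)).trans (hmesh j)
  have h1 := lintegral_sub_gridProj_le hN0 hMbox u hdiff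
  set v := u - Ω.gridProj N M u with hv
  have hKE : 0 ≤ K * ‖E‖ := by positivity
  have h2 : ‖mulC hc E v‖ₑ ^ 2 ≤ ENNReal.ofReal (K * ‖E‖) ^ 2 * (8 * ENNReal.ofReal D ^ 2) := by
    refine le_trans ?_ (mul_le_mul_right h1 _)
    rw [enorm_sq_eq_lintegral, ← lintegral_const_mul' _ _ (by finiteness),
      ← lintegral_indicator (isCompact_box r).measurableSet]
    refine lintegral_mono_ae ?_
    filter_upwards [coeFn_mulC hc E v, Lp.coeFn_sub u (Ω.gridProj N M u), Ω.ae_mem_cell]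
      with x h3 h4 h5
    rw [h3]
    by_cases hx : x ∈ box r
    · rw [indicator_of_mem hx, ← Pi.sub_apply (u : E3 → E3), ← h4, ← mul_pow]
      gcongr
      rw [← ofReal_norm, ← ofReal_norm, ← ENNReal.ofReal_mul hKE, norm_smul, mul_assoc]
      exact ENNReal.ofReal_le_ofReal (mul_le_mul (hb x) (E.le_opNorm _) (norm_nonneg _) hK)
    · rw [hbox x h5 hx, zero_smul, enorm_zero]
      simp
  have h3 : ‖mulC hc E v‖ ^ 2 ≤ (3 * K * ‖E‖ * D) ^ 2 := by
    rw [← ofReal_norm, ← ENNReal.ofReal_pow (norm_nonneg _), ← ENNReal.ofReal_pow hKE,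
      ← ENNReal.ofReal_pow hD0, show (8 : ENNReal) = ENNReal.ofReal 8 by norm_num,
      ← ENNReal.ofReal_mul (by norm_num), ← ENNReal.ofReal_mul (by positivity),
      ENNReal.ofReal_le_ofReal_iff (by positivity)] at h2
    -- The constant `3` comes from `8 ≤ 3 ^ 2`.
    nlinarith [sq_nonneg (K * ‖E‖ * D)]
  have h4 := abs_le_of_sq_le_sq' h3 (by positivity) |>.2
  have h5 : (mulC hc E) u - (mulC hc E ∘L Ω.gridProj N M ∘L ContinuousLinearMap.id ℝ _) u
      = mulC hc E v := by
    rw [hv, map_sub]; rfl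
  rw [h5]
  refine h4.trans ?_
  rw [hD, ← mul_assoc]
  gcongr
  rw [div_lt_iff₀ hη] at hN
  rw [← mul_div_assoc, div_le_iff₀ hN0']
  linarith

lemma isRellich_quadOp {Φ : E3 → E3} (hΦ : Ω.SmoothCpt Φ) : IsRellich (quadOp hΦ) :=
  IsRellich.sum _ fun _ _ => IsRellich.sum _ fun _ _ => isRellich_mulC _ _

end Domain

/-! ### Invariance and additivity of the quadratic form, and room around supports. -/

namespace Domain

variable {Ω : Domain}

lemma trans_toL2 {ψ : E3 → E3} (hψ : Ω.SmoothCpt ψ) (h : E3) :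
    Ω.trans h hψ.toL2 = (hψ.translate h).toL2 := by
  apply Lp.ext
  have h1 := (Ω.measurePreserving_shift h).quasiMeasurePreserving.ae hψ.coeFn_toL2
  filter_upwards [coeFn_trans h hψ.toL2, h1, (hψ.translate h).coeFn_toL2] with x h2 h3 h4
  rw [h2, h3, h4, Periodic.comp_shift hψ.periodic]

lemma mulC_trans {c : E3 → ℝ} (hc : Ω.SmoothCpt c) (E : E3 →L[ℝ] E3) {h : E3}
    (hh : ∀ x, c (x + h) = c x) (u : Ω.L2) :
    mulC hc E (Ω.trans h u) = Ω.trans h (mulC hc E u) := by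
  apply Lp.ext
  have h1 := (Ω.measurePreserving_shift h).quasiMeasurePreserving.ae (coeFn_mulC hc E u)
  filter_upwards [coeFn_mulC hc E (Ω.trans h u), coeFn_trans h u, coeFn_trans h (mulC hc E u), h1]
    with x h2 h3 h4 h5
  rw [h2, h3, h4, h5, Periodic.comp_shift hc.periodic, hh]

lemma pd_add_of_invariant {Φ : E3 → E3} {h : E3} (hh : ∀ x, Φ (x + h) = Φ x) (i j : Fin 3) (x : E3) :
    pd Φ i j (x + h) = pd Φ i j x := by
  have : Φ = fun x => Φ (x + h) := by ext1 x; rw [hh]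
  conv_rhs => rw [this]
  rw [pd, pd, fderiv_comp_add_right]

lemma quadOp_trans {Φ : E3 → E3} (hΦ : Ω.SmoothCpt Φ) {h : E3} (hh : ∀ x, Φ (x + h) = Φ x)
    (u : Ω.L2) : quadOp hΦ (Ω.trans h u) = Ω.trans h (quadOp hΦ u) := by
  simp only [quadOp, _root_.sum_apply, map_sum]
  refine Finset.sum_congr rfl fun i _ => Finset.sum_congr rfl fun j _ => mulC_trans _ _ (fun x => ?_) u
  simp only [qCoeff, div, pd_add_of_invariant hh]

lemma quadOp_vert {Φ : E3 → E3} (hΦ : Ω.SmoothCpt Φ) (hv : ∀ (x : E3) (s : ℝ), Φ (x + s • e 2) = Φ x)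
    (u : Ω.L2) : quadOp hΦ (vert u) = vert (quadOp hΦ u) :=
  clm_avg (quadOp hΦ) 2 _ (fun s u => quadOp_trans hΦ (fun x => hv x s) u) u

lemma quadOp_add {Φ Ψ Θ : E3 → E3} (hΦ : Ω.SmoothCpt Φ) (hΨ : Ω.SmoothCpt Ψ) (hΘ : Ω.SmoothCpt Θ)
    (h : ∀ x, Θ x = Φ x + Ψ x) : quadOp hΘ = quadOp hΦ + quadOp hΨ := by
  have hpd : ∀ i j x, pd Θ i j x = pd Φ i j x + pd Ψ i j x := by
    intro i j x
    rw [funext h, pd, fderiv_fun_add (hΦ.differentiable x) (hΨ.differentiable x)]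
    rfl
  ext1 u
  refine ext_inner_right ℝ fun v => ?_
  rw [add_apply, inner_add_left, inner_quadOp, inner_quadOp, inner_quadOp, ← Finset.sum_add_distrib]
  refine Finset.sum_congr rfl fun i _ => ?_
  rw [← Finset.sum_add_distrib]
  refine Finset.sum_congr rfl fun j _ => ?_
  rw [← integral_add (integrable_mul3 (hΦ.qCoeff i j) u v j i)
    (integrable_mul3 (hΨ.qCoeff i j) u v j i)]
  refine integral_congr_ae (ae_of_all _ fun x => ?_)
  simp only [qCoeff, div, hpd, Fin.sum_univ_three]
  split_ifs <;> ring

lemma SmoothCpt.tsupport_add_mem {F : Type*} [NormedAddCommGroup F] [NormedSpace ℝ F] {f : E3 → F}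
    (hf : Ω.SmoothCpt f) {v : E3} (hv : v ∈ Ω.lattice) {x : E3} (hx : x ∈ tsupport f) :
    x + v ∈ tsupport f := by
  refine map_mem_closure (f := fun y => y + v) (by fun_prop) hx fun y hy => ?_
  rw [Function.mem_support] at hy ⊢
  rwa [hf.periodic.add_mem hv]

/-- A neighborhood of the support of a test field stays in a periodic open set under small
translations. -/
lemma SmoothCpt.exists_shift_mem {F : Type*} [NormedAddCommGroup F] [NormedSpace ℝ F] {f : E3 → F}
    (hf : Ω.SmoothCpt f) {V : Set E3} (hV : IsOpen V) (h : tsupport f ⊆ V) :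
    ∃ δ > 0, ∀ x ∈ tsupport f, ∃ v ∈ Ω.lattice, ∀ k : E3, ‖k‖ ≤ δ → x + k + v ∈ V := by
  obtain ⟨R, hR⟩ := hf.compact_support
  set r : ℝ := |R| + ∑ i, |Ω.len i| with hr
  -- The support is not compact in `ℝ³` when there are periods. Its part in a box is, and a lattice
  -- vector brings every point of the support into that part.
  have hK : IsCompact (tsupport f ∩ box r) := (isCompact_box r).inter_left (isClosed_tsupport f)
  obtain ⟨δ, hδ, hsub⟩ := hK.exists_thickening_subset_open hV (inter_subset_left.trans h)
  refine ⟨δ / 2, by positivity, fun x hx => ⟨Ω.wrap x - x, Ω.wrap_sub_mem x, fun k hk => hsub ?_⟩⟩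
  have hw : Ω.wrap x ∈ tsupport f := by
    have := hf.tsupport_add_mem (Ω.wrap_sub_mem x) hx
    rwa [add_sub_cancel] at this
  rw [Metric.mem_thickening_iff]
  refine ⟨Ω.wrap x, ⟨hw, fun i => ?_⟩, ?_⟩
  · have hs := Finset.sum_nonneg (fun i (_ : i ∈ Finset.univ) => abs_nonneg (Ω.len i))
    by_cases hi : Ω.len i = 0
    · have := hR _ hw i hi
      linarith [le_abs_self R]
    · have h1 := Ω.wrap_mem_cell x i hi
      have := Finset.single_le_sum (f := fun i => |Ω.len i|)
        (fun i _ => abs_nonneg _) (Finset.mem_univ i)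
      rw [abs_of_nonneg h1.1]
      linarith [le_abs_self (Ω.len i), abs_nonneg R, h1.2]
  · rw [dist_eq_norm]
    have : x + k + (Ω.wrap x - x) - Ω.wrap x = k := by abel
    rw [this]
    linarith

end Domain

/-! ### Reduction of the form of `Π_⊥ u` to a compact one. -/

namespace Rotation

open Domain

variable {Ω : Domain} (B : Rotation Ω)

/-- A smooth field with values in the kernel of `L`. -/
lemma smooth_KerL {Φ : E3 → E3} (hΦ : Ω.SmoothCpt Φ) (h : ∃ g ∈ B.KerL, ⇑g =ᵐ[Ω.μ] Φ) :
    (∀ (x : E3) (s : ℝ), Φ (x + s • e 2) = Φ x) ∧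
    ∀ x, fderiv ℝ B.amp x (e 0) * Φ x 0 + fderiv ℝ B.amp x (e 1) * Φ x 1 = 0 := by
  obtain ⟨g, hg, hgΦ⟩ := h
  constructor
  · intro x s
    have h1 : (fun x => Φ (x + s • e 2)) = Φ := by
      refine Ω.eq_of_ae_eq (hΦ.translate _).periodic hΦ.periodic (hΦ.translate _).continuous
        hΦ.continuous ?_
      have h2 := (Ω.measurePreserving_shift (s • e 2)).quasiMeasurePreserving.ae hgΦ
      have h3 := coeFn_trans (s • e 2) g
      rw [B.KerL_trans_eq hg] at h3
      filter_upwards [h2, h3, hgΦ] with x h2 h3 h4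
      rw [← h4, h3, h2, Periodic.comp_shift hΦ.periodic]
    exact congrFun h1 x
  · have h1 : (fun x => fderiv ℝ B.amp x (e 0) * Φ x 0 + fderiv ℝ B.amp x (e 1) * Φ x 1)
        = fun _ => 0 := by
      refine Ω.eq_of_ae_eq (fun x i => ?_) (fun _ _ => rfl) ?_ continuous_const ?_
      · simp only [B.amp_fderiv_periodic _ x i, hΦ.periodic x i]
      · exact ((B.amp_fderiv_continuous _).mul (hΦ.coord 0).continuous).add
          ((B.amp_fderiv_continuous _).mul (hΦ.coord 1).continuous)
      · filter_upwards [B.KerL_tangent hg, hgΦ] with x h1 h2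
        rw [← h2, h1]
    exact congrFun h1

/-- The vertical component of the vertical average. -/
def vertVertical : Ω.L2 →L[ℝ] Ω.L2 := matL (unitMat 2 2) ∘L vert

lemma vertVertical_trans (h : E3) (u : Ω.L2) :
    vertVertical (Ω.trans h u) = Ω.trans h (vertVertical u) := by
  rw [vertVertical, ContinuousLinearMap.comp_apply, vert_trans, matL_trans]
  rfl

lemma matL_matL_unitMat (i : Fin 3) (u : Ω.L2) :
    matL (unitMat i i) (matL (unitMat i i) u) = matL (unitMat i i) u := by
  apply Lp.ext
  filter_upwards [coeFn_matL (unitMat i i) (matL (unitMat i i) u), coeFn_matL (unitMat i i) u]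
    with x h1 h2
  rw [h1, h2]
  simp [unitMat_apply, e]

lemma fderiv_amp_eq_zero_iff (x : E3) :
    fderiv ℝ B.amp x = 0 ↔ fderiv ℝ B.amp x (e 0) = 0 ∧ fderiv ℝ B.amp x (e 1) = 0 := by
  constructor
  · intro h
    simp [h]
  · rintro ⟨h0, h1⟩
    ext v
    rw [eq_sum_smul_e v]
    simp [h0, h1, fderiv_amp_two]

lemma fderiv_amp_ne_zero_iff (x : E3) : fderiv ℝ B.amp x ≠ 0 ↔ hor x ∈ B.O := by
  rw [O, mem_ofPred_eq, not_iff_not]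
  constructor
  · intro h
    ext v
    have h1 : fderiv ℝ B.amp x (!₂[v 0, v 1, 0]) = 0 := by rw [h]; rfl
    rw [fderiv_amp] at h1
    have h2 : hor (!₂[v 0, v 1, 0] : E3) = v := by
      ext i; fin_cases i <;> simp [hor]
    rw [h2] at h1
    rw [h1]
    rfl
  · intro h
    ext v
    rw [fderiv_amp, h]
    rfl

/-- The quadratic form of `Π_⊥ u` when `Φ` is supported where `∇b` does not vanish. -/
lemma inner_quadOp_PiPerp_of_O {Φ : E3 → E3} (hΦ : Ω.SmoothCpt Φ)
    (ht : ∀ x, fderiv ℝ B.amp x (e 0) * Φ x 0 + fderiv ℝ B.amp x (e 1) * Φ x 1 = 0)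
    (hs : ∀ x, Φ x ≠ 0 → fderiv ℝ B.amp x ≠ 0) (u : Ω.L2) :
    ⟪quadOp hΦ (B.PiPerp u), B.PiPerp u⟫_ℝ = ⟪quadOp hΦ (u - vertVertical u),
      (u - vertVertical u) - (2 : ℝ) • (B.Pi u - vertVertical u)⟫_ℝ := by
  -- The vertical component of `Π u` commutes with translations, so only the horizontal part of `Π
  -- u` is troublesome, and this is `z`.
  set z := B.Pi u - vertVertical u with hz
  have hzK : z ∈ B.KerL := B.KerL.sub_mem (B.Pi_mem u) (B.vert_vertical_mem_KerL u)
  have hz0 : ⟪quadOp hΦ z, z⟫_ℝ = 0 := by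
    refine inner_quadOp_eq_zero_of_parallel hΦ (B.mem_KerL_iff.1 hzK).1 (B.KerL_trans_eq hzK) ?_ ?_
    · rw [hz, map_sub, B.vertical_Pi, vertVertical, ContinuousLinearMap.comp_apply,
        matL_matL_unitMat, sub_self]
    · filter_upwards [B.KerL_tangent hzK] with x h1
      by_cases hx : Φ x = 0
      · simp [hx]
      · have h2 := hs x hx
        -- In the plane, `z` and `Φ` are both orthogonal to the nonzero vector `∇b`, so they are
        -- parallel.
        rw [Ne, B.fderiv_amp_eq_zero_iff, not_and_or] at h2
        have h3 := ht x
        rcases h2 with h2 | h2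
        · refine mul_left_cancel₀ h2 ?_
          linear_combination z x 1 * h3 - Φ x 1 * h1
        · refine mul_left_cancel₀ h2 ?_
          linear_combination Φ x 0 * h1 - z x 0 * h3
  have hw : B.PiPerp u = (u - vertVertical u) - z := by rw [PiPerp_apply, hz]; abel
  rw [hw]
  generalize u - vertVertical u = p
  clear_value z
  have h5 : ⟪quadOp hΦ z, p⟫_ℝ = ⟪quadOp hΦ p, z⟫_ℝ := by
    rw [quadOp_symm, real_inner_comm]
  -- Expansion of the form at `p - z`, with no contribution of `z` alone, gives `⟪Q p, p - 2 z⟫`.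
  -- The first argument no longer contains `Π`.
  rw [map_sub, inner_sub_left, inner_sub_right, inner_sub_right, inner_sub_right,
    real_inner_smul_right, hz0, h5]
  ring

/-- A field which is a rotated gradient where `b` is constant has its vertical average in the
kernel of `L`. -/
lemma vert_curlTest_mem_KerL {φ : E3 → ℝ} (hφ : Ω.SmoothCpt φ)
    (h : ∀ x, φ x ≠ 0 → fderiv ℝ B.amp x = 0) : vert (hφ.curlTest 1 0).toL2 ∈ B.KerL := by
  rw [mem_KerL_iff]
  refine ⟨vert_mem_H (curlTest_mem_H hφ 1 0), fun η hη => ?_⟩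
  have hβ := hφ.mul_left B.amp_smooth B.amp_periodic
  have hm : ∀ x j, fderiv ℝ (fun x => B.amp x * φ x) x (e j) = B.amp x * fderiv ℝ φ x (e j) := by
    intro x j
    rw [SmoothCpt.fderiv_mul hφ.differentiable B.amp_differentiable]
    by_cases hx : φ x = 0
    · simp [hx]
    · simp [h x hx]
  have h1 := mem_H_iff_sum.1 (vert_mem_H hη) _ hβ
  rw [Fin.sum_univ_three, integral_fderiv_mul_eq_zero_of_trans (fun s => trans_vert s η) hβ, add_zero,
    ← integral_add (integrable_mul_coord (hβ.fderiv_apply _) _ _)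
      (integrable_mul_coord (hβ.fderiv_apply _) _ _)] at h1
  -- Since `∇b = 0` where `φ ≠ 0`, the field `b` times a rotated gradient of `φ` is, after the
  -- wedge, the horizontal gradient of `b φ`. It is orthogonal to the divergence free, vertically
  -- invariant field `vert η`.
  rw [← vert_wedgeL2, vert_symm, inner_wedgeL2, ← h1]
  refine integral_congr_ae ?_
  filter_upwards [(hφ.curlTest 1 0).coeFn_toL2] with x hx
  rw [hx, hm, hm]
  simp [curlTest, e]

/-- The quadratic form of `Π_⊥ u` when `Φ` is supported where `b` is locally constant. -/
lemma inner_quadOp_PiPerp_of_S {Φ : E3 → E3} (hΦ : Ω.SmoothCpt Φ)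
    (hv : ∀ (x : E3) (s : ℝ), Φ (x + s • e 2) = Φ x) (hs : ∀ x ∈ tsupport Φ, hor x ∈ B.S) {u : Ω.L2}
    (hu : u ∈ Ω.H) :
    ⟪quadOp hΦ (B.PiPerp u), B.PiPerp u⟫_ℝ = ⟪quadOp hΦ (u - vert u), u - vert u⟫_ℝ := by
  -- The splitting is `Π_⊥ u = (u - vert u) + z`, where `z` is planar and does not depend on the
  -- vertical variable.
  set z := vert (B.PiPerp u) with hz
  have hzP : z = vert u - B.Pi u := by rw [hz, PiPerp_apply, map_sub, vert_Pi]
  obtain ⟨δ, hδ, hshift⟩ := hΦ.exists_shift_mem (V := hor ⁻¹' B.S)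
    (isOpen_interior.preimage horL.continuous) hs
  have hS : ∀ x, hor x ∈ B.S → fderiv ℝ B.amp x = 0 := by
    intro x hx
    by_contra hne
    rw [← Ne, B.fderiv_amp_ne_zero_iff] at hne
    exact hne (show hor x ∈ {y | fderiv ℝ B.b y = 0} from interior_subset hx)
  have hz0 : ⟪quadOp hΦ z, z⟫_ℝ = 0 := by
    refine inner_quadOp_eq_zero_of_irrotational hΦ ?_ (fun s => trans_vert s _) ?_ hδ ?_
    · rw [hzP]
      exact Ω.H.sub_mem (vert_mem_H hu) (B.mem_KerL_iff.1 (B.Pi_mem u)).1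
    · rw [hzP, map_sub, B.vertical_Pi, sub_self]
    · intro φ hφ hsub h hh
      have h1 : Ω.trans (-h) (hφ.curlTest 1 0).toL2 = ((hφ.translate (-h)).curlTest 1 0).toL2 := by
        rw [trans_toL2]
        apply Lp.ext
        filter_upwards [((hφ.curlTest 1 0).translate (-h)).coeFn_toL2,
          ((hφ.translate (-h)).curlTest 1 0).coeFn_toL2] with x h2 h3
        rw [h2, h3]
        simp only [curlTest, fderiv_comp_add_right]
      -- A small translate of the test still lives where `b` is locally constant. Its vertical
      -- average is then in `Ker L`, to which `Π_⊥ u` is orthogonal.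
      rw [inner_trans, h1, hz, vert_symm]
      refine B.inner_PiPerp (B.vert_curlTest_mem_KerL (hφ.translate (-h)) fun x hx => ?_) u
      obtain ⟨v, hvl, hvS⟩ := hshift (x + -h) (hsub (subset_closure hx))
      have h2 := hS _ (hvS h hh)
      rw [neg_add_cancel_right] at h2
      ext w
      have h3 := Periodic.add_mem (B.amp_fderiv_periodic w) hvl x
      rw [← h3, h2]
  have hw : B.PiPerp u = (u - vert u) + z := by rw [PiPerp_apply, hzP]; abel
  have hzz : vert z = z := vert_vert _
  -- The form commutes with the vertical average, which kills `u - vert u`, so the two parts do not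
  -- interact.
  have hcross : ⟪quadOp hΦ z, u - vert u⟫_ℝ = 0 := by
    rw [← hzz, quadOp_vert hΦ hv, vert_symm, map_sub, vert_vert, sub_self, inner_zero_right]
  have h5 : ⟪quadOp hΦ (u - vert u), z⟫_ℝ = 0 := by
    rw [quadOp_symm, real_inner_comm, hcross]
  rw [hw, map_add, inner_add_left, inner_add_right, inner_add_right, hz0, hcross, h5]
  ring

lemma isOpen_ne_zero : IsOpen {x : E3 | fderiv ℝ B.amp x ≠ 0} :=
  isOpen_ne_fun (B.amp_smooth.continuous_fderiv (by simp)) continuous_const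

/-- A test field supported in `𝒪 ∪ 𝒮` is the sum of a field supported in `𝒪` and of a field
supported in `𝒮`. -/
lemma exists_split {Φ : E3 → E3} (hΦ : Ω.SmoothCpt Φ) (hs : ∀ x ∈ tsupport Φ, hor x ∈ B.O ∪ B.S) :
    ∃ Φ₁ Φ₂ : E3 → E3, Ω.SmoothCpt Φ₁ ∧ Ω.SmoothCpt Φ₂ ∧ (∀ x, Φ x = Φ₁ x + Φ₂ x) ∧
      (∀ x, Φ₁ x = Φ x ∨ Φ₁ x = 0) ∧ (∀ x, Φ₁ x ≠ 0 → fderiv ℝ B.amp x ≠ 0) ∧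
      (∀ x ∈ tsupport Φ₂, hor x ∈ B.S) ∧
      ((∀ (x : E3) (s : ℝ), Φ (x + s • e 2) = Φ x) →
        ∀ (x : E3) (s : ℝ), Φ₂ (x + s • e 2) = Φ₂ x) := by
  classical
  set U : Set E3 := {x : E3 | fderiv ℝ B.amp x ≠ 0} with hU
  set V : Set E3 := hor ⁻¹' B.S with hV
  have hUo : IsOpen U := B.isOpen_ne_zero
  have hVo : IsOpen V := isOpen_interior.preimage horL.continuous
  have hmem : ∀ x ∈ tsupport Φ, x ∈ U ∨ x ∈ V := fun x hx =>
    (hs x hx).imp (fun h => (B.fderiv_amp_ne_zero_iff x).2 h) id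
  have hdisj : ∀ x ∈ V, x ∉ U := by
    intro x hx hxU
    exact (B.fderiv_amp_ne_zero_iff x).1 hxU
      (show hor x ∈ {y | fderiv ℝ B.b y = 0} from interior_subset hx)
  have hamp : ∀ (x v : E3), (∀ y, B.amp (y + v) = B.amp y) →
      fderiv ℝ B.amp (x + v) = fderiv ℝ B.amp x := by
    intro x v hv
    have : B.amp = fun x => B.amp (x + v) := by ext1 x; rw [hv]
    conv_rhs => rw [this]
    rw [fderiv_comp_add_right]
  set Φ₁ : E3 → E3 := fun x => if x ∈ U then Φ x else 0 with hΦ₁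
  -- The sharp cutoff by `U` is smooth because the support of `Φ` is covered by the disjoint open
  -- sets `U` and `V`.
  have hloc : ∀ x, Φ₁ =ᶠ[𝓝 x] Φ ∨ Φ₁ =ᶠ[𝓝 x] fun _ => 0 := by
    intro x
    by_cases hx : x ∈ tsupport Φ
    · rcases hmem x hx with h | h
      · left
        filter_upwards [hUo.mem_nhds h] with y hy
        rw [hΦ₁]
        exact if_pos hy
      · right
        filter_upwards [hVo.mem_nhds h] with y hy
        rw [hΦ₁]
        exact if_neg (hdisj y hy)
    · right
      filter_upwards [(isClosed_tsupport Φ).isOpen_compl.mem_nhds hx] with y hy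
      have : Φ y = 0 := image_eq_zero_of_notMem_tsupport hy
      simp [hΦ₁, this]
  have h1s : ContDiff ℝ ∞ Φ₁ := by
    rw [contDiff_iff_contDiffAt]
    intro x
    rcases hloc x with h | h
    · exact hΦ.smooth.contDiffAt.congr_of_eventuallyEq h
    · exact contDiffAt_const.congr_of_eventuallyEq h
  have h1 : Ω.SmoothCpt Φ₁ := by
    refine hΦ.of_zero h1s (fun x i => ?_) fun x hx => by simp [hΦ₁, hx]
    simp only [hΦ₁, hΦ.periodic x i]
    have : x + Ω.len i • e i ∈ U ↔ x ∈ U := by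
      rw [hU, mem_ofPred_eq, mem_ofPred_eq, hamp x _ fun y => B.amp_periodic y i]
    simp only [this]
  have h2 := hΦ.sub h1
  refine ⟨Φ₁, fun x => Φ x - Φ₁ x, h1, h2, fun x => (add_sub_cancel _ _).symm,
    fun x => ?_, fun x hx => ?_,
    fun x hx => ?_, fun hv x s => ?_⟩
  · by_cases h : x ∈ U <;> simp [hΦ₁, h]
  · by_contra hne
    have : x ∉ U := fun h => h hne
    exact hx (by simp [hΦ₁, this])
  · have hxΦ : x ∈ tsupport Φ := by
      refine closure_mono (fun y (hy : Φ y - Φ₁ y ≠ 0) => ?_) hx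
      exact fun hyΦ : Φ y = 0 => hy (by simp [hΦ₁, hyΦ])
    rcases hmem x hxΦ with h | h
    · exfalso
      rw [tsupport, mem_closure_iff_nhds] at hx
      obtain ⟨y, hyU, hy⟩ := hx U (hUo.mem_nhds h)
      exact hy (by simp [hΦ₁, hyU])
    · exact h
  · have : x + s • e 2 ∈ U ↔ x ∈ U := by
      rw [hU, mem_ofPred_eq, mem_ofPred_eq, hamp x _ fun y => by
        rw [amp, amp, hor_add, hor_smul, hor_e_two, smul_zero, add_zero]]
    simp only [hΦ₁, hv, this]

/-- The quadratic form of `Π_⊥ u` is compact on the divergence free fields with square integrable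
derivatives. -/
theorem exists_isRellich {Φ : E3 → E3} (hΦ : Ω.SmoothCpt Φ) (h : ∃ g ∈ B.KerL, ⇑g =ᵐ[Ω.μ] Φ)
    (hs : ∀ x ∈ tsupport Φ, hor x ∈ B.O ∪ B.S) : ∃ K : Ω.L2 →L[ℝ] Ω.L2, IsRellich K ∧
    ∀ u ∈ Ω.H, ⟪quadOp hΦ (B.PiPerp u), B.PiPerp u⟫_ℝ = ⟪K u, u⟫_ℝ := by
  obtain ⟨hv, ht⟩ := B.smooth_KerL hΦ h
  obtain ⟨Φ₁, Φ₂, h1, h2, hadd, hor, hO, hS, hv2⟩ := B.exists_split hΦ hs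
  have ht1 : ∀ x, fderiv ℝ B.amp x (e 0) * Φ₁ x 0 + fderiv ℝ B.amp x (e 1) * Φ₁ x 1 = 0 := by
    intro x
    rcases hor x with h | h
    · rw [h, ht]
    · simp [h]
  set X : Ω.L2 →L[ℝ] Ω.L2 := ContinuousLinearMap.id ℝ _ - vertVertical with hX
  set Y : Ω.L2 →L[ℝ] Ω.L2 := X - (2 : ℝ) • (B.Pi - vertVertical) with hY
  set Z : Ω.L2 →L[ℝ] Ω.L2 := ContinuousLinearMap.id ℝ _ - vert with hZ
  -- The inner operators `X` and `Z` commute with translations. The projection `Π` occurs only in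
  -- `Y`, on the outer side, where nothing is required.
  refine ⟨Y.adjoint ∘L quadOp h1 ∘L X + Z.adjoint ∘L quadOp h2 ∘L Z,
    ((isRellich_quadOp h1).comp _ X fun k u => ?_).add
      ((isRellich_quadOp h2).comp _ Z fun k u => ?_), fun u hu => ?_⟩
  · simp [hX, vertVertical_trans]
  · simp [hZ, vert_trans]
  · rw [quadOp_add h1 h2 hΦ hadd, add_apply, inner_add_left, B.inner_quadOp_PiPerp_of_O h1 ht1 hO,
      B.inner_quadOp_PiPerp_of_S h2 (hv2 hv) hS hu, add_apply, inner_add_left]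
    simp only [ContinuousLinearMap.comp_apply, ContinuousLinearMap.adjoint_inner_left]
    rfl

end Rotation

/-! ### Vanishing of the trace on finite dimensional spaces invariant by `L`. -/

/-- An orthonormal basis of eigenvectors of the square of a skew-symmetric operator. -/
lemma exists_orthonormalBasis_of_skew {E : Type*} [NormedAddCommGroup E] [InnerProductSpace ℝ E]
    [FiniteDimensional ℝ E] (T : E →ₗ[ℝ] E) (hskew : ∀ f g : E, ⟪T f, g⟫_ℝ = -⟪f, T g⟫_ℝ) :
    ∃ (b : OrthonormalBasis (Fin (Module.finrank ℝ E)) ℝ E)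
      (c : Fin (Module.finrank ℝ E) → ℝ) (τ : Fin (Module.finrank ℝ E) →
        Fin (Module.finrank ℝ E) → ℝ),
      (∀ i, T (T (b i)) = c i • b i) ∧ (∀ i, c i = 0 → T (b i) = 0) ∧
      (∀ i, T (b i) = ∑ j, τ i j • b j) ∧
      ∀ S : Fin (Module.finrank ℝ E) → Fin (Module.finrank ℝ E) → ℝ, (∀ i j, S i j = S j i) →
        ∑ i, (c i)⁻¹ * ∑ j, τ i j * S i j = 0 := by
  have hsym : (T ∘ₗ T).IsSymmetric := by
    intro f g
    rw [LinearMap.comp_apply, LinearMap.comp_apply, hskew, hskew, neg_neg]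
  set b := hsym.eigenvectorBasis rfl with hb
  set c := hsym.eigenvalues rfl with hc
  have hTT : ∀ i, T (T (b i)) = c i • b i := fun i => hsym.apply_eigenvectorBasis rfl i
  have hτ_anti : ∀ i j, ⟪T (b i), b j⟫_ℝ = - ⟪T (b j), b i⟫_ℝ := by
    intro i j
    rw [hskew, real_inner_comm]
  -- A skew operator commutes with its square, so its matrix only couples eigenvectors with the same
  -- `c`.
  have hτ_comm : ∀ i j, c i * ⟪T (b i), b j⟫_ℝ = c j * ⟪T (b i), b j⟫_ℝ := by
    intro i j
    have h1 : ⟪T (T (T (b i))), b j⟫_ℝ = c i * ⟪T (b i), b j⟫_ℝ := by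
      rw [hTT, map_smul, real_inner_smul_left]
    have h2 : ⟪T (T (T (b i))), b j⟫_ℝ = c j * ⟪T (b i), b j⟫_ℝ := by
      rw [hskew, hskew, neg_neg, hTT, real_inner_smul_right]
    rw [← h1, h2]
  refine ⟨b, c, fun i j => ⟪T (b i), b j⟫_ℝ, hTT, fun i hci => ?_, fun i => ?_, fun S hS => ?_⟩
  -- If `c i = 0` then `‖T (b i)‖² = -⟪T (T (b i)), b i⟫ = 0`.
  · have h2 := hskew (T (b i)) (b i)
    rw [hTT, hci, zero_smul, inner_zero_left, zero_eq_neg] at h2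
    exact inner_self_eq_zero.1 h2
  · conv_lhs => rw [← b.sum_repr (T (b i))]
    refine Finset.sum_congr rfl fun j _ => ?_
    rw [b.repr_apply_apply, real_inner_comm]
  · simp only [Finset.mul_sum]
    -- Exchanging `i` and `j` changes the sign: `τ` is skew, `S` is symmetric, and the weights `(c
    -- i)⁻¹`, `(c j)⁻¹` agree where `τ` is nonzero.
    have hterm : ∀ i j, (c i)⁻¹ * (⟪T (b i), b j⟫_ℝ * S i j)
        = - ((c j)⁻¹ * (⟪T (b j), b i⟫_ℝ * S j i)) := by
      intro i j
      rw [hS j i, hτ_anti j i]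
      by_cases h : ⟪T (b i), b j⟫_ℝ = 0
      · simp [h]
      · rw [mul_right_cancel₀ h (hτ_comm i j)]
        ring
    have h1 : ∑ i, ∑ j, (c i)⁻¹ * (⟪T (b i), b j⟫_ℝ * S i j)
        = - ∑ i, ∑ j, (c i)⁻¹ * (⟪T (b i), b j⟫_ℝ * S i j) := by
      conv_lhs => rw [Finset.sum_comm]
      rw [← Finset.sum_neg_distrib]
      refine Finset.sum_congr rfl fun i _ => ?_
      rw [← Finset.sum_neg_distrib]
      exact Finset.sum_congr rfl fun j _ => hterm j i
    linarith

namespace Domain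

variable {Ω : Domain}

lemma rotForm_eq_inner {Φ : E3 → E3} (hΦ : Ω.SmoothCpt Φ) (g : Ω.L2) (y' : Fin 3 → Ω.L2) :
    rotForm Φ g y' = ∑ i, ∑ j, (⟪mulC (hΦ.coord j) (unitMat i i) (y' j), g⟫_ℝ
      - ⟪mulC (hΦ.coord j) (unitMat i j) (y' i), g⟫_ℝ) := by
  simp only [inner_mulC, rotForm]

lemma rotForm_sum {Φ : E3 → E3} (hΦ : Ω.SmoothCpt Φ) {ι : Type*} (s : Finset ι) (a : ι → ℝ)
    (g : Ω.L2) (y' : ι → Fin 3 → Ω.L2) :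
    rotForm Φ g (fun j => ∑ k ∈ s, a k • y' k j) = ∑ k ∈ s, a k * rotForm Φ g (y' k) := by
  simp only [rotForm_eq_inner hΦ, map_sum, map_smul, sum_inner, real_inner_smul_left,
    Finset.mul_sum, mul_sub, ← Finset.sum_sub_distrib]
  rw [Finset.sum_comm (s := s)]
  exact Finset.sum_congr rfl fun i _ => Finset.sum_comm
  
lemma IsWeakPartial.sum {ι : Type*} (s : Finset ι) {a : ι → ℝ} {u g : ι → Ω.L2} {j : Fin 3}
    (h : ∀ k ∈ s, Ω.IsWeakPartial j (u k) (g k)) :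
    Ω.IsWeakPartial j (∑ k ∈ s, a k • u k) (∑ k ∈ s, a k • g k) := by
  classical
  induction s using Finset.induction_on with
  | empty =>
    simp only [Finset.sum_empty]
    exact isWeakPartial_zero_of_trans fun s => map_zero _
  | insert k s hk ih =>
    rw [Finset.sum_insert hk, Finset.sum_insert hk]
    exact ((h k (Finset.mem_insert_self _ _)).smul _).add
      (ih fun l hl => h l (Finset.mem_insert_of_mem hl))

end Domain

namespace Rotation

open Domain

variable {Ω : Domain} (B : Rotation Ω)

lemma L_apply (u : Ω.L2) : B.L u = Ω.H.starProjection (B.wedgeL2 u) := rfl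

lemma L_mem_H (u : Ω.L2) : B.L u ∈ Ω.H := by
  rw [L_apply]
  exact Submodule.starProjection_apply_mem _ _

lemma inner_L {v : Ω.L2} (hv : v ∈ Ω.H) (u : Ω.L2) : ⟪B.L u, v⟫_ℝ = ⟪B.wedgeL2 u, v⟫_ℝ := by
  rw [L_apply, Submodule.inner_starProjection_left_eq_right,
    Submodule.starProjection_eq_self_iff.2 hv]

/-- `L` is skew-symmetric on the divergence free fields. -/
lemma inner_L_left {u v : Ω.L2} (hu : u ∈ Ω.H) (hv : v ∈ Ω.H) : ⟪B.L u, v⟫_ℝ = -⟪u, B.L v⟫_ℝ := by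
  rw [B.inner_L hv, inner_wedgeL2_left, real_inner_comm, ← B.inner_L hu, real_inner_comm]

set_option maxHeartbeats 1000000 in
/-- On a finite dimensional space of fields with square integrable derivatives which is invariant
by `L`, the trace of the quadratic form of `Π_⊥ u` vanishes. -/
theorem exists_sum_quadOp_PiPerp_eq_zero {Φ : E3 → E3} (hΦ : Ω.SmoothCpt Φ)
    (hΦ2 : ∀ x, fderiv ℝ Φ x (e 2) = 0)
    (hΦb : ∀ x, fderiv ℝ B.amp x (e 0) * Φ x 0 + fderiv ℝ B.amp x (e 1) * Φ x 1 = 0)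
    (E : Submodule ℝ Ω.L2) [FiniteDimensional ℝ E] (hEH : E ≤ Ω.H)
    (hE' : ∀ f ∈ E, ∀ j, ∃ g, Ω.IsWeakPartial j f g) (hL : ∀ f ∈ E, B.L f ∈ E) :
    ∃ b : OrthonormalBasis (Fin (Module.finrank ℝ E)) ℝ E,
      ∑ i, ⟪quadOp hΦ (B.PiPerp (b i)), B.PiPerp (b i)⟫_ℝ = 0 := by
  set T : E →ₗ[ℝ] E := (B.L : Ω.L2 →ₗ[ℝ] Ω.L2).restrict hL with hT
  have hTc : ∀ f : E, ((T f : E) : Ω.L2) = B.L f := fun f => rfl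
  have hskew : ∀ f g : E, ⟪T f, g⟫_ℝ = -⟪f, T g⟫_ℝ := fun f g =>
    B.inner_L_left (hEH f.2) (hEH g.2)
  obtain ⟨b, c, τ, hTT, hc0, hτ, hsum⟩ := exists_orthonormalBasis_of_skew T hskew
  refine ⟨b, ?_⟩
  choose! D hD using hE'
  -- The entry `S i j` stands for `∫ (b_i ∧ rot L b_j) · Φ`.
  set S : Fin (Module.finrank ℝ E) → Fin (Module.finrank ℝ E) → ℝ :=
    fun i j => rotForm Φ (b i : E) (D (T (b j) : E)) with hS
  have hS_symm : ∀ i j, S i j = S j i := fun i j =>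
    B.rotForm_L_symm hΦ hΦ2 hΦb (hEH (b j).2) (hEH (b i).2) (hD _ (b j).2) (hD _ (b i).2)
      (hD _ (T (b j)).2) (hD _ (T (b i)).2) (fun ξ hξ => B.inner_L hξ _)
      (fun ξ hξ => B.inner_L hξ _)
  have hQ : ∀ i, ⟪quadOp hΦ (B.PiPerp (b i)), B.PiPerp (b i)⟫_ℝ
      = (c i)⁻¹ * ∑ j, τ i j * S i j := by
    intro i
    by_cases hci : c i = 0
    -- A basis vector in `Ker L` has no image under `Π_⊥`. The convention `0⁻¹ = 0` makes the other
    -- side vanish as well.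
    · have h1 : T (b i) = 0 := hc0 i hci
      have h3 : ((b i : E) : Ω.L2) ∈ B.KerL :=
        ⟨hEH (b i).2, by
          change B.L (b i) = 0
          rw [← hTc, h1]; rfl⟩
      have h4 : B.PiPerp (b i) = 0 := by
        rw [PiPerp_apply, Pi, Submodule.starProjection_eq_self_iff.2 h3, sub_self]
      rw [h4, inner_zero_right, hci, inv_zero, zero_mul]
    -- The vector is in the range of `L`, hence orthogonal to `Ker L` by skewness, and `Π_⊥` fixes
    -- it.
    · have h1 : ((b i : E) : Ω.L2) = (c i)⁻¹ • B.L (B.L (b i)) := by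
        rw [← hTc, ← hTc, hTT, Submodule.coe_smul, inv_smul_smul₀ hci]
      have h2 : B.Pi (b i) = 0 := by
        rw [Pi, Submodule.starProjection_apply_eq_zero_iff, Submodule.mem_orthogonal']
        intro k hk
        rw [h1, real_inner_smul_left, B.inner_L_left (B.L_mem_H _) hk.1]
        have : B.L k = 0 := hk.2
        rw [this, inner_zero_right, neg_zero, mul_zero]
      have h4 : B.PiPerp (b i) = b i := by rw [PiPerp_apply, h2, sub_zero]
      have h5 : ((b i : E) : Ω.L2) = ∑ j, ((c i)⁻¹ * τ i j) • ((T (b j) : E) : Ω.L2) := by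
        have h7 : T (T (b i)) = ∑ j, τ i j • T (b j) := by
          conv_lhs => rw [hτ]
          simp only [map_sum, map_smul]
        rw [h1, ← hTc, ← hTc, h7]
        simp only [Submodule.coe_sum, Submodule.coe_smul, Finset.smul_sum, smul_smul]
      -- Weak derivatives are unique, so the chosen derivatives of `b i` are the same combination of
      -- the derivatives of the `T (b j)`.
      have h8 : D (b i) = fun l => ∑ j, ((c i)⁻¹ * τ i j) • D (T (b j)) l := by
        ext1 l
        refine (hD _ (b i).2 l).unique ?_
        conv_lhs => rw [h5]
        exact IsWeakPartial.sum _ fun j _ => hD _ (T (b j)).2 l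
      rw [h4, inner_quadOp_self hΦ (hEH (b i).2) (hD _ (b i).2), h8, rotForm_sum hΦ, Finset.mul_sum]
      exact Finset.sum_congr rfl fun j _ => mul_assoc _ _ _
  simp only [hQ]
  exact hsum S hS_symm

end Rotation

/-! ### Nonnegative operators of finite trace. -/

section Trace

variable {V : Type*} [NormedAddCommGroup V] [InnerProductSpace ℝ V]

/-- Positivity is tested at `y - t R y` with `t = (‖R‖ + 1)⁻¹`; the added `1` keeps the quotient
meaningful when `R = 0`. -/
lemma norm_sq_apply_le_of_nonneg {R : V →L[ℝ] V} (hsym : ∀ x y, ⟪R x, y⟫_ℝ = ⟪x, R y⟫_ℝ)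
    (hpos : ∀ x, 0 ≤ ⟪R x, x⟫_ℝ) (y : V) : ‖R y‖ ^ 2 ≤ (‖R‖ + 1) * ⟪R y, y⟫_ℝ := by
  set t : ℝ := (‖R‖ + 1)⁻¹ with ht
  have hR : 0 < ‖R‖ + 1 := by positivity
  have h1 := hpos (y - t • R y)
  have h2 : ⟪R (R y), y⟫_ℝ = ‖R y‖ ^ 2 := by rw [hsym, real_inner_self_eq_norm_sq]
  have h3 : ⟪R (R y), R y⟫_ℝ ≤ (‖R‖ + 1) * ‖R y‖ ^ 2 := by
    refine (real_inner_le_norm _ _).trans ?_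
    have := R.le_opNorm (R y)
    nlinarith [norm_nonneg (R y)]
  simp only [map_sub, map_smul, inner_sub_left, inner_sub_right, real_inner_smul_left,
    real_inner_smul_right, h2, real_inner_self_eq_norm_sq] at h1
  have h4 : t * (t * ⟪R (R y), R y⟫_ℝ) ≤ t * ‖R y‖ ^ 2 := by
    have : t * ⟪R (R y), R y⟫_ℝ ≤ t * ((‖R‖ + 1) * ‖R y‖ ^ 2) := by gcongr
    rw [← mul_assoc, ht, inv_mul_cancel₀ hR.ne', one_mul, ← ht] at this
    gcongr
  have h5 : t * ‖R y‖ ^ 2 ≤ ⟪R y, y⟫_ℝ := by linarith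
  rw [ht, inv_mul_le_iff₀ hR] at h5
  exact h5

/-- A nonnegative symmetric operator of finite trace is compact. -/
lemma isCompactOperator_of_trace [CompleteSpace V] {R : V →L[ℝ] V}
    (hsym : ∀ x y, ⟪R x, y⟫_ℝ = ⟪x, R y⟫_ℝ) (hpos : ∀ x, 0 ≤ ⟪R x, x⟫_ℝ) {C : ℝ}
    (htr : ∀ (n : ℕ) (v : Fin n → V), Orthonormal ℝ v → ∑ i, ⟪R (v i), v i⟫_ℝ ≤ C) :
    IsCompactOperator R := by
  set A : Set ℝ := {a | ∃ (n : ℕ) (v : Fin n → V), Orthonormal ℝ v ∧ a = ∑ i, ⟪R (v i), v i⟫_ℝ}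
    with hA
  have hbdd : BddAbove A := ⟨C, by rintro a ⟨n, v, hv, rfl⟩; exact htr n v hv⟩
  have hne : A.Nonempty := ⟨_, 0, Fin.elim0, by
    refine ⟨⟨fun i => i.elim0, fun i => i.elim0⟩, rfl⟩⟩
  have hmem : R ∈ closure {f : V →L[ℝ] V | IsCompactOperator f} := by
    rw [Metric.mem_closure_iff]
    intro η hη
    -- Chosen so that `(‖R‖ + 1) d = (η / 2) ^ 2` in the final estimate.
    set d : ℝ := (η / 2) ^ 2 / (‖R‖ + 1) with hd
    have hdpos : 0 < d := by positivity
    -- The family comes within `d` of the largest partial trace, so any further unit vector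
    -- orthogonal to it adds at most `d`.
    obtain ⟨a, ⟨n, v, hv, rfl⟩, ha⟩ := exists_lt_of_lt_csSup hne (sub_lt_self (sSup A) hdpos)
    set W : Submodule ℝ V := Submodule.span ℝ (range v) with hW
    have hWf : FiniteDimensional ℝ W := FiniteDimensional.span_of_finite ℝ (finite_range v)
    have hsmall : ∀ y ∈ Wᗮ, ⟪R y, y⟫_ℝ ≤ d * ‖y‖ ^ 2 := by
      intro y hy
      by_cases hy0 : y = 0
      · simp [hy0]
      have hyn : ‖y‖ ≠ 0 := norm_ne_zero_iff.2 hy0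
      set z := ‖y‖⁻¹ • y with hz
      have hzn : ‖z‖ = 1 := by
        rw [hz, norm_smul, norm_inv, norm_norm, inv_mul_cancel₀ hyn]
      have hort : Orthonormal ℝ (Matrix.vecCons z v) := by
        refine orthonormal_vecCons_iff.2 ⟨hzn, fun i => ?_, hv⟩
        rw [hz, real_inner_smul_left,
          Submodule.inner_left_of_mem_orthogonal (Submodule.subset_span (mem_range_self i)) hy,
          mul_zero]
      have h1 := le_csSup hbdd ⟨n + 1, _, hort, rfl⟩
      rw [Fin.sum_univ_succ] at h1
      simp only [Matrix.cons_val_zero, Matrix.cons_val_succ] at h1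
      have h2 : ⟪R z, z⟫_ℝ ≤ d := by linarith
      have h3 : y = ‖y‖ • z := by rw [hz, smul_inv_smul₀ hyn]
      rw [h3, map_smul, real_inner_smul_left, real_inner_smul_right, norm_smul, hzn, mul_one,
        norm_norm]
      nlinarith [sq_nonneg ‖y‖]
    -- On the orthogonal of `W` the form of `R` is small, hence so is `R`. The finite rank operator
    -- `R ∘L W.starProjection` is then close to `R`.
    refine ⟨R ∘L W.starProjection, ?_, ?_⟩
    · have h1 : IsCompactOperator (id : W → W) := isCompactOperator_id_iff_finiteDimensional.2 hWf
      exact (h1.comp_clm W.orthogonalProjectionOnto).clm_comp (R ∘L W.subtypeL)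
    · rw [dist_eq_norm]
      refine lt_of_le_of_lt (ContinuousLinearMap.opNorm_le_bound _ (by positivity) fun x => ?_)
        (half_lt_self hη)
      set y := x - W.starProjection x with hy
      have hyW : y ∈ Wᗮ := Submodule.sub_starProjection_mem_orthogonal x
      have h1 : (R - R ∘L W.starProjection) x = R y := by rw [hy, map_sub]; rfl
      have h2 := norm_sq_apply_le_of_nonneg hsym hpos y
      have h3 : ‖y‖ ≤ ‖x‖ := by
        have h4 := Submodule.norm_sq_eq_add_norm_sq_starProjection x W
        rw [Submodule.starProjection_orthogonal_val, ← hy] at h4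
        refine abs_le_of_sq_le_sq' ?_ (norm_nonneg _) |>.2
        nlinarith [sq_nonneg ‖W.starProjection x‖]
      rw [h1]
      refine abs_le_of_sq_le_sq' ?_ (by positivity) |>.2
      calc ‖R y‖ ^ 2 ≤ (‖R‖ + 1) * (d * ‖y‖ ^ 2) := h2.trans (by gcongr; exact hsmall y hyW)
        _ = (η / 2) ^ 2 * ‖y‖ ^ 2 := by rw [hd]; field_simp
        _ ≤ (η / 2) ^ 2 * ‖x‖ ^ 2 := by gcongr
        _ = _ := by ring
  have hcl : IsClosed {f : V →L[ℝ] V | IsCompactOperator f} := isClosed_setOfPred_isCompactOperator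
  rw [hcl.closure_eq] at hmem
  exact hmem

/-- The spectral decomposition of a compact symmetric operator, in bases of the eigenspaces. -/
lemma hasSum_eigenvalues [CompleteSpace V] {R : V →L[ℝ] V} (hR : IsCompactOperator R)
    (hsym : ∀ x y, ⟪R x, y⟫_ℝ = ⟪x, R y⟫_ℝ) {n : ℝ → ℕ} {v : (l : ℝ) → Fin (n l) → V}
    (hv : ∀ l, l ≠ 0 → ∀ i, R (v l i) = l • v l i)
    (hbasis : ∀ l, l ≠ 0 → ∀ w, R w = l • w → w = ∑ i, ⟪v l i, w⟫_ℝ • v l i) (a f : V) :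
    HasSum (fun l => l * ∑ i, ⟪a, v l i⟫_ℝ * ⟪f, v l i⟫_ℝ) ⟪R a, f⟫_ℝ := by
  have hsym' : (R : V →ₗ[ℝ] V).IsSymmetric := hsym
  have hbot := ContinuousLinearMap.orthogonalComplement_iSup_eigenspaces_eq_bot hR hsym'
  have hmem : ∀ l w, w ∈ Module.End.eigenspace (R : V →ₗ[ℝ] V) l ↔ R w = l • w := fun l w =>
    Module.End.mem_eigenspace_iff
  have hcomp : ∀ l : ℝ, CompleteSpace (Module.End.eigenspace (R : V →ₗ[ℝ] V) l) := by
    intro l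
    have : IsClosed {w | R w = l • w} := isClosed_eq R.continuous (by fun_prop)
    have h2 : ((Module.End.eigenspace (R : V →ₗ[ℝ] V) l : Submodule ℝ V) : Set V)
        = {w | R w = l • w} := by
      ext w; exact hmem l w
    rw [← h2] at this
    exact this.completeSpace_coe
  -- Compactness and symmetry make the space the Hilbert sum of the eigenspaces. That of `0` may be
  -- infinite dimensional, but the factor `l` removes it.
  have hH := IsHilbertSum.mkInternal (𝕜 := ℝ)
    (fun l => Module.End.eigenspace (R : V →ₗ[ℝ] V) l) hsym'.orthogonalFamily_eigenspaces
    (by rw [Submodule.topologicalClosure_eq_top_iff.2 hbot])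
  set w := hH.linearIsometryEquiv a with hw
  have hsum := hH.hasSum_linearIsometryEquiv_symm w
  rw [hw, LinearIsometryEquiv.symm_apply_apply, ← hw] at hsum
  have hRw : ∀ l, R (w l) = l • (w l : V) := fun l => (hmem l _).1 (w l).2
  have hinner : ∀ l, l ≠ 0 → ∀ i, ⟪v l i, a⟫_ℝ = ⟪v l i, (w l : V)⟫_ℝ := by
    intro l hl i
    have h1 := hsum.mapL (innerSL ℝ (v l i))
    have h2 : HasSum (fun m => innerSL ℝ (v l i) ((w m : V))) ⟪v l i, (w l : V)⟫_ℝ := by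
      refine hasSum_single l fun m hm => ?_
      have := hsym'.orthogonalFamily_eigenspaces (Ne.symm hm) ⟨v l i, (hmem l _).2 (hv l hl i)⟩ (w m)
      simpa using this
    exact h1.unique h2
  have h3 := (hsum.mapL R).mapL (innerSL ℝ f)
  simp only [innerSL_apply_apply] at h3
  rw [real_inner_comm] at h3
  convert! h3 using 1
  ext l
  change _ = ⟪f, R (w l)⟫_ℝ
  rw [hRw, real_inner_smul_right]
  by_cases hl : l = 0
  · simp [hl]
  · congr 1
    conv_rhs => rw [hbasis l hl (w l) (hRw l)]
    rw [inner_sum]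
    refine Finset.sum_congr rfl fun i _ => ?_
    rw [real_inner_smul_right, ← hinner l hl, real_inner_comm]

end Trace

/-! ### Correlation operators of bounded families. -/

section Correlation

variable {V : Type*} [NormedAddCommGroup V] [InnerProductSpace ℝ V] {α ι : Type*}
  [MeasurableSpace α] {m : Measure α}

/-- The operator `T` is the limit along `l` of the correlations `∫ f ⊗ g`. -/
def IsCorrelation (l : Filter ι) (m : Measure α) (f g : ι → α → V) (T : V →L[ℝ] V) : Prop :=
  ∀ a b, Tendsto (fun i => ∫ s, ⟪f i s, a⟫_ℝ * ⟪g i s, b⟫_ℝ ∂m) l (𝓝 ⟪T a, b⟫_ℝ)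

omit [InnerProductSpace ℝ V] in
lemma memLp_norm_mul_norm_integrable {f g : α → V} (hf : MemLp f 2 m) (hg : MemLp g 2 m) :
    Integrable (fun s => ‖f s‖ * ‖g s‖) m :=
  MemLp.integrable_mul (p := 2) (q := 2) hf.norm hg.norm

omit [InnerProductSpace ℝ V] in
lemma memLp_norm_sq_integrable {f : α → V} (hf : MemLp f 2 m) :
    Integrable (fun s => ‖f s‖ ^ 2) m := hf.norm.integrable_sq

lemma memLp_inner_mul_inner_integrable {f g : α → V} (hf : MemLp f 2 m) (hg : MemLp g 2 m)
    (a b : V) : Integrable (fun s => ⟪f s, a⟫_ℝ * ⟪g s, b⟫_ℝ) m :=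
  MemLp.integrable_mul (p := 2) (q := 2) (hf.inner_const a) (hg.inner_const b)

omit [InnerProductSpace ℝ V] in
lemma integral_norm_mul_norm_le {f g : α → V} (hf : MemLp f 2 m) (hg : MemLp g 2 m) {C D : ℝ}
    (hC : ∫ s, ‖f s‖ ^ 2 ∂m ≤ C) (hD : ∫ s, ‖g s‖ ^ 2 ∂m ≤ D) :
    ∫ s, ‖f s‖ * ‖g s‖ ∂m ≤ (C + D) / 2 := by
  have h1 : ∫ s, ‖f s‖ * ‖g s‖ ∂m ≤ ∫ s, (‖f s‖ ^ 2 + ‖g s‖ ^ 2) / 2 ∂m :=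
    integral_mono (memLp_norm_mul_norm_integrable hf hg)
      (((memLp_norm_sq_integrable hf).add (memLp_norm_sq_integrable hg)).div_const 2)
      fun s => by
        change ‖f s‖ * ‖g s‖ ≤ (‖f s‖ ^ 2 + ‖g s‖ ^ 2) / 2
        nlinarith [sq_nonneg (‖f s‖ - ‖g s‖)]
  rw [integral_div, integral_add (memLp_norm_sq_integrable hf) (memLp_norm_sq_integrable hg)] at h1
  linarith

lemma abs_integral_inner_mul_inner_le {f g : α → V} (hf : MemLp f 2 m) (hg : MemLp g 2 m)
    {C D : ℝ} (hC : ∫ s, ‖f s‖ ^ 2 ∂m ≤ C) (hD : ∫ s, ‖g s‖ ^ 2 ∂m ≤ D) (a b : V) :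
    |∫ s, ⟪f s, a⟫_ℝ * ⟪g s, b⟫_ℝ ∂m| ≤ (C + D) / 2 * ‖a‖ * ‖b‖ := by
  rw [← Real.norm_eq_abs]
  refine (norm_integral_le_of_norm_le (g := fun s => ‖f s‖ * ‖g s‖ * (‖a‖ * ‖b‖))
    ((memLp_norm_mul_norm_integrable hf hg).mul_const _) (ae_of_all _ fun s => ?_)).trans ?_
  · rw [norm_mul]
    have h1 := norm_inner_le_norm (𝕜 := ℝ) (f s) a
    have h2 := norm_inner_le_norm (𝕜 := ℝ) (g s) b
    calc _ ≤ (‖f s‖ * ‖a‖) * (‖g s‖ * ‖b‖) := by gcongr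
      _ = _ := by ring
  · rw [integral_mul_const, mul_assoc]
    gcongr
    exact integral_norm_mul_norm_le hf hg hC hD

/-- Bounded families have correlation operators along ultrafilters. -/
lemma exists_isCorrelation [CompleteSpace V] (𝓤 : Ultrafilter ι) {f g : ι → α → V}
    (hf : ∀ i, MemLp (f i) 2 m) (hg : ∀ i, MemLp (g i) 2 m) {C D : ℝ}
    (hC : ∀ i, ∫ s, ‖f i s‖ ^ 2 ∂m ≤ C) (hD : ∀ i, ∫ s, ‖g i s‖ ^ 2 ∂m ≤ D) :
    ∃ T : V →L[ℝ] V, IsCorrelation 𝓤 m f g T := by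
  have hbd : ∀ a b i, |∫ s, ⟪f i s, a⟫_ℝ * ⟪g i s, b⟫_ℝ ∂m| ≤ (C + D) / 2 * ‖a‖ * ‖b‖ :=
    fun a b i => abs_integral_inner_mul_inner_le (hf i) (hg i) (hC i) (hD i) a b
  have hlim : ∀ a b, ∃ t : ℝ, |t| ≤ (C + D) / 2 * ‖a‖ * ‖b‖ ∧
      Tendsto (fun i => ∫ s, ⟪f i s, a⟫_ℝ * ⟪g i s, b⟫_ℝ ∂m) 𝓤 (𝓝 t) := by
    intro a b
    set r := (C + D) / 2 * ‖a‖ * ‖b‖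
    -- An ultrafilter pushed into a compact interval converges, so no subsequence and no
    -- separability is needed.
    have h1 := (isCompact_Icc (a := -r) (b := r)).ultrafilter_le_nhds
      (𝓤.map fun i => ∫ s, ⟪f i s, a⟫_ℝ * ⟪g i s, b⟫_ℝ ∂m)
      (by
        rw [Ultrafilter.coe_map, le_principal_iff, mem_map]
        exact univ_mem' fun i => abs_le.1 (hbd a b i))
    obtain ⟨t, ht, hle⟩ := h1
    exact ⟨t, abs_le.2 ht, hle⟩
  choose β hβ hlim using hlim
  have hi : ∀ a b i, Integrable (fun s => ⟪f i s, a⟫_ℝ * ⟪g i s, b⟫_ℝ) m := fun a b i =>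
    memLp_inner_mul_inner_integrable (hf i) (hg i) a b
  set Bl : V →ₗ[ℝ] V →ₗ[ℝ] ℝ := LinearMap.mk₂ ℝ β
    (fun a a' b => tendsto_nhds_unique (hlim (a + a') b) (by
      refine ((hlim a b).add (hlim a' b)).congr fun i => ?_
      rw [← integral_add (hi a b i) (hi a' b i)]
      exact integral_congr_ae (ae_of_all _ fun s => by simp [inner_add_right, add_mul])))
    (fun c a b => tendsto_nhds_unique (hlim (c • a) b) (by
      refine ((hlim a b).const_mul c).congr fun i => ?_
      rw [← integral_const_mul]
      exact integral_congr_ae (ae_of_all _ fun s => by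
        simp [real_inner_smul_right, mul_assoc])))
    (fun a b b' => tendsto_nhds_unique (hlim a (b + b')) (by
      refine ((hlim a b).add (hlim a b')).congr fun i => ?_
      rw [← integral_add (hi a b i) (hi a b' i)]
      exact integral_congr_ae (ae_of_all _ fun s => by simp [inner_add_right, mul_add])))
    (fun c a b => tendsto_nhds_unique (hlim a (c • b)) (by
      refine ((hlim a b).const_mul c).congr fun i => ?_
      rw [← integral_const_mul]
      exact integral_congr_ae (ae_of_all _ fun s => by
        simp only [real_inner_smul_right]; ring))) with hBl
  set Bc : V →L[ℝ] V →L[ℝ] ℝ := Bl.mkContinuous₂ ((C + D) / 2) fun a b => hβ a b with hBc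
  refine ⟨InnerProductSpace.continuousLinearMapOfBilin (𝕜 := ℝ) Bc, fun a b => ?_⟩
  rw [InnerProductSpace.continuousLinearMapOfBilin_apply]
  exact hlim a b

variable {l : Filter ι} [l.NeBot] {f g : ι → α → V} {R T : V →L[ℝ] V}

namespace IsCorrelation

lemma symm (hR : IsCorrelation l m f f R) (a b : V) : ⟪R a, b⟫_ℝ = ⟪a, R b⟫_ℝ := by
  rw [real_inner_comm (R b) a]
  refine tendsto_nhds_unique (hR a b) ((hR b a).congr fun i => ?_)
  exact integral_congr_ae (ae_of_all _ fun s => mul_comm _ _)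

lemma nonneg (hR : IsCorrelation l m f f R) (a : V) : 0 ≤ ⟪R a, a⟫_ℝ :=
  ge_of_tendsto' (hR a a) fun _ => integral_nonneg fun _ => mul_self_nonneg _

omit [l.NeBot] in
lemma sum (hR : IsCorrelation l m f g R) (hf : ∀ i, MemLp (f i) 2 m) (hg : ∀ i, MemLp (g i) 2 m)
    {κ : Type*} (s : Finset κ) (a b : κ → V) :
    Tendsto (fun i => ∫ t, ∑ k ∈ s, ⟪f i t, a k⟫_ℝ * ⟪g i t, b k⟫_ℝ ∂m) l
      (𝓝 (∑ k ∈ s, ⟪R (a k), b k⟫_ℝ)) := by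
  refine (tendsto_finsetSum s fun k _ => hR (a k) (b k)).congr fun i => ?_
  rw [integral_finsetSum]
  exact fun k _ => memLp_inner_mul_inner_integrable (hf i) (hg i) _ _

/-- Bessel's inequality under the integral bounds the partial traces of `R` by the energy. -/
lemma sum_le (hR : IsCorrelation l m f f R) (hf : ∀ i, MemLp (f i) 2 m) {C : ℝ}
    (hC : ∀ i, ∫ s, ‖f i s‖ ^ 2 ∂m ≤ C) {κ : Type*} (s : Finset κ) {v : κ → V}
    (hv : Orthonormal ℝ v) : ∑ k ∈ s, ⟪R (v k), v k⟫_ℝ ≤ C := by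
  refine le_of_tendsto' (hR.sum hf hf s v v) fun i => le_trans ?_ (hC i)
  refine integral_mono (integrable_finsetSum _ fun k _ =>
    memLp_inner_mul_inner_integrable (hf i) (hf i) _ _) (memLp_norm_sq_integrable (hf i))
    fun t => ?_
  refine le_trans (le_of_eq ?_) (hv.sum_inner_products_le (f i t) (s := s))
  exact Finset.sum_congr rfl fun k _ => by rw [real_inner_comm, Real.norm_eq_abs, sq_abs, sq]

lemma isCompactOperator [CompleteSpace V] (hR : IsCorrelation l m f f R)
    (hf : ∀ i, MemLp (f i) 2 m) {C : ℝ} (hC : ∀ i, ∫ s, ‖f i s‖ ^ 2 ∂m ≤ C) :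
    IsCompactOperator R :=
  isCompactOperator_of_trace hR.symm hR.nonneg fun _ _ hv => hR.sum_le hf hC Finset.univ hv

/-- Bessel's inequality for the correlations with a second family. -/
lemma sum_norm_sq_le (hR : IsCorrelation l m f f R) (hT : IsCorrelation l m f g T)
    (hf : ∀ i, MemLp (f i) 2 m) (hg : ∀ i, MemLp (g i) 2 m) {D : ℝ}
    (hD : ∀ i, ∫ s, ‖g i s‖ ^ 2 ∂m ≤ D) {κ : Type*} (s : Finset κ) {v : κ → V}
    (hv : Orthonormal ℝ v) {c : κ → ℝ} (hc : ∀ k ∈ s, c k ≠ 0) (hRv : ∀ k ∈ s, R (v k) = c k • v k) :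
    ∑ k ∈ s, c k * ‖(c k)⁻¹ • T (v k)‖ ^ 2 ≤ D := by
  classical
  -- The field `∑ ⟪f, v k⟫ w k` is the natural approximation of `g` by means of `f`. Its product
  -- with `g` and its own square both have limit `S`.
  set w : κ → V := fun k => (c k)⁻¹ • T (v k) with hw
  set S : ℝ := ∑ k ∈ s, c k * ‖w k‖ ^ 2 with hS
  have h1 : ∑ k ∈ s, ⟪T (v k), w k⟫_ℝ = S := by
    refine Finset.sum_congr rfl fun k hk => ?_
    have : T (v k) = c k • w k := by rw [hw]; simp only [smul_inv_smul₀ (hc k hk)]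
    rw [this, real_inner_smul_left, real_inner_self_eq_norm_sq]
  have h2 : ∑ p ∈ s ×ˢ s, ⟪R (v p.1), v p.2⟫_ℝ * ⟪w p.1, w p.2⟫_ℝ = S := by
    rw [Finset.sum_product]
    refine Finset.sum_congr rfl fun k hk => ?_
    rw [Finset.sum_eq_single k]
    · rw [hRv k hk, real_inner_smul_left, real_inner_self_eq_norm_sq, real_inner_self_eq_norm_sq,
        hv.1 k]
      ring
    · intro l _ hlk
      rw [hRv k hk, real_inner_smul_left, hv.2 (Ne.symm hlk)]
      simp
    · exact fun h => absurd hk h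
  have ht1 : Tendsto (fun i => ∫ t, ∑ k ∈ s, ⟪f i t, v k⟫_ℝ * ⟪g i t, w k⟫_ℝ ∂m) l (𝓝 S) := by
    rw [← h1]; exact hT.sum hf hg s v w
  have ht2 : Tendsto (fun i => ∫ t, ‖∑ k ∈ s, ⟪f i t, v k⟫_ℝ • w k‖ ^ 2 ∂m) l (𝓝 S) := by
    rw [← h2]
    refine (tendsto_finsetSum (s ×ˢ s) fun p _ =>
      (hR (v p.1) (v p.2)).mul_const ⟪w p.1, w p.2⟫_ℝ).congr fun i => ?_
    simp only [← integral_mul_const]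
    rw [← integral_finsetSum]
    · refine integral_congr_ae (ae_of_all _ fun t => ?_)
      simp only [← real_inner_self_eq_norm_sq, sum_inner, inner_sum, real_inner_smul_left,
        real_inner_smul_right]
      rw [Finset.sum_product, Finset.sum_comm]
      refine Finset.sum_congr rfl fun k _ => Finset.sum_congr rfl fun l _ => ?_
      rw [real_inner_comm (w k)]
      ring
    · exact fun p _ => (memLp_inner_mul_inner_integrable (hf i) (hf i) _ _).mul_const _
  -- Young's inequality `2 x y ≤ x² + y²` before the limit; the resulting `S / 2` is absorbed.
  have h3 : S ≤ (D + S) / 2 := by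
    refine le_of_tendsto_of_tendsto' ht1 ((ht2.const_add D).div_const 2) fun i => ?_
    have hm : MemLp (fun t => ∑ k ∈ s, ⟪f i t, v k⟫_ℝ • w k) 2 m :=
      memLp_finsetSum s fun k _ =>
      (((innerSL ℝ (v k)).smulRight (w k)).comp_memLp' (hf i)).ae_eq (ae_of_all _ fun t => by
        simp [real_inner_comm])
    refine le_trans ?_ (integral_norm_mul_norm_le (hg i) hm (hD i) le_rfl)
    refine integral_mono (integrable_finsetSum _ fun k _ =>
      memLp_inner_mul_inner_integrable (hf i) (hg i) _ _)
      (memLp_norm_mul_norm_integrable (hg i) hm) fun t => ?_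
    refine le_trans (le_of_eq ?_) (real_inner_le_norm (g i t) _)
    simp only [inner_sum, real_inner_smul_right]
  linarith

/-- The limit is the trace of `F R`. For rank one it is the definition of `R` together with its
spectral decomposition, and both sides are linear in `F`. -/
lemma tendsto_of_mem_finiteRank [CompleteSpace V] (hR : IsCorrelation l m f f R)
    (hf : ∀ i, MemLp (f i) 2 m) {C : ℝ} (hC : ∀ i, ∫ s, ‖f i s‖ ^ 2 ∂m ≤ C)
    {n : ℝ → ℕ} {v : (c : ℝ) → Fin (n c) → V}
    (hv : ∀ c, c ≠ 0 → ∀ i, R (v c i) = c • v c i)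
    (hbasis : ∀ c, c ≠ 0 → ∀ w, R w = c • w → w = ∑ i, ⟪v c i, w⟫_ℝ • v c i)
    {F : V →L[ℝ] V} (hF : F ∈ Domain.finiteRank V) :
    ∃ τ, HasSum (fun c => c * ∑ i, ⟪F (v c i), v c i⟫_ℝ) τ ∧
      Tendsto (fun i => ∫ s, ⟪F (f i s), f i s⟫_ℝ ∂m) l (𝓝 τ) := by
  have hi : ∀ (F : V →L[ℝ] V) i, Integrable (fun s => ⟪F (f i s), f i s⟫_ℝ) m := by
    intro F i
    refine ((memLp_norm_sq_integrable (hf i)).const_mul ‖F‖).mono'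
      ((F.continuous.comp_aestronglyMeasurable (hf i).1).inner (hf i).1) (ae_of_all _ fun s => ?_)
    refine (norm_inner_le_norm _ _).trans ?_
    rw [sq, ← mul_assoc]
    gcongr
    exact F.le_opNorm _
  induction hF using Submodule.span_induction with
  | mem F hF =>
    obtain ⟨a, b, rfl⟩ := hF
    refine ⟨⟪R a, b⟫_ℝ, ?_, ?_⟩
    · convert! hasSum_eigenvalues (hR.isCompactOperator hf hC) hR.symm hv hbasis a b using 1
      ext c
      simp [real_inner_smul_left]
    · refine (hR a b).congr fun i => integral_congr_ae (ae_of_all _ fun s => ?_)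
      change ⟪f i s, a⟫_ℝ * ⟪f i s, b⟫_ℝ = ⟪⟪a, f i s⟫_ℝ • b, f i s⟫_ℝ
      rw [real_inner_smul_left, real_inner_comm (f i s) a, real_inner_comm (f i s) b]
  | zero => exact ⟨0, by simp, by simp⟩
  | add F G _ _ hF hG =>
    obtain ⟨τ, h1, h2⟩ := hF
    obtain ⟨τ', h1', h2'⟩ := hG
    refine ⟨τ + τ', ?_, (h2.add h2').congr fun i => ?_⟩
    · convert! h1.add h1' using 1
      ext c
      simp [inner_add_left, Finset.sum_add_distrib, mul_add]
    · rw [← integral_add (hi F i) (hi G i)]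
      simp [inner_add_left]
  | smul c F _ hF =>
    obtain ⟨τ, h1, h2⟩ := hF
    refine ⟨c * τ, ?_, (h2.const_mul c).congr fun i => ?_⟩
    · convert! h1.mul_left c using 1
      ext d
      simp only [FunLike.coe_smul, Pi.smul_apply, real_inner_smul_left, ← Finset.mul_sum]
      ring
    · rw [← integral_const_mul]
      simp [real_inner_smul_left]

end IsCorrelation

end Correlation

/-! ### Passage to the limit in compact quadratic forms. -/

namespace Domain

variable {Ω : Domain} {α ι : Type*} [MeasurableSpace α] {m : Measure α}

lemma isWeakPartial_iff_inner {j : Fin 3} {u g : Ω.L2} : Ω.IsWeakPartial j u g ↔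
    ∀ (φ : E3 → ℝ) (hφ : Ω.SmoothCpt φ) (v : E3),
      ⟪u, ((hφ.fderiv_apply (e j)).smul_const v).toL2⟫_ℝ = -⟪g, (hφ.smul_const v).toL2⟫_ℝ := by
  rw [isWeakPartial_iff]
  refine forall_congr' fun φ => forall_congr' fun hφ => ?_
  have h1 : ∀ v : E3, (⟪u, ((hφ.fderiv_apply (e j)).smul_const v).toL2⟫_ℝ
      = -⟪g, (hφ.smul_const v).toL2⟫_ℝ) ↔
      ⟪pairL (hφ.fderiv_apply (e j)) u, v⟫_ℝ = ⟪-pairL hφ g, v⟫_ℝ := by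
    intro v
    rw [inner_smul_toL2 (hφ.fderiv_apply (e j)), inner_smul_toL2 hφ, pairL_apply, pairL_apply,
      inner_neg_left]
  simp only [h1]
  exact ⟨fun h v => by rw [h], fun h => ext_inner_right ℝ h⟩

/-- The weak relation between `u` and its derivative is linear in tests, so it survives in the
correlations. The range of `R` thereby inherits square integrable derivatives, hence so do the
eigenvectors for nonzero eigenvalues. -/
lemma isWeakPartial_of_isCorrelation {l : Filter ι} [l.NeBot] {u g : ι → α → Ω.L2} {j : Fin 3}
    (hw : ∀ i, ∀ᵐ s ∂m, Ω.IsWeakPartial j (u i s) (g i s)) {R T : Ω.L2 →L[ℝ] Ω.L2}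
    (hR : IsCorrelation l m u u R) (hT : IsCorrelation l m u g T) (a : Ω.L2) :
    Ω.IsWeakPartial j (R a) (T a) := by
  rw [isWeakPartial_iff_inner]
  intro φ hφ v
  refine tendsto_nhds_unique (hR a _) ((hT a _).neg.congr fun i => ?_)
  rw [← integral_neg]
  refine integral_congr_ae ?_
  filter_upwards [hw i] with s hs
  rw [isWeakPartial_iff_inner.1 hs φ hφ v]
  ring

lemma mem_H_of_isCorrelation {l : Filter ι} [l.NeBot] {u : ι → α → Ω.L2}
    (hu : ∀ i, ∀ᵐ s ∂m, u i s ∈ Ω.H) {R : Ω.L2 →L[ℝ] Ω.L2} (hR : IsCorrelation l m u u R)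
    (a : Ω.L2) : R a ∈ Ω.H := by
  rw [← Ω.H.orthogonal_orthogonal, Submodule.mem_orthogonal']
  intro w hw
  refine tendsto_nhds_unique (hR a w) (tendsto_const_nhds.congr fun i => ?_)
  rw [eq_comm]
  refine integral_eq_zero_of_ae ?_
  filter_upwards [hu i] with s hs
  rw [Submodule.inner_right_of_mem_orthogonal hs hw, mul_zero]
  rfl

/-- If the trace of the quadratic form `K` vanishes on the eigenspaces of the correlation operator,
then its average tends to zero. -/
theorem IsRellich.tendsto_zero {K : Ω.L2 →L[ℝ] Ω.L2} (hK : IsRellich K) {𝓤 : Ultrafilter ι}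
    {u : ι → α → Ω.L2} {G : ι → α → Fin 3 → Ω.L2} {C : ℝ} (hu : ∀ i, MemLp (u i) 2 m)
    (hC : ∀ i, ∫ s, ‖u i s‖ ^ 2 ∂m ≤ C) (hG : ∀ i j, MemLp (fun s => G i s j) 2 m)
    (hGC : ∀ i j, ∫ s, ‖G i s j‖ ^ 2 ∂m ≤ C)
    (hw : ∀ i, ∀ᵐ s ∂m, ∀ j, Ω.IsWeakPartial j (u i s) (G i s j))
    {R : Ω.L2 →L[ℝ] Ω.L2} (hR : IsCorrelation 𝓤 m u u R) {n : ℝ → ℕ}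
    {v : (c : ℝ) → Fin (n c) → Ω.L2} (hn : n 0 = 0) (hon : ∀ c, Orthonormal ℝ (v c))
    (hv : ∀ c, c ≠ 0 → ∀ i, R (v c i) = c • v c i)
    (hbasis : ∀ c, c ≠ 0 → ∀ w, R w = c • w → w = ∑ i, ⟪v c i, w⟫_ℝ • v c i)
    (h0 : ∀ c, c ≠ 0 → ∑ i, ⟪K (v c i), v c i⟫_ℝ = 0) :
    Tendsto (fun i => ∫ s, ⟪K (u i s), u i s⟫_ℝ ∂m) 𝓤 (𝓝 0) := by
  have hT : ∀ j, ∃ T : Ω.L2 →L[ℝ] Ω.L2, IsCorrelation 𝓤 m u (fun i s => G i s j) T := fun j =>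
    exists_isCorrelation 𝓤 hu (fun i => hG i j) hC (fun i => hGC i j)
  choose T hT using hT
  obtain ⟨i₀⟩ : Nonempty ι := (𝓤 : Filter ι).nonempty_of_neBot
  have hC0 : 0 ≤ C := (integral_nonneg fun _ => sq_nonneg _).trans (hC i₀)
  -- No vector is attached to the eigenvalue `0`, because `n 0 = 0`.
  have hne : ∀ c, Fin (n c) → c ≠ 0 := by
    intro c i hc
    subst hc
    exact (Fin.cast hn i).elim0
  have hv' : ∀ c i, R (v c i) = c • v c i := fun c i => hv c (hne c i) i
  set V : (Σ c, Fin (n c)) → Ω.L2 := fun p => v p.1 p.2 with hV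
  have hVon : Orthonormal ℝ V := by
    refine ⟨fun p => (hon p.1).1 p.2, ?_⟩
    rintro ⟨c, i⟩ ⟨d, k⟩ hne
    by_cases hcd : c = d
    · subst hcd
      exact (hon c).2 fun h => hne (congrArg (Sigma.mk c) h)
    · have h1 := hR.symm (v c i) (v d k)
      rw [hv', hv', real_inner_smul_left, real_inner_smul_right] at h1
      have h2 : (c - d) * ⟪v c i, v d k⟫_ℝ = 0 := by linarith
      exact (mul_eq_zero.1 h2).resolve_left (sub_ne_zero.2 hcd)
  have hRV : ∀ p, R (V p) = p.1 • V p := fun p => hv' _ _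
  have hpos : ∀ p : Σ c, Fin (n c), 0 ≤ p.1 := by
    intro p
    have h1 := hR.nonneg (V p)
    rw [hRV, real_inner_smul_left, real_inner_self_eq_norm_sq, hVon.1] at h1
    linarith
  -- From `R V = c V`, the derivative of an eigenvector is `c⁻¹` times its correlation with the
  -- gradients.
  set g : Fin 3 → (Σ c, Fin (n c)) → Ω.L2 := fun j p => p.1⁻¹ • T j (V p) with hg
  have hwp : ∀ p j, Ω.IsWeakPartial j (V p) (g j p) := by
    intro p j
    have h1 := (isWeakPartial_of_isCorrelation (fun i => (hw i).mono fun s hs => hs j) hR (hT j)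
      (V p)).smul p.1⁻¹
    rwa [hRV, inv_smul_smul₀ (hne _ p.2)] at h1
  have htr : ∀ s : Finset (Σ c, Fin (n c)), ∑ p ∈ s, p.1 ≤ C := by
    intro s
    refine le_trans (le_of_eq (Finset.sum_congr rfl fun p _ => ?_)) (hR.sum_le hu hC s hVon)
    rw [hRV, real_inner_smul_left, real_inner_self_eq_norm_sq, hVon.1]
    ring
  have hgr : ∀ (s : Finset (Σ c, Fin (n c))) j, ∑ p ∈ s, p.1 * ‖g j p‖ ^ 2 ≤ C := fun s j =>
    hR.sum_norm_sq_le (hT j) hu (fun i => hG i j) (fun i => hGC i j) s hVon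
      (fun p _ => hne _ p.2) (fun p _ => hRV p)
  have hint : ∀ (F : Ω.L2 →L[ℝ] Ω.L2) i, Integrable (fun s => ⟪F (u i s), u i s⟫_ℝ) m := by
    intro F i
    refine ((memLp_norm_sq_integrable (hu i)).const_mul ‖F‖).mono'
      ((F.continuous.comp_aestronglyMeasurable (hu i).1).inner (hu i).1) (ae_of_all _ fun s => ?_)
    refine (norm_inner_le_norm _ _).trans ?_
    rw [sq, ← mul_assoc]
    gcongr
    exact F.le_opNorm _
  rw [Metric.tendsto_nhds]
  intro δ hδ
  -- Three errors are added: `3 C η` for the trace of `F`, `3 C η` for replacing `K` by `F`, and `η`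
  -- for the limit, in all `δ / 2`.
  set η : ℝ := δ / (2 * (6 * C + 1)) with hη
  have hη0 : 0 < η := by positivity
  obtain ⟨F, hF, hKF⟩ := hK η hη0
  obtain ⟨τ, hs, ht⟩ := hR.tendsto_of_mem_finiteRank hu hC hv hbasis hF
  have hτ : |τ| ≤ 3 * C * η := by
    refine le_of_tendsto (f := fun s : Finset ℝ => |∑ c ∈ s, c * ∑ i, ⟪F (v c i), v c i⟫_ℝ|)
      ((continuous_abs.tendsto _).comp hs) (univ_mem' fun s => ?_)
    change |∑ c ∈ s, c * ∑ i, ⟪F (v c i), v c i⟫_ℝ| ≤ 3 * C * η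
    -- The trace of `K` vanishes on each eigenspace, so the trace of `F` is that of `F - K`, which
    -- is small on fields with controlled gradients.
    have h1 : ∑ c ∈ s, c * ∑ i, ⟪F (v c i), v c i⟫_ℝ
        = - ∑ p ∈ s.sigma (fun _ => Finset.univ), p.1 * ⟪K (V p) - F (V p), V p⟫_ℝ := by
      rw [Finset.sum_sigma, ← Finset.sum_neg_distrib]
      refine Finset.sum_congr rfl fun c _ => ?_
      by_cases hc : c = 0
      · simp [hc]
      · rw [← Finset.mul_sum]
        simp only [hV, inner_sub_left, Finset.sum_sub_distrib, h0 c hc]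
        ring
    rw [h1, abs_neg]
    refine (Finset.abs_sum_le_sum_abs _ _).trans ?_
    have h2 : ∀ p, |p.1 * ⟪K (V p) - F (V p), V p⟫_ℝ|
        ≤ ∑ j, η * ((p.1 + p.1 * ‖g j p‖ ^ 2) / 2) := by
      intro p
      rw [abs_mul, abs_of_nonneg (hpos p)]
      have h3 := abs_real_inner_le_norm (K (V p) - F (V p)) (V p)
      rw [hVon.1, mul_one] at h3
      calc _ ≤ p.1 * (η * ∑ j, ‖g j p‖) :=
            mul_le_mul_of_nonneg_left (h3.trans (hKF _ _ (hwp p))) (hpos p)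
        _ = ∑ j, η * (p.1 * ‖g j p‖) := by
          rw [Finset.mul_sum, Finset.mul_sum]
          exact Finset.sum_congr rfl fun j _ => by ring
        _ ≤ _ := by
          refine Finset.sum_le_sum fun j _ => mul_le_mul_of_nonneg_left ?_ hη0.le
          nlinarith [mul_nonneg (hpos p) (sq_nonneg (‖g j p‖ - 1))]
    refine (Finset.sum_le_sum fun p _ => h2 p).trans ?_
    rw [Finset.sum_comm]
    have h4 : ∀ j : Fin 3, ∑ p ∈ s.sigma (fun _ => Finset.univ),
        η * ((p.1 + p.1 * ‖g j p‖ ^ 2) / 2) ≤ C * η := by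
      intro j
      rw [← Finset.mul_sum, ← Finset.sum_div, Finset.sum_add_distrib, mul_comm]
      refine mul_le_mul_of_nonneg_right ?_ hη0.le
      have := htr (s.sigma fun _ => Finset.univ)
      have := hgr (s.sigma fun _ => Finset.univ) j
      linarith
    refine (Finset.sum_le_sum fun j _ => h4 j).trans (le_of_eq ?_)
    simp
    ring
  -- The same approximation before the limit, with the gradients of the family itself, and uniformly
  -- in `i`.
  have hdiff : ∀ i, |∫ s, ⟪K (u i s), u i s⟫_ℝ ∂m - ∫ s, ⟪F (u i s), u i s⟫_ℝ ∂m|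
      ≤ 3 * C * η := by
    intro i
    rw [← integral_sub (hint K i) (hint F i), ← Real.norm_eq_abs]
    refine (norm_integral_le_of_norm_le (g := fun s => ∑ j, η * (‖G i s j‖ * ‖u i s‖))
      (integrable_finsetSum _ fun j _ =>
        (memLp_norm_mul_norm_integrable (hG i j) (hu i)).const_mul η) ?_).trans ?_
    · filter_upwards [hw i] with s hs
      rw [← inner_sub_left]
      refine (norm_inner_le_norm _ _).trans ?_
      refine (mul_le_mul_of_nonneg_right (hKF _ _ hs) (norm_nonneg _)).trans (le_of_eq ?_)
      rw [Finset.mul_sum, Finset.sum_mul]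
      exact Finset.sum_congr rfl fun j _ => by ring
    · rw [integral_finsetSum _ fun j _ =>
        (memLp_norm_mul_norm_integrable (hG i j) (hu i)).const_mul η]
      have h4 : ∀ j : Fin 3, ∫ s, η * (‖G i s j‖ * ‖u i s‖) ∂m ≤ C * η := by
        intro j
        rw [integral_const_mul, mul_comm]
        refine mul_le_mul_of_nonneg_right ?_ hη0.le
        have := integral_norm_mul_norm_le (hG i j) (hu i) (hGC i j) (hC i)
        linarith
      refine (Finset.sum_le_sum fun j _ => h4 j).trans (le_of_eq ?_)
      simp
      ring
  filter_upwards [(Metric.tendsto_nhds.1 ht) η hη0] with i hi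
  rw [Real.dist_eq] at hi ⊢
  have h5 : (6 * C + 1) * η = δ / 2 := by rw [hη]; field_simp
  have h6 := abs_le.1 (hdiff i)
  have h7 := abs_le.1 hτ
  have h8 := abs_lt.1 hi
  rw [sub_zero, abs_lt]
  constructor <;> nlinarith

end Domain

namespace Rotation

open Domain

variable {Ω : Domain} (B : Rotation Ω) {α ι : Type*} [MeasurableSpace α] {m : Measure α}

/-- If the correlation operator commutes with `L`, then the average of the quadratic form of
`Π_⊥ u` tends to zero, for the test fields of `Ker L` supported in `𝒪 ∪ 𝒮`. -/
theorem tendsto_quadOp_PiPerp {𝓤 : Ultrafilter ι}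
    {u : ι → α → Ω.L2} {G : ι → α → Fin 3 → Ω.L2} {C : ℝ} (hu : ∀ i, MemLp (u i) 2 m)
    (hC : ∀ i, ∫ s, ‖u i s‖ ^ 2 ∂m ≤ C) (hG : ∀ i j, MemLp (fun s => G i s j) 2 m)
    (hGC : ∀ i j, ∫ s, ‖G i s j‖ ^ 2 ∂m ≤ C) (hH : ∀ i, ∀ᵐ s ∂m, u i s ∈ Ω.H)
    (hw : ∀ i, ∀ᵐ s ∂m, ∀ j, Ω.IsWeakPartial j (u i s) (G i s j))
    {R : Ω.L2 →L[ℝ] Ω.L2} (hR : IsCorrelation 𝓤 m u u R)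
    (hcomm : ∀ a ∈ Ω.H, R (B.L a) = B.L (R a)) {Φ : E3 → E3} (hΦ : Ω.SmoothCpt Φ)
    (hker : ∃ g ∈ B.KerL, ⇑g =ᵐ[Ω.μ] Φ) (hs : ∀ x ∈ tsupport Φ, hor x ∈ B.O ∪ B.S) :
    Tendsto (fun i => ∫ s, ⟪quadOp hΦ (B.PiPerp (u i s)), B.PiPerp (u i s)⟫_ℝ ∂m) 𝓤 (𝓝 0) := by
  obtain ⟨K, hK, hKq⟩ := B.exists_isRellich hΦ hker hs
  obtain ⟨hΦ2, hΦb⟩ := B.smooth_KerL hΦ hker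
  have hT : ∀ j, ∃ T : Ω.L2 →L[ℝ] Ω.L2, IsCorrelation 𝓤 m u (fun i s => G i s j) T := fun j =>
    exists_isCorrelation 𝓤 hu (fun i => hG i j) hC (fun i => hGC i j)
  choose T hT using hT
  have hΦ2' : ∀ x, fderiv ℝ Φ x (e 2) = 0 := by
    intro x
    have h1 : HasFDerivAt Φ (fderiv ℝ Φ x) (x + (0 : ℝ) • e 2) := by
      rw [zero_smul, add_zero]
      exact (hΦ.smooth.differentiable (by simp) x).hasFDerivAt
    have h2 : HasDerivAt (fun s : ℝ => x + s • e 2) (e 2) 0 := by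
      simpa using ((hasDerivAt_id (0 : ℝ)).smul_const (e 2)).const_add x
    have h3 := h1.comp_hasDerivAt (0 : ℝ) h2
    have h4 : (Φ ∘ fun s : ℝ => x + s • e 2) = fun _ => Φ x := funext fun s => hΦ2 x s
    rw [h4] at h3
    exact h3.unique (hasDerivAt_const _ _)
  have hcpt := hR.isCompactOperator hu hC
  have hex : ∀ c : ℝ, ∃ (n : ℕ) (v : Fin n → Ω.L2), (c = 0 → n = 0) ∧ Orthonormal ℝ v ∧
      (c ≠ 0 → (∀ i, R (v i) = c • v i) ∧ (∀ w, R w = c • w → w = ∑ i, ⟪v i, w⟫_ℝ • v i) ∧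
        ∑ i, ⟪K (v i), v i⟫_ℝ = 0) := by
    intro c
    by_cases hc : c = 0
    · exact ⟨0, Fin.elim0, fun _ => rfl, ⟨fun i => i.elim0, fun i => i.elim0⟩,
        fun h => absurd hc h⟩
    set E : Submodule ℝ Ω.L2 := Module.End.eigenspace (R : Ω.L2 →ₗ[ℝ] Ω.L2) c with hE
    have hmem : ∀ w, w ∈ E ↔ R w = c • w := fun w => Module.End.mem_eigenspace_iff
    have hfin : FiniteDimensional ℝ E := ContinuousLinearMap.finite_dimensional_eigenspace hcpt c hc
    have heq : ∀ w ∈ E, c⁻¹ • R w = w := by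
      intro w hw
      rw [(hmem w).1 hw, inv_smul_smul₀ hc]
    have hEH : E ≤ Ω.H := by
      intro w hw
      -- An eigenvector is `c⁻¹ R w`, so it has every property of the range of `R`.
      rw [← heq w hw]
      exact Ω.H.smul_mem _ (mem_H_of_isCorrelation hH hR w)
    obtain ⟨b, hb⟩ := B.exists_sum_quadOp_PiPerp_eq_zero hΦ hΦ2' hΦb E hEH
      (fun f hf j => ⟨c⁻¹ • T j f, by
        have h1 := (isWeakPartial_of_isCorrelation (fun i => (hw i).mono fun s hs => hs j) hR (hT j)
          f).smul c⁻¹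
        rwa [heq f hf] at h1⟩)
      (fun f hf => by
        -- Commutation with `R` makes the eigenspace invariant by `L`.
        rw [hmem, hcomm f (hEH hf), (hmem f).1 hf, map_smul])
    refine ⟨_, fun i => (b i : Ω.L2), fun h => absurd h hc, ?_, fun _ => ⟨fun i => ?_, ?_, ?_⟩⟩
    · exact b.orthonormal.comp_linearIsometry E.subtypeₗᵢ
    · exact (hmem _).1 (b i).2
    · intro w hw
      have h1 := congrArg (fun x : E => (x : Ω.L2)) (b.sum_repr ⟨w, (hmem w).2 hw⟩)
      simp only [b.repr_apply_apply, Submodule.coe_sum, Submodule.coe_smul, Submodule.coe_inner] at h1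
      exact h1.symm
    · rw [← hb]
      exact Finset.sum_congr rfl fun i _ => (hKq _ (hEH (b i).2)).symm
  choose n v hn hon hv using hex
  refine (hK.tendsto_zero hu hC hG hGC hw hR (hn 0 rfl) hon (fun c hc => (hv c hc).1)
    (fun c hc => (hv c hc).2.1) (fun c hc => (hv c hc).2.2)).congr fun i => ?_
  refine integral_congr_ae ?_
  filter_upwards [hH i] with s hs
  exact (hKq _ hs).symm

end Rotation

/-! ### Density of the smooth divergence free test fields in `H`. -/

namespace Domain

variable {Ω : Domain}

lemma div_curlTest {φ : E3 → ℝ} (hφ : Ω.SmoothCpt φ) (i j : Fin 3) (x : E3) :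
    div (curlTest φ i j) x = 0 := by
  have h1 : ∀ k, pd (curlTest φ i j) k k x
      = fderiv ℝ (fun y => fderiv ℝ φ y (e j)) x (e k) * e i k
        - fderiv ℝ (fun y => fderiv ℝ φ y (e i)) x (e k) * e j k := by
    intro k
    have ha : HasFDerivAt (curlTest φ i j) _ x :=
      (((hφ.fderiv_apply (e j)).differentiable x).hasFDerivAt.smul_const (e i)).sub
        (((hφ.fderiv_apply (e i)).differentiable x).hasFDerivAt.smul_const (e j))
    rw [pd, ha.fderiv]
    simp
  simp only [div, h1, Finset.sum_sub_distrib]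
  have h2 : ∀ (L : E3 →L[ℝ] ℝ) i, ∑ k, L (e k) * e i k = L (e i) := by
    intro L i
    rw [Finset.sum_eq_single i (fun k _ hk => by simp [e, hk]) (by simp)]
    simp [e]
  rw [h2, h2, fderiv_fderiv_apply hφ.smooth, sub_self]

/-- The smooth divergence free test fields. -/
def solenoidal (Ω : Domain) : Submodule ℝ Ω.L2 :=
  Submodule.span ℝ {g | ∃ (ψ : E3 → E3) (hψ : Ω.SmoothCpt ψ), (∀ x, div ψ x = 0) ∧ g = hψ.toL2}

lemma toL2_mem_solenoidal {ψ : E3 → E3} (hψ : Ω.SmoothCpt ψ) (h : ∀ x, div ψ x = 0) :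
    hψ.toL2 ∈ Ω.solenoidal := Submodule.subset_span ⟨ψ, hψ, h, rfl⟩

lemma solenoidal_le_H : Ω.solenoidal ≤ Ω.H := by
  refine Submodule.span_le.2 ?_
  rintro _ ⟨ψ, hψ, hd, rfl⟩
  refine mem_H_iff_sum.2 fun φ hφ => ?_
  have h1 : ∀ j, ∫ x, fderiv ℝ φ x (e j) * hψ.toL2 x j ∂Ω.μ
      = - ∫ x, φ x * pd ψ j j x ∂Ω.μ := by
    intro j
    have h2 := integral_fderiv_mul hφ (hψ.coord j) (e j)
    simp only [fderiv_coord hψ.differentiable] at h2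
    change _ = - ∫ x, φ x * fderiv ℝ ψ x (e j) j ∂Ω.μ
    rw [← h2]
    refine integral_congr_ae ?_
    filter_upwards [hψ.coeFn_toL2] with x hx
    rw [hx]
  simp only [h1, Finset.sum_neg_distrib]
  rw [← integral_finsetSum]
  · simp only [← Finset.mul_sum]
    simp [show ∀ x, ∑ j, pd ψ j j x = 0 from hd]
  · intro j _
    have h2 := (((hψ.coord j).fderiv_apply (e j)).mul_left hφ.smooth hφ.periodic).integrable
    simpa only [fderiv_coord hψ.differentiable] using! h2

lemma trans_mem_solenoidal {v : Ω.L2} (hv : v ∈ Ω.solenoidal) (h : E3) :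
    Ω.trans h v ∈ Ω.solenoidal := by
  induction hv using Submodule.span_induction with
  | mem v hv =>
    obtain ⟨ψ, hψ, hd, rfl⟩ := hv
    rw [trans_toL2]
    refine toL2_mem_solenoidal _ fun x => ?_
    have := hd (x + h)
    simpa only [div, pd, fderiv_comp_add_right] using this
  | zero => rw [map_zero]; exact zero_mem _
  | add x y _ _ hx hy => rw [map_add]; exact add_mem hx hy
  | smul a x _ hx => rw [map_smul]; exact Submodule.smul_mem _ _ hx

/-- The fields of `H` which are orthogonal to the test fields. -/
def defect (Ω : Domain) : Submodule ℝ Ω.L2 := Ω.H ⊓ Ω.solenoidalᗮ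

lemma trans_mem_defect {u : Ω.L2} (hu : u ∈ Ω.defect) (h : E3) : Ω.trans h u ∈ Ω.defect := by
  refine ⟨trans_mem_H hu.1 h, ?_⟩
  refine (Submodule.mem_orthogonal' _ _).2 fun v hv => ?_
  have h1 := Submodule.inner_left_of_mem_orthogonal (trans_mem_solenoidal hv (-h)) hu.2
  rw [← (Ω.trans h).inner_map_map, trans_trans, add_neg_cancel, trans_zero] at h1
  exact h1

lemma isClosed_defect : IsClosed (Ω.defect : Set Ω.L2) :=
  isClosed_H.inter (Submodule.isClosed_orthogonal _)

lemma avg_mem_defect {u : Ω.L2} (hu : u ∈ Ω.defect) (j : Fin 3) (δ : ℝ) :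
    avg j δ u ∈ Ω.defect :=
  avg_mem_of_trans_mem j δ _ isClosed_defect fun _ => trans_mem_defect hu _

/-- Fields of the defect space are irrotational. -/
lemma irrotational_of_mem_defect {u : Ω.L2} (hu : u ∈ Ω.defect) {g : Fin 3 → Ω.L2}
    (hg : ∀ j, Ω.IsWeakPartial j u (g j)) (i j : Fin 3) : ∀ᵐ x ∂Ω.μ, g j x i = g i x j := by
  have hl := (locallyIntegrable_coord i (g j)).sub (locallyIntegrable_coord j (g i))
  have := ae_eq_zero_of_integral_smul (Ω := Ω) (f := fun x => g j x i - g i x j) hl (fun φ hφ => by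
    have h0 := Submodule.inner_left_of_mem_orthogonal
      (toL2_mem_solenoidal (hφ.curlTest i j) (div_curlTest hφ i j)) hu.2
    rw [inner_curlTest hφ, (hg j).integral_mul hφ, (hg i).integral_mul hφ] at h0
    simp only [smul_eq_mul, mul_sub]
    rw [integral_sub (integrable_mul_coord hφ _ _) (integrable_mul_coord hφ _ _)]
    linarith)
  filter_upwards [this] with x hx
  exact sub_eq_zero.1 hx

/-- Divergence free and irrotational fields are constant. -/
lemma partial_eq_zero_of_irrotational {u : Ω.L2} {g : Fin 3 → Ω.L2}
    (hg : ∀ j, Ω.IsWeakPartial j u (g j)) (hcurl : ∀ i j, ∀ᵐ x ∂Ω.μ, g j x i = g i x j)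
    (hgH : ∀ j, g j ∈ Ω.H) (hg' : ∀ j k, ∃ g', Ω.IsWeakPartial k (g j) g') (j : Fin 3) :
    g j = 0 := by
  choose g' hg' using hg'
  -- Summed over `j`, the right side contains the divergence of `∂_k u`, which is zero. Summed over
  -- `k`, the left side is `‖∂_j u‖²` because the field is irrotational.
  have h1 : ∀ j k, ⟪matL (unitMat j k) (g j), g k⟫_ℝ
      = - ⟪matL (unitMat j k) u, g' k j⟫_ℝ := fun j k =>
    ((hg j).clm _ (matL_trans _)).inner_eq (hg' k j)
  have h2 : ∀ (j k : Fin 3) (v w : Ω.L2), ⟪matL (unitMat j k) v, w⟫_ℝ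
      = ∫ x, v x k * w x j ∂Ω.μ := by
    intro j k v w
    rw [L2.inner_def]
    refine integral_congr_ae ?_
    filter_upwards [coeFn_matL (unitMat j k) v] with x hx
    rw [hx, unitMat_apply, real_inner_smul_left, inner_e]
  have hint : ∀ (j k : Fin 3) (v w : Ω.L2), Integrable (fun x => v x k * w x j) Ω.μ := by
    intro j k v w
    refine (L2.integrable_inner (𝕜 := ℝ) (matL (unitMat j k) v) w).congr ?_
    filter_upwards [coeFn_matL (unitMat j k) v] with x hx
    rw [hx, unitMat_apply, real_inner_smul_left, inner_e]
  have h3 : ∀ k, ∑ j, ⟪matL (unitMat j k) (g j), g k⟫_ℝ = 0 := by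
    intro k
    simp only [h1, h2, Finset.sum_neg_distrib]
    rw [neg_eq_zero, ← integral_finsetSum _ fun j _ => hint j k _ _]
    refine integral_eq_zero_of_ae ?_
    filter_upwards [div_eq_zero (hgH k) (hg' k)] with x hx
    rw [← Finset.mul_sum, hx, mul_zero]
    rfl
  have h4 : ∀ j, ∑ k, ⟪matL (unitMat j k) (g j), g k⟫_ℝ = ‖g j‖ ^ 2 := by
    intro j
    simp only [h2]
    rw [← integral_finsetSum _ fun k _ => hint j k _ _, ← real_inner_self_eq_norm_sq, L2.inner_def]
    refine integral_congr_ae ?_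
    filter_upwards [ae_all_iff.2 fun k => hcurl j k] with x hx
    simp only [hx, PiLp.inner_apply]
    exact Finset.sum_congr rfl fun k _ => by simp [sq]
  have h5 : ∑ j, ‖g j‖ ^ 2 = 0 := by
    simp only [← h4]
    rw [Finset.sum_comm]
    exact Finset.sum_eq_zero fun k _ => h3 k
  have h6 := (Finset.sum_eq_zero_iff_of_nonneg fun j _ => sq_nonneg ‖g j‖).1 h5 j (Finset.mem_univ _)
  exact norm_eq_zero.1 (pow_eq_zero_iff two_ne_zero |>.1 h6)

/-- A square integrable field which is invariant by the translations along a full line is zero. -/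
lemma eq_zero_of_trans_of_line (h0 : Ω.len 0 = 0) {u : Ω.L2}
    (hu : ∀ h : E3, Ω.trans h u = u) : u = 0 := by
  -- The fields vanishing for large `|x 0|` are dense, and each is orthogonal to a far translate of
  -- itself.
  set S : Submodule ℝ Ω.L2 :=
    { carrier := {w | ∃ R : ℝ, ∀ᵐ x ∂Ω.μ, R < |x 0| → w x = 0}
      add_mem' := by
        rintro v w ⟨R, hv⟩ ⟨R', hw⟩
        refine ⟨max R R', ?_⟩
        filter_upwards [hv, hw, Lp.coeFn_add v w] with x h1 h2 h3 h4
        rw [h3, Pi.add_apply, h1 ((le_max_left _ _).trans_lt h4),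
          h2 ((le_max_right _ _).trans_lt h4), add_zero]
      zero_mem' := ⟨0, by
        filter_upwards [Lp.coeFn_zero E3 2 Ω.μ] with x h1 h2
        rw [h1]; rfl⟩
      smul_mem' := by
        rintro c v ⟨R, hv⟩
        refine ⟨R, ?_⟩
        filter_upwards [hv, Lp.coeFn_smul c v] with x h1 h2 h3
        rw [h2, Pi.smul_apply, h1 h3, smul_zero] } with hS
  have hd : Dense (S : Set Ω.L2) := by
    refine dense_tests S fun φ hφ v => ?_
    obtain ⟨R, hR⟩ := (hφ.smul_const v).compact_support
    refine ⟨R, ?_⟩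
    filter_upwards [(hφ.smul_const v).coeFn_toL2] with x h1 h2
    rw [h1]
    by_contra h3
    exact absurd (hR x (subset_tsupport _ h3) 0 h0) (not_le.2 h2)
  have horth : ∀ w ∈ S, ∃ h : E3, ⟪Ω.trans h w, w⟫_ℝ = 0 := by
    rintro w ⟨R, hw⟩
    -- This shift separates the slab `|x 0| ≤ R` from its translate.
    refine ⟨(2 * |R| + 1) • e 0, ?_⟩
    rw [L2.inner_def]
    refine integral_eq_zero_of_ae ?_
    have h1 := (Ω.measurePreserving_shift ((2 * |R| + 1) • e 0)).quasiMeasurePreserving.ae hw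
    filter_upwards [hw, h1, coeFn_trans ((2 * |R| + 1) • e 0) w] with x h2 h3 h4
    have h5 : Ω.shift ((2 * |R| + 1) • e 0) x 0 = x 0 + (2 * |R| + 1) := by
      rw [shift, wrap_apply, if_pos h0]
      simp [e]
    rw [h5] at h3
    by_cases h6 : R < |x 0|
    · rw [h2 h6, inner_zero_right]; rfl
    · rw [h4, h3 ?_, inner_zero_left]; rfl
      have h7 := abs_le.1 (not_lt.1 h6)
      have h8 := le_abs_self R
      refine lt_of_lt_of_le ?_ (le_abs_self _)
      linarith [abs_nonneg R]
  by_contra hne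
  have hpos : 0 < ‖u‖ := norm_pos_iff.2 hne
  obtain ⟨w, hwS, hw⟩ := hd.exists_dist_lt u (ε := ‖u‖ / 4) (by positivity)
  obtain ⟨h, hh⟩ := horth w hwS
  rw [dist_eq_norm] at hw
  -- With `‖u - w‖ < ‖u‖ / 4` the right side is below `(1 / 4 + 5 / 16) ‖u‖²`, a contradiction.
  have h1 : ⟪u, u⟫_ℝ = ⟪Ω.trans h (u - w), u⟫_ℝ + ⟪Ω.trans h w, u - w⟫_ℝ := by
    rw [inner_sub_right, hh, sub_zero, ← inner_add_left, ← map_add, sub_add_cancel, hu]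
  have h2 := real_inner_le_norm (Ω.trans h (u - w)) u
  have h3 := real_inner_le_norm (Ω.trans h w) (u - w)
  rw [LinearIsometry.norm_map] at h2 h3
  rw [real_inner_self_eq_norm_sq] at h1
  have h4 : ‖w‖ ≤ ‖u‖ + ‖u - w‖ := norm_le_norm_add_norm_sub _ _
  nlinarith [norm_nonneg (u - w), norm_nonneg w]

/-- A field of a compact domain which is invariant by translations is constant. -/
lemma eq_zero_of_trans_of_compact (h0 : 0 < Ω.len 0) (h1 : 0 < Ω.len 1) {u : Ω.L2}
    (hu : ∀ h : E3, Ω.trans h u = u)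
    (hc : ∀ (v : E3) (hv : Ω.SmoothCpt fun _ => v), ⟪u, hv.toL2⟫_ℝ = 0) : u = 0 := by
  have hlen : ∀ i, Ω.len i ≠ 0 := by
    intro i
    fin_cases i
    · exact h0.ne'
    · exact h1.ne'
    · exact Ω.vertical.ne'
  have hone : Ω.SmoothCpt fun _ => (1 : ℝ) :=
    ⟨contDiff_const, fun _ _ => rfl, 0, fun x _ i hi => absurd hi (hlen i)⟩
  have hint1 := hone.integrable
  have hfin : IsFiniteMeasure Ω.μ := by
    rcases integrable_const_iff.1 hint1 with h | h
    · exact absurd h one_ne_zero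
    · exact h
  have hmean : pairL hone u = 0 := by
    refine ext_inner_right ℝ fun v => ?_
    rw [pairL_apply, ← inner_smul_toL2 hone, inner_zero_left]
    have h2 := hc v ⟨contDiff_const, fun _ _ => rfl, 0, fun x _ i hi => absurd hi (hlen i)⟩
    simp only [one_smul]
    exact h2
  rw [pairL_apply] at hmean
  simp only [one_smul] at hmean
  have huI : Integrable u Ω.μ := (Lp.memLp u).integrable (by norm_num)
  refine pairL_ext fun φ hφ => ?_
  rw [map_zero]
  have hinv : ∀ h : E3, ∫ x, φ (x + h) • u x ∂Ω.μ = pairL hφ u := by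
    intro h
    have h2 := pairL_trans hφ (-h) u
    rw [hu, pairL_apply (hφ.translate _)] at h2
    rw [h2]
    simp
  have hφI : ∀ x : E3, ∫ h, φ (x + h) ∂Ω.μ = ∫ h, φ h ∂Ω.μ := by
    intro x
    have h2 := integral_comp_shift x (Ω := Ω) hφ.integrable.aestronglyMeasurable
    rw [← h2]
    refine integral_congr_ae (ae_of_all _ fun h => ?_)
    change φ (x + h) = φ (Ω.shift x h)
    rw [hφ.periodic.comp_shift, add_comm]
  obtain ⟨C, hC0, hC⟩ := hφ.exists_bound
  have hF : Integrable (fun p : E3 × E3 => φ (p.2 + p.1) • u p.2) (Ω.μ.prod Ω.μ) := by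
    refine ((huI.comp_snd Ω.μ).norm.const_mul C).mono' ?_ (ae_of_all _ fun p => ?_)
    · have h2 : Continuous fun p : E3 × E3 => φ (p.2 + p.1) := by
        have := hφ.continuous
        fun_prop
      exact h2.aestronglyMeasurable.smul (huI.comp_snd Ω.μ).aestronglyMeasurable
    · rw [norm_smul]
      gcongr
      exact hC _
  -- Averaged over all translations `h`, the constant pairing becomes, in the other order of
  -- integration, the integral of `φ` times the mean of `u`, which is zero.
  have h3 := integral_integral_swap (f := fun h x => φ (x + h) • u x) hF
  simp only [hinv, integral_smul_const, hφI] at h3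
  rw [integral_smul, hmean, smul_zero, integral_const] at h3
  rcases smul_eq_zero.1 h3 with h4 | h4
  · rw [measureReal_def, ENNReal.toReal_eq_zero_iff, or_iff_left (measure_ne_top _ _),
      Measure.measure_univ_eq_zero] at h4
    rw [pairL_apply]
    refine integral_eq_zero_of_ae ?_
    rw [EventuallyEq, ae_eq_bot.2 h4]
    exact eventually_bot
  · exact h4

lemma eq_zero_of_avg_eq_zero (j : Fin 3) {u : Ω.L2} (h : ∀ δ > 0, avg j δ u = 0) : u = 0 := by
  refine norm_eq_zero.1 (le_antisymm (le_of_forall_pos_le_add fun η hη => ?_) (norm_nonneg _))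
  have h1 := (continuous_trans_smul (e j) u).tendsto 0
  rw [zero_smul, trans_zero] at h1
  obtain ⟨δ, hδ, hd⟩ := Metric.tendsto_nhds_nhds.1 h1 η hη
  have h2 := norm_avg_sub_le j (half_pos hδ) (C := η) u fun s hs => by
    have := hd (x := s) (by
      rw [Real.dist_eq, sub_zero, abs_of_nonneg hs.1]
      linarith [hs.2])
    rw [dist_eq_norm] at this
    exact this.le
  rwa [h _ (half_pos hδ), zero_sub, norm_neg, ← zero_add η] at h2

/-- Averages commute, so any direction can be taken outermost, where the average is differentiable
with derivative again in the defect space. -/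
lemma avg_avg_avg_mem_defect {u : Ω.L2} (hu : u ∈ Ω.defect) (a b c : ℝ) :
    avg 0 a (avg 1 b (avg 2 c u)) ∈ Ω.defect ∧
    ∀ j, ∃ g ∈ Ω.defect, Ω.IsWeakPartial j (avg 0 a (avg 1 b (avg 2 c u))) g := by
  refine ⟨avg_mem_defect (avg_mem_defect (avg_mem_defect hu _ _) _ _) _ _, ?_⟩
  have hd : ∀ (j : Fin 3) (δ : ℝ) {v : Ω.L2}, v ∈ Ω.defect →
      ∃ g ∈ Ω.defect, Ω.IsWeakPartial j (avg j δ v) g := fun j δ v hv =>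
    ⟨_, Submodule.smul_mem _ _ (sub_mem (trans_mem_defect hv _) hv), isWeakPartial_avg j δ v⟩
  intro j
  fin_cases j
  · exact hd 0 a (avg_mem_defect (avg_mem_defect hu _ _) _ _)
  · rw [avg_comm 0 1]
    exact hd 1 b (avg_mem_defect (avg_mem_defect hu _ _) _ _)
  · rw [avg_comm 1 2, avg_comm 0 2]
    exact hd 2 c (avg_mem_defect (avg_mem_defect hu _ _) _ _)

/-- A regular element is divergence free and irrotational, hence invariant by translations. It is
zero by integrability on a full line; on a compact domain, the constants are themselves divergence
free tests. Two triple averages supply the two derivatives needed, and an element whose averages all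
vanish is zero. -/
theorem defect_eq_bot : Ω.defect = ⊥ := by
  have hreg : ∀ u ∈ Ω.defect, ∀ g : Fin 3 → Ω.L2, (∀ j, Ω.IsWeakPartial j u (g j)) →
      (∀ j, g j ∈ Ω.H) → (∀ j k, ∃ g', Ω.IsWeakPartial k (g j) g') → u = 0 := by
    intro u hu g hg hgH hg'
    have h1 := partial_eq_zero_of_irrotational hg (irrotational_of_mem_defect hu hg) hgH hg'
    have h2 : ∀ j (s : ℝ), Ω.trans (s • e j) u = u := fun j s => by
      have := hg j
      rw [h1 j] at this
      exact this.trans_eq s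
    have h3 : ∀ h : E3, Ω.trans h u = u := by
      intro h
      rw [eq_sum_smul_e h, ← trans_trans, ← trans_trans, h2, h2, h2]
    rcases Ω.horizontal with ⟨h0, -⟩ | ⟨h0, h1⟩
    · exact eq_zero_of_trans_of_line h0 h3
    · refine eq_zero_of_trans_of_compact h0 h1 h3 fun v hv => ?_
      exact Submodule.inner_left_of_mem_orthogonal
        (toL2_mem_solenoidal hv fun x => by simp [div, pd]) hu.2
  rw [Submodule.eq_bot_iff]
  intro u hu
  refine eq_zero_of_avg_eq_zero 2 fun c _ => eq_zero_of_avg_eq_zero 1 fun b _ =>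
    eq_zero_of_avg_eq_zero 0 fun a _ => eq_zero_of_avg_eq_zero 2 fun c' _ =>
    eq_zero_of_avg_eq_zero 1 fun b' _ => eq_zero_of_avg_eq_zero 0 fun a' _ => ?_
  obtain ⟨hm, hp⟩ := avg_avg_avg_mem_defect hu a b c
  choose g hgm hg using hp
  refine hreg _ (avg_avg_avg_mem_defect hm a' b' c').1
    (fun j => avg 0 a' (avg 1 b' (avg 2 c' (g j)))) (fun j => ?_) (fun j => ?_) (fun j k => ?_)
  · exact (((hg j).clm _ (avg_trans 2 c')).clm _ (avg_trans 1 b')).clm _ (avg_trans 0 a')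
  · exact (avg_avg_avg_mem_defect (hgm j) a' b' c').1.1
  · obtain ⟨g', -, h⟩ := (avg_avg_avg_mem_defect (hgm j) a' b' c').2 k
    exact ⟨g', h⟩

/-- The smooth divergence free test fields are dense in `H`. -/
lemma mem_closure_solenoidal {u : Ω.L2} (hu : u ∈ Ω.H) : u ∈ Ω.solenoidal.topologicalClosure := by
  set K := Ω.solenoidal.topologicalClosure with hK
  have hKH : K ≤ Ω.H := Submodule.topologicalClosure_minimal _ solenoidal_le_H isClosed_H
  have : CompleteSpace K := Ω.solenoidal.isClosed_topologicalClosure.completeSpace_coe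
  have h1 : u - K.starProjection u ∈ Ω.defect := by
    refine ⟨sub_mem hu (hKH (Submodule.starProjection_apply_mem _ _)), ?_⟩
    exact Submodule.orthogonal_le Ω.solenoidal.le_topologicalClosure
      (Submodule.sub_starProjection_mem_orthogonal u)
  rw [defect_eq_bot, Submodule.mem_bot, sub_eq_zero] at h1
  rw [h1]
  exact Submodule.starProjection_apply_mem _ _

end Domain

/-! ### Weak derivatives in time on the half-line. -/

section Primitive

lemma absolutelyContinuous_const_add_integral {h : ℝ → ℝ} {a b : ℝ}
    (hh : IntervalIntegrable h volume a b) (k : ℝ) {c : ℝ} (hc : c ∈ uIcc a b) :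
    AbsolutelyContinuousOnInterval (fun x => k + ∫ v in c..x, h v) a b := by
  have h1 : AbsolutelyContinuousOnInterval (fun _ : ℝ => k) a b :=
    ((LipschitzWith.const k).lipschitzOnWith (s := uIcc a b)).absolutelyContinuousOnInterval
  exact h1.add (hh.absolutelyContinuousOnInterval_intervalIntegral hc)

/-- The product rule for primitives. -/
lemma integral_mul_primitive {h₁ h₂ : ℝ → ℝ} {s t : ℝ} (hs : 0 ≤ s) (hst : s ≤ t)
    (hh₁ : IntervalIntegrable h₁ volume 0 t) (hh₂ : IntervalIntegrable h₂ volume 0 t) (k₁ k₂ : ℝ) :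
    ∫ x in s..t, (h₁ x * (k₂ + ∫ v in (0 : ℝ)..x, h₂ v) + (k₁ + ∫ v in (0 : ℝ)..x, h₁ v) * h₂ x)
      = (k₁ + ∫ v in (0 : ℝ)..t, h₁ v) * (k₂ + ∫ v in (0 : ℝ)..t, h₂ v)
        - (k₁ + ∫ v in (0 : ℝ)..s, h₁ v) * (k₂ + ∫ v in (0 : ℝ)..s, h₂ v) := by
  have hsub : uIcc s t ⊆ uIcc 0 t := by
    rw [uIcc_of_le hst, uIcc_of_le (hs.trans hst)]
    exact Icc_subset_Icc_left hs
  have a1 := (absolutelyContinuous_const_add_integral hh₁ k₁ left_mem_uIcc).mono hsub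
  have a2 := (absolutelyContinuous_const_add_integral hh₂ k₂ left_mem_uIcc).mono hsub
  rw [← a1.integral_deriv_mul_eq_sub a2]
  refine intervalIntegral.integral_congr_ae ?_
  filter_upwards [hh₁.ae_hasDerivAt_integral, hh₂.ae_hasDerivAt_integral] with x d1 d2 hx
  have hx' := hsub (uIoc_subset_uIcc hx)
  have e1 := ((d1 hx' 0 left_mem_uIcc).const_add k₁).deriv
  have e2 := ((d2 hx' 0 left_mem_uIcc).const_add k₂).deriv
  rw [e1, e2]

/-- A function on the half-line with an integrable weak derivative is a primitive. -/
lemma ae_eq_primitive {f h : ℝ → ℝ} {f0 : ℝ} (hf : ∀ T, 0 ≤ T → IntervalIntegrable f volume 0 T)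
    (hh : ∀ T, 0 ≤ T → IntervalIntegrable h volume 0 T)
    (heq : ∀ θ : ℝ → ℝ, ContDiff ℝ ∞ θ → HasCompactSupport θ →
      ∫ t in Ioi (0 : ℝ), (-(deriv θ t * f t) + θ t * h t) = θ 0 * f0) :
    ∀ᵐ t ∂(volume.restrict (Ioi (0 : ℝ))), f t = f0 + ∫ v in (0 : ℝ)..t, -h v := by
  set F : ℝ → ℝ := fun t => f0 + ∫ v in (0 : ℝ)..t, -h v with hF
  have hFc : ∀ T, 0 ≤ T → ContinuousOn F (uIcc 0 T) := fun T hT =>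
    (absolutelyContinuous_const_add_integral (hh T hT).neg f0 left_mem_uIcc).continuousOn
  rw [ae_restrict_iff' measurableSet_Ioi]
  have key := isOpen_Ioi.ae_eq_zero_of_integral_contDiff_smul_eq_zero (U := Ioi (0 : ℝ))
    (μ := volume) (f := fun t => f t - F t) ?_ ?_
  · filter_upwards [key] with t ht h0
    exact sub_eq_zero.1 (ht h0)
  · intro x hx
    have hx1 : 0 ≤ x + 1 := by linarith [mem_Ioi.1 hx]
    refine ⟨Ioc 0 (x + 1), inter_mem_nhdsWithin (Ioi 0) (Iic_mem_nhds (by linarith)), ?_⟩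
    rw [← intervalIntegrable_iff_integrableOn_Ioc_of_le hx1]
    exact (hf _ hx1).sub (hFc _ hx1).intervalIntegrable
  intro χ hχ hχc hχs
  obtain ⟨M, hM0, hM⟩ : ∃ M : ℝ, 0 < M ∧ ∀ t, M < t → χ t = 0 := by
    obtain ⟨M, hM⟩ := hχc.isCompact.isBounded.subset_closedBall 0
    refine ⟨max M 1, by positivity, fun t ht => ?_⟩
    by_contra hne
    have h1 := hM (subset_tsupport _ hne)
    rw [mem_closedBall_zero_iff, Real.norm_eq_abs] at h1
    have h2 := le_abs_self t
    have h3 := (le_max_left M 1).trans_lt ht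
    linarith
  have hχ0 : ∀ t, t ≤ 0 → χ t = 0 := fun t ht => by
    by_contra hne
    exact absurd (hχs (subset_tsupport _ hne)) (not_lt.2 ht)
  have hχi : ∀ a b, IntervalIntegrable χ volume a b := fun a b =>
    hχ.continuous.intervalIntegrable a b
  -- The constant makes the primitive `X` of `χ` vanish beyond `M`.
  set k : ℝ := - ∫ v in (0 : ℝ)..M, χ v with hk
  set X : ℝ → ℝ := fun t => k + ∫ v in (0 : ℝ)..t, χ v with hX
  have hXd : ∀ t, HasDerivAt X (χ t) t := fun t =>
    (intervalIntegral.integral_hasDerivAt_right (hχi 0 t)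
      (hχ.continuous.stronglyMeasurableAtFilter _ _) hχ.continuous.continuousAt).const_add k
  have hXs : ContDiff ℝ ∞ X := by
    rw [contDiff_infty_iff_deriv]
    refine ⟨fun t => (hXd t).differentiableAt, ?_⟩
    rwa [funext fun t => (hXd t).deriv]
  have hX0 : ∀ t, M ≤ t → X t = 0 := by
    intro t ht
    have h1 : ∫ v in M..t, χ v = 0 := by
      rw [intervalIntegral.integral_of_le ht]
      exact setIntegral_eq_zero_of_forall_eq_zero fun v hv => hM v hv.1
    have h2 := intervalIntegral.integral_add_adjacent_intervals (hχi 0 M) (hχi M t)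
    change k + ∫ v in (0 : ℝ)..t, χ v = 0
    rw [← h2, h1, hk]
    ring
  -- A cutoff at negative times gives a compact support on the whole line and leaves `X` unchanged
  -- for `t > -1`, so that the value at `0` is kept.
  set θ : ℝ → ℝ := fun t => Real.smoothTransition (t + 2) * X t with hθ
  have hθs : ContDiff ℝ ∞ θ :=
    (Real.smoothTransition.contDiff.comp (contDiff_id.add contDiff_const)).mul hXs
  have hθc : HasCompactSupport θ := by
    refine HasCompactSupport.intro (K := Icc (-2) M) isCompact_Icc fun t ht => ?_
    rw [hθ]
    rcases lt_or_ge t (-2) with h1 | h1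
    · simp only [Real.smoothTransition.zero_of_nonpos (by linarith : t + 2 ≤ 0), zero_mul]
    · have h2 : M ≤ t := by
        by_contra h3
        exact ht ⟨h1, (not_le.1 h3).le⟩
      simp only [hX0 t h2, mul_zero]
  have hθX : ∀ t, -1 < t → θ t = X t := by
    intro t ht
    simp only [hθ, Real.smoothTransition.one_of_one_le (by linarith : 1 ≤ t + 2), one_mul]
  have hθd : ∀ t, -1 < t → deriv θ t = χ t := by
    intro t ht
    have h1 : θ =ᶠ[𝓝 t] X := by
      filter_upwards [lt_mem_nhds ht] with s hs using hθX s hs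
    rw [h1.deriv_eq, (hXd t).deriv]
  have h1 := heq θ hθs hθc
  rw [hθX 0 (by norm_num)] at h1
  have h2 : ∫ t in Ioi (0 : ℝ), (-(deriv θ t * f t) + θ t * h t)
      = ∫ t in (0 : ℝ)..M, (-(χ t * f t) + X t * h t) := by
    rw [intervalIntegral.integral_of_le hM0.le]
    rw [setIntegral_eq_of_subset_of_forall_sdiff_eq_zero measurableSet_Ioi
      (Ioc_subset_Ioi_self : Ioc 0 M ⊆ Ioi 0)]
    · refine setIntegral_congr_fun measurableSet_Ioc fun t ht => ?_
      simp only [hθd t (by linarith [ht.1]), hθX t (by linarith [ht.1])]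
    · intro t ht
      have h3 : M < t := by
        by_contra h4
        exact ht.2 ⟨ht.1, not_lt.1 h4⟩
      simp only [hθd t (by linarith), hθX t (by linarith), hX0 t h3.le, hM t h3]
      ring
  -- The product rule shows that the primitive `F` satisfies the same weak equation as `f`; by
  -- subtraction `f - F` is orthogonal to `χ`.
  have h3 := integral_mul_primitive le_rfl hM0.le (hχi 0 M) (hh M hM0.le).neg k f0
  have hXc : ContinuousOn X (uIcc 0 M) := hXs.continuous.continuousOn
  have i1 : IntervalIntegrable (fun t => χ t * f t) volume 0 M :=
    (hf M hM0.le).continuousOn_mul hχ.continuous.continuousOn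
  have i2 : IntervalIntegrable (fun t => X t * h t) volume 0 M :=
    (hh M hM0.le).continuousOn_mul hXc
  have i3 : IntervalIntegrable (fun t => χ t * F t) volume 0 M :=
    (hχi 0 M).mul_continuousOn (hFc M hM0.le)
  have h4 : ∫ x in (0 : ℝ)..M, (χ x * F x - X x * h x) = X M * F M - X 0 * f0 := by
    have : X 0 * f0 = (k + ∫ v in (0 : ℝ)..0, χ v) * (f0 + ∫ v in (0 : ℝ)..0, -h v) := by
      simp [hX]
    rw [this]
    refine Eq.trans ?_ h3
    refine intervalIntegral.integral_congr fun x _ => ?_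
    simp only [hX, hF, Pi.neg_apply]
    ring
  rw [hX0 M le_rfl, zero_mul, zero_sub, intervalIntegral.integral_sub i3 i2] at h4
  have i1' : IntervalIntegrable (fun t => -(χ t * f t)) volume 0 M := i1.neg
  rw [h2, intervalIntegral.integral_add i1' i2, intervalIntegral.integral_neg] at h1
  have h5 : ∫ x, χ x • (f x - F x) = ∫ x in (0 : ℝ)..M, (χ x * f x - χ x * F x) := by
    rw [intervalIntegral.integral_of_le hM0.le, ← integral_indicator measurableSet_Ioc]
    congr 1
    ext x
    by_cases hx : x ∈ Ioc 0 M
    · rw [indicator_of_mem hx, smul_eq_mul, mul_sub]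
    · rw [indicator_of_notMem hx]
      have : χ x = 0 := by
        rcases le_or_gt x 0 with h6 | h6
        · exact hχ0 x h6
        · exact hM x (by
            by_contra h7
            exact hx ⟨h6, not_lt.1 h7⟩)
      rw [this, zero_smul]
  rw [h5, intervalIntegral.integral_sub i1 i3]
  linarith

end Primitive

/-! ### Evolution of weak solutions against static test fields. -/

section WeakSolutions

open Domain

variable {Ω : Domain} (B : Rotation Ω)

/-- The part of the time derivative of `⟪u, ψ⟫` due to viscosity and convection. -/
def forcing {ψ : E3 → E3} (hψ : Ω.SmoothCpt ψ) (ν : ℝ) (v : Ω.L2) (g : Fin 3 → Ω.L2) : ℝ :=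
  ν * ∑ j, ⟪g j, (hψ.fderiv_apply (e j)).toL2⟫_ℝ - ⟪quadOp hψ v, v⟫_ℝ

lemma integrable_inner_test {ψ : E3 → E3} (hψ : Ω.SmoothCpt ψ) (v : Ω.L2) :
    Integrable (fun x => ⟪v x, ψ x⟫_ℝ) Ω.μ := by
  refine (L2.integrable_inner (𝕜 := ℝ) v hψ.toL2).congr ?_
  filter_upwards [hψ.coeFn_toL2] with x hx
  rw [hx]

/-- The weak formulation against the product of a function of time and a static field. -/
lemma integral_static_test {ψ : E3 → E3} (hψ : Ω.SmoothCpt ψ) (hd : ∀ x, div ψ x = 0)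
    (ν ε a b : ℝ) (v : Ω.L2) (g : Fin 3 → Ω.L2) :
    ∫ x, (- ⟪v x, a • ψ x⟫_ℝ + ν * ∑ j, ⟪g j x, b • fderiv ℝ ψ x (e j)⟫_ℝ
        - ∑ i, ∑ j, v x i * v x j * (b * pd ψ i j x)
        + (1 / ε) * ⟪wedge (v x) (B.b (hor x)), b • ψ x⟫_ℝ) ∂Ω.μ
      = -(a * ⟪v, hψ.toL2⟫_ℝ) + b * (forcing hψ ν v g + (1 / ε) * ⟪B.wedgeL2 v, hψ.toL2⟫_ℝ) := by
  have h1 := integrable_inner_test hψ v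
  have h2 : ∀ j, Integrable (fun x => ⟪g j x, fderiv ℝ ψ x (e j)⟫_ℝ) Ω.μ := fun j =>
    integrable_inner_test (hψ.fderiv_apply (e j)) (g j)
  have h3 : Integrable (fun x => ∑ i, ∑ j, v x i * v x j * pd ψ i j x) Ω.μ :=
    integrable_finsetSum _ fun i _ => integrable_finsetSum _ fun j _ =>
      (integrable_mul3 (hψ.pd i j) v v i j).congr (ae_of_all _ fun x => by ring)
  have h4 : Integrable (fun x => ⟪wedge (v x) (B.b (hor x)), ψ x⟫_ℝ) Ω.μ := by
    refine (integrable_inner_test hψ (B.wedgeL2 v)).congr ?_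
    filter_upwards [B.coeFn_wedgeL2 v] with x hx
    rw [hx]
  -- For a divergence free test the convection term and the quadratic form of `quadOp` coincide.
  have e3 : ∫ x, ∑ i, ∑ j, v x i * v x j * pd ψ i j x ∂Ω.μ = ⟪quadOp hψ v, v⟫_ℝ := by
    rw [← integral_quad hψ]
    simp only [hd, mul_zero, sub_zero]
  have e4 : ∫ x, ⟪wedge (v x) (B.b (hor x)), ψ x⟫_ℝ ∂Ω.μ = ⟪B.wedgeL2 v, hψ.toL2⟫_ℝ := by
    rw [hψ.inner_toL2]
    refine integral_congr_ae ?_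
    filter_upwards [B.coeFn_wedgeL2 v] with x hx
    rw [hx]
  have e0 : ∀ x, (- ⟪v x, a • ψ x⟫_ℝ + ν * ∑ j, ⟪g j x, b • fderiv ℝ ψ x (e j)⟫_ℝ
        - ∑ i, ∑ j, v x i * v x j * (b * pd ψ i j x)
        + (1 / ε) * ⟪wedge (v x) (B.b (hor x)), b • ψ x⟫_ℝ)
      = (-a) * ⟪v x, ψ x⟫_ℝ + b * (ν * ∑ j, ⟪g j x, fderiv ℝ ψ x (e j)⟫_ℝ
        - ∑ i, ∑ j, v x i * v x j * pd ψ i j x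
        + (1 / ε) * ⟪wedge (v x) (B.b (hor x)), ψ x⟫_ℝ) := by
    intro x
    have h5 : ∑ i, ∑ j, v x i * v x j * (b * pd ψ i j x)
        = b * ∑ i, ∑ j, v x i * v x j * pd ψ i j x := by
      simp only [Finset.mul_sum]
      exact Finset.sum_congr rfl fun i _ => Finset.sum_congr rfl fun j _ => by ring
    rw [h5]
    simp only [real_inner_smul_right, ← Finset.mul_sum]
    ring
  simp only [e0]
  have h6 : Integrable (fun x => ν * ∑ j, ⟪g j x, fderiv ℝ ψ x (e j)⟫_ℝ) Ω.μ :=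
    (integrable_finsetSum _ fun j _ => h2 j).const_mul ν
  have h7 : Integrable (fun x => ν * ∑ j, ⟪g j x, fderiv ℝ ψ x (e j)⟫_ℝ
      - ∑ i, ∑ j, v x i * v x j * pd ψ i j x) Ω.μ := h6.sub h3
  have h8 : Integrable (fun x => ν * ∑ j, ⟪g j x, fderiv ℝ ψ x (e j)⟫_ℝ
      - ∑ i, ∑ j, v x i * v x j * pd ψ i j x
      + (1 / ε) * ⟪wedge (v x) (B.b (hor x)), ψ x⟫_ℝ) Ω.μ := h7.add (h4.const_mul _)
  rw [integral_add (h1.const_mul _) (h8.const_mul b),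
    integral_const_mul, integral_const_mul, integral_add h7 (h4.const_mul _),
    integral_sub h6 h3, integral_const_mul, integral_const_mul, e3, e4,
    integral_finsetSum _ fun j _ => h2 j, ← hψ.inner_toL2, forcing]
  simp only [← (hψ.fderiv_apply (e _)).inner_toL2]
  ring

/-- A smooth function of time with compact support times a static test field. -/
lemma isTestField_static {ψ : E3 → E3} (hψ : Ω.SmoothCpt ψ) {θ : ℝ → ℝ} (hθ : ContDiff ℝ ∞ θ)
    (hc : HasCompactSupport θ) : Ω.IsTestField fun t x => θ t • ψ x := by
  obtain ⟨R, hR⟩ := hψ.compact_support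
  obtain ⟨M, hM⟩ := hc.isCompact.isBounded.subset_closedBall 0
  refine ⟨(hθ.comp contDiff_fst).smul (hψ.smooth.comp contDiff_snd), fun t x i => ?_,
    max R M, fun p hp => ⟨?_, fun i hi => ?_⟩⟩
  · simp only [hψ.periodic x i]
  · have h1 : p ∈ Prod.fst ⁻¹' tsupport θ := by
      refine closure_minimal (fun q hq => ?_) ((isClosed_tsupport θ).preimage continuous_fst) hp
      refine subset_tsupport _ fun h => hq ?_
      simp only [h, zero_smul]
    have h2 := hM h1
    rw [mem_closedBall_zero_iff, Real.norm_eq_abs] at h2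
    exact h2.trans (le_max_right _ _)
  · have h1 : p ∈ Prod.snd ⁻¹' tsupport ψ := by
      refine closure_minimal (fun q hq => ?_) ((isClosed_tsupport ψ).preimage continuous_snd) hp
      refine subset_tsupport _ fun h => hq ?_
      simp only [h, smul_zero]
    exact (hR _ h1 i hi).trans (le_max_left _ _)

/-- The properties of weak solutions which are used: bounds, regularity, and the evolution of the
products with static test fields. -/
structure SolutionBounds (ν ε : ℝ) (u0 : Ω.L2) (u : ℝ → Ω.L2) (G : ℝ → Fin 3 → Ω.L2) : Prop where
  aestronglyMeasurable : AEStronglyMeasurable u (volume.restrict (Ioi 0))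
  memLp_grad : ∀ j, MemLp (fun t => G t j) 2 (volume.restrict (Ioi 0))
  mem_H : ∀ᵐ t ∂(volume.restrict (Ioi (0 : ℝ))), u t ∈ Ω.H
  isWeakPartial : ∀ᵐ t ∂(volume.restrict (Ioi (0 : ℝ))), ∀ j, Ω.IsWeakPartial j (u t) (G t j)
  norm_le : ∀ᵐ t ∂(volume.restrict (Ioi (0 : ℝ))), ‖u t‖ ≤ ‖u0‖
  grad_le : ∀ T, ∀ j, ∫ t in Ioc 0 T, ‖G t j‖ ^ 2 ≤ ‖u0‖ ^ 2 / (2 * ν)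
  evolution : ∀ (ψ : E3 → E3) (hψ : Ω.SmoothCpt ψ), (∀ x, div ψ x = 0) →
    ∀ θ : ℝ → ℝ, ContDiff ℝ ∞ θ → HasCompactSupport θ →
      ∫ t in Ioi (0 : ℝ), (-(deriv θ t * ⟪u t, hψ.toL2⟫_ℝ)
        + θ t * (forcing hψ ν (u t) (G t) + (1 / ε) * ⟪B.wedgeL2 (u t), hψ.toL2⟫_ℝ))
      = θ 0 * ⟪u0, hψ.toL2⟫_ℝ

lemma IsWeakSolution.exists_bounds {ν ε : ℝ} (hν : 0 < ν) {u0 : Ω.L2} {u : ℝ → Ω.L2}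
    (h : IsWeakSolution B ν ε u0 u) : ∃ G, SolutionBounds B ν ε u0 u G := by
  obtain ⟨hum, hH, G, hG, hw, hen, heq⟩ := h
  have hGi : ∀ j, Integrable (fun t => ‖G t j‖ ^ 2) (volume.restrict (Ioi 0)) := fun j =>
    memLp_norm_sq_integrable (hG j)
  have hsum : Integrable (fun t => ∑ j, ‖G t j‖ ^ 2) (volume.restrict (Ioi 0)) :=
    integrable_finsetSum _ fun j _ => hGi j
  refine ⟨G, hum, hG, hH, hw, ?_, fun T j => ?_, fun ψ hψ hd θ hθ hc => ?_⟩
  · filter_upwards [hen] with t ht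
    have h1 : 0 ≤ ∫ s in Ioc 0 t, ∑ j, ‖G s j‖ ^ 2 :=
      integral_nonneg fun s => Finset.sum_nonneg fun j _ => sq_nonneg _
    refine abs_le_of_sq_le_sq' ?_ (norm_nonneg _) |>.2
    nlinarith [mul_nonneg hν.le h1]
  -- The energy inequality holds only almost everywhere, possibly not at `T`, so it is used at a
  -- later time.
  · have h1 : ∃ t ∈ Ioi (max T 0), ‖u t‖ ^ 2 + 2 * ν * ∫ s in Ioc 0 t, ∑ j, ‖G s j‖ ^ 2 ≤ ‖u0‖ ^ 2 := by
      have h2 : ∀ᵐ t ∂(volume.restrict (Ioi (max T 0))),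
          ‖u t‖ ^ 2 + 2 * ν * ∫ s in Ioc 0 t, ∑ j, ‖G s j‖ ^ 2 ≤ ‖u0‖ ^ 2 :=
        ae_restrict_of_ae_restrict_of_subset (Ioi_subset_Ioi (le_max_right _ _)) hen
      have h3 : ∀ᵐ t ∂(volume.restrict (Ioi (max T 0))), t ∈ Ioi (max T 0) :=
        ae_restrict_mem measurableSet_Ioi
      have h4 : (ae (volume.restrict (Ioi (max T 0)))).NeBot := by
        rw [ae_neBot, Ne, Measure.restrict_eq_zero, Real.volume_Ioi]
        exact ENNReal.top_ne_zero
      obtain ⟨t, ht⟩ := (h3.and h2).exists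
      exact ⟨t, ht.1, ht.2⟩
    obtain ⟨t, ht, hle⟩ := h1
    have ht' := max_lt_iff.1 (mem_Ioi.1 ht)
    have h5 : ∫ s in Ioc 0 T, ‖G s j‖ ^ 2 ≤ ∫ s in Ioc 0 t, ∑ j, ‖G s j‖ ^ 2 := by
      refine (setIntegral_mono_set ((hGi j).mono_measure (Measure.restrict_mono Ioc_subset_Ioi_self le_rfl))
        (ae_of_all _ fun s => sq_nonneg _)
        (Ioc_subset_Ioc_right ht'.1.le).eventuallyLE).trans ?_
      refine integral_mono
        ((hGi j).mono_measure (Measure.restrict_mono Ioc_subset_Ioi_self le_rfl))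
        (hsum.mono_measure (Measure.restrict_mono Ioc_subset_Ioi_self le_rfl)) fun s => ?_
      exact Finset.single_le_sum (f := fun j => ‖G s j‖ ^ 2) (fun j _ => sq_nonneg _)
        (Finset.mem_univ j)
    rw [le_div_iff₀ (by positivity)]
    nlinarith [sq_nonneg ‖u t‖]
  · have h1 := heq _ (isTestField_static hψ hθ hc) (fun t x => by
      have h2 : ∀ i, pd (fun x => θ t • ψ x) i i x = θ t * pd ψ i i x := fun i => by
        rw [pd, fderiv_fun_const_smul (hψ.differentiable x)]
        rfl
      simp only [div, h2, ← Finset.mul_sum]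
      rw [show ∑ i, pd ψ i i x = 0 from hd x, mul_zero])
    have h2 : ∀ t x, deriv (fun s => θ s • ψ x) t = deriv θ t • ψ x := fun t x =>
      deriv_smul_const (hθ.differentiable (by simp) t) _
    have h3 : ∀ t x, fderiv ℝ (fun x => θ t • ψ x) x = θ t • fderiv ℝ ψ x := fun t x =>
      fderiv_fun_const_smul (hψ.differentiable x) _
    have h4 : ∀ t i j x, pd (fun x => θ t • ψ x) i j x = θ t * pd ψ i j x := fun t i j x => by
      rw [pd, h3]
      rfl
    simp only [h2, h3, h4, FunLike.coe_smul, Pi.smul_apply] at h1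
    simp only [integral_static_test B hψ hd] at h1
    rw [h1, hψ.inner_toL2, ← integral_const_mul]
    simp only [real_inner_smul_right]

end WeakSolutions

/-! ### Uniform estimates and the averaging of fast oscillations. -/

section Estimates

open Domain

variable {Ω : Domain} {B : Rotation Ω} {ν ε : ℝ} {u0 : Ω.L2}

lemma Rotation.inner_wedgeL2_eq_neg {u : Ω.L2} (hu : u ∈ Ω.H) (v : Ω.L2) :
    ⟪B.wedgeL2 u, v⟫_ℝ = -⟪u, B.L v⟫_ℝ := by
  rw [B.inner_wedgeL2_left, real_inner_comm (B.L v), B.inner_L hu, real_inner_comm]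

lemma ae_Ioc_of_ae_Ioi {p : ℝ → Prop} {s t : ℝ} (hs : 0 ≤ s)
    (hp : ∀ᵐ t ∂(volume.restrict (Ioi (0 : ℝ))), p t) : ∀ᵐ x ∂(volume.restrict (Ioc s t)), p x :=
  ae_restrict_of_ae_restrict_of_subset (fun _ hx => hs.trans_lt hx.1) hp

lemma restrict_Ioc_le {s t : ℝ} (hs : 0 ≤ s) :
    volume.restrict (Ioc s t) ≤ volume.restrict (Ioi (0 : ℝ)) :=
  Measure.restrict_mono (fun _ hx => hs.trans_lt hx.1) le_rfl

/-- A uniform bound of the forcing on a time interval. -/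
def forcingBound {ψ : E3 → E3} (hψ : Ω.SmoothCpt ψ) (ν : ℝ) (u0 : Ω.L2) (T : ℝ) : ℝ :=
  ν * ∑ j, (T + ‖u0‖ ^ 2 / (2 * ν)) / 2 * ‖(hψ.fderiv_apply (e j)).toL2‖
    + T * (‖quadOp hψ‖ * ‖u0‖ ^ 2)

/-- A bound which is satisfied almost everywhere by a continuous function is satisfied
everywhere. -/
lemma abs_le_of_ae_le {F : ℝ → ℝ} {K T : ℝ} (hT : 0 < T) (hF : ContinuousOn F (Icc 0 T))
    (h : ∀ᵐ t ∂(volume.restrict (Ioi (0 : ℝ))), |F t| ≤ K) {t : ℝ} (ht : t ∈ Icc 0 T) :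
    |F t| ≤ K := by
  have h1 : (fun t => max |F t| K) =ᵐ[volume.restrict (Icc 0 T)] fun _ => K := by
    rw [← Measure.restrict_congr_set Ioc_ae_eq_Icc]
    filter_upwards [ae_Ioc_of_ae_Ioi le_rfl h] with t ht
    exact max_eq_right ht
  have h2 := Measure.eqOn_Icc_of_ae_eq (μ := volume) hT.ne h1
    (hF.abs.sup continuousOn_const) continuousOn_const ht
  exact max_eq_right_iff.1 h2

namespace SolutionBounds

variable {u : ℝ → Ω.L2} {G : ℝ → Fin 3 → Ω.L2}

lemma memLp (h : SolutionBounds B ν ε u0 u G) {s t : ℝ} (hs : 0 ≤ s) :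
    MemLp u 2 (volume.restrict (Ioc s t)) :=
  MemLp.of_bound (h.aestronglyMeasurable.mono_measure (restrict_Ioc_le hs)) ‖u0‖
    (ae_Ioc_of_ae_Ioi hs h.norm_le)

lemma memLp_partial (h : SolutionBounds B ν ε u0 u G) {s t : ℝ} (hs : 0 ≤ s) (j : Fin 3) :
    MemLp (fun x => G x j) 2 (volume.restrict (Ioc s t)) :=
  (h.memLp_grad j).mono_measure (restrict_Ioc_le hs)

lemma integral_norm_sq_le (h : SolutionBounds B ν ε u0 u G) {s t : ℝ} (hs : 0 ≤ s) (hst : s ≤ t) :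
    ∫ x in Ioc s t, ‖u x‖ ^ 2 ≤ t * ‖u0‖ ^ 2 := by
  have h1 : ∫ x in Ioc s t, ‖u x‖ ^ 2 ≤ ∫ x in Ioc s t, ‖u0‖ ^ 2 := by
    refine integral_mono_ae (memLp_norm_sq_integrable (h.memLp hs)) (integrable_const _) ?_
    filter_upwards [ae_Ioc_of_ae_Ioi hs h.norm_le] with x hx
    gcongr
  refine h1.trans ?_
  rw [setIntegral_const, smul_eq_mul, Real.volume_real_Ioc_of_le hst]
  gcongr
  linarith

lemma integral_partial_le (h : SolutionBounds B ν ε u0 u G) {s t : ℝ} (hs : 0 ≤ s) (j : Fin 3) :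
    ∫ x in Ioc s t, ‖G x j‖ ^ 2 ≤ ‖u0‖ ^ 2 / (2 * ν) := by
  refine le_trans ?_ (h.grad_le t j)
  exact setIntegral_mono_set (memLp_norm_sq_integrable (h.memLp_partial le_rfl j))
    (ae_of_all _ fun x => sq_nonneg _) (Ioc_subset_Ioc_left hs).eventuallyLE

lemma intervalIntegrable_inner (h : SolutionBounds B ν ε u0 u G) {T : ℝ} (hT : 0 ≤ T) (v : Ω.L2) :
    IntervalIntegrable (fun t => ⟪u t, v⟫_ℝ) volume 0 T := by
  rw [intervalIntegrable_iff_integrableOn_Ioc_of_le hT]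
  exact ((h.memLp le_rfl).integrable (by norm_num)).inner_const v

lemma forcing_le (h : SolutionBounds B ν ε u0 u G) (hν : 0 < ν) {ψ : E3 → E3}
    (hψ : Ω.SmoothCpt ψ) {T : ℝ} (hT : 0 ≤ T) :
    IntegrableOn (fun t => forcing hψ ν (u t) (G t)) (Ioc 0 T) ∧
    ∫ t in Ioc 0 T, |forcing hψ ν (u t) (G t)| ≤ forcingBound hψ ν u0 T := by
  -- Only the square of the gradient is controlled, whence the bound of `a` by `(1 + a ^ 2) / 2`.
  set b : ℝ → ℝ := fun t => ν * ∑ j, (1 + ‖G t j‖ ^ 2) / 2 * ‖(hψ.fderiv_apply (e j)).toL2‖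
    + ‖quadOp hψ‖ * ‖u0‖ ^ 2 with hb
  have hGi : ∀ j, Integrable (fun t => ‖G t j‖ ^ 2) (volume.restrict (Ioc 0 T)) := fun j =>
    memLp_norm_sq_integrable (h.memLp_partial le_rfl j)
  have hi : ∀ j, Integrable (fun t => (1 + ‖G t j‖ ^ 2) / 2 * ‖(hψ.fderiv_apply (e j)).toL2‖)
      (volume.restrict (Ioc 0 T)) := fun j =>
    (((integrable_const 1).add (hGi j)).div_const 2).mul_const _
  have hbi : Integrable b (volume.restrict (Ioc 0 T)) :=
    ((integrable_finsetSum _ fun j _ => hi j).const_mul ν).add (integrable_const _)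
  have hle : ∀ᵐ t ∂(volume.restrict (Ioc 0 T)), |forcing hψ ν (u t) (G t)| ≤ b t := by
    filter_upwards [ae_Ioc_of_ae_Ioi le_rfl h.norm_le] with t ht
    rw [forcing, hb]
    refine (abs_sub _ _).trans (add_le_add ?_ ?_)
    · rw [abs_mul, abs_of_pos hν]
      gcongr
      refine (Finset.abs_sum_le_sum_abs _ _).trans (Finset.sum_le_sum fun j _ => ?_)
      refine (abs_real_inner_le_norm _ _).trans ?_
      gcongr
      nlinarith [sq_nonneg (‖G t j‖ - 1)]
    · refine (abs_real_inner_le_norm _ _).trans ?_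
      rw [sq, ← mul_assoc]
      gcongr
      exact ((quadOp hψ).le_opNorm _).trans (by gcongr)
  have hum : AEStronglyMeasurable u (volume.restrict (Ioc 0 T)) := (h.memLp le_rfl).1
  have hmeas : AEStronglyMeasurable (fun t => forcing hψ ν (u t) (G t))
      (volume.restrict (Ioc 0 T)) := by
    refine AEStronglyMeasurable.sub (AEStronglyMeasurable.const_mul ?_ ν)
      (((quadOp hψ).continuous.comp_aestronglyMeasurable hum).inner hum)
    exact Finset.aestronglyMeasurable_fun_sum _ fun j _ =>
      (h.memLp_partial le_rfl j).1.inner aestronglyMeasurable_const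
  have hint : Integrable (fun t => forcing hψ ν (u t) (G t)) (volume.restrict (Ioc 0 T)) :=
    hbi.mono' hmeas hle
  refine ⟨hint, (integral_mono_ae hint.abs hbi hle).trans ?_⟩
  rw [hb, integral_add ((integrable_finsetSum _ fun j _ => hi j).const_mul ν) (integrable_const _),
    integral_const_mul, integral_finsetSum _ fun j _ => hi j, setIntegral_const, smul_eq_mul,
    Real.volume_real_Ioc_of_le hT, sub_zero, forcingBound]
  gcongr with j
  rw [integral_mul_const, integral_div, integral_add (integrable_const 1) (hGi j),
    setIntegral_const, smul_eq_mul, Real.volume_real_Ioc_of_le hT, sub_zero, mul_one]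
  gcongr
  exact h.grad_le T j

/-- The fast oscillations make the correlations with the range of `L` small. -/
lemma abs_integral_bracket_le (h : SolutionBounds B ν ε u0 u G) (hν : 0 < ν) (hε : 0 < ε)
    {ψ φ : E3 → E3} (hψ : Ω.SmoothCpt ψ) (hφ : Ω.SmoothCpt φ) (dψ : ∀ x, div ψ x = 0)
    (dφ : ∀ x, div φ x = 0) {s t : ℝ} (hs : 0 ≤ s) (hst : s < t) :
    |∫ x in Ioc s t, (⟪u x, B.L hψ.toL2⟫_ℝ * ⟪u x, hφ.toL2⟫_ℝ
      + ⟪u x, hψ.toL2⟫_ℝ * ⟪u x, B.L hφ.toL2⟫_ℝ)|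
    ≤ ε * (2 * (‖u0‖ * ‖hψ.toL2‖ * (‖u0‖ * ‖hφ.toL2‖))
      + ‖u0‖ * ‖hφ.toL2‖ * forcingBound hψ ν u0 t
      + ‖u0‖ * ‖hψ.toL2‖ * forcingBound hφ ν u0 t) := by
  have ht : 0 < t := hs.trans_lt hst
  -- the evolution of the product with one test field
  have key : ∀ {ψ : E3 → E3} (hψ : Ω.SmoothCpt ψ), (∀ x, div ψ x = 0) →
      ∃ k : ℝ → ℝ, IntervalIntegrable k volume 0 t ∧
        (∀ᵐ x ∂(volume.restrict (Ioc s t)),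
          k x = -forcing hψ ν (u x) (G x) + ε⁻¹ * ⟪u x, B.L hψ.toL2⟫_ℝ) ∧
        (∀ᵐ x ∂(volume.restrict (Ioc s t)),
          ⟪u x, hψ.toL2⟫_ℝ = ⟪u0, hψ.toL2⟫_ℝ + ∫ v in (0 : ℝ)..x, k v) ∧
        ∀ x ∈ Icc 0 t, |⟪u0, hψ.toL2⟫_ℝ + ∫ v in (0 : ℝ)..x, k v| ≤ ‖u0‖ * ‖hψ.toL2‖ := by
    intro ψ hψ dψ
    set g : ℝ → ℝ := fun x => forcing hψ ν (u x) (G x) + (1 / ε) * ⟪B.wedgeL2 (u x), hψ.toL2⟫_ℝ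
      with hg
    have hgi : ∀ T, 0 ≤ T → IntervalIntegrable g volume 0 T := by
      intro T hT
      rw [intervalIntegrable_iff_integrableOn_Ioc_of_le hT]
      refine (h.forcing_le hν hψ hT).1.add (Integrable.const_mul ?_ _)
      exact (B.wedgeL2.integrable_comp ((h.memLp le_rfl).integrable (by norm_num))).inner_const _
    -- The primitive is a continuous representative of the product with the test. It has values at
    -- every time, bounded independently of `ε`, although its derivative is of order `ε⁻¹`.
    have h1 := ae_eq_primitive (fun T hT => h.intervalIntegrable_inner hT hψ.toL2) hgi
      (h.evolution ψ hψ dψ)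
    refine ⟨fun x => -g x, (hgi t ht.le).neg, ?_, ae_Ioc_of_ae_Ioi hs h1, fun x hx => ?_⟩
    · filter_upwards [ae_Ioc_of_ae_Ioi hs h.mem_H] with x hx
      rw [hg]
      simp only [B.inner_wedgeL2_eq_neg hx]
      ring
    · refine abs_le_of_ae_le (F := fun x => ⟪u0, hψ.toL2⟫_ℝ + ∫ v in (0 : ℝ)..x, -g v) ht ?_ ?_ hx
      · have := (absolutelyContinuous_const_add_integral (hgi t ht.le).neg ⟪u0, hψ.toL2⟫_ℝ
          left_mem_uIcc).continuousOn
        rwa [uIcc_of_le ht.le] at this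
      · filter_upwards [h1, h.norm_le] with x h2 h3
        rw [← h2]
        exact (abs_real_inner_le_norm _ _).trans (by gcongr)
  obtain ⟨k, ki, kf, ku, kb⟩ := key hψ dψ
  obtain ⟨l, li, lf, lu, lb⟩ := key hφ dφ
  -- The integral of the derivative of the product of the two representatives is the difference of
  -- its end values.
  have hprod := integral_mul_primitive hs hst.le ki li ⟪u0, hψ.toL2⟫_ℝ ⟪u0, hφ.toL2⟫_ℝ
  rw [intervalIntegral.integral_of_le hst.le] at hprod
  set X : ℝ := (⟪u0, hψ.toL2⟫_ℝ + ∫ v in (0 : ℝ)..t, k v) * (⟪u0, hφ.toL2⟫_ℝ + ∫ v in (0 : ℝ)..t, l v)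
        - (⟪u0, hψ.toL2⟫_ℝ + ∫ v in (0 : ℝ)..s, k v) * (⟪u0, hφ.toL2⟫_ℝ + ∫ v in (0 : ℝ)..s, l v)
    with hX
  have hXb : |X| ≤ 2 * (‖u0‖ * ‖hψ.toL2‖ * (‖u0‖ * ‖hφ.toL2‖)) := by
    have m1 := kb t ⟨ht.le, le_rfl⟩
    have m2 := kb s ⟨hs, hst.le⟩
    have m3 := lb t ⟨ht.le, le_rfl⟩
    have m4 := lb s ⟨hs, hst.le⟩
    refine (abs_sub _ _).trans ?_
    rw [abs_mul, abs_mul, two_mul]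
    gcongr
  have hm := h.memLp (t := t) hs
  have i1 : Integrable (fun x => ⟪u x, B.L hψ.toL2⟫_ℝ * ⟪u x, hφ.toL2⟫_ℝ
      + ⟪u x, hψ.toL2⟫_ℝ * ⟪u x, B.L hφ.toL2⟫_ℝ) (volume.restrict (Ioc s t)) :=
    (memLp_inner_mul_inner_integrable hm hm _ _).add (memLp_inner_mul_inner_integrable hm hm _ _)
  have hbd : ∀ {ψ φ : E3 → E3} (hψ : Ω.SmoothCpt ψ) (hφ : Ω.SmoothCpt φ),
      Integrable (fun x => forcing hψ ν (u x) (G x) * ⟪u x, hφ.toL2⟫_ℝ) (volume.restrict (Ioc s t)) ∧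
      |∫ x in Ioc s t, forcing hψ ν (u x) (G x) * ⟪u x, hφ.toL2⟫_ℝ|
        ≤ ‖u0‖ * ‖hφ.toL2‖ * forcingBound hψ ν u0 t := by
    intro ψ φ hψ hφ
    obtain ⟨f1, f2⟩ := h.forcing_le hν hψ ht.le
    have f3 : IntegrableOn (fun t => forcing hψ ν (u t) (G t)) (Ioc s t) :=
      f1.mono_set (Ioc_subset_Ioc_left hs)
    have f4 : ∀ᵐ x ∂(volume.restrict (Ioc s t)), ‖forcing hψ ν (u x) (G x) * ⟪u x, hφ.toL2⟫_ℝ‖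
        ≤ ‖u0‖ * ‖hφ.toL2‖ * |forcing hψ ν (u x) (G x)| := by
      filter_upwards [ae_Ioc_of_ae_Ioi hs h.norm_le] with x hx
      rw [norm_mul, mul_comm]
      gcongr
      · exact (norm_inner_le_norm _ _).trans (by gcongr)
      · exact le_rfl
    refine ⟨(f3.abs.const_mul _).mono' (f3.aestronglyMeasurable.mul
      (hm.1.inner aestronglyMeasurable_const)) f4, ?_⟩
    rw [← Real.norm_eq_abs]
    refine (norm_integral_le_of_norm_le (f3.abs.const_mul _) f4).trans ?_
    rw [integral_const_mul]
    gcongr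
    exact (setIntegral_mono_set f1.abs (ae_of_all _ fun x => abs_nonneg _)
      (Ioc_subset_Ioc_left hs).eventuallyLE).trans f2
  obtain ⟨j1, b1⟩ := hbd hψ hφ
  obtain ⟨j2, b2⟩ := hbd hφ hψ
  -- The singular part of the derivative is isolated: `ε⁻¹` times the bracket equals boundary and
  -- forcing terms, all bounded uniformly in `ε`.
  have hid : ε⁻¹ * ∫ x in Ioc s t, (⟪u x, B.L hψ.toL2⟫_ℝ * ⟪u x, hφ.toL2⟫_ℝ
      + ⟪u x, hψ.toL2⟫_ℝ * ⟪u x, B.L hφ.toL2⟫_ℝ)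
      = X + ((∫ x in Ioc s t, forcing hψ ν (u x) (G x) * ⟪u x, hφ.toL2⟫_ℝ)
        + ∫ x in Ioc s t, forcing hφ ν (u x) (G x) * ⟪u x, hψ.toL2⟫_ℝ) := by
    have j3 : Integrable (fun x => forcing hψ ν (u x) (G x) * ⟪u x, hφ.toL2⟫_ℝ
        + forcing hφ ν (u x) (G x) * ⟪u x, hψ.toL2⟫_ℝ) (volume.restrict (Ioc s t)) := j1.add j2
    rw [← hprod, ← integral_const_mul, ← sub_eq_iff_eq_add, ← integral_add j1 j2,
      ← integral_sub (i1.const_mul _) j3]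
    refine integral_congr_ae ?_
    filter_upwards [kf, ku, lf, lu] with x a1 a2 a3 a4
    rw [← a2, ← a4, a1, a3]
    ring
  have hfin : |ε⁻¹ * ∫ x in Ioc s t, (⟪u x, B.L hψ.toL2⟫_ℝ * ⟪u x, hφ.toL2⟫_ℝ
      + ⟪u x, hψ.toL2⟫_ℝ * ⟪u x, B.L hφ.toL2⟫_ℝ)| ≤
      2 * (‖u0‖ * ‖hψ.toL2‖ * (‖u0‖ * ‖hφ.toL2‖))
      + ‖u0‖ * ‖hφ.toL2‖ * forcingBound hψ ν u0 t
      + ‖u0‖ * ‖hψ.toL2‖ * forcingBound hφ ν u0 t := by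
    rw [hid, add_assoc]
    exact (abs_add_le _ _).trans (add_le_add hXb ((abs_add_le _ _).trans (add_le_add b1 b2)))
  rwa [abs_mul, abs_of_pos (inv_pos.2 hε), inv_mul_le_iff₀ hε] at hfin

end SolutionBounds

end Estimates

/-! ### Commutation of the correlation operator with `L`, and the limit for static tests. -/

section Limit

open Domain

variable {Ω : Domain} {B : Rotation Ω} {ν : ℝ} {u0 : Ω.L2} {ι : Type*}

/-- The correlation operator of the solutions commutes with `L`. -/
lemma correlation_comm (hν : 0 < ν) {ε : ι → ℝ} (hε : ∀ i, 0 < ε i) {l : Filter ι} [l.NeBot]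
    (hl : Tendsto ε l (𝓝 0)) {u : ι → ℝ → Ω.L2} {G : ι → ℝ → Fin 3 → Ω.L2}
    (h : ∀ i, SolutionBounds B ν (ε i) u0 (u i) (G i)) {s t : ℝ} (hs : 0 ≤ s) (hst : s < t)
    {R : Ω.L2 →L[ℝ] Ω.L2} (hR : IsCorrelation l (volume.restrict (Ioc s t)) u u R) :
    ∀ a ∈ Ω.H, R (B.L a) = B.L (R a) := by
  -- For smooth tests the correlation bracket is of order `ε`. The relation is then extended to `H`
  -- in each argument by density.
  have h1 : ∀ {ψ φ : E3 → E3} (hψ : Ω.SmoothCpt ψ) (hφ : Ω.SmoothCpt φ), (∀ x, div ψ x = 0) →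
      (∀ x, div φ x = 0) →
      ⟪R (B.L hψ.toL2), hφ.toL2⟫_ℝ + ⟪R hψ.toL2, B.L hφ.toL2⟫_ℝ = 0 := by
    intro ψ φ hψ hφ dψ dφ
    have ht := (hR (B.L hψ.toL2) hφ.toL2).add (hR hψ.toL2 (B.L hφ.toL2))
    refine tendsto_nhds_unique ht (squeeze_zero_norm (fun i => ?_)
      (by simpa using hl.mul_const (2 * (‖u0‖ * ‖hψ.toL2‖ * (‖u0‖ * ‖hφ.toL2‖))
        + ‖u0‖ * ‖hφ.toL2‖ * forcingBound hψ ν u0 t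
        + ‖u0‖ * ‖hψ.toL2‖ * forcingBound hφ ν u0 t)))
    have hm := (h i).memLp (t := t) hs
    rw [← integral_add (memLp_inner_mul_inner_integrable hm hm _ _)
      (memLp_inner_mul_inner_integrable hm hm _ _), Real.norm_eq_abs]
    exact (h i).abs_integral_bracket_le hν (hε i) hψ hφ dψ dφ hs hst
  have h2 : ∀ {φ : E3 → E3} (hφ : Ω.SmoothCpt φ), (∀ x, div φ x = 0) → ∀ a ∈ Ω.H,
      ⟪R (B.L a), hφ.toL2⟫_ℝ + ⟪R a, B.L hφ.toL2⟫_ℝ = 0 := by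
    intro φ hφ dφ a ha
    set ℓ : Ω.L2 →L[ℝ] ℝ := innerSL ℝ hφ.toL2 ∘L R ∘L B.L + innerSL ℝ (B.L hφ.toL2) ∘L R with hℓ
    have hℓa : ∀ a, ℓ a = ⟪R (B.L a), hφ.toL2⟫_ℝ + ⟪R a, B.L hφ.toL2⟫_ℝ := by
      intro a
      rw [real_inner_comm, real_inner_comm (B.L hφ.toL2)]
      rfl
    have h3 : Ω.solenoidal.topologicalClosure ≤ ℓ.ker := by
      refine Submodule.topologicalClosure_minimal _ (Submodule.span_le.2 ?_) ℓ.isClosed_ker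
      rintro _ ⟨ψ, hψ, dψ, rfl⟩
      change ℓ hψ.toL2 = 0
      rw [hℓa]
      exact h1 hψ hφ dψ dφ
    rw [← hℓa]
    exact h3 (mem_closure_solenoidal ha)
  have h4 : ∀ a ∈ Ω.H, ∀ b ∈ Ω.H, ⟪R (B.L a), b⟫_ℝ + ⟪R a, B.L b⟫_ℝ = 0 := by
    intro a ha b hb
    set ℓ : Ω.L2 →L[ℝ] ℝ := innerSL ℝ (R (B.L a)) + innerSL ℝ (R a) ∘L B.L with hℓ
    have h3 : Ω.solenoidal.topologicalClosure ≤ ℓ.ker := by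
      refine Submodule.topologicalClosure_minimal _ (Submodule.span_le.2 ?_) ℓ.isClosed_ker
      rintro _ ⟨ψ, hψ, dψ, rfl⟩
      exact h2 hψ dψ a ha
    exact h3 (mem_closure_solenoidal hb)
  have hRH : ∀ a, R a ∈ Ω.H :=
    mem_H_of_isCorrelation (fun i => ae_Ioc_of_ae_Ioi hs (h i).mem_H) hR
  intro a ha
  have h5 : ∀ b ∈ Ω.H, ⟪R (B.L a) - B.L (R a), b⟫_ℝ = 0 := by
    intro b hb
    rw [inner_sub_left, B.inner_L_left (hRH a) hb]
    linarith [h4 a ha b hb]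
  -- The commutator takes values in `H` and is orthogonal to `H`.
  exact sub_eq_zero.1 (inner_self_eq_zero.1 (h5 _ (sub_mem (hRH _) (B.L_mem_H _))))

/-- The convergence of the averages over a time interval, for a static test field. -/
theorem tendsto_integral_quadOp (hν : 0 < ν) {ε : ι → ℝ} (hε : ∀ i, 0 < ε i) {l : Filter ι}
    (hl : Tendsto ε l (𝓝 0)) {u : ι → ℝ → Ω.L2} {G : ι → ℝ → Fin 3 → Ω.L2}
    (h : ∀ i, SolutionBounds B ν (ε i) u0 (u i) (G i)) {s t : ℝ} (hs : 0 ≤ s) (hst : s < t)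
    {Φ : E3 → E3} (hΦ : Ω.SmoothCpt Φ) (hker : ∃ g ∈ B.KerL, ⇑g =ᵐ[Ω.μ] Φ)
    (hsupp : ∀ x ∈ tsupport Φ, hor x ∈ B.O ∪ B.S) :
    Tendsto (fun i => ∫ x in Ioc s t, ⟪quadOp hΦ (B.PiPerp (u i x)), B.PiPerp (u i x)⟫_ℝ)
      l (𝓝 0) := by
  -- The correlation operator may depend on the ultrafilter, but the limit is always zero.
  rw [tendsto_iff_ultrafilter]
  intro 𝓤 h𝓤
  set C : ℝ := max (t * ‖u0‖ ^ 2) (‖u0‖ ^ 2 / (2 * ν)) with hC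
  have hu : ∀ i, MemLp (u i) 2 (volume.restrict (Ioc s t)) := fun i => (h i).memLp hs
  have huC : ∀ i, ∫ x in Ioc s t, ‖u i x‖ ^ 2 ≤ C := fun i =>
    ((h i).integral_norm_sq_le hs hst.le).trans (le_max_left _ _)
  obtain ⟨R, hR⟩ := exists_isCorrelation 𝓤 hu hu huC huC
  exact B.tendsto_quadOp_PiPerp hu huC (fun i j => (h i).memLp_partial hs j)
    (fun i j => ((h i).integral_partial_le hs j).trans (le_max_right _ _))
    (fun i => ae_Ioc_of_ae_Ioi hs (h i).mem_H) (fun i => ae_Ioc_of_ae_Ioi hs (h i).isWeakPartial)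
    hR (correlation_comm hν hε (hl.mono_left h𝓤) h hs hst hR) hΦ hker hsupp

end Limit

/-! ### Time dependent test fields and conclusion. -/

open Domain

/-- Quadratic integrals which tend to zero for frozen coefficients on all time intervals tend to
zero for continuous time dependent coefficients. -/
lemma tendsto_integral_of_frozen {ι V : Type*} [NormedAddCommGroup V] [InnerProductSpace ℝ V]
    {A : ℝ → V →L[ℝ] V} (hA : Continuous A) {l : Filter ι} {w : ι → ℝ → V} {C T : ℝ} (hC : 0 ≤ C)
    (hT : 0 < T) (hw : ∀ i, AEStronglyMeasurable (w i) (volume.restrict (Ioc 0 T)))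
    (hb : ∀ i, ∀ᵐ t ∂(volume.restrict (Ioc 0 T)), ‖w i t‖ ≤ C)
    (h : ∀ s, 0 ≤ s → ∀ a b, 0 ≤ a → a < b →
      Tendsto (fun i => ∫ t in Ioc a b, ⟪A s (w i t), w i t⟫_ℝ) l (𝓝 0)) :
    Tendsto (fun i => ∫ t in Ioc 0 T, ⟪A t (w i t), w i t⟫_ℝ) l (𝓝 0) := by
  have hint : ∀ (A' : ℝ → V →L[ℝ] V), Continuous A' → ∀ i,
      IntegrableOn (fun t => ⟪A' t (w i t), w i t⟫_ℝ) (Ioc 0 T) := by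
    intro A' hA' i
    obtain ⟨M, hM⟩ := (isCompact_Icc (a := (0 : ℝ)) (b := T)).exists_bound_of_continuousOn
      hA'.continuousOn
    refine Integrable.of_bound ?_ (M * C * C) ?_
    · have h1 : AEStronglyMeasurable (fun t => A' t (w i t)) (volume.restrict (Ioc 0 T)) :=
        (isBoundedBilinearMap_apply (𝕜 := ℝ) (E := V) (F := V)).continuous.comp_aestronglyMeasurable
          ((Continuous.aestronglyMeasurable hA').prodMk (hw i))
      exact AEStronglyMeasurable.inner (𝕜 := ℝ) h1 (hw i)
    · filter_upwards [hb i, ae_restrict_mem measurableSet_Ioc] with t ht htT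
      have h1 := hM t (Ioc_subset_Icc_self htT)
      have hM0 : 0 ≤ M := (norm_nonneg _).trans h1
      calc ‖⟪A' t (w i t), w i t⟫_ℝ‖ ≤ ‖A' t (w i t)‖ * ‖w i t‖ := norm_inner_le_norm _ _
        _ ≤ (M * C) * C := by
          gcongr
          exact ((A' t).le_opNorm _).trans (mul_le_mul h1 ht (norm_nonneg _) hM0)
  rw [Metric.tendsto_nhds]
  intro δ hδ
  -- A variation of `A` by at most `η` on each subinterval produces a total error at most `η C² T`.
  obtain ⟨η, hη, hηδ⟩ : ∃ η > 0, η * C * C * T < δ / 2 := by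
    refine ⟨δ / 2 / (C * C * T + 1), by positivity, ?_⟩
    rw [mul_assoc, mul_assoc, div_mul_eq_mul_div, div_lt_iff₀ (by positivity)]
    nlinarith [mul_nonneg (mul_nonneg hC hC) hT.le]
  obtain ⟨d, hd, hAd⟩ := Metric.uniformContinuousOn_iff.1
    ((isCompact_Icc (a := (0 : ℝ)) (b := T)).uniformContinuousOn_of_continuous hA.continuousOn) η hη
  obtain ⟨N, hN⟩ := exists_nat_gt (T / d)
  have hN0 : (0 : ℝ) < N := (div_nonneg hT.le hd.le).trans_lt hN
  set s : ℕ → ℝ := fun k => k * (T / N) with hs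
  have hs0 : ∀ k, 0 ≤ s k := fun k => by positivity
  have hs1 : ∀ k, s (k + 1) = s k + T / N := fun k => by simp only [hs]; push_cast; ring
  have hlt : ∀ k, s k < s (k + 1) := fun k => by
    rw [hs1]
    linarith [div_pos hT hN0]
  have hsN : s N = T := by
    simp only [hs]
    field_simp
  have hsT : ∀ k < N, s (k + 1) ≤ T := fun k hk => by
    rw [← hsN]
    simp only [hs]
    gcongr
    exact hk
  have hsub : ∀ k < N, Ioc (s k) (s (k + 1)) ⊆ Ioc 0 T := fun k hk =>
    Ioc_subset_Ioc (hs0 k) (hsT k hk)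
  have hTN : T / N < d := by
    rw [div_lt_iff₀ hN0]
    rwa [div_lt_iff₀ hd, mul_comm] at hN
  have hlim : Tendsto (fun i => ∑ k ∈ Finset.range N,
      ∫ t in Ioc (s k) (s (k + 1)), ⟪A (s k) (w i t), w i t⟫_ℝ) l (𝓝 0) := by
    simpa using tendsto_finsetSum (Finset.range N) fun k _ =>
      h (s k) (hs0 k) (s k) (s (k + 1)) (hs0 k) (hlt k)
  filter_upwards [(Metric.tendsto_nhds.1 hlim) (δ / 2) (half_pos hδ)] with i hi
  have hsum : ∫ t in Ioc 0 T, ⟪A t (w i t), w i t⟫_ℝ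
      = ∑ k ∈ Finset.range N, ∫ t in Ioc (s k) (s (k + 1)), ⟪A t (w i t), w i t⟫_ℝ := by
    have h1 := intervalIntegral.sum_integral_adjacent_intervals (μ := volume) (a := s) (n := N)
      (f := fun t => ⟪A t (w i t), w i t⟫_ℝ) fun k hk =>
        (intervalIntegrable_iff_integrableOn_Ioc_of_le (hlt k).le).2
          ((hint A hA i).mono_set (hsub k hk))
    rw [hsN, show s 0 = 0 by simp [hs], intervalIntegral.integral_of_le hT.le] at h1
    rw [← h1]
    exact Finset.sum_congr rfl fun k _ => intervalIntegral.integral_of_le (hlt k).le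
  have herr : ∀ k ∈ Finset.range N, |(∫ t in Ioc (s k) (s (k + 1)), ⟪A t (w i t), w i t⟫_ℝ)
      - ∫ t in Ioc (s k) (s (k + 1)), ⟪A (s k) (w i t), w i t⟫_ℝ| ≤ η * C * C * (T / N) := by
    intro k hk
    have hk := Finset.mem_range.1 hk
    rw [← integral_sub ((hint A hA i).mono_set (hsub k hk))
      ((hint (fun _ => A (s k)) continuous_const i).mono_set (hsub k hk)), ← Real.norm_eq_abs]
    refine (norm_setIntegral_le_of_norm_le_const_ae (C := η * C * C) (by simp) ?_).trans_eq ?_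
    · filter_upwards [ae_restrict_of_ae_restrict_of_subset (hsub k hk) (hb i),
        ae_restrict_mem measurableSet_Ioc] with t ht htk
      have h2 : ‖A t - A (s k)‖ ≤ η := by
        rw [← dist_eq_norm]
        refine (hAd t (Ioc_subset_Icc_self (hsub k hk htk)) (s k)
          ⟨hs0 k, (hlt k).le.trans (hsT k hk)⟩ ?_).le
        rw [Real.dist_eq, abs_of_nonneg (by linarith [htk.1])]
        linarith [htk.2, hs1 k]
      rw [← inner_sub_left]
      calc ‖⟪A t (w i t) - A (s k) (w i t), w i t⟫_ℝ‖
          ≤ ‖(A t - A (s k)) (w i t)‖ * ‖w i t‖ := norm_inner_le_norm _ _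
        _ ≤ (η * C) * C := by
          gcongr
          exact ((A t - A (s k)).le_opNorm _).trans (mul_le_mul h2 ht (norm_nonneg _) hη.le)
    · rw [hs1]
      simp [measureReal_def, ENNReal.toReal_ofReal (div_pos hT hN0).le]
  have htot := (Finset.abs_sum_le_sum_abs _ _).trans (Finset.sum_le_sum herr)
  rw [Finset.sum_sub_distrib, ← hsum, Finset.sum_const, Finset.card_range, nsmul_eq_mul,
    show (N : ℝ) * (η * C * C * (T / N)) = η * C * C * T by field_simp] at htot
  refine (dist_triangle _ (∑ k ∈ Finset.range N,
      ∫ t in Ioc (s k) (s (k + 1)), ⟪A (s k) (w i t), w i t⟫_ℝ) _).trans_lt ?_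
  rw [Real.dist_eq]
  linarith

namespace Domain

variable {Ω : Domain}

lemma IsTestField.tsupport_slice {Φ : ℝ → E3 → E3} (t : ℝ) {x : E3} (hx : x ∈ tsupport (Φ t)) :
    (t, x) ∈ tsupport (fun p : ℝ × E3 => Φ p.1 p.2) :=
  closure_minimal (s := Function.support (Φ t))
    (t := (fun x => (t, x)) ⁻¹' tsupport (fun p : ℝ × E3 => Φ p.1 p.2))
    (fun y hy => subset_tsupport (fun p : ℝ × E3 => Φ p.1 p.2) (a := (t, y)) hy)
    ((isClosed_tsupport _).preimage (by fun_prop)) hx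

lemma IsTestField.smoothCpt {Φ : ℝ → E3 → E3} (hΦ : Ω.IsTestField Φ) (t : ℝ) :
    Ω.SmoothCpt (Φ t) := by
  obtain ⟨R, hR⟩ := hΦ.compact_support
  exact ⟨hΦ.smooth.comp (contDiff_prodMk_right t), hΦ.periodic t, R, fun x hx =>
    (hR _ (tsupport_slice t hx)).2⟩

lemma IsTestField.pd_eq {Φ : ℝ → E3 → E3} (hΦ : Ω.IsTestField Φ) (i j : Fin 3) (t : ℝ) (x : E3) :
    pd (Φ t) i j x = fderiv ℝ (fun p : ℝ × E3 => Φ p.1 p.2) (t, x) (0, e j) i := by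
  have h1 := ((hΦ.smooth.differentiable (by simp) (t, x)).hasFDerivAt).comp x
    (hasFDerivAt_prodMk_right t x)
  have h2 : fderiv ℝ (Φ t) x = _ := h1.fderiv
  rw [pd, h2]
  rfl

lemma IsTestField.continuous_qCoeff {Φ : ℝ → E3 → E3} (hΦ : Ω.IsTestField Φ) (i j : Fin 3) :
    Continuous fun p : ℝ × E3 => qCoeff (Φ p.1) i j p.2 := by
  have h1 : ∀ i j, Continuous fun p : ℝ × E3 => pd (Φ p.1) i j p.2 := by
    intro i j
    simp only [hΦ.pd_eq]
    exact (EuclideanSpace.proj i : E3 →L[ℝ] ℝ).continuous.comp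
      ((hΦ.smooth.continuous_fderiv (by simp)).clm_apply continuous_const)
  have h2 : Continuous fun p : ℝ × E3 => div (Φ p.1) p.2 := continuous_finsetSum _ fun i _ => h1 i i
  unfold qCoeff
  by_cases h : i = j
  · simp only [if_pos h]
    exact (((h1 i j).add (h1 j i)).div_const 2).sub (h2.div_const 2)
  · simp only [if_neg h]
    exact (((h1 i j).add (h1 j i)).div_const 2).sub continuous_const

lemma pd_eq_zero {Φ : E3 → E3} {x : E3} (hx : x ∉ tsupport Φ) (i j : Fin 3) : pd Φ i j x = 0 := by
  have h0 : fderiv ℝ Φ x = 0 := by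
    by_contra hne
    exact hx (support_fderiv_subset ℝ (f := Φ) hne)
  simp [pd, h0]

lemma qCoeff_eq_zero {Φ : E3 → E3} {x : E3} (hx : x ∉ tsupport Φ) (i j : Fin 3) :
    qCoeff Φ i j x = 0 := by
  simp [qCoeff, div, pd_eq_zero hx]

lemma norm_mulC_sub_le {c c' : E3 → ℝ} (hc : Ω.SmoothCpt c) (hc' : Ω.SmoothCpt c') {η : ℝ}
    (hη : 0 ≤ η) (h : ∀ x ∈ Ω.cell, |c x - c' x| ≤ η) (E : E3 →L[ℝ] E3) :
    ‖mulC hc E - mulC hc' E‖ ≤ η * ‖E‖ := by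
  refine ContinuousLinearMap.opNorm_le_bound _ (by positivity) fun u => ?_
  refine Lp.norm_le_mul_norm_of_ae_le_mul ?_
  filter_upwards [coeFn_mulC hc E u, coeFn_mulC hc' E u,
    Lp.coeFn_sub (mulC hc E u) (mulC hc' E u), Ω.ae_mem_cell] with x h1 h2 h3 hx
  rw [_root_.sub_apply, h3, Pi.sub_apply, h1, h2, ← sub_smul, norm_smul, mul_assoc]
  exact mul_le_mul (h x hx) (E.le_opNorm _) (norm_nonneg _) hη

/-- The quadratic form depends continuously on the time. -/
lemma IsTestField.continuous_quadOp {Φ : ℝ → E3 → E3} (hΦ : Ω.IsTestField Φ) :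
    Continuous fun t => quadOp (hΦ.smoothCpt t) := by
  obtain ⟨R, hR⟩ := hΦ.compact_support
  obtain ⟨r, hr⟩ : ∃ r : ℝ, ∀ i, R ≤ r ∧ Ω.len i ≤ r := by
    refine ⟨|R| + ∑ i, |Ω.len i|, fun i => ⟨?_, ?_⟩⟩
    · have := Finset.sum_nonneg (fun i (_ : i ∈ Finset.univ) => abs_nonneg (Ω.len i))
      linarith [le_abs_self R]
    · have := Finset.single_le_sum (f := fun i => |Ω.len i|)
        (fun i _ => abs_nonneg _) (Finset.mem_univ i)
      linarith [le_abs_self (Ω.len i), abs_nonneg R]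
  have hbox : ∀ t, ∀ x ∈ Ω.cell, x ∉ box r → x ∉ tsupport (Φ t) := by
    intro t x hx hxb hxt
    refine hxb fun i => ?_
    by_cases hi : Ω.len i = 0
    · exact ((hR _ (tsupport_slice t hxt)).2 i hi).trans (hr i).1
    · have := hx i hi
      exact abs_le.2 ⟨by linarith [this.1, this.2, (hr i).2], by linarith [this.2, (hr i).2]⟩
  refine continuous_finsetSum _ fun i _ => continuous_finsetSum _ fun j _ => ?_
  rw [Metric.continuous_iff']
  intro t₀ δ hδ
  set η : ℝ := δ / 2 / (‖unitMat i j‖ + 1) with hη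
  have hη0 : 0 < η := by positivity
  -- Compactness of the box turns joint continuity of the coefficients into continuity in time,
  -- uniform in space.
  obtain ⟨v, hv, hvη⟩ := (isCompact_box r).mem_uniformity_of_prod (s := univ) (q := t₀)
    (f := fun t x => qCoeff (Φ t) i j x) (hΦ.continuous_qCoeff i j).continuousOn (mem_univ _)
    (Metric.dist_mem_uniformity hη0)
  rw [nhdsWithin_univ] at hv
  filter_upwards [hv] with t ht
  rw [dist_eq_norm]
  refine (norm_mulC_sub_le (η := η) _ _ hη0.le (fun x hx => ?_) _).trans_lt ?_
  · by_cases hxb : x ∈ box r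
    · exact (hvη t ht x hxb).le
    · rw [qCoeff_eq_zero (hbox _ x hx hxb), qCoeff_eq_zero (hbox _ x hx hxb)]
      simpa using hη0.le
  · rw [hη, div_mul_eq_mul_div, div_lt_iff₀ (by positivity)]
    nlinarith [norm_nonneg (unitMat i j)]

lemma IsTestField.exists_quadOp_eq_zero {Φ : ℝ → E3 → E3} (hΦ : Ω.IsTestField Φ) :
    ∃ T, 0 < T ∧ ∀ t, T < t → quadOp (hΦ.smoothCpt t) = 0 := by
  obtain ⟨R, hR⟩ := hΦ.compact_support
  refine ⟨|R| + 1, by positivity, fun t ht => ?_⟩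
  have h1 : ∀ x, x ∉ tsupport (Φ t) := fun x hx => by
    have := (hR _ (tsupport_slice t hx)).1
    simp only at this
    linarith [le_abs_self t, le_abs_self R]
  ext1 u
  refine ext_inner_right ℝ fun v => ?_
  rw [inner_quadOp]
  simp [qCoeff_eq_zero (h1 _)]

end Domain

/-- The quadratic interactions of the oscillations disappear in the limit. -/
lemma IsKerTest.tendsto_wedgeRot {Ω : Domain} {B : Rotation Ω} {ν : ℝ} (hν : 0 < ν) {u0 : Ω.L2}
    {ι : Type*} {ε : ι → ℝ} (hε : ∀ i, 0 < ε i) {l : Filter ι} (hl : Tendsto ε l (𝓝 0))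
    {u : ι → ℝ → Ω.L2} (hu : ∀ i, IsWeakSolution B ν (ε i) u0 (u i)) {Φ : ℝ → E3 → E3}
    (hΦ : IsKerTest B Φ) :
    Tendsto (fun i => wedgeRot (fun t => B.PiPerp (u i t)) Φ) l (𝓝 0) := by
  choose G hG using fun i => (hu i).exists_bounds B hν
  obtain ⟨T, hT, hT0⟩ := hΦ.test.exists_quadOp_eq_zero
  have h1 : ∀ i, wedgeRot (fun t => B.PiPerp (u i t)) Φ
      = ∫ t in Ioc 0 T, ⟪quadOp (hΦ.test.smoothCpt t) (B.PiPerp (u i t)), B.PiPerp (u i t)⟫_ℝ := by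
    intro i
    simp only [wedgeRot, integral_quad (hΦ.test.smoothCpt _)]
    refine setIntegral_eq_of_subset_of_forall_sdiff_eq_zero measurableSet_Ioi
      Ioc_subset_Ioi_self fun t ht => ?_
    have h2 : T < t := not_le.1 fun h => ht.2 ⟨ht.1, h⟩
    simp [hT0 t h2]
  simp only [h1]
  refine tendsto_integral_of_frozen (C := ‖B.PiPerp‖ * ‖u0‖) hΦ.test.continuous_quadOp
    (by positivity) hT (fun i => ?_) (fun i => ?_) fun s hs a b ha hab => ?_
  · exact B.PiPerp.continuous.comp_aestronglyMeasurable
      ((hG i).aestronglyMeasurable.mono_measure (Measure.restrict_mono Ioc_subset_Ioi_self le_rfl))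
  · filter_upwards [ae_Ioc_of_ae_Ioi (t := T) le_rfl (hG i).norm_le] with t ht
    exact (B.PiPerp.le_opNorm _).trans (mul_le_mul_of_nonneg_left ht (norm_nonneg _))
  · exact tendsto_integral_quadOp hν hε hl hG ha hab (hΦ.test.smoothCpt s) (hΦ.mem_ker s hs)
      fun x hx => hΦ.support _ (IsTestField.tsupport_slice s hx)

end RotatingFluid

end

theorem mainTheorem2 (Ω : RotatingFluid.Domain) (B : RotatingFluid.Rotation Ω)
    (ν : ℝ) (hν : 0 < ν) (u0 : Ω.L2) (hu0 : u0 ∈ Ω.H) (u : ℝ → ℝ → Ω.L2)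
    (hu : ∀ ε : ℝ, 0 < ε → RotatingFluid.IsWeakSolution B ν ε u0 (u ε)) :
    RotatingFluid.ProjTendstoZero B
      (fun ε => RotatingFluid.wedgeRot (fun t => B.PiPerp (u ε t))) := by
  intro Φ hΦ
  -- The general statement concerns families all of whose parameters are positive, so the limit is
  -- taken on the subtype and carried back to `ℝ`.
  have h : Tendsto (fun ε : Ioi (0 : ℝ) =>
      RotatingFluid.wedgeRot (fun t => B.PiPerp (u ε t)) Φ)
      (comap (fun ε : Ioi (0 : ℝ) => (ε : ℝ)) (𝓝[>] 0)) (𝓝 0) :=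
    hΦ.tendsto_wedgeRot hν (ε := fun ε : Ioi (0 : ℝ) => (ε : ℝ)) (fun ε => ε.2)
      (tendsto_comap.mono_right nhdsWithin_le_nhds) fun ε => hu ε ε.2
  refine (tendsto_comap'_iff (i := fun ε : Ioi (0 : ℝ) => (ε : ℝ)) ?_).1 h
  rw [Subtype.range_coe]
  exact self_mem_nhdsWithin
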